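/- Let $S=\mathbb C[x,y,z]$, let $S_k$ be its homogeneous part of degree $k$, and fix $d\ge 4$. Let $X(d)\subset\mathbb P(S_1)^d$ be the set of $d$-tuples of pairwise distinct lines in $\mathbb P^2=\mathbb P^2(\mathbb C)$, let $\psi:\mathbb P(S_1)^d\to\mathbb P(S_d)$ be the multiplication map $(\ell_1,\dots,\ell_d)\mapsto \ell_1\cdots\ell_d$, and let $A(d)=\psi(X(d))$ be the set of arrangements of $d$ distinct lines. The intersection lattice $L(\mathcal A)$ of an arrangement is the set of all intersections of its lines (including $\mathbb P^2$, and $\emptyset$ if the lines are not concurrent), ordered by reverse inclusion. For a lattice $L$ let $X(L)\subset X(d)$ be the set of $(\ell_1,\dots,\ell_d)$ whose intersection lattice is isomorphic to $L$, let $A(L)=\psi(X(L))$, and let $\tau(L)=\sum_p(m_p-1)^2$, the sum over the multiple points $p$ (the elements of rank $2$ of $L$), $m_p$ being the number of lines through $p$. For $f\in S_d$ with $f=0$ reduced, $\tau(f)$ is the total Tjurina number of the curve $f=0$ in $\mathbb P^2$, i.e. the sum of the local Tjurina numbers $\dim_{\mathbb C}\mathbb C[[u,v]]/(g,g_u,g_v)$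 over its points, $g$ a local equation; $AR(f)\subset S^3$ is the graded module of triples $(a,b,c)$ with $af_x+bf_y+cf_z=0$; $mdr(f)$ is the smallest $r\ge0$ with $AR(f)_r\ne0$. The curve $f=0$ is free if $AR(f)\cong S(-d_1)\oplus S(-d_2)$ as graded modules for some integers $d_1,d_2\ge0$, and nearly free if the Milnor algebra $M(f)=S/(f_x,f_y,f_z)$ has a minimal graded resolution $$0\to S(-d-d_2)\to S(-d-d_1+1)\oplus S^2(-d-d_2+1)\to S^3(-d+1)\xrightarrow{(f_x,f_y,f_z)}S$$ for some integers $1\le d_1\le d_2$. Let $A(d,\tau)$ be the set of arrangements $f=0$ in $A(d)$ with $\tau(f)=\tau$. For $2\le m\le d$ let $L(d,m)$ be the intersection lattice of an arrangement of $d$ distinct lines having one point of multiplicity $m$ and only double points otherwise; this determines $L(d,m)$ up to isomorphism, and $X(L(d,m))$ is exactly the set of arrangements in $X(d)$ of this type. Then the following hold. 1. For $2\le m\le d$, the sets $X(L(d,m))\subset\mathbb P(S_1)^d$ and $A(L(d,m))\subset\mathbb P(S_d)$ are nonempty smooth locally closed subvarieties of pure dimension $2d-m+2$, and $A(L(d,m))$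 is irreducible. 2. For $2\le m\le d$, $\tau(L(d,m))=(m-1)^2+m+(m+1)+\dots+(d-1)=\binom d2+\binom{m-1}2$, and this is the total Tjurina number of every arrangement in $A(L(d,m))$. 3. If $2\le m\le d$ and $2m>d$, then $mdr(f)=d-m$ for every arrangement $f=0$ in $A(L(d,m))$. 4. For $m=d$ and $m=d-1$, every arrangement in $A(L(d,m))$ is free. Every arrangement in $A(L(d,d-2))$ is nearly free. For $2\le m\le d-3$, no arrangement in $A(L(d,m))$ is free or nearly free. 5. Every arrangement $f=0$ in $A(d)$ with $mdr(f)=0$ has intersection lattice isomorphic to $L(d,d)$; every one with $mdr(f)=1$ has intersection lattice isomorphic to $L(d,d-1)$. 6. $A(L(d,d))=A(d,\tau(L(d,d)))$ and $A(L(d,d-1))=A(d,\tau(L(d,d-1)))$. -/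

import Mathlib

noncomputable section

namespace LineArr

open MvPolynomial
open scoped LinearAlgebra.Projectivization

/-! ### Parameter spaces -/

/-- The coordinate ring `S = ℂ[x, y, z]`. -/
abbrev S : Type := MvPolynomial (Fin 3) ℂ

/-- The vector space `S_k` of homogeneous polynomials of degree `k`. -/
abbrev Sd (k : ℕ) : Type := MvPolynomial.homogeneousSubmodule (Fin 3) ℂ k

/-- The complex projective plane. -/
abbrev P2 : Type := ℙ ℂ (Fin 3 → ℂ)

/-- `C(d) = ℙ(S_d)`, the space of plane curves of degree `d`. -/
abbrev Curves (d : ℕ) : Type := ℙ ℂ (Sd d)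

/-- The product of the chosen representatives of `d` linear forms, as an element of `S_d`. -/
def prodForm {d : ℕ} (l : Fin d → ℙ ℂ (Sd 1)) : Sd d :=
  ⟨∏ i, ((l i).rep : S), by
    have h := MvPolynomial.IsHomogeneous.prod Finset.univ (fun i => ((l i).rep : S)) (fun _ => 1)
      (fun i _ => (MvPolynomial.mem_homogeneousSubmodule 1 _).1 (l i).rep.2)
    rw [MvPolynomial.mem_homogeneousSubmodule]
    simpa using h⟩

theorem prodForm_ne_zero {d : ℕ} (l : Fin d → ℙ ℂ (Sd 1)) : prodForm l ≠ 0 := by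
  intro h
  have h' : (∏ i, ((l i).rep : S)) = 0 := congrArg Subtype.val h
  obtain ⟨i, -, hi⟩ := Finset.prod_eq_zero_iff.1 h'
  exact (l i).rep_nonzero (Subtype.ext hi)

/-- The multiplication map `ψ : ℙ(S_1)^d → ℙ(S_d)`. -/
def psi {d : ℕ} (l : Fin d → ℙ ℂ (Sd 1)) : Curves d :=
  Projectivization.mk ℂ (prodForm l) (prodForm_ne_zero l)

/-- `X(d)`: ordered `d`-tuples of pairwise distinct lines. -/
def Xd (d : ℕ) : Set (Fin d → ℙ ℂ (Sd 1)) := {l | Function.Injective l}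

/-- `A(d)`: curves that are unions of `d` distinct lines. -/
def Ad (d : ℕ) : Set (Curves d) := psi '' Xd d

/-! ### Intersection lattices and strata -/

/-- The line in the plane defined by a linear form. -/
def line (h : ℙ ℂ (Sd 1)) : Set P2 := {p | eval p.rep (h.rep : S) = 0}

/-- The intersection lattice of the arrangement `l`: all intersections of subfamilies of lines
(the plane is the empty intersection; if the lines are not concurrent, the empty set is the
intersection of all of them), ordered by reverse inclusion. -/
abbrev InterLattice {d : ℕ} (l : Fin d → ℙ ℂ (Sd 1)) : Type :=
  (Set.range fun s : Set (Fin d) => ⋂ i ∈ s, line (l i))ᵒᵈ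

/-- `X(L)`: the ordered arrangements of `d` distinct lines with intersection lattice
isomorphic to `L`. -/
def XL (d : ℕ) (L : Type) [PartialOrder L] : Set (Fin d → ℙ ℂ (Sd 1)) :=
  {l | l ∈ Xd d ∧ Nonempty (InterLattice l ≃o L)}

/-- `A(L) = ψ(X(L))`. -/
def AL (d : ℕ) (L : Type) [PartialOrder L] : Set (Curves d) := psi '' XL d L

/-- The multiplicity of a point in an arrangement: the number of lines through it. -/
def mult {d : ℕ} (l : Fin d → ℙ ℂ (Sd 1)) (p : P2) : ℕ := {i | p ∈ line (l i)}.ncard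

/-- The arrangement has one point of multiplicity `m` and otherwise only double points. -/
def HasType {d : ℕ} (m : ℕ) (l : Fin d → ℙ ℂ (Sd 1)) : Prop :=
  ∃ p, mult l p = m ∧ ∀ q, q ≠ p → mult l q ≤ 2

/-- The first `m` of the `d` labels. -/
abbrev firstLines (d m : ℕ) : Finset (Fin d) := Finset.univ.filter fun i : Fin d => (i : ℕ) < m

/-- The lattice `L(d, m)`, ordered by inclusion, each element being recorded by the set of lines (labelled by `Fin d`)
that contain it: the whole plane `∅`, the lines, the `m`-fold point lying on the first `m` lines,
the double points, and the intersection of all lines. -/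
abbrev Ldm (d m : ℕ) : Type :=
  {F : Finset (Fin d) // F = ∅ ∨ F.card = 1 ∨ F = firstLines d m ∨
    (F.card = 2 ∧ ¬ F ⊆ firstLines d m) ∨ F = Finset.univ}

/-- `τ(L) = ∑_p (m_p - 1)²`, the sum being over the multiple points, i.e. the elements `p` of
rank two of `L`, where `m_p` is the number of lines (elements of rank one) below `p`. -/
def tauL (L : Type) [PartialOrder L] : ℕ :=
  ∑ᶠ (p : L) (_ : Order.height p = 2), ({a : L | Order.height a = 1 ∧ a ≤ p}.ncard - 1) ^ 2

/-! ### Total Tjurina number -/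

/-- The local equation of `f = 0` near the point `[v]`, in the affine chart of the `i`-th coordinate
(with `v i ≠ 0`), with affine coordinates centred at `[v]`. -/
def localEq (f : S) (v : Fin 3 → ℂ) (i : Fin 3) : MvPolynomial (Fin 2) ℂ :=
  aeval (fun k => MvPolynomial.C (v k) +
    Fin.insertNth (α := fun _ => MvPolynomial (Fin 2) ℂ) i 0 X k) f

/-- The Tjurina ideal `(g, g_x, g_y)` of a plane curve germ `g = 0` at the origin, in the ring
`ℂ⟦x, y⟧`. -/
def tjurinaIdeal (g : MvPolynomial (Fin 2) ℂ) : Ideal (MvPowerSeries (Fin 2) ℂ) :=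
  Ideal.span {MvPolynomial.toMvPowerSeries g, MvPolynomial.toMvPowerSeries (pderiv 0 g),
    MvPolynomial.toMvPowerSeries (pderiv 1 g)}

/-- The local Tjurina number `dim_ℂ ℂ⟦x, y⟧ / (g, g_x, g_y)` of the curve `f = 0` at `p`. -/
def localTjurina (f : S) (p : P2) : ℕ :=
  Module.finrank ℂ (MvPowerSeries (Fin 2) ℂ ⧸
    tjurinaIdeal (localEq f p.rep (Classical.choose (Function.ne_iff.1 p.rep_nonzero))))

/-- The total Tjurina number `τ(f)` of the curve `f = 0` (assumed reduced). -/
def tjurina (f : S) : ℕ := ∑ᶠ p : P2, localTjurina f p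

/-- `A(d, τ)`: the arrangements of `d` distinct lines with total Tjurina number `t`. -/
def Atau (d t : ℕ) : Set (Curves d) := {c | c ∈ Ad d ∧ tjurina (c.rep : S) = t}

/-! ### Jacobian syzygies, free and nearly free curves -/

/-- The map `(a, b, c) ↦ a f_x + b f_y + c f_z`. -/
def jacMap (f : S) : (Fin 3 → S) →ₗ[S] S :=
  Fintype.linearCombination S (fun i => pderiv i f)

/-- The module `AR(f)` of Jacobian syzygies. -/
def AR (f : S) : Submodule S (Fin 3 → S) := LinearMap.ker (jacMap f)

/-- The minimal degree of a nontrivial Jacobian syzygy. -/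
def mdr (f : S) : ℕ :=
  sInf {r | ∃ a ∈ AR f, a ≠ 0 ∧ ∀ i, (a i).IsHomogeneous r}

/-- `f = 0` is free: `AR(f) ≅ S(-d₁) ⊕ S(-d₂)` as graded modules, i.e. `AR(f)` has a basis made of
two homogeneous syzygies. -/
def IsFree (f : S) : Prop :=
  ∃ (e : Fin 2 → ℕ) (b : Module.Basis (Fin 2) S (AR f)),
    ∀ j i, ((b j : Fin 3 → S) i).IsHomogeneous (e j)

/-- `f = 0` (of degree `d`) is nearly free: for some `1 ≤ d₁ ≤ d₂` there is a graded resolution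
`0 → S(-d-d₂) → S(-d-d₁+1) ⊕ S²(-d-d₂+1) → S³(-d+1) → S` of the Milnor algebra. The first map is
multiplication by the vector `h`, the second one is given by the syzygies `ρ j`. The resolution is
automatically minimal, as all entries of `h` and `ρ` are homogeneous of positive degree. -/
def IsNearlyFree (f : S) : Prop :=
  ∃ d₁ d₂ : ℕ, 1 ≤ d₁ ∧ d₁ ≤ d₂ ∧ ∃ (ρ : Fin 3 → Fin 3 → S) (h : Fin 3 → S),
    (∀ i, (ρ 0 i).IsHomogeneous d₁) ∧ (∀ i, (ρ 1 i).IsHomogeneous d₂) ∧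
    (∀ i, (ρ 2 i).IsHomogeneous d₂) ∧
    (h 0).IsHomogeneous (d₂ - d₁ + 1) ∧ (h 1).IsHomogeneous 1 ∧ (h 2).IsHomogeneous 1 ∧
    Function.Injective (LinearMap.toSpanSingleton S (Fin 3 → S) h) ∧
    Function.Exact (LinearMap.toSpanSingleton S (Fin 3 → S) h) (Fintype.linearCombination S ρ) ∧
    Function.Exact (Fintype.linearCombination S ρ) (jacMap f)

/-! ### Zariski topology and smoothness in products of projective spaces -/

/-- The algebra of polynomial functions on a complex vector space. -/
def PolyFun (E : Type) [AddCommGroup E] [Module ℂ E] : Subalgebra ℂ (E → ℂ) :=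
  Algebra.adjoin ℂ (Set.range fun φ : Module.Dual ℂ E => (φ : E → ℂ))

section Multi

variable {ι : Type} [Fintype ι] {V : Type} [AddCommGroup V] [Module ℂ V]

/-- Multihomogeneous polynomial functions on `V^ι`. -/
def IsMultiHom (F : (ι → V) → ℂ) : Prop :=
  F ∈ PolyFun (ι → V) ∧
    ∃ k : ι → ℕ, ∀ (c : ι → ℂ) (v : ι → V), F (fun i => c i • v i) = (∏ i, c i ^ k i) * F v

/-- Representing vectors of a point of `ℙ(V)^ι`. -/
def reps (p : ι → ℙ ℂ V) : ι → V := fun i => (p i).rep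

/-- The Zariski topology on `ℙ(V)^ι`, with the complements of multihomogeneous hypersurfaces as a
basis of open sets. -/
@[reducible] def zariski (ι : Type) [Fintype ι] (V : Type) [AddCommGroup V] [Module ℂ V] :
    TopologicalSpace (ι → ℙ ℂ V) :=
  TopologicalSpace.generateFrom {U | ∃ F : (ι → V) → ℂ, IsMultiHom F ∧ U = {p | F (reps p) ≠ 0}}

/-- `Z ⊆ ℙ(V)^ι` is a nonempty smooth locally closed subvariety, everywhere of dimension `n`:
around each of its points `p` it is, in a Zariski open neighbourhood `g ≠ 0`, the zero set of
`c = dim ℙ(V)^ι - n` multihomogeneous polynomials whose differentials at `p` are linearly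
independent. -/
def IsSmoothOfDim (Z : Set (ι → ℙ ℂ V)) (n : ℕ) : Prop :=
  Z.Nonempty ∧ ∀ p ∈ Z, ∃ g : (ι → V) → ℂ, IsMultiHom g ∧ g (reps p) ≠ 0 ∧
    ∃ (c : ℕ) (F : Fin c → (ι → V) → ℂ), (∀ j, IsMultiHom (F j)) ∧
      c + n + Fintype.card ι = Fintype.card ι * Module.finrank ℂ V ∧
      LinearIndependent ℂ (fun j => fun w : ι → V => lineDeriv ℂ (F j) (reps p) w) ∧
      ∀ q, g (reps q) ≠ 0 → (q ∈ Z ↔ ∀ j, F j (reps q) = 0)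

end Multi

/-- A subset of `ℙ(S_d)`, viewed in a product of projective spaces with one factor. -/
def single {d : ℕ} (Z : Set (Curves d)) : Set (Unit → Curves d) := {q | q () ∈ Z}

end LineArr

end

/-! A line is encoded by its covector n in ℂ³, so that three distinct lines are concurrent exactly
when the determinant n_i · (n_j × n_k) vanishes. An isomorphism of intersection lattices permutes
the atoms, hence L(d, m) amounts to incidence data (`TypeData`): distinct lines, a set M of m of
them through a point v, and nonzero determinants for all triples not inside M (`XL_Ldm_eq`,
`exists_typeData_iff`).

Tjurina numbers are local. At a point on k ≥ 1 lines the equation is a unit times a product of k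
distinct binary linear forms, whose partials are coprime of degree k - 1, so the local number is (k
- 1)² (`localTjurina_prod`). Since Σ m_p (m_p - 1) = d (d - 1), the total number determines Σ (m_p -
1), and counting how the lines through one point meet the remaining ones bounds that sum from below
(`le_sum_mult_sub_one`). For the two values of τ in the last assertion only the expected type
survives.

A Jacobian syzygy is a derivation killing f, so it preserves every line and is radial at every
intersection point. Counting zeros of θ × x on each line gives degree at least d - m
(`TypeData.sub_le_degree`), and the derivation along v, corrected by the Euler field, is a syzygy
`centerSyz` of degree d - m. Any two syzygies satisfy θ × θ' = α ∇f. Freeness follows from Saito's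
criterion (α a nonzero constant), near freeness from an analogue in which three such α are the
coefficients of a relation. When θ' is `centerSyz`, α vanishes at all intersections of two lines
missing v. A free or nearly free resolution would make suitable α constants or linear forms, and
these zeros would then force `centerSyz` to vanish. A syzygy of degree 0 is a point common to all
lines; one of degree 1 is a matrix having all covectors as eigenvectors.

The ordered stratum is cut out locally by m - 2 determinants. For the unordered one, lines are
written x = T_i y + s_i z in coordinates where the slopes T_i are distinct. The restriction of the
product to z = 0 and its normal derivative determine (T, s) up to permutation, so products of lines
form a graph over these coordinates. The concurrency conditions are symmetrized, with a factor
(`sepFun`) isolating the identity permutation. Irreducibility comes from a polynomial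
parametrization by an open subset of a vector space. -/

noncomputable section

/-! ### Covectors, concurrency and incidence data. -/

namespace LineArr

open MvPolynomial
open scoped LinearAlgebra.Projectivization Matrix

/-! ### Linear forms -/

section LinForm

variable {σ : Type} [Fintype σ]

/-- The linear form with coefficient vector `n`. -/
def linForm (n : σ → ℂ) : MvPolynomial σ ℂ := ∑ k, C (n k) * X k

theorem eval_linForm (n x : σ → ℂ) : eval x (linForm n) = n ⬝ᵥ x := by
  simp [linForm, dotProduct]

theorem isHomogeneous_linForm (n : σ → ℂ) : (linForm n).IsHomogeneous 1 :=
  IsHomogeneous.sum _ _ _ fun k _ => by simpa using (isHomogeneous_C σ (n k)).mul (isHomogeneous_X ℂ k)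

theorem pderiv_linForm (n : σ → ℂ) (k : σ) : pderiv k (linForm n) = C (n k) := by
  classical
  simp [linForm, pderiv_X, Pi.single_apply, Derivation.leibniz]

theorem linForm_add (n n' : σ → ℂ) : linForm (n + n') = linForm n + linForm n' := by
  simp [linForm, add_mul, Finset.sum_add_distrib]

theorem linForm_smul (c : ℂ) (n : σ → ℂ) : linForm (c • n) = C c * linForm n := by
  simp [linForm, Finset.mul_sum, mul_assoc]

@[simp] theorem linForm_zero : linForm (0 : σ → ℂ) = 0 := by simp [linForm]

theorem coeff_linForm (n : σ → ℂ) (k : σ) : coeff (Finsupp.single k 1) (linForm n) = n k := by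
  classical
  rw [linForm, coeff_sum, Finset.sum_eq_single k]
  · simp
  · intro j _ hj
    rw [coeff_C_mul, coeff_X, if_neg, mul_zero]
    rwa [Finsupp.single_left_inj one_ne_zero]
  · simp

theorem linForm_injective : Function.Injective (linForm (σ := σ)) := fun n n' h => by
  ext k; rw [← coeff_linForm n, h, coeff_linForm]

theorem linForm_ne_zero {n : σ → ℂ} (hn : n ≠ 0) : linForm n ≠ 0 := fun h =>
  hn (linForm_injective (h.trans linForm_zero.symm))

theorem totalDegree_linForm {n : σ → ℂ} (hn : n ≠ 0) : (linForm n).totalDegree = 1 :=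
  (isHomogeneous_linForm n).totalDegree (linForm_ne_zero hn)

theorem prime_linForm {n : σ → ℂ} (hn : n ≠ 0) : Prime (linForm n) := by
  refine Irreducible.prime (irreducible_of_totalDegree_eq_one (totalDegree_linForm hn) fun x hx => ?_)
  obtain ⟨k, hk⟩ := Function.ne_iff.1 hn
  have := hx (Finsupp.single k 1)
  rw [coeff_linForm] at this
  exact isUnit_iff_ne_zero.2 fun h0 => hk (zero_dvd_iff.1 (h0 ▸ this))

theorem linForm_dvd_linForm {n n' : σ → ℂ} (h : linForm n ∣ linForm n') : ∃ c : ℂ, n' = c • n := by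
  by_cases hn' : n' = 0
  · exact ⟨0, by simp [hn']⟩
  obtain ⟨q, hq⟩ := h
  have h0 := linForm_ne_zero hn'
  have hn : n ≠ 0 := by rintro rfl; simp [hq] at h0
  have hq0 : q ≠ 0 := by rintro rfl; simp [hq] at h0
  have := congrArg totalDegree hq
  rw [totalDegree_mul_of_isDomain (linForm_ne_zero hn) hq0, totalDegree_linForm hn,
    totalDegree_linForm hn'] at this
  obtain ⟨c, rfl⟩ : ∃ c, q = C c := ⟨_, totalDegree_eq_zero_iff_eq_C.1 (by omega)⟩
  exact ⟨c, linForm_injective (by rw [linForm_smul, hq, mul_comm])⟩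

theorem eval_aeval_apply {σ τ : Type} (g : σ → MvPolynomial τ ℂ) (P : MvPolynomial σ ℂ)
    (x : τ → ℂ) : eval x (aeval g P) = eval (fun i => eval x (g i)) P := by
  induction P using MvPolynomial.induction_on <;> simp_all

/-- A polynomial vanishing on a hyperplane is divisible by its equation. -/
theorem linForm_dvd_of_eval {n : σ → ℂ} (hn : n ≠ 0) {P : MvPolynomial σ ℂ}
    (h : ∀ x, n ⬝ᵥ x = 0 → eval x P = 0) : linForm n ∣ P := by
  classical
  obtain ⟨k, hk⟩ := Function.ne_iff.1 hn
  -- Since n · w = 1, the substitution `φ` is the projection x ↦ x - (n · x) w onto the hyperplane.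
  -- It kills `P`, which vanishes there, and it is the identity modulo `linForm n`.
  set w : σ → ℂ := Pi.single k (n k)⁻¹ with hw
  have hnw : n ⬝ᵥ w = 1 := by simp [hw, mul_inv_cancel₀ hk]
  set φ : MvPolynomial σ ℂ →ₐ[ℂ] MvPolynomial σ ℂ :=
    aeval fun i => X i - linForm n * C (w i) with hφ
  have hzero : φ P = 0 := by
    refine MvPolynomial.funext fun x => ?_
    rw [hφ, eval_aeval_apply, map_zero]
    refine h _ ?_
    have : (fun i => eval x (X i - linForm n * C (w i))) = x - (n ⬝ᵥ x) • w := by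
      ext i; simp [eval_linForm]
    rw [this, dotProduct_sub, dotProduct_smul, hnw]; simp
  have hmk : ∀ Q : MvPolynomial σ ℂ, Ideal.Quotient.mk (Ideal.span {linForm n}) (φ Q) =
      Ideal.Quotient.mk (Ideal.span {linForm n}) Q := by
    intro Q
    have : ((Ideal.Quotient.mkₐ ℂ (Ideal.span {linForm n})).comp φ) =
        Ideal.Quotient.mkₐ ℂ (Ideal.span {linForm n}) := by
      refine MvPolynomial.algHom_ext fun i => ?_
      simp only [hφ, AlgHom.comp_apply, aeval_X, Ideal.Quotient.mkₐ_eq_mk]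
      rw [Ideal.Quotient.eq, Ideal.mem_span_singleton]
      exact ⟨-C (w i), by ring⟩
    exact DFunLike.congr_fun this Q
  have := hmk P
  rw [hzero, map_zero, eq_comm, Ideal.Quotient.eq_zero_iff_mem, Ideal.mem_span_singleton] at this
  exact this

end LinForm

/-! ### Vectors in three-space -/

section Vec

variable {a b c v w : Fin 3 → ℂ}

theorem exists_smul_of_cross_eq_zero (ha : a ≠ 0) (h : a ⨯₃ b = 0) : ∃ t : ℂ, b = t • a := by
  have h1 := mt crossProduct_ne_zero_iff_linearIndependent.2 (not_not.2 h)
  rw [LinearIndependent.pair_iff' ha] at h1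
  push Not at h1
  obtain ⟨t, ht⟩ := h1
  exact ⟨t, ht.symm⟩

theorem eq_smul_cross (h : a ⨯₃ b ≠ 0) (ha : a ⬝ᵥ v = 0) (hb : b ⬝ᵥ v = 0) :
    ∃ t : ℂ, v = t • (a ⨯₃ b) :=
  exists_smul_of_cross_eq_zero h (by rw [cross_cross_eq_smul_sub_smul, hb, ha]; simp)

theorem triple_eq_zero_of_dot (hv : v ≠ 0) (ha : a ⬝ᵥ v = 0) (hb : b ⬝ᵥ v = 0)
    (hc : c ⬝ᵥ v = 0) : a ⬝ᵥ b ⨯₃ c = 0 := by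
  by_cases h : b ⨯₃ c = 0
  · simp [h]
  obtain ⟨t, rfl⟩ := eq_smul_cross h hb hc
  rw [dotProduct_smul, smul_eq_mul] at ha
  exact (mul_eq_zero.1 ha).resolve_left fun ht => hv (by simp [ht])

theorem exists_ne_zero_of_triple_eq_zero (h : a ⬝ᵥ b ⨯₃ c = 0) (hbc : b ⨯₃ c ≠ 0) :
    ∃ v : Fin 3 → ℂ, v ≠ 0 ∧ a ⬝ᵥ v = 0 ∧ b ⬝ᵥ v = 0 ∧ c ⬝ᵥ v = 0 :=
  ⟨_, hbc, h, dot_self_cross b c, dot_cross_self b c⟩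

end Vec

/-! ### Lines of the plane and their coefficient vectors -/

/-- The linear form with a given coefficient vector, as an element of `S_1`. -/
def linMap : (Fin 3 → ℂ) →ₗ[ℂ] Sd 1 where
  toFun n := ⟨linForm n, isHomogeneous_linForm n⟩
  map_add' n n' := Subtype.ext (linForm_add n n')
  map_smul' c n := Subtype.ext (by simp [linForm_smul, smul_eq_C_mul])

theorem linMap_bijective : Function.Bijective linMap :=
  ⟨fun n n' h => linForm_injective (congrArg Subtype.val h), fun ⟨P, hP⟩ => by
    rw [homogeneousSubmodule_one_eq_span_X, Submodule.mem_span_range_iff_exists_fun] at hP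
    obtain ⟨c, hc⟩ := hP
    exact ⟨c, Subtype.ext (by simp [← hc, linMap, linForm, smul_eq_C_mul])⟩⟩

/-- Linear forms correspond to their coefficient vectors. -/
def linEquiv : (Fin 3 → ℂ) ≃ₗ[ℂ] Sd 1 := LinearEquiv.ofBijective linMap linMap_bijective

@[simp] theorem coe_linEquiv (n : Fin 3 → ℂ) : (linEquiv n : S) = linForm n := rfl

theorem finrank_Sd_one : Module.finrank ℂ (Sd 1) = 3 := by
  rw [← linEquiv.finrank_eq]; simp

/-- The coefficient vector of the chosen equation of a line. -/
def covec (h : ℙ ℂ (Sd 1)) : Fin 3 → ℂ := linEquiv.symm h.rep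

theorem rep_eq_linForm (h : ℙ ℂ (Sd 1)) : (h.rep : S) = linForm (covec h) := by
  rw [← coe_linEquiv, covec, LinearEquiv.apply_symm_apply]

theorem covec_ne_zero (h : ℙ ℂ (Sd 1)) : covec h ≠ 0 := by
  simpa [covec] using h.rep_nonzero

theorem mem_line {h : ℙ ℂ (Sd 1)} {p : P2} : p ∈ line h ↔ covec h ⬝ᵥ p.rep = 0 := by
  rw [line, Set.mem_ofPred_eq, rep_eq_linForm, eval_linForm]

theorem mk_mem_line {h : ℙ ℂ (Sd 1)} {v : Fin 3 → ℂ} (hv : v ≠ 0) :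
    Projectivization.mk ℂ v hv ∈ line h ↔ covec h ⬝ᵥ v = 0 := by
  obtain ⟨c, hc⟩ := Projectivization.exists_smul_eq_mk_rep ℂ v hv
  rw [mem_line, ← hc, Units.smul_def, dotProduct_smul, smul_eq_zero]
  simp

/-- The line with a given coefficient vector. -/
def ofCovec (n : Fin 3 → ℂ) (hn : n ≠ 0) : ℙ ℂ (Sd 1) :=
  Projectivization.mk ℂ (linEquiv n) (by simpa using hn)

theorem covec_ofCovec {n : Fin 3 → ℂ} (hn : n ≠ 0) :
    ∃ c : ℂ, c ≠ 0 ∧ covec (ofCovec n hn) = c • n := by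
  obtain ⟨c, hc⟩ := Projectivization.exists_smul_eq_mk_rep ℂ (linEquiv n) (by simpa using hn)
  refine ⟨c, c.ne_zero, ?_⟩
  rw [covec, ofCovec, ← hc, Units.smul_def, map_smul, LinearEquiv.symm_apply_apply]

theorem ofCovec_covec (h : ℙ ℂ (Sd 1)) : ofCovec (covec h) (covec_ne_zero h) = h := by
  simp [ofCovec, covec]

theorem cross_covec_eq_zero {h h' : ℙ ℂ (Sd 1)} : covec h ⨯₃ covec h' = 0 ↔ h = h' := by
  constructor
  · intro h0
    obtain ⟨t, ht⟩ := exists_smul_of_cross_eq_zero (covec_ne_zero h) h0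
    rw [← ofCovec_covec h, ← ofCovec_covec h', eq_comm, ofCovec, ofCovec,
      Projectivization.mk_eq_mk_iff']
    exact ⟨t, by rw [← map_smul, ht]⟩
  · rintro rfl; exact cross_self _

/-- The vectors `n i` are the covectors of pairwise distinct lines, exactly those with index in
`M` (a set of size `m`) pass through the point `v`, and all other multiple points are double. -/
structure TypeData {d : ℕ} (m : ℕ) (n : Fin d → Fin 3 → ℂ) (M : Finset (Fin d))
    (v : Fin 3 → ℂ) : Prop where
  card : M.card = m
  ne_zero : v ≠ 0
  dot : ∀ i ∈ M, n i ⬝ᵥ v = 0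
  cross : ∀ i j, i ≠ j → n i ⨯₃ n j ≠ 0
  triple : ∀ i j k, i ≠ j → i ≠ k → j ≠ k → ¬ (i ∈ M ∧ j ∈ M ∧ k ∈ M) →
    n i ⬝ᵥ n j ⨯₃ n k ≠ 0

/-- A line outside `M` through `v` would be concurrent with two lines of `M`, which exist because `2
≤ m`. -/
theorem TypeData.dot_ne_zero {d m : ℕ} {n : Fin d → Fin 3 → ℂ} {M : Finset (Fin d)}
    {v : Fin 3 → ℂ} (h : TypeData m n M v) (hm : 2 ≤ m) {i : Fin d} (hi : i ∉ M) :
    n i ⬝ᵥ v ≠ 0 := by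
  intro h0
  obtain ⟨j, hj, k, hk, hjk⟩ := Finset.one_lt_card.1 (by rw [h.card]; omega : 1 < M.card)
  refine h.triple i j k (fun e => hi (e ▸ hj)) (fun e => hi (e ▸ hk)) hjk (fun e => hi e.1) ?_
  exact triple_eq_zero_of_dot h.ne_zero h0 (h.dot j hj) (h.dot k hk)

theorem TypeData.mem_iff {d m : ℕ} {n : Fin d → Fin 3 → ℂ} {M : Finset (Fin d)}
    {v : Fin 3 → ℂ} (h : TypeData m n M v) (hm : 2 ≤ m) {i : Fin d} :
    n i ⬝ᵥ v = 0 ↔ i ∈ M :=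
  ⟨fun h0 => by_contra fun hi => h.dot_ne_zero hm hi h0, h.dot i⟩

theorem TypeData.smul {d m : ℕ} {n : Fin d → Fin 3 → ℂ} {M : Finset (Fin d)}
    {v : Fin 3 → ℂ} (h : TypeData m n M v) {c : Fin d → ℂ} (hc : ∀ i, c i ≠ 0) :
    TypeData m (fun i => c i • n i) M v where
  card := h.card
  ne_zero := h.ne_zero
  dot i hi := by rw [smul_dotProduct, h.dot i hi, smul_zero]
  cross i j hij := by
    simp only [map_smul, LinearMap.smul_apply]
    exact smul_ne_zero (hc _) (smul_ne_zero (hc _) (h.cross i j hij))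
  triple i j k h1 h2 h3 h4 := by
    simp only [map_smul, LinearMap.smul_apply, smul_dotProduct, dotProduct_smul]
    exact smul_ne_zero (hc _) (smul_ne_zero (hc _) (smul_ne_zero (hc _) (h.triple i j k h1 h2 h3 h4)))

theorem line_inter_subsingleton {h h' : ℙ ℂ (Sd 1)} (hh : h ≠ h') {p q : P2} (hp : p ∈ line h)
    (hp' : p ∈ line h') (hq : q ∈ line h) (hq' : q ∈ line h') : p = q := by
  have h0 : covec h ⨯₃ covec h' ≠ 0 := fun e => hh (cross_covec_eq_zero.1 e)
  obtain ⟨t, ht⟩ := eq_smul_cross h0 (mem_line.1 hp) (mem_line.1 hp')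
  obtain ⟨s, hs⟩ := eq_smul_cross h0 (mem_line.1 hq) (mem_line.1 hq')
  rw [← p.mk_rep, ← q.mk_rep, Projectivization.mk_eq_mk_iff']
  have hs0 : s ≠ 0 := by rintro rfl; exact q.rep_nonzero (by simp [hs])
  exact ⟨t / s, by rw [hs, ht, smul_smul, div_mul_cancel₀ _ hs0]⟩

theorem exists_mem_line_inter (h h' : ℙ ℂ (Sd 1)) : ∃ p : P2, p ∈ line h ∧ p ∈ line h' := by
  by_cases hh : h = h'
  · subst hh
    -- For equal lines any point of the line will do, and a nonzero `covec h ⨯₃ b` is one.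
    obtain ⟨b, hb⟩ : ∃ b, covec h ⨯₃ b ≠ 0 := by
      by_contra! H
      obtain ⟨k, hk⟩ := Function.ne_iff.1 (covec_ne_zero h)
      have h1 := congrFun (H (Pi.single 0 1))
      have h2 := congrFun (H (Pi.single 1 1))
      simp only [cross_apply] at h1 h2
      have a1 := h1 1; have a2 := h1 2; have a3 := h2 2
      simp at a1 a2 a3
      fin_cases k <;> simp_all
    exact ⟨Projectivization.mk ℂ _ hb, (mk_mem_line hb).2 (dot_self_cross _ _),
      (mk_mem_line hb).2 (dot_self_cross _ _)⟩
  · have h0 : covec h ⨯₃ covec h' ≠ 0 := fun e => hh (cross_covec_eq_zero.1 e)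
    exact ⟨Projectivization.mk ℂ _ h0, (mk_mem_line h0).2 (dot_self_cross _ _),
      (mk_mem_line h0).2 (dot_cross_self _ _)⟩

open Classical in
/-- The labels of the lines through a point. -/
def linesAt {d : ℕ} (l : Fin d → ℙ ℂ (Sd 1)) (p : P2) : Finset (Fin d) :=
  Finset.univ.filter fun i => p ∈ line (l i)

@[simp] theorem mem_linesAt {d : ℕ} {l : Fin d → ℙ ℂ (Sd 1)} {p : P2} {i : Fin d} :
    i ∈ linesAt l p ↔ p ∈ line (l i) := by simp [linesAt]

theorem mult_eq_card {d : ℕ} (l : Fin d → ℙ ℂ (Sd 1)) (p : P2) : mult l p = (linesAt l p).card := by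
  rw [mult, ← Set.ncard_coe_finset]; congr 1; ext i; simp

/-- Passage from points and multiplicities to determinants: a point on three lines is a common zero
of three covectors, and the only such triples allowed are those through the special point. For `m =
2` any double point may play that role. -/
theorem exists_typeData_iff {d m : ℕ} (hm : 2 ≤ m) {l : Fin d → ℙ ℂ (Sd 1)} :
    (l ∈ Xd d ∧ HasType m l) ↔ ∃ M v, TypeData m (fun i => covec (l i)) M v := by
  constructor
  · rintro ⟨hl, p, hp, hq⟩
    have hcross : ∀ i j, i ≠ j → covec (l i) ⨯₃ covec (l j) ≠ 0 := fun i j hij e =>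
      hij (hl (cross_covec_eq_zero.1 e))
    refine ⟨linesAt l p, p.rep, by rw [← mult_eq_card, hp], p.rep_nonzero,
      fun i hi => mem_line.1 (mem_linesAt.1 hi), hcross, ?_⟩
    intro i j k hij hik hjk hM h0
    obtain ⟨v, hv, h1, h2, h3⟩ := exists_ne_zero_of_triple_eq_zero h0 (hcross j k hjk)
    have hne : Projectivization.mk ℂ v hv ≠ p := by
      rintro rfl
      exact hM ⟨mem_linesAt.2 ((mk_mem_line hv).2 h1), mem_linesAt.2 ((mk_mem_line hv).2 h2),
        mem_linesAt.2 ((mk_mem_line hv).2 h3)⟩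
    have h4 := hq _ hne
    rw [mult_eq_card, ← not_lt] at h4
    refine h4 (Finset.two_lt_card.2 ⟨i, ?_, j, ?_, k, ?_, hij, hik, hjk⟩) <;>
      rw [mem_linesAt, mk_mem_line] <;> assumption
  · rintro ⟨M, v, h⟩
    refine ⟨fun i j hij => by_contra fun hne => h.cross i j hne (by rw [hij]; exact cross_self _), ?_⟩
    refine ⟨Projectivization.mk ℂ v h.ne_zero, ?_, fun q hq => ?_⟩
    · rw [mult_eq_card]
      refine Eq.trans (congrArg Finset.card ?_) h.card
      ext i
      rw [mem_linesAt, mk_mem_line, h.mem_iff hm]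
    · rw [mult_eq_card]
      by_contra! h3
      obtain ⟨i, hi, j, hj, k, hk, hij, hik, hjk⟩ := Finset.two_lt_card.1 h3
      rw [mem_linesAt] at hi hj hk
      by_cases hM : i ∈ M ∧ j ∈ M ∧ k ∈ M
      · refine hq (line_inter_subsingleton (h := l i) (h' := l j) ?_ hi hj ?_ ?_)
        · intro e
          exact h.cross i j hij (by simp only [e]; exact cross_self _)
        · exact (mk_mem_line h.ne_zero).2 (h.dot i hM.1)
        · exact (mk_mem_line h.ne_zero).2 (h.dot j hM.2.1)
      · exact h.triple i j k hij hik hjk hM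
          (triple_eq_zero_of_dot q.rep_nonzero (mem_line.1 hi) (mem_line.1 hj) (mem_line.1 hk))

end LineArr

end

/-! ### The lattice of type (d, m): recognition and the invariant τ. -/

noncomputable section

namespace LineArr

open MvPolynomial
open scoped LinearAlgebra.Projectivization Matrix

/-! ### Intersection lattices as lattices of flats -/

section Flats

variable {d : ℕ}

/-- A set of labels is a flat if it consists of all lines containing the intersection of the lines
with labels in it. -/
def IsFlat (l : Fin d → ℙ ℂ (Sd 1)) (F : Finset (Fin d)) : Prop :=
  ∀ j, (⋂ i ∈ F, line (l i)) ⊆ line (l j) → j ∈ F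

open Classical in
/-- The labels of the lines containing a set. -/
def flatOf (l : Fin d → ℙ ℂ (Sd 1)) (x : Set P2) : Finset (Fin d) :=
  Finset.univ.filter fun i => x ⊆ line (l i)

theorem mem_flatOf {l : Fin d → ℙ ℂ (Sd 1)} {x : Set P2} {i : Fin d} :
    i ∈ flatOf l x ↔ x ⊆ line (l i) := by simp [flatOf]

theorem subset_iInter_flatOf (l : Fin d → ℙ ℂ (Sd 1)) (x : Set P2) :
    x ⊆ ⋂ i ∈ flatOf l x, line (l i) :=
  Set.subset_iInter₂ fun _ hi => mem_flatOf.1 hi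

theorem iInter_flatOf (l : Fin d → ℙ ℂ (Sd 1)) (s : Set (Fin d)) :
    ⋂ i ∈ flatOf l (⋂ i ∈ s, line (l i)), line (l i) = ⋂ i ∈ s, line (l i) := by
  refine Set.Subset.antisymm (Set.subset_iInter₂ fun i hi => ?_) (subset_iInter_flatOf l _)
  exact Set.iInter₂_subset i (mem_flatOf.2 (Set.iInter₂_subset i hi))

theorem isFlat_flatOf (l : Fin d → ℙ ℂ (Sd 1)) (x : Set P2) : IsFlat l (flatOf l x) := fun _ hj =>
  mem_flatOf.2 ((subset_iInter_flatOf l x).trans hj)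

theorem IsFlat.flatOf_eq {l : Fin d → ℙ ℂ (Sd 1)} {F : Finset (Fin d)} (hF : IsFlat l F) :
    flatOf l (⋂ i ∈ F, line (l i)) = F :=
  Finset.Subset.antisymm (fun j hj => hF j (mem_flatOf.1 hj)) fun _ hi =>
    mem_flatOf.2 (Set.iInter₂_subset _ hi)

/-- The intersection lattice is isomorphic to the poset of flats. -/
def interLatticeIso (l : Fin d → ℙ ℂ (Sd 1)) :
    InterLattice l ≃o {F : Finset (Fin d) // IsFlat l F} :=
  RelIso.ofSurjective
    (OrderEmbedding.ofMapLEIff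
      (fun x : InterLattice l =>
        (⟨flatOf l (OrderDual.ofDual x).1, isFlat_flatOf l _⟩ : {F : Finset (Fin d) // IsFlat l F}))
      (by
        rintro ⟨x, s, rfl⟩ ⟨y, t, rfl⟩
        constructor
        · intro h
          show (⋂ i ∈ t, line (l i)) ⊆ ⋂ i ∈ s, line (l i)
          rw [← iInter_flatOf l s, ← iInter_flatOf l t]
          exact Set.biInter_subset_biInter_left h
        · intro h i hi
          exact mem_flatOf.2 (Set.Subset.trans h (mem_flatOf.1 hi))))
    (fun ⟨F, hF⟩ => ⟨OrderDual.toDual ⟨⋂ i ∈ F, line (l i), (F : Set (Fin d)), by simp⟩,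
      Subtype.ext hF.flatOf_eq⟩)

/-- Two families of sets of labels containing the empty set and all singletons are isomorphic as
posets if and only if they differ by a permutation of the labels. -/
theorem nonempty_iso_iff {P Q : Finset (Fin d) → Prop} (hP0 : P ∅) (hQ0 : Q ∅)
    (hP1 : ∀ i, P {i}) (hQ1 : ∀ i, Q {i}) :
    Nonempty ({F // P F} ≃o {F // Q F}) ↔
      ∃ σ : Equiv.Perm (Fin d), ∀ F, P F ↔ Q (F.map σ.toEmbedding) := by
  constructor
  · rintro ⟨e⟩
    -- An isomorphism preserves the bottom element `∅`, hence maps atoms to atoms. The atoms are the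
    -- singletons, and this defines the permutation.
    have key : ∀ i, ∃ j, (e ⟨{i}, hP1 i⟩).1 = {j} := by
      intro i
      have hbot : e ⟨∅, hP0⟩ = ⟨∅, hQ0⟩ := by
        apply le_antisymm
        · rw [← e.le_symm_apply]; exact Finset.empty_subset _
        · exact Finset.empty_subset _
      have hne : (e ⟨{i}, hP1 i⟩).1.Nonempty := by
        rw [Finset.nonempty_iff_ne_empty]
        intro h
        have : e ⟨{i}, hP1 i⟩ = e ⟨∅, hP0⟩ := by rw [hbot]; exact Subtype.ext h
        have := congrArg Subtype.val (e.injective this)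
        simp at this
      obtain ⟨j, hj⟩ := hne
      refine ⟨j, ?_⟩
      have h1 : (⟨{j}, hQ1 j⟩ : {F // Q F}) ≤ e ⟨{i}, hP1 i⟩ := Finset.singleton_subset_iff.2 hj
      have h2 : e.symm ⟨{j}, hQ1 j⟩ ≤ ⟨{i}, hP1 i⟩ := by rwa [e.symm_apply_le]
      rcases Finset.subset_singleton_iff.1 (show (e.symm ⟨{j}, hQ1 j⟩).1 ⊆ {i} from h2) with h3 | h3
      · have : e.symm ⟨{j}, hQ1 j⟩ = ⟨∅, hP0⟩ := Subtype.ext h3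
        rw [e.symm_apply_eq, hbot] at this
        have := congrArg Subtype.val this
        simp at this
      · have : e.symm ⟨{j}, hQ1 j⟩ = ⟨{i}, hP1 i⟩ := Subtype.ext h3
        rw [e.symm_apply_eq] at this
        rw [← this]
    choose σ hσ using key
    have hinj : Function.Injective σ := by
      intro i j hij
      have : e ⟨{i}, hP1 i⟩ = e ⟨{j}, hP1 j⟩ := Subtype.ext (by rw [hσ, hσ, hij])
      have := congrArg Subtype.val (e.injective this)
      simpa using this
    let τ : Equiv.Perm (Fin d) := Equiv.ofBijective σ (Finite.injective_iff_bijective.1 hinj)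
    have hτ : ∀ i, τ i = σ i := fun i => rfl
    -- Membership of `i` in `F` says that the atom `{i}` lies below `F`, so the isomorphism is
    -- determined by its effect on atoms.
    have hmem : ∀ (F : {F // P F}) i, i ∈ F.1 ↔ τ i ∈ (e F).1 := by
      intro F i
      rw [← Finset.singleton_subset_iff, ← Finset.singleton_subset_iff (a := τ i), hτ, ← hσ i]
      exact (e.le_iff_le (x := ⟨{i}, hP1 i⟩) (y := F)).symm
    have hval : ∀ F : {F // P F}, (e F).1 = F.1.map τ.toEmbedding := by
      intro F
      ext j
      obtain ⟨i, rfl⟩ := τ.surjective j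
      rw [← hmem]
      simp
    refine ⟨τ, fun F => ⟨fun hF => ?_, fun hF => ?_⟩⟩
    · rw [← hval ⟨F, hF⟩]; exact (e ⟨F, hF⟩).2
    · have h1 := hval (e.symm ⟨_, hF⟩)
      rw [e.apply_symm_apply] at h1
      have h2 : F = (e.symm ⟨_, hF⟩).1 := Finset.map_injective _ h1
      rw [h2]; exact (e.symm ⟨_, hF⟩).2
  · rintro ⟨σ, hσ⟩
    refine ⟨RelIso.ofSurjective (OrderEmbedding.ofMapLEIff
      (fun F : {F // P F} => (⟨F.1.map σ.toEmbedding, (hσ _).1 F.2⟩ : {F // Q F})) ?_) ?_⟩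
    · intro F G
      exact Finset.map_subset_map
    · rintro ⟨G, hG⟩
      have h1 : (G.map σ.symm.toEmbedding).map σ.toEmbedding = G := by
        rw [Finset.map_map]; ext; simp
      refine ⟨⟨G.map σ.symm.toEmbedding, (hσ _).2 (by rwa [h1])⟩, Subtype.ext h1⟩

theorem card_firstLines {d m : ℕ} (h : m ≤ d) : (firstLines d m).card = m := by
  rw [firstLines, Fin.card_filter_val_lt, min_eq_right h]

/-- The sets of labels belonging to `L(d, m)`, with an arbitrary set `M` of lines through the
special point. -/
def LdmFamily (M F : Finset (Fin d)) : Prop :=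
  F = ∅ ∨ F.card = 1 ∨ F = M ∨ (F.card = 2 ∧ ¬ F ⊆ M) ∨ F = Finset.univ

theorem LdmFamily_map (σ : Equiv.Perm (Fin d)) (M F : Finset (Fin d)) :
    LdmFamily (M.map σ.toEmbedding) (F.map σ.toEmbedding) ↔ LdmFamily M F := by
  have h : F.map σ.toEmbedding = Finset.univ ↔ F = Finset.univ := by
    conv_lhs => rw [← Finset.map_univ_equiv σ]
    exact (Finset.map_injective _).eq_iff
  simp [LdmFamily, h, Finset.map_subset_map]

theorem isFlat_empty {l : Fin d → ℙ ℂ (Sd 1)} : IsFlat l ∅ := by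
  intro j hj
  exfalso
  simp only [Finset.notMem_empty, Set.iInter_of_empty, Set.iInter_univ] at hj
  obtain ⟨k, hk⟩ := Function.ne_iff.1 (covec_ne_zero (l j))
  have h1 : (Pi.single k 1 : Fin 3 → ℂ) ≠ 0 := by simp
  have h2 := (mk_mem_line h1).1 (hj (Set.mem_univ (Projectivization.mk ℂ _ h1)))
  simp at h2
  exact hk h2

/-- Every nonzero n × b is a point of the first line, so n' · (n × b) = 0 for all b. Hence n × n' is
orthogonal to every vector. -/
theorem eq_of_line_subset {h h' : ℙ ℂ (Sd 1)} (hs : line h ⊆ line h') : h = h' := by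
  rw [← cross_covec_eq_zero]
  set n := covec h
  set n' := covec h'
  have key : ∀ b, n' ⬝ᵥ n ⨯₃ b = 0 := by
    intro b
    by_cases hb : n ⨯₃ b = 0
    · simp [hb]
    · exact (mk_mem_line hb).1 (hs ((mk_mem_line hb).2 (dot_self_cross _ _)))
  refine dotProduct_eq _ 0 fun b => ?_
  rw [zero_dotProduct, dotProduct_comm]
  have := key b
  rw [triple_product_permutation, triple_product_permutation, ← cross_anticomm, dotProduct_neg,
    neg_eq_zero] at this
  rwa [← cross_anticomm, dotProduct_neg, neg_eq_zero, ← cross_anticomm, dotProduct_neg, neg_eq_zero]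

theorem isFlat_singleton {l : Fin d → ℙ ℂ (Sd 1)} (hl : l ∈ Xd d) (i : Fin d) : IsFlat l {i} := by
  intro j hj
  simp only [Finset.mem_singleton, Set.iInter_iInter_eq_left] at hj ⊢
  exact (hl (eq_of_line_subset hj)).symm

theorem isFlat_linesAt (l : Fin d → ℙ ℂ (Sd 1)) (p : P2) : IsFlat l (linesAt l p) := fun _ hj =>
  mem_linesAt.2 (hj (Set.mem_iInter₂.2 fun _ hi => mem_linesAt.1 hi))

/-- The flats of an arrangement with one `m`-fold point and otherwise double points. -/
theorem TypeData.isFlat_iff {m : ℕ} (hm : 2 ≤ m) {l : Fin d → ℙ ℂ (Sd 1)} (hl : l ∈ Xd d)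
    {M : Finset (Fin d)} {v : Fin 3 → ℂ} (h : TypeData m (fun i => covec (l i)) M v)
    (F : Finset (Fin d)) : IsFlat l F ↔ LdmFamily M F := by
  constructor
  · intro hF
    by_cases h0 : F.card ≤ 1
    · rcases Nat.le_one_iff_eq_zero_or_eq_one.1 h0 with h1 | h1
      · exact Or.inl (Finset.card_eq_zero.1 h1)
      · exact Or.inr (Or.inl h1)
    push Not at h0
    obtain ⟨i, hi, j, hj, hij⟩ := Finset.one_lt_card.1 h0
    -- Two lines of `M` meet only at `v`, so a flat inside `M` with two elements is `M`. A set of at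
    -- least three lines not contained in `M` has empty intersection, so as a flat it contains every
    -- line.
    by_cases hFM : F ⊆ M
    · refine Or.inr (Or.inr (Or.inl (Finset.Subset.antisymm hFM fun k hk => hF k fun q hq => ?_)))
      rw [Set.mem_iInter₂] at hq
      have : q = Projectivization.mk ℂ v h.ne_zero :=
        line_inter_subsingleton (hl.ne hij) (hq i hi) (hq j hj)
          ((mk_mem_line _).2 (h.dot i (hFM hi))) ((mk_mem_line _).2 (h.dot j (hFM hj)))
      rw [this, mk_mem_line]
      exact h.dot k hk
    by_cases h2 : F.card = 2
    · exact Or.inr (Or.inr (Or.inr (Or.inl ⟨h2, hFM⟩)))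
    refine Or.inr (Or.inr (Or.inr (Or.inr (Finset.eq_univ_of_forall fun k => hF k fun q hq => ?_))))
    exfalso
    rw [Set.mem_iInter₂] at hq
    obtain ⟨a, ha, haM⟩ := Finset.not_subset.1 hFM
    have : 1 < (F.erase a).card := by rw [Finset.card_erase_of_mem ha]; omega
    obtain ⟨b, hb, c, hc, hbc⟩ := Finset.one_lt_card.1 this
    rw [Finset.mem_erase] at hb hc
    exact h.triple a b c hb.1.symm hc.1.symm hbc (fun e => haM e.1)
      (triple_eq_zero_of_dot q.rep_nonzero (mem_line.1 (hq a ha)) (mem_line.1 (hq b hb.2))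
        (mem_line.1 (hq c hc.2)))
  · rintro (rfl | h1 | rfl | ⟨h2, hFM⟩ | rfl)
    · exact isFlat_empty
    · obtain ⟨i, rfl⟩ := Finset.card_eq_one.1 h1
      exact isFlat_singleton hl i
    · intro j hj
      have := hj (Set.mem_iInter₂.2 fun i hi => (mk_mem_line h.ne_zero).2 (h.dot i hi))
      exact (h.mem_iff hm).1 ((mk_mem_line h.ne_zero).1 this)
    · obtain ⟨i, j, hij, rfl⟩ := Finset.card_eq_two.1 h2
      intro k hk
      by_contra hkij
      obtain ⟨q, hq, hq'⟩ := exists_mem_line_inter (l i) (l j)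
      have hqk : q ∈ line (l k) := hk (by simp [hq, hq'])
      simp only [Finset.mem_insert, Finset.mem_singleton, not_or] at hkij
      refine h.triple i j k hij (Ne.symm hkij.1) (Ne.symm hkij.2) ?_
        (triple_eq_zero_of_dot q.rep_nonzero (mem_line.1 hq) (mem_line.1 hq') (mem_line.1 hqk))
      rintro ⟨h1, h2, -⟩
      exact hFM (by simp [Finset.insert_subset_iff, h1, h2])
    · intro j _; exact Finset.mem_univ j

/-- The special point is the intersection of two lines of `M`. The lines through it form a flat
containing both labels, and the list of flats leaves only `M`. -/
theorem hasType_of_isFlat_iff {m : ℕ} (hm : 2 ≤ m) {l : Fin d → ℙ ℂ (Sd 1)} (hl : l ∈ Xd d)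
    {M : Finset (Fin d)} (hM : M.card = m) (h : ∀ F, IsFlat l F ↔ LdmFamily M F) :
    HasType m l := by
  obtain ⟨i, hi, j, hj, hij⟩ := Finset.one_lt_card.1 (by omega : 1 < M.card)
  obtain ⟨p, hp, hp'⟩ := exists_mem_line_inter (l i) (l j)
  have hflat : ∀ q, i ∈ linesAt l q → j ∈ linesAt l q → q = p := fun q h1 h2 =>
    line_inter_subsingleton (hl.ne hij) (mem_linesAt.1 h1) (mem_linesAt.1 h2) hp hp'
  have hMp : linesAt l p = M := by
    have hi' : i ∈ linesAt l p := mem_linesAt.2 hp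
    have hj' : j ∈ linesAt l p := mem_linesAt.2 hp'
    rcases (h _).1 (isFlat_linesAt l p) with h1 | h1 | h1 | ⟨h1, h2⟩ | h1
    · simp [h1] at hi'
    · exact absurd (Finset.card_le_one.1 h1.le i hi' j hj') hij
    · exact h1
    · refine absurd ?_ h2
      have : linesAt l p = {i, j} := (Finset.eq_of_subset_of_card_le
        (by simp [Finset.insert_subset_iff, hp, hp']) (by rw [h1, Finset.card_pair hij])).symm
      rw [this]
      simp [Finset.insert_subset_iff, hi, hj]
    · have hMf : IsFlat l M := (h M).2 (Or.inr (Or.inr (Or.inl rfl)))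
      refine h1.trans (Finset.eq_univ_of_forall fun k => hMf k fun q hq => ?_).symm
      rw [Set.mem_iInter₂] at hq
      rw [hflat q (mem_linesAt.2 (hq i hi)) (mem_linesAt.2 (hq j hj))]
      exact mem_linesAt.1 (by rw [h1]; exact Finset.mem_univ k)
  refine ⟨p, by rw [mult_eq_card, hMp, hM], fun q hq => ?_⟩
  rw [mult_eq_card]
  rcases (h _).1 (isFlat_linesAt l q) with h1 | h1 | h1 | ⟨h1, h2⟩ | h1
  · simp [h1]
  · omega
  · exact absurd (hflat q (h1 ▸ hi) (h1 ▸ hj)) hq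
  · omega
  · exact absurd (hflat q (h1 ▸ Finset.mem_univ i) (h1 ▸ Finset.mem_univ j)) hq

theorem exists_perm_map_eq {M N : Finset (Fin d)} (h : M.card = N.card) :
    ∃ σ : Equiv.Perm (Fin d), M.map σ.toEmbedding = N := by
  have e : {i // i ∈ M} ≃ {i // i ∈ N} := Finset.equivOfCardEq h
  refine ⟨e.extendSubtype, ?_⟩
  refine Finset.eq_of_subset_of_card_le (fun j hj => ?_) (by simp [h])
  obtain ⟨i, hi, rfl⟩ := Finset.mem_map.1 hj
  exact e.extendSubtype_mem i hi

/-- Both posets are families of label sets containing `∅` and the singletons, so an isomorphism is a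
relabelling of the lines. Relabelling only replaces the set `firstLines d m` by another set of `m`
labels. -/
theorem XL_Ldm_eq {m : ℕ} (hm : 2 ≤ m) (hmd : m ≤ d) :
    XL d (Ldm d m) = {l | l ∈ Xd d ∧ HasType m l} := by
  ext l
  refine and_congr_right fun hl => ?_
  have h1 : Nonempty (InterLattice l ≃o Ldm d m) ↔
      Nonempty ({F : Finset (Fin d) // IsFlat l F} ≃o
        {F : Finset (Fin d) // LdmFamily (firstLines d m) F}) :=
    ⟨fun ⟨e⟩ => ⟨(interLatticeIso l).symm.trans e⟩, fun ⟨e⟩ => ⟨(interLatticeIso l).trans e⟩⟩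
  rw [h1, nonempty_iso_iff isFlat_empty (Or.inl rfl) (isFlat_singleton hl)
    (fun i => Or.inr (Or.inl (Finset.card_singleton i)))]
  constructor
  · rintro ⟨σ, hσ⟩
    refine hasType_of_isFlat_iff hm hl (M := (firstLines d m).map σ.symm.toEmbedding)
      (by rw [Finset.card_map, card_firstLines hmd]) fun F => ?_
    rw [hσ, ← LdmFamily_map σ.symm]
    simp [Finset.map_map]
  · intro ht
    obtain ⟨M, v, h⟩ := (exists_typeData_iff hm).1 ⟨hl, ht⟩
    obtain ⟨σ, hσ⟩ := exists_perm_map_eq (h.card.trans (card_firstLines hmd).symm)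
    exact ⟨σ, fun F => by rw [h.isFlat_iff hm hl, ← hσ, LdmFamily_map]⟩

end Flats

end LineArr

end

noncomputable section

namespace LineArr

open Order

/-! ### The invariant `τ` of the lattices `L(d, m)` -/

section Tau

variable {d m : ℕ}

/-- Along a strict chain of label sets the cardinality strictly increases. -/
theorem Ldm_height_le_card (x : Ldm d m) : height x ≤ x.1.card := by
  induction hn : x.1.card using Nat.strong_induction_on generalizing x with
  | _ n ih =>
    refine height_le_coe_iff.2 fun y hy => ?_
    have h : y.1.card < n := hn ▸ Finset.card_lt_card hy
    exact (ih _ h y rfl).trans_lt (by exact_mod_cast h)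

theorem Ldm_height_lt_top (x : Ldm d m) : height x < ⊤ :=
  (Ldm_height_le_card x).trans_lt (ENat.natCast_lt_top _)

theorem Ldm_height_eq_one_of_card (x : Ldm d m) (hx : x.1.card = 1) : height x = 1 := by
  have hb : height (⟨∅, Or.inl rfl⟩ : Ldm d m) = 0 :=
    height_eq_zero.2 fun y _ => Finset.empty_subset _
  have h := (height_eq_coe_add_one_iff (x := x) (n := 0)).2 ⟨Ldm_height_lt_top x,
    ⟨⟨∅, Or.inl rfl⟩, lt_of_le_of_ne (Finset.empty_subset _) fun h => ?_, by simpa using hb⟩, fun y hy => ?_⟩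
  · simpa using h
  · rw [← h] at hx; simp at hx
  · have : y.1.card < x.1.card := Finset.card_lt_card hy
    have hy0 : y = ⟨∅, Or.inl rfl⟩ := Subtype.ext (Finset.card_eq_zero.1 (by omega))
    rw [hy0, hb]; simp

theorem Ldm_two_le_height (x : Ldm d m) (hx : 2 ≤ x.1.card) : 2 ≤ height x := by
  obtain ⟨i, hi⟩ := Finset.card_pos.1 (by omega : 0 < x.1.card)
  have h1 : (⟨{i}, Or.inr (Or.inl (Finset.card_singleton i))⟩ : Ldm d m) < x := by
    refine lt_of_le_of_ne (Finset.singleton_subset_iff.2 hi) fun h => ?_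
    rw [← h] at hx; simp at hx
  have h2 := height_strictMono h1 (Ldm_height_lt_top _)
  rw [Ldm_height_eq_one_of_card _ (Finset.card_singleton i)] at h2
  exact Order.add_one_le_of_lt h2

theorem Ldm_height_eq_one_iff (x : Ldm d m) : height x = 1 ↔ x.1.card = 1 := by
  refine ⟨fun h => ?_, Ldm_height_eq_one_of_card x⟩
  by_contra hx
  rcases Nat.lt_or_ge x.1.card 2 with h1 | h1
  · have hx0 : x.1 = ∅ := Finset.card_eq_zero.1 (by omega)
    have : height x = 0 := height_eq_zero.2 fun y _ => by
      show x.1 ⊆ y.1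
      rw [hx0]; exact Finset.empty_subset _
    simp [this] at h
  · have := Ldm_two_le_height x h1
    rw [h] at this
    norm_num at this

theorem Ldm_height_eq_two_of_lt (x : Ldm d m) (hx : 2 ≤ x.1.card)
    (h : ∀ y < x, y.1.card ≤ 1) : height x = 2 := by
  refine le_antisymm ?_ (Ldm_two_le_height x hx)
  refine height_le_coe_iff.2 fun y hy => (Ldm_height_le_card y).trans_lt ?_
  exact_mod_cast Nat.lt_succ_of_le (h y hy)

/-- The top element needs care: it has rank two only when it is the `m`-fold point itself. Otherwise
it lies strictly above that point, which already has rank two. -/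
theorem Ldm_height_eq_two_iff (hm : 2 ≤ m) (hmd : m ≤ d) (x : Ldm d m) :
    height x = 2 ↔ x.1 = firstLines d m ∨ (x.1.card = 2 ∧ ¬ x.1 ⊆ firstLines d m) := by
  have hM : height (⟨firstLines d m, Or.inr (Or.inr (Or.inl rfl))⟩ : Ldm d m) = 2 := by
    refine Ldm_height_eq_two_of_lt _ (by simp only [card_firstLines hmd]; exact hm) fun y hy => ?_
    have hlt : y.1 ⊂ firstLines d m := hy
    rcases y.2 with h | h | h | ⟨h, h'⟩ | h
    · simp [h]
    · exact h.le
    · exact absurd h hlt.ne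
    · exact absurd hlt.subset h'
    · rw [h] at hlt; exact absurd (Finset.subset_univ _) hlt.not_subset
  constructor
  · intro h
    rcases x.2 with h1 | h1 | h1 | h1 | h1
    · have : height x = 0 := height_eq_zero.2 fun y _ => by
        show x.1 ⊆ y.1
        rw [h1]; exact Finset.empty_subset _
      simp [this] at h
    · rw [(Ldm_height_eq_one_iff x).2 h1] at h; norm_num at h
    · exact Or.inl h1
    · exact Or.inr h1
    · by_cases hu : Finset.univ = firstLines d m
      · exact Or.inl (h1.trans hu)
      · exfalso
        have hlt : (⟨firstLines d m, Or.inr (Or.inr (Or.inl rfl))⟩ : Ldm d m) < x := by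
          refine lt_of_le_of_ne ?_ fun e => hu ?_
          · show firstLines d m ⊆ x.1
            rw [h1]; exact Finset.subset_univ _
          · rw [← h1, ← e]
        have := height_strictMono hlt (Ldm_height_lt_top _)
        rw [hM, h] at this
        exact lt_irrefl _ this
  · rintro (h | ⟨h, -⟩)
    · rw [← hM]; congr 1; exact Subtype.ext h
    · refine Ldm_height_eq_two_of_lt _ h.ge fun y hy => ?_
      have : y.1.card < x.1.card := Finset.card_lt_card hy
      omega

theorem Ldm_ncard_height_one (x : Ldm d m) :
    {a : Ldm d m | height a = 1 ∧ a ≤ x}.ncard = x.1.card := by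
  have h : {a : Ldm d m | height a = 1 ∧ a ≤ x} = (fun i : Fin d =>
      (⟨{i}, Or.inr (Or.inl (Finset.card_singleton i))⟩ : Ldm d m)) '' (x.1 : Set (Fin d)) := by
    ext a
    simp only [Set.mem_ofPred_eq, Set.mem_image, Ldm_height_eq_one_iff]
    constructor
    · rintro ⟨h1, h2⟩
      obtain ⟨i, hi⟩ := Finset.card_eq_one.1 h1
      refine ⟨i, ?_, Subtype.ext hi.symm⟩
      have : a.1 ⊆ x.1 := h2
      rw [hi] at this
      simpa using this
    · rintro ⟨i, hi, rfl⟩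
      exact ⟨Finset.card_singleton i, Finset.singleton_subset_iff.2 hi⟩
  rw [h, Set.ncard_image_of_injective, Set.ncard_coe_finset]
  intro i j hij
  simpa using congrArg Subtype.val hij

/-- The rank-two elements are the `m`-fold point and one double point for each pair of lines not
both through it, binom(d, 2) - binom(m, 2) in number. The additive form avoids truncated
subtraction. -/
theorem tauL_Ldm (hm : 2 ≤ m) (hmd : m ≤ d) :
    tauL (Ldm d m) + m.choose 2 = (m - 1) ^ 2 + d.choose 2 := by
  classical
  set M := firstLines d m with hMdef
  have hMc : M.card = m := card_firstLines hmd
  set T : Finset (Finset (Fin d)) := (Finset.univ.powersetCard 2).filter fun F => ¬ F ⊆ M with hT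
  have hTc : T.card + m.choose 2 = d.choose 2 := by
    have h1 := Finset.card_filter_add_card_filter_not (s := (Finset.univ : Finset (Fin d)).powersetCard 2)
      (p := fun F => F ⊆ M)
    have h2 : ((Finset.univ : Finset (Fin d)).powersetCard 2).filter (fun F => F ⊆ M) =
        M.powersetCard 2 := by
      ext F; simp [Finset.mem_powersetCard, and_comm]
    rw [h2, Finset.card_powersetCard, Finset.card_powersetCard, hMc, Finset.card_univ,
      Fintype.card_fin] at h1
    rw [hT]; omega
  have hsum : tauL (Ldm d m) = ∑ F ∈ insert M T, (F.card - 1) ^ 2 := by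
    rw [tauL]
    have : ∀ p : Ldm d m, (∑ᶠ (_ : height p = 2), ({a : Ldm d m | height a = 1 ∧ a ≤ p}.ncard - 1) ^ 2)
        = if p.1 ∈ insert M T then (p.1.card - 1) ^ 2 else 0 := by
      intro p
      rw [finsum_eq_if, Ldm_ncard_height_one]
      refine if_congr ?_ rfl rfl
      rw [Ldm_height_eq_two_iff hm hmd]
      simp [hT, ← hMdef]
    simp_rw [this]
    rw [finsum_eq_sum_of_fintype, ← Finset.sum_filter]
    refine Finset.sum_bij (fun p _ => p.1) (fun p hp => (Finset.mem_filter.1 hp).2)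
      (fun p _ q _ h => Subtype.ext h) (fun F hF => ⟨⟨F, ?_⟩, by simpa using hF, rfl⟩) (fun _ _ => rfl)
    rcases Finset.mem_insert.1 hF with h | h
    · exact Or.inr (Or.inr (Or.inl h))
    · rw [hT, Finset.mem_filter, Finset.mem_powersetCard_univ] at h
      exact Or.inr (Or.inr (Or.inr (Or.inl h)))
  have hMT : M ∉ T := by simp [hT]
  rw [hsum, Finset.sum_insert hMT, hMc]
  have : ∑ F ∈ T, (F.card - 1) ^ 2 = T.card := by
    rw [Finset.card_eq_sum_ones]
    refine Finset.sum_congr rfl fun F hF => ?_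
    rw [hT, Finset.mem_filter, Finset.mem_powersetCard_univ] at hF
    rw [hF.1]; rfl
  omega

theorem two_mul_choose_two (n : ℕ) : 2 * n.choose 2 = n * (n - 1) := by
  rw [Nat.choose_two_right, Nat.mul_div_cancel' (Nat.even_mul_pred_self n).two_dvd]

theorem tauL_Ldm_eq_choose (hm : 2 ≤ m) (hmd : m ≤ d) :
    tauL (Ldm d m) = d.choose 2 + (m - 1).choose 2 := by
  have h := tauL_Ldm hm hmd
  have h1 := two_mul_choose_two m
  have h2 := two_mul_choose_two (m - 1)
  obtain ⟨k, rfl⟩ : ∃ k, m = k + 2 := ⟨m - 2, by omega⟩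
  simp only [show k + 2 - 1 = k + 1 from rfl, show k + 1 - 1 = k from rfl] at *
  nlinarith

theorem choose_two_add_choose_two (hm : 2 ≤ m) (hmd : m ≤ d) :
    d.choose 2 + (m - 1).choose 2 = (m - 1) ^ 2 + ∑ i ∈ Finset.Ico m d, i := by
  induction d, hmd using Nat.le_induction with
  | base =>
    have h1 := two_mul_choose_two m
    have h2 := two_mul_choose_two (m - 1)
    obtain ⟨k, rfl⟩ : ∃ k, m = k + 2 := ⟨m - 2, by omega⟩
    simp only [show k + 2 - 1 = k + 1 from rfl, show k + 1 - 1 = k from rfl, Finset.Ico_self, Finset.sum_empty] at *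
    nlinarith
  | succ n hmn ih =>
    rw [Finset.sum_Ico_succ_top hmn, Nat.choose_succ_succ' n 1, Nat.choose_one_right,
      show (1 + 1 : ℕ) = 2 from rfl]
    omega

end Tau

end LineArr

end

/-! ### Total Tjurina numbers: local computation and counting of points. -/

noncomputable section

namespace LineArr

open MvPolynomial
open scoped LinearAlgebra.Projectivization Matrix

/-! ### Coordinates on spaces of homogeneous polynomials -/

section HomCoord

variable {σ : Type} [Fintype σ]

/-- Exponents of the monomials of degree `k`. -/
abbrev MonIdx (σ : Type) [Fintype σ] [DecidableEq σ] (k : ℕ) : Type :=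
  {μ : σ →₀ ℕ // μ ∈ (Finset.univ : Finset σ).finsuppAntidiag k}

variable [DecidableEq σ]

theorem mem_antidiag_iff {k : ℕ} {μ : σ →₀ ℕ} :
    μ ∈ (Finset.univ : Finset σ).finsuppAntidiag k ↔ μ.degree = k := by
  simp [Finset.mem_finsuppAntidiag, Finsupp.degree_eq_sum]

/-- The coefficients of a homogeneous polynomial. -/
def homCoord (σ : Type) [Fintype σ] [DecidableEq σ] (k : ℕ) :
    homogeneousSubmodule σ ℂ k ≃ₗ[ℂ] (MonIdx σ k → ℂ) where
  toFun P μ := coeff μ.1 P.1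
  map_add' P Q := by ext; simp
  map_smul' c P := by ext; simp
  invFun c := ⟨∑ μ, monomial μ.1 (c μ), Submodule.sum_mem _ fun μ _ =>
    isHomogeneous_monomial _ (mem_antidiag_iff.1 μ.2)⟩
  left_inv P := by
    ext ν
    simp only [coeff_sum, coeff_monomial]
    by_cases hν : ν.degree = k
    · rw [Finset.sum_eq_single ⟨ν, mem_antidiag_iff.2 hν⟩]
      · simp
      · intro μ _ hμ
        exact if_neg fun h => hμ (Subtype.ext h)
      · simp
    · rw [((mem_homogeneousSubmodule _ _).1 P.2).coeff_eq_zero hν]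
      refine Finset.sum_eq_zero fun μ _ => if_neg ?_
      rintro rfl
      exact hν (mem_antidiag_iff.1 μ.2)
  right_inv c := by
    ext ν
    simp only [coeff_sum, coeff_monomial]
    rw [Finset.sum_eq_single ν]
    · simp
    · intro μ _ hμ
      exact if_neg fun h => hμ (Subtype.ext h)
    · simp

theorem finrank_homogeneousSubmodule (k : ℕ) :
    Module.finrank ℂ (homogeneousSubmodule σ ℂ k) = Fintype.card (MonIdx σ k) := by
  rw [(homCoord σ k).finrank_eq, Module.finrank_fintype_fun_eq_card]

instance (k : ℕ) : Module.Finite ℂ (homogeneousSubmodule σ ℂ k) :=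
  Module.Finite.equiv (homCoord σ k).symm

end HomCoord

/-! ### Products of distinct linear forms have no common factor with all their derivatives -/

section Gradient

variable {σ : Type} [Fintype σ] {ι : Type}

/-- The vectors are pairwise non-proportional. -/
def PairwiseIndep (s : Finset ι) (n : ι → σ → ℂ) : Prop :=
  (∀ i ∈ s, n i ≠ 0) ∧ ∀ i ∈ s, ∀ j ∈ s, i ≠ j → ∀ c : ℂ, n j ≠ c • n i

theorem isHomogeneous_prod_linForm (s : Finset ι) (n : ι → σ → ℂ) :
    (∏ i ∈ s, linForm (n i)).IsHomogeneous s.card := by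
  have := IsHomogeneous.prod s (fun i => linForm (n i)) (fun _ => 1)
    (fun i _ => isHomogeneous_linForm (n i))
  simpa using this

theorem prod_linForm_ne_zero {s : Finset ι} {n : ι → σ → ℂ} (hn : ∀ i ∈ s, n i ≠ 0) :
    (∏ i ∈ s, linForm (n i)) ≠ 0 :=
  Finset.prod_ne_zero_iff.2 fun i hi => linForm_ne_zero (hn i hi)

theorem PairwiseIndep.not_dvd_prod_erase [DecidableEq ι] {s : Finset ι} {n : ι → σ → ℂ}
    (h : PairwiseIndep s n) {j : ι} (hj : j ∈ s) :
    ¬ linForm (n j) ∣ ∏ i ∈ s.erase j, linForm (n i) := by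
  intro hd
  obtain ⟨i, hi, hdi⟩ := (prime_linForm (h.1 j hj)).exists_mem_finset_dvd hd
  rw [Finset.mem_erase] at hi
  obtain ⟨c, hc⟩ := linForm_dvd_linForm hdi
  exact h.2 j hj i hi.2 hi.1.symm c hc

/-- By Euler's formula a common prime factor of the partials divides the product, so it is one of
the factors ℓ_j. Modulo ℓ_j, the k-th partial is the k-th coefficient of ℓ_j times the product of
the other factors, which is nonzero for a suitable k. -/
theorem PairwiseIndep.not_forall_dvd_pderiv {s : Finset ι} (hs : s.Nonempty) {n : ι → σ → ℂ}
    (h : PairwiseIndep s n) {π : MvPolynomial σ ℂ} (hπ : Prime π)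
    (hd : ∀ k, π ∣ pderiv k (∏ i ∈ s, linForm (n i))) : False := by
  classical
  have hE := (isHomogeneous_prod_linForm s n).sum_X_mul_pderiv
  have hdvd : π ∣ ∏ i ∈ s, linForm (n i) := by
    have h1 : π ∣ s.card • ∏ i ∈ s, linForm (n i) := by
      rw [← hE]; exact Finset.dvd_sum fun k _ => (hd k).mul_left _
    rw [nsmul_eq_mul, ← map_natCast (C : ℂ →+* MvPolynomial σ ℂ)] at h1
    refine (hπ.dvd_or_dvd h1).resolve_left fun h2 => hπ.not_isUnit (isUnit_of_dvd_unit h2 ?_)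
    exact (isUnit_iff_ne_zero.2 (Nat.cast_ne_zero.2 hs.card_pos.ne')).map C
  obtain ⟨j, hj, hdj⟩ := hπ.exists_mem_finset_dvd hdvd
  have hassoc := hπ.irreducible.associated_of_dvd (prime_linForm (h.1 j hj)).irreducible hdj
  obtain ⟨k, hk⟩ := Function.ne_iff.1 (h.1 j hj)
  have h2 := hassoc.symm.dvd.trans (hd k)
  rw [← Finset.mul_prod_erase s _ hj, pderiv_mul, pderiv_linForm] at h2
  have h3 := (dvd_add_left (Dvd.intro _ rfl)).1 h2
  rcases (prime_linForm (h.1 j hj)).dvd_or_dvd h3 with h4 | h4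
  · exact (prime_linForm (h.1 j hj)).not_isUnit
      (isUnit_of_dvd_unit h4 ((isUnit_iff_ne_zero.2 hk).map C))
  · exact h.not_dvd_prod_erase hj h4

end Gradient

/-! ### Power series in two variables modulo two coprime forms -/

section PowerSeries

/-- Binary forms of degree `k`. -/
abbrev T2 (k : ℕ) : Submodule ℂ (MvPolynomial (Fin 2) ℂ) := homogeneousSubmodule (Fin 2) ℂ k

theorem finrank_T2 (k : ℕ) : Module.finrank ℂ (T2 k) = k + 1 := by
  rw [finrank_homogeneousSubmodule, Fintype.card_coe,
    Finset.card_finsuppAntidiag_nat_eq_choose]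
  simp [Nat.add_comm 1 k]

/-- The homogeneous component of degree `k` of a power series, as a polynomial. -/
def hcomp (k : ℕ) : MvPowerSeries (Fin 2) ℂ →ₗ[ℂ] T2 k :=
  (homCoord (Fin 2) k).symm.toLinearMap ∘ₗ LinearMap.pi fun μ => MvPowerSeries.coeff μ.1

theorem coeff_hcomp {k : ℕ} (r : MvPowerSeries (Fin 2) ℂ) {μ : Fin 2 →₀ ℕ} (hμ : μ.degree = k) :
    coeff μ (hcomp k r : MvPolynomial (Fin 2) ℂ) = MvPowerSeries.coeff μ r := by
  have := congrFun ((homCoord (Fin 2) k).apply_symm_apply fun μ => MvPowerSeries.coeff μ.1 r)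
    ⟨μ, mem_antidiag_iff.2 hμ⟩
  exact this

theorem ext_hcomp {r s : MvPowerSeries (Fin 2) ℂ} (h : ∀ k, hcomp k r = hcomp k s) : r = s := by
  ext μ
  rw [← coeff_hcomp r rfl, h, coeff_hcomp s rfl]

theorem exists_hcomp_eq (t : ∀ k, T2 k) : ∃ r, ∀ k, hcomp k r = t k := by
  obtain ⟨r, hr⟩ : ∃ r : MvPowerSeries (Fin 2) ℂ, ∀ μ,
      MvPowerSeries.coeff μ r = coeff μ (t μ.degree : MvPolynomial (Fin 2) ℂ) :=
    ⟨fun μ => coeff μ (t μ.degree : MvPolynomial (Fin 2) ℂ), fun _ => rfl⟩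
  refine ⟨r, fun k => ?_⟩
  ext μ
  by_cases hμ : μ.degree = k
  · rw [coeff_hcomp _ hμ, hr]
    subst hμ; rfl
  · rw [((mem_homogeneousSubmodule _ _).1 (t k).2).coeff_eq_zero hμ,
      ((mem_homogeneousSubmodule _ _).1 (hcomp k _).2).coeff_eq_zero hμ]

theorem coe_hcomp_mul {n : ℕ} {A : MvPolynomial (Fin 2) ℂ} (hA : A.IsHomogeneous n)
    (r : MvPowerSeries (Fin 2) ℂ) (k : ℕ) :
    (hcomp k (r * A.toMvPowerSeries) : MvPolynomial (Fin 2) ℂ) =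
      if n ≤ k then hcomp (k - n) r * A else 0 := by
  classical
  ext μ
  by_cases hμ : μ.degree = k
  · rw [coeff_hcomp _ hμ, MvPowerSeries.coeff_mul]
    have hdeg : ∀ x ∈ Finset.HasAntidiagonal.antidiagonal μ, x.1.degree + x.2.degree = k := by
      intro x hx
      rw [← hμ, ← Finset.HasAntidiagonal.mem_antidiagonal.1 hx, map_add]
    split_ifs with hnk
    · rw [coeff_mul]
      refine Finset.sum_congr rfl fun x hx => ?_
      rw [coeff_coe]
      by_cases hx2 : x.2.degree = n
      · rw [coeff_hcomp]
        have := hdeg x hx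
        omega
      · rw [hA.coeff_eq_zero hx2, mul_zero, mul_zero]
    · rw [coeff_zero]
      refine Finset.sum_eq_zero fun x hx => ?_
      rw [coeff_coe, hA.coeff_eq_zero, mul_zero]
      have := hdeg x hx
      omega
  · rw [((mem_homogeneousSubmodule _ _).1 (hcomp k _).2).coeff_eq_zero hμ]
    split_ifs with hnk
    · rw [IsHomogeneous.coeff_eq_zero (n := k) ?_ hμ]
      have := ((mem_homogeneousSubmodule _ _).1 (hcomp (k - n) r).2).mul hA
      rwa [Nat.sub_add_cancel hnk] at this
    · simp

variable {n : ℕ} {A B : MvPolynomial (Fin 2) ℂ}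

/-- `(a, b) ↦ aA + bB` on forms of degree `j`. -/
def combMap (A B : MvPolynomial (Fin 2) ℂ) (j : ℕ) :
    (T2 j × T2 j) →ₗ[ℂ] MvPolynomial (Fin 2) ℂ :=
  ((LinearMap.mulRight ℂ A) ∘ₗ (T2 j).subtype).coprod ((LinearMap.mulRight ℂ B) ∘ₗ (T2 j).subtype)

theorem combMap_apply (j : ℕ) (x : T2 j × T2 j) :
    combMap A B j x = x.1 * A + x.2 * B := rfl

theorem range_combMap_le (hA : A.IsHomogeneous n) (hB : B.IsHomogeneous n) (j : ℕ) :
    LinearMap.range (combMap A B j) ≤ T2 (j + n) := by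
  rintro _ ⟨x, rfl⟩
  exact Submodule.add_mem _ (((mem_homogeneousSubmodule _ _).1 x.1.2).mul hA)
    (((mem_homogeneousSubmodule _ _).1 x.2.2).mul hB)

/-- If aA + bB = 0 with A, B coprime, then A divides b, impossible for a nonzero b of degree j < n;
symmetrically for a. -/
theorem combMap_injective (hA : A.IsHomogeneous n) (hB : B.IsHomogeneous n) (hn : 1 ≤ n)
    (hAB : IsRelPrime A B) {j : ℕ} (hj : j < n) : Function.Injective (combMap A B j) := by
  have key : ∀ {A B : MvPolynomial (Fin 2) ℂ}, A.IsHomogeneous n → B.IsHomogeneous n →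
      IsRelPrime A B → ∀ a b : T2 j, (a : MvPolynomial (Fin 2) ℂ) * A + b * B = 0 → b = 0 := by
    intro A B hA hB hAB a b h
    have hB0 : B.IsHomogeneous 0 → B = 0 := fun h0 => by
      by_contra hB1
      have := (hB.totalDegree hB1).symm.trans (h0.totalDegree hB1)
      omega
    have hA0 : A ≠ 0 := by
      rintro rfl
      have hu : IsUnit B := isRelPrime_zero_left.1 hAB
      have h1 := hB.totalDegree hu.ne_zero
      rw [(isUnit_iff_totalDegree_of_isReduced.1 hu).2] at h1
      omega
    have hdvd : A ∣ b * B := ⟨-a, by linear_combination h⟩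
    obtain ⟨c, hc⟩ := hAB.dvd_of_dvd_mul_right hdvd
    by_contra hb
    have hb' : (b : MvPolynomial (Fin 2) ℂ) ≠ 0 := fun h => hb (Subtype.ext h)
    have hc0 : c ≠ 0 := by rintro rfl; simp [hc] at hb'
    have h1 := ((mem_homogeneousSubmodule _ _).1 b.2).totalDegree hb'
    rw [hc, totalDegree_mul_of_isDomain hA0 hc0, hA.totalDegree hA0] at h1
    omega
  rw [← LinearMap.ker_eq_bot, LinearMap.ker_eq_bot']
  rintro ⟨a, b⟩ h
  rw [combMap_apply] at h
  rw [Prod.mk_eq_zero]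
  exact ⟨key hB hA hAB.symm b a (by rw [add_comm]; exact h), key hA hB hAB a b h⟩

theorem finrank_range_combMap (hA : A.IsHomogeneous n) (hB : B.IsHomogeneous n) (hn : 1 ≤ n)
    (hAB : IsRelPrime A B) {j : ℕ} (hj : j < n) :
    Module.finrank ℂ (LinearMap.range (combMap A B j)) = 2 * (j + 1) := by
  rw [LinearMap.finrank_range_of_inj (combMap_injective hA hB hn hAB hj), Module.finrank_prod,
    finrank_T2]
  ring

/-- In degree 2n - 1 the injective map (a, b) ↦ aA + bB has source and target of the same dimension
2n, so it is onto. Multiplication by the variables carries this to all higher degrees. -/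
theorem T2_le_range_combMap (hA : A.IsHomogeneous n) (hB : B.IsHomogeneous n) (hn : 1 ≤ n)
    (hAB : IsRelPrime A B) (i : ℕ) : T2 (n - 1 + i + n) ≤ LinearMap.range (combMap A B (n - 1 + i)) := by
  induction i with
  | zero =>
    refine (Submodule.eq_of_le_of_finrank_eq (range_combMap_le hA hB _) ?_).ge
    rw [add_zero, finrank_range_combMap hA hB hn hAB (by omega), finrank_T2]
    omega
  | succ i ih =>
    intro P hP
    rw [P.as_sum]
    refine Submodule.sum_mem _ fun μ hμ => ?_
    have hdeg : μ.degree = n - 1 + (i + 1) + n := by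
      by_contra h
      exact (mem_support_iff.1 hμ) (((mem_homogeneousSubmodule _ _).1 hP).coeff_eq_zero h)
    obtain ⟨k, hk⟩ : ∃ k, μ k ≠ 0 := by
      by_contra! h
      have : μ = 0 := Finsupp.ext h
      rw [this, map_zero] at hdeg
      omega
    set ν := μ - Finsupp.single k 1 with hν
    have hμν : μ = Finsupp.single k 1 + ν := by
      rw [hν, add_tsub_cancel_of_le]
      simpa [Finsupp.single_le_iff] using Nat.one_le_iff_ne_zero.2 hk
    have hνd : ν.degree = n - 1 + i + n := by
      have := congrArg Finsupp.degree hμν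
      rw [map_add, hdeg, Finsupp.degree_single] at this
      omega
    obtain ⟨⟨a, b⟩, hab⟩ := ih (isHomogeneous_monomial (coeff μ P) hνd)
    rw [combMap_apply] at hab
    have hX : ∀ c : T2 (n - 1 + i), X k * (c : MvPolynomial (Fin 2) ℂ) ∈ T2 (n - 1 + (i + 1)) := by
      intro c
      have := (isHomogeneous_X ℂ k).mul ((mem_homogeneousSubmodule _ _).1 c.2)
      rwa [show 1 + (n - 1 + i) = n - 1 + (i + 1) by ring] at this
    refine ⟨(⟨_, hX a⟩, ⟨_, hX b⟩), ?_⟩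
    rw [combMap_apply, hμν, ← one_mul (coeff _ P), ← monomial_mul, ← hμν, ← hab]
    show X k * (a : MvPolynomial (Fin 2) ℂ) * A + X k * (b : MvPolynomial (Fin 2) ℂ) * B =
      X k * ((a : MvPolynomial (Fin 2) ℂ) * A + (b : MvPolynomial (Fin 2) ℂ) * B)
    ring

/-- The forms of degree `k` in the ideal generated by `A` and `B`. -/
def gradedPart (n : ℕ) (A B : MvPolynomial (Fin 2) ℂ) (k : ℕ) : Submodule ℂ (T2 k) :=
  if n ≤ k then (LinearMap.range (combMap A B (k - n))).comap (T2 k).subtype else ⊥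

theorem mem_gradedPart {k : ℕ} {P : T2 k} : P ∈ gradedPart n A B k ↔
    ∃ a b : T2 (k - n), (P : MvPolynomial (Fin 2) ℂ) = if n ≤ k then a * A + b * B else 0 := by
  unfold gradedPart
  split_ifs with h
  · constructor
    · rintro ⟨⟨a, b⟩, hab⟩
      exact ⟨a, b, hab.symm⟩
    · rintro ⟨a, b, hab⟩
      exact ⟨(a, b), hab.symm⟩
  · simp

theorem finrank_quotient_gradedPart (hA : A.IsHomogeneous n) (hB : B.IsHomogeneous n) (hn : 1 ≤ n)
    (hAB : IsRelPrime A B) {k : ℕ} (hk : k < 2 * n) :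
    Module.finrank ℂ (T2 k ⧸ gradedPart n A B k) = if n ≤ k then 2 * n - 1 - k else k + 1 := by
  have h1 := Submodule.finrank_quotient_add_finrank (gradedPart n A B k)
  rw [finrank_T2] at h1
  split_ifs with h
  · have hle : LinearMap.range (combMap A B (k - n)) ≤ T2 k := by
      have := range_combMap_le hA hB (k - n)
      rwa [Nat.sub_add_cancel h] at this
    have h2 : Module.finrank ℂ (gradedPart n A B k) = 2 * (k - n + 1) := by
      rw [gradedPart, if_pos h, (Submodule.comapSubtypeEquivOfLe hle).finrank_eq,
        finrank_range_combMap hA hB hn hAB (by omega)]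
    omega
  · have h2 : Module.finrank ℂ (gradedPart n A B k) = 0 := by
      rw [gradedPart, if_neg h, finrank_bot]
    omega

/-- The Hilbert function being summed is 1, 2, ..., n, n - 1, ..., 1. -/
theorem sum_finrank_eq_sq (hn : 1 ≤ n) :
    ∑ k ∈ Finset.range (2 * n - 1), (if n ≤ k then 2 * n - 1 - k else k + 1) = n ^ 2 := by
  obtain ⟨m, rfl⟩ : ∃ m, n = m + 1 := ⟨n - 1, by omega⟩
  rw [show 2 * (m + 1) - 1 = (m + 1) + m by omega, Finset.sum_range_add]
  have h1 : ∑ k ∈ Finset.range (m + 1), (if m + 1 ≤ k then m + 1 + m - k else k + 1) =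
      ∑ k ∈ Finset.range (m + 1), (k + 1) := by
    refine Finset.sum_congr rfl fun k hk => if_neg ?_
    rw [Finset.mem_range] at hk; omega
  have h2 : ∑ k ∈ Finset.range m, (if m + 1 ≤ m + 1 + k then m + 1 + m - (m + 1 + k) else m + 1 + k + 1) =
      ∑ k ∈ Finset.range m, (k + 1) := by
    rw [← Finset.sum_range_reflect]
    refine Finset.sum_congr rfl fun k hk => ?_
    rw [Finset.mem_range] at hk
    rw [if_pos (by omega)]; omega
  rw [h1, h2]
  clear h1 h2 hn
  induction m with
  | zero => simp
  | succ m ih =>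
    rw [Finset.sum_range_succ _ (m + 1)]
    rw [Finset.sum_range_succ _ m] at ih ⊢
    nlinarith [ih]

/-- Binary forms of degree `k` modulo the ideal generated by `A` and `B`. -/
def GradedQuot (n : ℕ) (A B : MvPolynomial (Fin 2) ℂ) (k : ℕ) : Type := T2 k ⧸ gradedPart n A B k

instance (k : ℕ) : AddCommGroup (GradedQuot n A B k) :=
  inferInstanceAs (AddCommGroup (T2 k ⧸ gradedPart n A B k))

instance (k : ℕ) : Module ℂ (GradedQuot n A B k) :=
  inferInstanceAs (Module ℂ (T2 k ⧸ gradedPart n A B k))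

instance (k : ℕ) : Module.Finite ℂ (GradedQuot n A B k) :=
  inferInstanceAs (Module.Finite ℂ (T2 k ⧸ gradedPart n A B k))

/-- The projection onto the graded quotient. -/
def gradedMk (n : ℕ) (A B : MvPolynomial (Fin 2) ℂ) (k : ℕ) : T2 k →ₗ[ℂ] GradedQuot n A B k :=
  (gradedPart n A B k).mkQ

theorem gradedMk_eq_zero {k : ℕ} {P : T2 k} : gradedMk n A B k P = 0 ↔ P ∈ gradedPart n A B k :=
  Submodule.Quotient.mk_eq_zero _

theorem gradedMk_surjective (k : ℕ) : Function.Surjective (gradedMk n A B k) :=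
  (gradedPart n A B k).mkQ_surjective

/-- The homogeneous components of a power series modulo the graded pieces of `(A, B)`. -/
def compMap (n : ℕ) (A B : MvPolynomial (Fin 2) ℂ) :
    MvPowerSeries (Fin 2) ℂ →ₗ[ℂ] ((k : Fin (2 * n - 1)) → GradedQuot n A B k) :=
  LinearMap.pi fun k => gradedMk n A B k ∘ₗ hcomp k

theorem compMap_surjective (n : ℕ) (A B : MvPolynomial (Fin 2) ℂ) : Function.Surjective (compMap n A B) := by
  intro w
  choose t ht using fun k => gradedMk_surjective (n := n) (A := A) (B := B) (k : Fin (2 * n - 1)) (w k)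
  obtain ⟨r, hr⟩ := exists_hcomp_eq fun k => if h : k < 2 * n - 1 then t ⟨k, h⟩ else 0
  refine ⟨r, funext fun k => ?_⟩
  rw [← ht k]
  simp [compMap, hr]

/-- From degree 2n - 1 on, the ideal contains every form, so only finitely many components impose a
condition. Since `A` and `B` are homogeneous of degree `n`, cofactors found degree by degree
assemble into power series. -/
theorem ker_compMap (hA : A.IsHomogeneous n) (hB : B.IsHomogeneous n) (hn : 1 ≤ n)
    (hAB : IsRelPrime A B) : LinearMap.ker (compMap n A B) =
      (Ideal.span {A.toMvPowerSeries, B.toMvPowerSeries}).restrictScalars ℂ := by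
  ext r
  have hker : r ∈ LinearMap.ker (compMap n A B) ↔
      ∀ k : Fin (2 * n - 1), hcomp k r ∈ gradedPart n A B k := by
    rw [LinearMap.mem_ker, funext_iff]
    exact forall_congr' fun k => gradedMk_eq_zero
  rw [hker, Submodule.restrictScalars_mem, Ideal.mem_span_pair]
  constructor
  · intro h
    have hall : ∀ k, hcomp k r ∈ gradedPart n A B k := by
      intro k
      rcases lt_or_ge k (2 * n - 1) with hk | hk
      · exact h ⟨k, hk⟩
      · have := T2_le_range_combMap hA hB hn hAB (k - (2 * n - 1))
        rw [show n - 1 + (k - (2 * n - 1)) + n = k by omega,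
          show n - 1 + (k - (2 * n - 1)) = k - n by omega] at this
        rw [gradedPart, if_pos (by omega)]
        exact this (hcomp k r).2
    choose a b hab using fun k => mem_gradedPart.1 (hall k)
    obtain ⟨a', ha'⟩ := exists_hcomp_eq fun j => ⟨(a (j + n) : MvPolynomial (Fin 2) ℂ),
      by simpa using (a (j + n)).2⟩
    obtain ⟨b', hb'⟩ := exists_hcomp_eq fun j => ⟨(b (j + n) : MvPolynomial (Fin 2) ℂ),
      by simpa using (b (j + n)).2⟩
    refine ⟨a', b', ext_hcomp fun k => Subtype.ext ?_⟩
    rw [map_add, Submodule.coe_add, coe_hcomp_mul hA, coe_hcomp_mul hB, hab k, ha', hb']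
    split_ifs with hk
    · have : ∀ j, j = k → (a j : MvPolynomial (Fin 2) ℂ) * A + b j * B = a k * A + b k * B := by
        rintro _ rfl; rfl
      exact this _ (by omega)
    · simp
  · rintro ⟨a, b, rfl⟩ k
    refine mem_gradedPart.2 ⟨hcomp _ a, hcomp _ b, ?_⟩
    rw [map_add, Submodule.coe_add, coe_hcomp_mul hA, coe_hcomp_mul hB]
    split_ifs <;> simp

/-- The local intersection number of two coprime binary forms of degree `n` is `n²`. -/
theorem finrank_quotient_span_pair (hA : A.IsHomogeneous n) (hB : B.IsHomogeneous n) (hn : 1 ≤ n)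
    (hAB : IsRelPrime A B) : Module.finrank ℂ (MvPowerSeries (Fin 2) ℂ ⧸
      Ideal.span {A.toMvPowerSeries, B.toMvPowerSeries}) = n ^ 2 := by
  have e1 := LinearMap.quotKerEquivOfSurjective (compMap n A B)
    (compMap_surjective n A B)
  have e2 := Submodule.quotEquivOfEq _ _ (ker_compMap hA hB hn hAB)
  have e3 := Submodule.Quotient.restrictScalarsEquiv ℂ
    (Ideal.span {A.toMvPowerSeries, B.toMvPowerSeries})
  rw [← (e2.symm.trans e1).finrank_eq.symm.trans e3.finrank_eq,
    Module.finrank_pi_fintype, ← sum_finrank_eq_sq hn, Finset.sum_range]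
  refine Finset.sum_congr rfl fun k _ => ?_
  have hk : (k : ℕ) < 2 * n := by omega
  exact finrank_quotient_gradedPart hA hB hn hAB hk

end PowerSeries

end LineArr

end

noncomputable section

namespace LineArr

open MvPolynomial
open scoped LinearAlgebra.Projectivization Matrix

/-! ### Local Tjurina numbers of line arrangements -/

section Local

theorem localEq_mul (f g : S) (v : Fin 3 → ℂ) (i : Fin 3) :
    localEq (f * g) v i = localEq f v i * localEq g v i := map_mul _ _ _

theorem localEq_C (c : ℂ) (v : Fin 3 → ℂ) (i : Fin 3) : localEq (C c) v i = C c := aeval_C _ _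

theorem localEq_prod {ι : Type} (s : Finset ι) (f : ι → S) (v : Fin 3 → ℂ) (i : Fin 3) :
    localEq (∏ j ∈ s, f j) v i = ∏ j ∈ s, localEq (f j) v i := map_prod _ _ _

theorem localEq_linForm (n v : Fin 3 → ℂ) (i : Fin 3) :
    localEq (linForm n) v i = C (n ⬝ᵥ v) + linForm (n ∘ i.succAbove) := by
  rw [localEq, linForm, map_sum]
  simp only [map_mul, aeval_X, aeval_C, algebraMap_eq, mul_add, Finset.sum_add_distrib]
  congr 1
  · simp [dotProduct, map_sum]
  · rw [Fin.sum_univ_succAbove _ i]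
    simp [linForm]

theorem tjurinaIdeal_mul_le (U h : MvPolynomial (Fin 2) ℂ) :
    tjurinaIdeal (U * h) ≤ tjurinaIdeal h := by
  have h0 : h.toMvPowerSeries ∈ tjurinaIdeal h := Ideal.subset_span (by simp)
  have h1 : ∀ k, (pderiv k h).toMvPowerSeries ∈ tjurinaIdeal h := by
    intro k; fin_cases k <;> exact Ideal.subset_span (by simp)
  have h2 : ∀ k, (pderiv k (U * h)).toMvPowerSeries ∈ tjurinaIdeal h := by
    intro k
    rw [pderiv_mul, coe_add, coe_mul, coe_mul]
    exact add_mem (Ideal.mul_mem_left _ _ h0) (Ideal.mul_mem_left _ _ (h1 k))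
  rw [tjurinaIdeal, Ideal.span_le]
  rintro x (rfl | rfl | rfl)
  · rw [coe_mul]; exact Ideal.mul_mem_left _ _ h0
  · exact h2 0
  · exact h2 1

/-- A polynomial with nonzero constant term is a unit among power series. Applied to the factors of
lines missing the point, this discards them. -/
theorem tjurinaIdeal_mul {U : MvPolynomial (Fin 2) ℂ} (hU : coeff 0 U ≠ 0)
    (h : MvPolynomial (Fin 2) ℂ) : tjurinaIdeal (U * h) = tjurinaIdeal h := by
  refine le_antisymm (tjurinaIdeal_mul_le U h) ?_
  have hu : IsUnit U.toMvPowerSeries := by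
    rw [MvPowerSeries.isUnit_iff_constantCoeff, isUnit_iff_ne_zero,
      ← MvPowerSeries.coeff_zero_eq_constantCoeff_apply, coeff_coe]
    exact hU
  have h0 : h.toMvPowerSeries ∈ tjurinaIdeal (U * h) := by
    rw [← Ideal.unit_mul_mem_iff_mem _ hu, ← coe_mul]
    exact Ideal.subset_span (by simp)
  have h2 : ∀ k, (pderiv k (U * h)).toMvPowerSeries ∈ tjurinaIdeal (U * h) := by
    intro k; fin_cases k <;> exact Ideal.subset_span (by simp)
  have h1 : ∀ k, (pderiv k h).toMvPowerSeries ∈ tjurinaIdeal (U * h) := by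
    intro k
    rw [← Ideal.unit_mul_mem_iff_mem _ hu]
    have := h2 k
    rw [pderiv_mul, coe_add, coe_mul, coe_mul] at this
    exact (Ideal.add_mem_iff_right _ (Ideal.mul_mem_left _ _ h0)).1 this
  rw [tjurinaIdeal, Ideal.span_le]
  rintro x (rfl | rfl | rfl)
  · exact h0
  · exact h1 0
  · exact h1 1

/-- Euler's formula puts the form itself in the ideal of its partials. -/
theorem tjurinaIdeal_of_isHomogeneous {h : MvPolynomial (Fin 2) ℂ} {m : ℕ} (hm : m ≠ 0)
    (hh : h.IsHomogeneous m) : tjurinaIdeal h =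
      Ideal.span {(pderiv 0 h).toMvPowerSeries, (pderiv 1 h).toMvPowerSeries} := by
  refine le_antisymm ?_ (Ideal.span_mono (by simp))
  rw [tjurinaIdeal, Ideal.span_insert, sup_le_iff]
  refine ⟨?_, le_rfl⟩
  rw [Ideal.span_singleton_le_iff_mem, Ideal.mem_span_pair]
  have hE := hh.sum_X_mul_pderiv
  rw [Fin.sum_univ_two, nsmul_eq_mul, ← map_natCast (C : ℂ →+* MvPolynomial (Fin 2) ℂ)] at hE
  refine ⟨(C (m : ℂ)⁻¹ * X 0 : MvPolynomial (Fin 2) ℂ).toMvPowerSeries,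
    (C (m : ℂ)⁻¹ * X 1 : MvPolynomial (Fin 2) ℂ).toMvPowerSeries, ?_⟩
  rw [← coe_mul, ← coe_mul, ← coe_add, mul_assoc, mul_assoc, ← mul_add, hE, ← mul_assoc, ← C_mul,
    inv_mul_cancel₀ (Nat.cast_ne_zero.2 hm), C_1, one_mul]

/-- The Tjurina algebra of `m` distinct lines through a point has dimension `(m - 1)²`. -/
theorem finrank_tjurina_prod_linForm {ι : Type} {s : Finset ι} {n : ι → Fin 2 → ℂ}
    (h : PairwiseIndep s n) : Module.finrank ℂ (MvPowerSeries (Fin 2) ℂ ⧸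
      tjurinaIdeal (∏ i ∈ s, linForm (n i))) = (s.card - 1) ^ 2 := by
  -- Off the curve and at a smooth point the ideal is the unit ideal, in agreement with the
  -- truncated value `s.card - 1 = 0`. These cases are separated because the dimension count
  -- requires partials of positive degree.
  rcases s.eq_empty_or_nonempty with rfl | hs
  · have : tjurinaIdeal (1 : MvPolynomial (Fin 2) ℂ) = ⊤ := by
      rw [Ideal.eq_top_iff_one]
      refine Ideal.subset_span ?_
      simp
    rw [Finset.prod_empty, this]
    simp [Module.finrank_zero_of_subsingleton]
  have hh := isHomogeneous_prod_linForm s n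
  rw [tjurinaIdeal_of_isHomogeneous hs.card_pos.ne' hh]
  set A := pderiv 0 (∏ i ∈ s, linForm (n i)) with hA
  set B := pderiv 1 (∏ i ∈ s, linForm (n i)) with hB
  have hnd : ∀ π : MvPolynomial (Fin 2) ℂ, Prime π → π ∣ A → π ∣ B → False := by
    intro π hπ h0 h1
    refine h.not_forall_dvd_pderiv hs hπ fun k => ?_
    fin_cases k
    · exact h0
    · exact h1
  have hAB : IsRelPrime A B := by
    refine WfDvdMonoid.isRelPrime_of_no_irreducible_factors ?_ fun z hz h1 h2 => hnd z hz.prime h1 h2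
    rintro ⟨h1, h2⟩
    exact hnd (X 0) (by exact X_prime) (h1 ▸ dvd_zero _) (h2 ▸ dvd_zero _)
  by_cases hs1 : s.card = 1
  · have hu : IsUnit A ∨ IsUnit B := by
      have hA0 : A.totalDegree = 0 := (totalDegree_zero_iff_isHomogeneous _).2 (by
        have := hh.pderiv (i := 0); rwa [hs1] at this)
      have hB0 : B.totalDegree = 0 := (totalDegree_zero_iff_isHomogeneous _).2 (by
        have := hh.pderiv (i := 1); rwa [hs1] at this)
      by_cases hA1 : A = 0
      · right
        rw [hA1] at hAB
        exact isRelPrime_zero_left.1 hAB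
      · left
        rw [totalDegree_eq_zero_iff_eq_C] at hA0
        rw [hA0]
        refine (isUnit_iff_ne_zero.2 fun h0 => hA1 ?_).map C
        rw [hA0, h0, C_0]
    have htop : Ideal.span {A.toMvPowerSeries, B.toMvPowerSeries} = ⊤ := by
      rcases hu with hu | hu
      · exact Ideal.eq_top_of_isUnit_mem _ (Ideal.subset_span (by simp))
          (hu.map (coeToMvPowerSeries.ringHom (R := ℂ)))
      · exact Ideal.eq_top_of_isUnit_mem _ (Ideal.subset_span (by simp))
          (hu.map (coeToMvPowerSeries.ringHom (R := ℂ)))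
    rw [htop, hs1]
    simp [Module.finrank_zero_of_subsingleton]
  · have := hs.card_pos
    exact finrank_quotient_span_pair hh.pderiv hh.pderiv (by omega) hAB

/-- In the chart v i ≠ 0, the `i`-th coefficient of a line through `v` is determined by the other
two. -/
theorem eq_zero_of_comp_succAbove {n v : Fin 3 → ℂ} {i : Fin 3} (hv : v i ≠ 0)
    (h : n ⬝ᵥ v = 0) (hn : n ∘ i.succAbove = 0) : n = 0 := by
  have hk : ∀ k, n (i.succAbove k) = 0 := fun k => congrFun hn k
  rw [dotProduct, Fin.sum_univ_succAbove _ i] at h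
  simp only [hk, zero_mul, Finset.sum_const_zero, add_zero] at h
  ext k
  rcases Fin.eq_self_or_eq_succAbove i k with rfl | ⟨j, rfl⟩
  · exact (mul_eq_zero.1 h).resolve_right hv
  · exact hk j

/-- Lines missing `p` become units in the local ring, while lines through `p` become binary linear
forms that remain pairwise non-proportional. -/
theorem localTjurina_prod {d : ℕ} {l : Fin d → ℙ ℂ (Sd 1)} (hl : l ∈ Xd d) {c : ℂ} (hc : c ≠ 0)
    (p : P2) : localTjurina (C c * ∏ i, linForm (covec (l i))) p = (mult l p - 1) ^ 2 := by
  unfold localTjurina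
  set i₀ := Classical.choose (Function.ne_iff.1 p.rep_nonzero) with hi₀
  have hp : p.rep i₀ ≠ 0 := Classical.choose_spec (Function.ne_iff.1 p.rep_nonzero)
  set s := linesAt l p with hs
  have hdot : ∀ i ∈ s, covec (l i) ⬝ᵥ p.rep = 0 := fun i hi => mem_line.1 (mem_linesAt.1 hi)
  set U : MvPolynomial (Fin 2) ℂ := C c * ∏ i ∈ sᶜ, localEq (linForm (covec (l i))) p.rep i₀
  have hfac : localEq (C c * ∏ i, linForm (covec (l i))) p.rep i₀ =
      U * ∏ i ∈ s, linForm (covec (l i) ∘ i₀.succAbove) := by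
    rw [localEq_mul, localEq_C, localEq_prod, ← Finset.prod_mul_prod_compl s, mul_assoc]
    congr 1
    rw [mul_comm]
    congr 1
    refine Finset.prod_congr rfl fun i hi => ?_
    rw [localEq_linForm, hdot i hi, C_0, zero_add]
  have hU : coeff 0 U ≠ 0 := by
    rw [← constantCoeff_eq, map_mul, map_prod, constantCoeff_C]
    refine mul_ne_zero hc (Finset.prod_ne_zero_iff.2 fun i hi => ?_)
    rw [localEq_linForm, map_add, constantCoeff_C, constantCoeff_eq,
      (isHomogeneous_linForm _).coeff_eq_zero (by simp), add_zero]
    intro h0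
    exact (Finset.mem_compl.1 hi) (mem_linesAt.2 (mem_line.2 h0))
  rw [hfac, tjurinaIdeal_mul hU, finrank_tjurina_prod_linForm, mult_eq_card]
  constructor
  · intro i hi h0
    exact covec_ne_zero _ (eq_zero_of_comp_succAbove hp (hdot i hi) h0)
  · intro i hi j hj hij t ht
    have h0 : covec (l j) - t • covec (l i) = 0 := by
      refine eq_zero_of_comp_succAbove hp ?_ ?_
      · rw [sub_dotProduct, smul_dotProduct, hdot i hi, hdot j hj]; simp
      · ext k
        have := congrFun ht k
        simp only [Function.comp_apply, Pi.smul_apply, smul_eq_mul] at this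
        simp [this]
    refine hij (hl (cross_covec_eq_zero.1 ?_))
    rw [sub_eq_zero.1 h0, map_smul, cross_self, smul_zero]

theorem psi_rep {d : ℕ} (l : Fin d → ℙ ℂ (Sd 1)) :
    ∃ c : ℂ, c ≠ 0 ∧ ((psi l).rep : S) = C c * ∏ i, linForm (covec (l i)) := by
  obtain ⟨c, hc⟩ := Projectivization.exists_smul_eq_mk_rep ℂ (prodForm l) (prodForm_ne_zero l)
  refine ⟨c, c.ne_zero, ?_⟩
  rw [psi, ← hc]
  simp only [prodForm, rep_eq_linForm]
  rw [Units.smul_def, ← smul_eq_C_mul]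
  rfl

end Local

/-! ### Counting multiple points -/

section Count

variable {d : ℕ} {l : Fin d → ℙ ℂ (Sd 1)}

/-- A common point of two lines of the arrangement. -/
def meet (l : Fin d → ℙ ℂ (Sd 1)) (i j : Fin d) : P2 :=
  (exists_mem_line_inter (l i) (l j)).choose

theorem mem_linesAt_meet_left (i j : Fin d) : i ∈ linesAt l (meet l i j) :=
  mem_linesAt.2 (exists_mem_line_inter (l i) (l j)).choose_spec.1

theorem mem_linesAt_meet_right (i j : Fin d) : j ∈ linesAt l (meet l i j) :=
  mem_linesAt.2 (exists_mem_line_inter (l i) (l j)).choose_spec.2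

theorem eq_of_mem_linesAt (hl : l ∈ Xd d) {i j : Fin d} (hij : i ≠ j) {p q : P2}
    (h1 : i ∈ linesAt l p) (h2 : j ∈ linesAt l p) (h3 : i ∈ linesAt l q) (h4 : j ∈ linesAt l q) :
    p = q := by
  rw [mem_linesAt] at *
  exact line_inter_subsingleton (hl.ne hij) h1 h2 h3 h4

open Classical in
/-- The multiple points of the arrangement. -/
def multPts (l : Fin d → ℙ ℂ (Sd 1)) : Finset P2 :=
  (Finset.univ : Finset (Fin d)).offDiag.image fun x => meet l x.1 x.2

theorem mem_multPts (hl : l ∈ Xd d) {p : P2} : p ∈ multPts l ↔ 2 ≤ mult l p := by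
  classical
  rw [mult_eq_card, multPts, Finset.mem_image]
  constructor
  · rintro ⟨⟨i, j⟩, hij, rfl⟩
    rw [Finset.mem_offDiag] at hij
    exact Finset.one_lt_card.2 ⟨i, mem_linesAt_meet_left i j, j, mem_linesAt_meet_right i j, hij.2.2⟩
  · intro h
    obtain ⟨i, hi, j, hj, hij⟩ := Finset.one_lt_card.1 h
    exact ⟨(i, j), by simp [hij], eq_of_mem_linesAt hl hij (mem_linesAt_meet_left i j)
      (mem_linesAt_meet_right i j) hi hj⟩

/-- Each ordered pair of distinct lines meets in exactly one point, and a point of multiplicity k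
accounts for k (k - 1) pairs. -/
theorem sum_mult_mul (hl : l ∈ Xd d) :
    ∑ p ∈ multPts l, mult l p * (mult l p - 1) = d * (d - 1) := by
  classical
  have h := Finset.card_eq_sum_card_fiberwise (f := fun x : Fin d × Fin d => meet l x.1 x.2)
    (s := (Finset.univ : Finset (Fin d)).offDiag) (t := multPts l)
    (fun x hx => Finset.mem_image_of_mem _ hx)
  rw [Finset.offDiag_card, Finset.card_univ, Fintype.card_fin] at h
  rw [Nat.mul_sub, mul_one, h]
  refine Finset.sum_congr rfl fun p hp => ?_
  rw [Nat.mul_sub, mul_one, mult_eq_card, ← Finset.offDiag_card]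
  congr 1
  ext ⟨i, j⟩
  simp only [Finset.mem_offDiag, Finset.mem_filter, Finset.mem_univ, true_and]
  constructor
  · rintro ⟨hi, hj, hij⟩
    exact ⟨hij, eq_of_mem_linesAt hl hij (mem_linesAt_meet_left i j)
      (mem_linesAt_meet_right i j) hi hj⟩
  · rintro ⟨hij, rfl⟩
    exact ⟨mem_linesAt_meet_left i j, mem_linesAt_meet_right i j, hij⟩

theorem sum_sq_add_sum (hl : l ∈ Xd d) :
    ∑ p ∈ multPts l, (mult l p - 1) ^ 2 + ∑ p ∈ multPts l, (mult l p - 1) = d * (d - 1) := by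
  rw [← sum_mult_mul hl, ← Finset.sum_add_distrib]
  refine Finset.sum_congr rfl fun p hp => ?_
  obtain ⟨k, hk⟩ : ∃ k, mult l p = k + 1 := ⟨mult l p - 1, by have := (mem_multPts hl).1 hp; omega⟩
  rw [hk, Nat.add_sub_cancel]; ring

/-- At most one line passes through two distinct points. -/
theorem mult_add_mult_le (hl : l ∈ Xd d) {p q : P2} (hpq : q ≠ p) :
    mult l p + mult l q ≤ d + 1 := by
  rw [mult_eq_card, mult_eq_card, ← Finset.card_union_add_card_inter]
  refine add_le_add ((Finset.card_le_univ _).trans (by simp)) (Finset.card_le_one.2 ?_)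
  intro i hi j hj
  rw [Finset.mem_inter] at hi hj
  by_contra hij
  exact hpq (eq_of_mem_linesAt hl hij hi.2 hj.2 hi.1 hj.1)

theorem mult_le (p : P2) : mult l p ≤ d := by
  rw [mult_eq_card]; exact (Finset.card_le_univ _).trans (by simp)

theorem hasType_of_mult_ge (hl : l ∈ Xd d) {m : ℕ} (hm : d ≤ m + 1) {p : P2} (hp : mult l p = m) :
    HasType m l :=
  ⟨p, hp, fun q hq => by have := mult_add_mult_le hl hq; omega⟩

/-- A line through `p` and a line not through `p` meet at some q ≠ p. At most one line through q
passes through `p`, so q accounts for at most m_q - 1 of these pairs. -/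
theorem le_sum_mult_sub_one (hl : l ∈ Xd d) {p : P2} (hp : p ∈ multPts l) :
    (mult l p - 1) + mult l p * (d - mult l p) ≤ ∑ q ∈ multPts l, (mult l q - 1) := by
  classical
  rw [← Finset.add_sum_erase _ _ hp]
  refine Nat.add_le_add_left ?_ _
  set F := linesAt l p with hF
  have hmaps : ∀ x ∈ F ×ˢ Fᶜ, meet l x.1 x.2 ∈ (multPts l).erase p := by
    rintro ⟨i, j⟩ hx
    rw [Finset.mem_product, Finset.mem_compl] at hx
    rw [Finset.mem_erase]
    refine ⟨fun e => hx.2 ?_, Finset.mem_image.2 ⟨(i, j), ?_, rfl⟩⟩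
    · rw [hF, ← e]; exact mem_linesAt_meet_right i j
    · have hne : i ≠ j := fun e => hx.2 (e ▸ hx.1)
      simpa using hne
  have h := Finset.card_eq_sum_card_fiberwise (f := fun x : Fin d × Fin d => meet l x.1 x.2)
    (s := F ×ˢ Fᶜ) (t := (multPts l).erase p) hmaps
  rw [Finset.card_product, Finset.card_compl, Fintype.card_fin, ← mult_eq_card] at h
  rw [h]
  refine Finset.sum_le_sum fun q hq => ?_
  rw [Finset.mem_erase] at hq
  have huniq : ∀ i ∈ F, i ∈ linesAt l q → ∀ i' ∈ F, i' ∈ linesAt l q → i = i' := by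
    intro i hi hiq i' hi' hiq'
    by_contra hne
    exact hq.1 (eq_of_mem_linesAt hl hne hiq hiq' hi hi')
  rcases ((F ×ˢ Fᶜ).filter fun x => meet l x.1 x.2 = q).eq_empty_or_nonempty with he | ⟨⟨i, j⟩, hx⟩
  · rw [he]; simp
  · rw [Finset.mem_filter, Finset.mem_product] at hx
    have hi : i ∈ linesAt l q := by rw [← hx.2]; exact mem_linesAt_meet_left i j
    rw [mult_eq_card, ← Finset.card_erase_of_mem hi]
    refine Finset.card_le_card_of_injOn Prod.snd ?_ ?_
    · rintro ⟨i', j'⟩ hx'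
      simp only [Finset.coe_filter, Finset.mem_product, Finset.mem_compl, Set.mem_ofPred_eq] at hx'
      refine Finset.mem_coe.2 (Finset.mem_erase.2 ⟨fun e => hx'.1.2 ?_, ?_⟩)
      · show j' ∈ F
        rw [show j' = i from e]; exact hx.1.1
      · rw [← hx'.2]; exact mem_linesAt_meet_right i' j'
    · rintro ⟨i₁, j₁⟩ h₁ ⟨i₂, j₂⟩ h₂ e
      simp only [Finset.coe_filter, Finset.mem_product, Finset.mem_compl, Set.mem_ofPred_eq] at h₁ h₂ e
      have : i₁ = i₂ := huniq i₁ h₁.1.1 (by rw [← h₁.2]; exact mem_linesAt_meet_left i₁ j₁)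
        i₂ h₂.1.1 (by rw [← h₂.2]; exact mem_linesAt_meet_left i₂ j₂)
      rw [this, e]

theorem sum_sq_of_hasType {m : ℕ} (hm : 2 ≤ m) (hl : l ∈ Xd d) (h : HasType m l) :
    ∑ p ∈ multPts l, (mult l p - 1) ^ 2 = d.choose 2 + (m - 1).choose 2 := by
  classical
  obtain ⟨p, hp, hq⟩ := h
  have hpm : p ∈ multPts l := (mem_multPts hl).2 (hp ▸ hm)
  have h2 : ∀ q ∈ (multPts l).erase p, mult l q = 2 := by
    intro q hq'
    rw [Finset.mem_erase] at hq'
    have := (mem_multPts hl).1 hq'.2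
    have := hq q hq'.1
    omega
  have h1 := sum_mult_mul hl
  rw [← Finset.add_sum_erase _ _ hpm, hp, Finset.sum_congr rfl (fun q hq => by rw [h2 q hq]),
    Finset.sum_const, smul_eq_mul] at h1
  rw [← Finset.add_sum_erase _ _ hpm, hp, Finset.sum_congr rfl (fun q hq => by rw [h2 q hq]),
    Finset.sum_const, smul_eq_mul]
  have e1 := two_mul_choose_two d
  have e2 := two_mul_choose_two (m - 1)
  obtain ⟨k, rfl⟩ : ∃ k, m = k + 2 := ⟨m - 2, by omega⟩
  simp only [show k + 2 - 1 = k + 1 from rfl, show k + 1 - 1 = k from rfl, show 2 - 1 = 1 from rfl,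
    one_pow, mul_one] at *
  nlinarith

theorem exists_mem_multPts (hd : 2 ≤ d) : ∃ p, p ∈ multPts l := by
  classical
  exact ⟨meet l ⟨0, by omega⟩ ⟨1, by omega⟩, Finset.mem_image.2 ⟨(⟨0, by omega⟩, ⟨1, by omega⟩),
    by simp, rfl⟩⟩

/-- The hypothesis gives Σ (m_q - 1) = d - 1, while a point of multiplicity k makes this sum at
least (k - 1) + k (d - k). The excess (d - k)(k - 1) must vanish, so k = d. -/
theorem hasType_of_sum_sq_eq (hd : 2 ≤ d) (hl : l ∈ Xd d)
    (h : ∑ p ∈ multPts l, (mult l p - 1) ^ 2 = (d - 1) ^ 2) : HasType d l := by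
  obtain ⟨p, hp⟩ := exists_mem_multPts (l := l) hd
  have h1 := le_sum_mult_sub_one hl hp
  have h2 := sum_sq_add_sum hl
  have h3 := (mem_multPts hl).1 hp
  obtain ⟨j, hj⟩ := Nat.exists_eq_add_of_le (mult_le (l := l) p)
  have hj0 : j = 0 := by
    obtain ⟨k, hk⟩ := Nat.exists_eq_add_of_le h3
    rw [h] at h2
    rw [hk] at hj h1
    subst hj
    simp only [Nat.add_sub_cancel_left, show 2 + k + j - 1 = k + j + 1 by omega,
      show 2 + k - 1 = k + 1 by omega] at h1 h2
    nlinarith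
  exact hasType_of_mult_ge hl (by omega) (p := p) (by omega)

/-- Here Σ (m_q - 1) = 2d - 3. A point of multiplicity k with 3 ≤ k ≤ d - 2 makes the sum larger,
and k = d gives another value of τ. If all multiple points were double there would be binom(d, 2) =
2d - 3 of them, which fails for d ≥ 4. -/
theorem hasType_pred_of_sum_sq_eq (hd : 4 ≤ d) (hl : l ∈ Xd d)
    (h : ∑ p ∈ multPts l, (mult l p - 1) ^ 2 = d.choose 2 + (d - 2).choose 2) :
    HasType (d - 1) l := by
  have h2 := sum_sq_add_sum hl
  have hsum : ∑ p ∈ multPts l, (mult l p - 1) = 2 * d - 3 := by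
    have e1 := two_mul_choose_two d
    have e2 := two_mul_choose_two (d - 2)
    rw [h] at h2
    obtain ⟨k, rfl⟩ : ∃ k, d = k + 4 := ⟨d - 4, by omega⟩
    simp only [show k + 4 - 1 = k + 3 by omega, show k + 4 - 2 = k + 2 by omega,
      show k + 2 - 1 = k + 1 by omega, show 2 * (k + 4) - 3 = 2 * k + 5 by omega] at *
    nlinarith
  by_contra hne
  have hM : ∀ p ∈ multPts l, mult l p ≠ d - 1 := fun p _ hp =>
    hne (hasType_of_mult_ge hl (by omega) hp)
  have hMd : ∀ p ∈ multPts l, mult l p ≠ d := by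
    intro p hp hpd
    have h3 := sum_sq_of_hasType (by omega) hl (hasType_of_mult_ge hl (by omega) hpd)
    rw [h] at h3
    obtain ⟨k, rfl⟩ : ∃ k, d = k + 4 := ⟨d - 4, by omega⟩
    simp only [show k + 4 - 1 = (k + 2) + 1 by omega, show k + 4 - 2 = k + 2 by omega] at h3
    rw [Nat.choose_succ_succ' (k + 2) 1, Nat.choose_one_right, show 1 + 1 = 2 from rfl] at h3
    omega
  have h2all : ∀ p ∈ multPts l, mult l p = 2 := by
    intro p hp
    have h3 := (mem_multPts hl).1 hp
    by_contra hp2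
    have h1 := le_sum_mult_sub_one hl hp
    rw [hsum] at h1
    obtain ⟨k, hk⟩ := Nat.exists_eq_add_of_le (by omega : 3 ≤ mult l p)
    obtain ⟨j, hj⟩ := Nat.exists_eq_add_of_le (show mult l p + 2 ≤ d by
      have := mult_le (l := l) p
      have := hM p hp
      have := hMd p hp
      omega)
    rw [hk] at h1 hj
    subst hj
    simp only [show 3 + k - 1 = k + 2 by omega, show 3 + k + 2 + j - (3 + k) = j + 2 by omega,
      show 2 * (3 + k + 2 + j) - 3 = 2 * k + 2 * j + 7 by omega] at h1
    nlinarith [Nat.zero_le (k * j)]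
  have h4 := sum_mult_mul hl
  rw [Finset.sum_congr rfl (fun q hq => by rw [h2all q hq]), Finset.sum_const, smul_eq_mul] at h4
  rw [Finset.sum_congr rfl (fun q hq => by rw [h2all q hq]), Finset.sum_const, smul_eq_mul] at hsum
  obtain ⟨k, rfl⟩ : ∃ k, d = k + 4 := ⟨d - 4, by omega⟩
  simp only [show k + 4 - 1 = k + 3 by omega, show 2 * (k + 4) - 3 = 2 * k + 5 by omega,
    show 2 - 1 = 1 from rfl, mul_one] at *
  nlinarith

theorem tjurina_psi (hl : l ∈ Xd d) :
    tjurina ((psi l).rep : S) = ∑ p ∈ multPts l, (mult l p - 1) ^ 2 := by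
  obtain ⟨c, hc, h⟩ := psi_rep l
  rw [h, tjurina, finsum_congr (localTjurina_prod hl hc)]
  refine finsum_eq_sum_of_support_subset _ fun p hp => ?_
  rw [Finset.mem_coe, mem_multPts hl]
  by_contra h2
  refine hp ?_
  simp [show mult l p - 1 = 0 by omega]

end Count

end LineArr

end

/-! ### Jacobian syzygies, freeness and near freeness. -/

noncomputable section

namespace LineArr

open MvPolynomial
open scoped LinearAlgebra.Projectivization Matrix

/-! ### Vectors of polynomials -/

section CrossAlgebra

theorem forall_fin_three {P : Fin 3 → Prop} : (∀ i, P i) ↔ P 0 ∧ P 1 ∧ P 2 :=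
  Fin.forall_fin_succ.trans (and_congr_right fun _ => Fin.forall_fin_two)

theorem vec_three_ext {α : Type} {a b : Fin 3 → α} (h0 : a 0 = b 0) (h1 : a 1 = b 1) (h2 : a 2 = b 2) :
    a = b := funext (forall_fin_three.2 ⟨h0, h1, h2⟩)

variable {R : Type} [CommRing R]

theorem dot_three (a b : Fin 3 → R) : a ⬝ᵥ b = a 0 * b 0 + a 1 * b 1 + a 2 * b 2 := by
  simp [dotProduct, Fin.sum_univ_three]

theorem cross_zero_apply (a b : Fin 3 → R) : (a ⨯₃ b) 0 = a 1 * b 2 - a 2 * b 1 := by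
  simp [cross_apply]

theorem cross_one_apply (a b : Fin 3 → R) : (a ⨯₃ b) 1 = a 2 * b 0 - a 0 * b 2 := by
  simp [cross_apply]

theorem cross_two_apply (a b : Fin 3 → R) : (a ⨯₃ b) 2 = a 0 * b 1 - a 1 * b 0 := by
  simp [cross_apply]

theorem map_cross {R' : Type} [CommRing R'] (φ : R →+* R') (a b : Fin 3 → R) :
    φ ∘ (a ⨯₃ b) = (φ ∘ a) ⨯₃ (φ ∘ b) := by
  apply vec_three_ext <;> simp [cross_apply]

theorem map_dot {R' : Type} [CommRing R'] (φ : R →+* R') (a b : Fin 3 → R) :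
    φ (a ⬝ᵥ b) = (φ ∘ a) ⬝ᵥ (φ ∘ b) := by
  simp [dot_three]

variable [IsDomain R]

/-- Over the fraction field, `η` is proportional to two independent vectors. Without denominators:
each (a × b)_k η_i is a combination of the entries of η × a and η × b. -/
theorem eq_zero_of_cross_eq_zero {η a b : Fin 3 → R} (hab : a ⨯₃ b ≠ 0) (ha : η ⨯₃ a = 0)
    (hb : η ⨯₃ b = 0) : η = 0 := by
  have a0 := congrFun ha 0; have a1 := congrFun ha 1; have a2 := congrFun ha 2
  have b0 := congrFun hb 0; have b1 := congrFun hb 1; have b2 := congrFun hb 2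
  simp only [cross_zero_apply, cross_one_apply, cross_two_apply, Pi.zero_apply] at a0 a1 a2 b0 b1 b2
  have key : ∀ k i, (a ⨯₃ b) k * η i = 0 := by
    rw [forall_fin_three]
    simp only [forall_fin_three, cross_zero_apply, cross_one_apply, cross_two_apply]
    refine ⟨⟨?_, ?_, ?_⟩, ⟨?_, ?_, ?_⟩, ⟨?_, ?_, ?_⟩⟩
    · linear_combination b 2 * a2 + b 1 * a1 + a 0 * b0
    · linear_combination a 1 * b0 - b 1 * a0
    · linear_combination a 2 * b0 - b 2 * a0
    · linear_combination a 0 * b1 - b 0 * a1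
    · linear_combination b 2 * a2 + b 0 * a0 + a 1 * b1
    · linear_combination a 2 * b1 - b 2 * a1
    · linear_combination a 0 * b2 - b 0 * a2
    · linear_combination a 1 * b2 - b 1 * a2
    · linear_combination b 0 * a0 + b 1 * a1 + a 2 * b2
  obtain ⟨k, hk⟩ := Function.ne_iff.1 hab
  exact funext fun i => (mul_eq_zero.1 (key k i)).resolve_left hk

/-- A vector is primitive if no prime divides all its entries. -/
def IsPrimitiveVec (u : Fin 3 → R) : Prop := ∀ π, Prime π → ∃ k, ¬ π ∣ u k

/-- If w_k / u_k = b / a in lowest terms, proportionality shows that a divides every entry of the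
primitive vector `u`, so a is a unit. -/
theorem IsPrimitiveVec.exists_smul [UniqueFactorizationMonoid R] {u w : Fin 3 → R}
    (hu : IsPrimitiveVec u) (hu0 : u ≠ 0) (h : w ⨯₃ u = 0) : ∃ γ : R, w = γ • u := by
  have hc : ∀ i j, w i * u j = u i * w j := by
    have a0 := congrFun h 0; have a1 := congrFun h 1; have a2 := congrFun h 2
    simp only [cross_zero_apply, cross_one_apply, cross_two_apply, Pi.zero_apply] at a0 a1 a2
    simp only [forall_fin_three]
    refine ⟨⟨?_, ?_, ?_⟩, ⟨?_, ?_, ?_⟩, ⟨?_, ?_, ?_⟩⟩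
    · ring
    · linear_combination a2
    · linear_combination -a1
    · linear_combination -a2
    · ring
    · linear_combination a0
    · linear_combination a1
    · linear_combination -a0
    · ring
  obtain ⟨k, hk⟩ := Function.ne_iff.1 hu0
  obtain ⟨a, b, c, hab, ha, hb⟩ := UniqueFactorizationMonoid.exists_reduced_factors (u k) hk (w k)
  have hc0 : c ≠ 0 := by rintro rfl; exact hk (by simpa using ha.symm)
  have ha0 : a ≠ 0 := by rintro rfl; exact hk (by simpa using ha.symm)
  have hdvd : ∀ j, a ∣ u j := by
    intro j
    refine hab.dvd_of_dvd_mul_left ⟨w j, mul_left_cancel₀ hc0 ?_⟩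
    rw [← mul_assoc, ← mul_assoc, ha, hb, hc]
  have haU : IsUnit a := by
    by_contra hnu
    obtain ⟨π, hπ, hπa⟩ := WfDvdMonoid.exists_irreducible_factor hnu ha0
    obtain ⟨j, hj⟩ := hu π hπ.prime
    exact hj (hπa.trans (hdvd j))
  obtain ⟨e, rfl⟩ := haU
  refine ⟨b * (e⁻¹ : Rˣ), funext fun j => mul_left_cancel₀ hk ?_⟩
  rw [Pi.smul_apply, smul_eq_mul, ← hc, ← hb, ← ha]
  calc c * b * u j = c * b * (e * (e⁻¹ : Rˣ)) * u j := by rw [Units.mul_inv, mul_one]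
    _ = _ := by ring

end CrossAlgebra

section Grad

/-- A constant vector. -/
def cvec (v : Fin 3 → ℂ) : Fin 3 → S := fun i => C (v i)

/-- The gradient of a polynomial. -/
def grad (f : S) : Fin 3 → S := fun i => pderiv i f

/-- The coordinate vector. -/
def xvec : Fin 3 → S := X

theorem linForm_eq_dot (n : Fin 3 → ℂ) : linForm n = cvec n ⬝ᵥ xvec := rfl

theorem grad_linForm (n : Fin 3 → ℂ) : grad (linForm n) = cvec n :=
  funext fun k => pderiv_linForm n k

theorem grad_mul (f g : S) : grad (f * g) = f • grad g + g • grad f := by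
  ext1 k; simp [grad]

theorem grad_C (c : ℂ) : grad (C c) = 0 := funext fun _ => pderiv_C

theorem cvec_dot (v w : Fin 3 → ℂ) : cvec v ⬝ᵥ cvec w = C (v ⬝ᵥ w) :=
  (map_dot (C : ℂ →+* S) v w).symm

theorem cvec_cross (v w : Fin 3 → ℂ) : cvec v ⨯₃ cvec w = cvec (v ⨯₃ w) :=
  (map_cross (C : ℂ →+* S) v w).symm

theorem mem_AR {f : S} {θ : Fin 3 → S} : θ ∈ AR f ↔ θ ⬝ᵥ grad f = 0 := by
  rw [AR, LinearMap.mem_ker, jacMap, Fintype.linearCombination_apply]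
  rfl

theorem dot_grad_prod {ι : Type} (s : Finset ι) (n : ι → Fin 3 → ℂ) {θ : Fin 3 → S}
    (h : ∀ i ∈ s, θ ⬝ᵥ cvec (n i) = 0) : θ ⬝ᵥ grad (∏ i ∈ s, linForm (n i)) = 0 := by
  classical
  induction s using Finset.induction_on with
  | empty => rw [Finset.prod_empty, ← C_1, grad_C, dotProduct_zero]
  | insert a s ha ih =>
    rw [Finset.prod_insert ha, grad_mul, dotProduct_add, dotProduct_smul, dotProduct_smul,
      ih fun i hi => h i (Finset.mem_insert_of_mem hi), grad_linForm,
      h a (Finset.mem_insert_self a s)]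
    simp

theorem xvec_dot_grad {f : S} {k : ℕ} (hf : f.IsHomogeneous k) : xvec ⬝ᵥ grad f = k * f := by
  rw [← nsmul_eq_mul, ← hf.sum_X_mul_pderiv]; rfl

theorem isHomogeneous_grad {f : S} {k : ℕ} (hf : f.IsHomogeneous k) (i : Fin 3) :
    (grad f i).IsHomogeneous (k - 1) := hf.pderiv

theorem isHomogeneous_cross {a b : Fin 3 → S} {p q : ℕ} (ha : ∀ i, (a i).IsHomogeneous p)
    (hb : ∀ i, (b i).IsHomogeneous q) (i : Fin 3) : ((a ⨯₃ b) i).IsHomogeneous (p + q) := by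
  revert i
  rw [forall_fin_three, cross_zero_apply, cross_one_apply, cross_two_apply]
  exact ⟨((ha _).mul (hb _)).sub ((ha _).mul (hb _)), ((ha _).mul (hb _)).sub ((ha _).mul (hb _)),
    ((ha _).mul (hb _)).sub ((ha _).mul (hb _))⟩

theorem isHomogeneous_dot {a b : Fin 3 → S} {p q : ℕ} (ha : ∀ i, (a i).IsHomogeneous p)
    (hb : ∀ i, (b i).IsHomogeneous q) : (a ⬝ᵥ b).IsHomogeneous (p + q) :=
  IsHomogeneous.sum _ _ _ fun i _ => (ha i).mul (hb i)

theorem isHomogeneous_cvec (v : Fin 3 → ℂ) (i : Fin 3) : (cvec v i).IsHomogeneous 0 :=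
  isHomogeneous_C _ _

theorem isHomogeneous_xvec (i : Fin 3) : (xvec i).IsHomogeneous 1 := isHomogeneous_X _ _

end Grad

/-! ### Polynomials divisible by many linear forms -/

section ManyForms

theorem eval_smul_of_isHomogeneous {σ : Type} {P : MvPolynomial σ ℂ} {e : ℕ} (he : P.IsHomogeneous e)
    (c : ℂ) (x : σ → ℂ) : eval (c • x) P = c ^ e * eval x P := by
  classical
  rw [eval_eq, eval_eq, Finset.mul_sum]
  refine Finset.sum_congr rfl fun μ hμ => ?_
  have hd : μ.degree = e := by
    by_contra h
    exact mem_support_iff.1 hμ (he.coeff_eq_zero h)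
  simp only [Pi.smul_apply, smul_eq_mul, mul_pow, Finset.prod_mul_distrib]
  rw [Finset.prod_pow_eq_pow_sum, ← Finsupp.degree_apply, hd]
  ring

variable {σ : Type} [Fintype σ] {ι : Type}

theorem PairwiseIndep.prod_dvd {s : Finset ι} {n : ι → σ → ℂ} (h : PairwiseIndep s n)
    {P : MvPolynomial σ ℂ} (hP : ∀ i ∈ s, linForm (n i) ∣ P) : ∏ i ∈ s, linForm (n i) ∣ P := by
  refine Finset.prod_dvd_of_isRelPrime (fun i hi j hj hij => ?_) hP
  refine ((prime_linForm (h.1 i hi)).irreducible.isRelPrime_iff_not_dvd).2 fun hd => ?_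
  obtain ⟨c, hc⟩ := linForm_dvd_linForm hd
  exact h.2 i hi j hj hij c hc

theorem PairwiseIndep.eq_zero_of_dvd {s : Finset ι} {n : ι → σ → ℂ} (h : PairwiseIndep s n)
    {P : MvPolynomial σ ℂ} {e : ℕ} (he : P.IsHomogeneous e) (hs : e < s.card)
    (hP : ∀ i ∈ s, linForm (n i) ∣ P) : P = 0 := by
  by_contra hP0
  obtain ⟨q, hq⟩ := h.prod_dvd hP
  have hq0 : q ≠ 0 := by rintro rfl; simp [hq] at hP0
  have h1 := congrArg totalDegree hq
  rw [he.totalDegree hP0, totalDegree_mul_of_isDomain (prod_linForm_ne_zero h.1) hq0,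
    (isHomogeneous_prod_linForm s n).totalDegree (prod_linForm_ne_zero h.1)] at h1
  omega

end ManyForms

section LineVanishing

theorem exists_combination {u w x n : Fin 3 → ℂ} (hn : n ≠ 0) (huw : u ⨯₃ w ≠ 0)
    (hu : n ⬝ᵥ u = 0) (hw : n ⬝ᵥ w = 0) (hx : n ⬝ᵥ x = 0) : ∃ s t : ℂ, x = s • u + t • w := by
  have hdet : x ⬝ᵥ u ⨯₃ w = 0 := by
    refine triple_eq_zero_of_dot hn ?_ ?_ ?_ <;> rw [dotProduct_comm] <;> assumption
  obtain ⟨k, hk⟩ := Function.ne_iff.1 huw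
  set e : Fin 3 → ℂ := Pi.single k 1
  have he : e ⬝ᵥ u ⨯₃ w ≠ 0 := by simpa [e] using hk
  refine ⟨(e ⬝ᵥ x ⨯₃ w) / (e ⬝ᵥ u ⨯₃ w), (e ⬝ᵥ u ⨯₃ x) / (e ⬝ᵥ u ⨯₃ w), ?_⟩
  -- Cramer's rule for the basis u, w, e. The coefficient of e vanishes because x, u, w lie in the
  -- plane orthogonal to `n`.
  have key : (e ⬝ᵥ u ⨯₃ w) • x = (e ⬝ᵥ x ⨯₃ w) • u + (e ⬝ᵥ u ⨯₃ x) • w + (x ⬝ᵥ u ⨯₃ w) • e := by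
    apply vec_three_ext <;>
    · simp only [dot_three, cross_zero_apply, cross_one_apply, cross_two_apply, Pi.add_apply,
        Pi.smul_apply, smul_eq_mul]
      ring
  rw [hdet, zero_smul, add_zero] at key
  calc x = (e ⬝ᵥ u ⨯₃ w)⁻¹ • ((e ⬝ᵥ u ⨯₃ w) • x) := (inv_smul_smul₀ he x).symm
    _ = _ := by rw [key, smul_add, smul_smul, smul_smul, div_eq_inv_mul, div_eq_inv_mul]

/-- A form of degree `e` vanishing at more than `e` points of a line is divisible by the equation
of the line. -/
theorem linForm_dvd_of_points {ι : Type} {J : Finset ι} {q : ι → Fin 3 → ℂ} {n : Fin 3 → ℂ}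
    (hn : n ≠ 0) (hq : ∀ j ∈ J, n ⬝ᵥ q j = 0)
    (hqq : ∀ i ∈ J, ∀ j ∈ J, i ≠ j → q i ⨯₃ q j ≠ 0) {P : S} {e : ℕ} (hP : P.IsHomogeneous e)
    (hJ : e < J.card) (hJ2 : 2 ≤ J.card) (h0 : ∀ j ∈ J, eval (q j) P = 0) : linForm n ∣ P := by
  obtain ⟨j₁, hj₁, j₂, hj₂, hj⟩ := Finset.one_lt_card.1 hJ2
  set u := q j₁
  set w := q j₂
  have huw : u ⨯₃ w ≠ 0 := hqq _ hj₁ _ hj₂ hj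
  -- The restriction of `P` to the line, in the coordinates given by two of the points. It is a
  -- binary form of degree `e` vanishing at every (s j : t j).
  set P' : MvPolynomial (Fin 2) ℂ := aeval (fun k => linForm ![u k, w k]) P with hP'
  have heval : ∀ x : Fin 2 → ℂ, eval x P' = eval (x 0 • u + x 1 • w) P := by
    intro x
    rw [hP', eval_aeval_apply]
    congr 2
    ext k
    simp [eval_linForm, dotProduct, Fin.sum_univ_two, mul_comm]
  have hhom : P'.IsHomogeneous e := by
    have := hP.aeval (fun k => linForm ![u k, w k]) (n := 1) fun k => isHomogeneous_linForm _
    rwa [one_mul] at this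
  choose! s t hst using fun j (hj : j ∈ J) => exists_combination hn huw (hq _ hj₁) (hq _ hj₂) (hq j hj)
  have hcross : ∀ i ∈ J, ∀ j ∈ J, q i ⨯₃ q j = (s i * t j - t i * s j) • (u ⨯₃ w) := by
    intro i hi j hj
    rw [hst i hi, hst j hj]
    apply vec_three_ext <;>
    · simp only [cross_zero_apply, cross_one_apply, cross_two_apply, Pi.add_apply,
        Pi.smul_apply, smul_eq_mul]
      ring
  have hne : ∀ i ∈ J, ∀ j ∈ J, i ≠ j → s i * t j - t i * s j ≠ 0 := by
    intro i hi j hj hij h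
    exact hqq i hi j hj hij (by rw [hcross i hi j hj, h, zero_smul])
  have hzero : P' = 0 := by
    -- `![t j, -s j]` is the equation of the point (s j : t j) of the projective line.
    refine PairwiseIndep.eq_zero_of_dvd (s := J) (n := fun j => ![t j, -s j]) ⟨?_, ?_⟩ hhom hJ ?_
    · intro i hi h
      have h1 := congrFun h 0; have h2 := congrFun h 1
      simp at h1 h2
      obtain ⟨j, hj, hji⟩ : ∃ j ∈ J, i ≠ j := by
        by_cases hi1 : i = j₁
        · exact ⟨j₂, hj₂, hi1 ▸ hj⟩
        · exact ⟨j₁, hj₁, hi1⟩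
      exact hne i hi j hj hji (by rw [h1, h2]; ring)
    · intro i hi j hj hij c hc
      have h1 := congrFun hc 0; have h2 := congrFun hc 1
      simp at h1 h2
      refine hne i hi j hj hij ?_
      linear_combination s i * h1 - t i * h2
    · intro i hi
      have hni : (![t i, -s i] : Fin 2 → ℂ) ≠ 0 := by
        intro h
        have h1 := congrFun h 0; have h2 := congrFun h 1
        simp at h1 h2
        obtain ⟨j, hj, hji⟩ : ∃ j ∈ J, i ≠ j := by
          by_cases hi1 : i = j₁
          · exact ⟨j₂, hj₂, hi1 ▸ hj⟩
          · exact ⟨j₁, hj₁, hi1⟩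
        exact hne i hi j hj hji (by rw [h1, h2]; ring)
      refine linForm_dvd_of_eval hni fun x hx => ?_
      simp only [dotProduct, Fin.sum_univ_two, Matrix.cons_val_zero, Matrix.cons_val_one] at hx
      obtain ⟨c, hc0, hc1⟩ : ∃ c, x 0 = c * s i ∧ x 1 = c * t i := by
        by_cases hsi : s i = 0
        · have hti : t i ≠ 0 := fun h => hni (by simp [hsi, h])
          refine ⟨x 1 / t i, ?_, by field_simp⟩
          rw [hsi] at hx ⊢
          simpa [hti] using hx
        · refine ⟨x 0 / s i, by field_simp, ?_⟩
          field_simp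
          linear_combination -hx
      rw [heval, hc0, hc1, mul_smul, mul_smul, ← smul_add, ← hst i hi,
        eval_smul_of_isHomogeneous hP, h0 i hi, mul_zero]
  refine linForm_dvd_of_eval hn fun x hx => ?_
  obtain ⟨a, b, rfl⟩ := exists_combination hn huw (hq _ hj₁) (hq _ hj₂) hx
  have := heval ![a, b]
  rw [hzero, map_zero] at this
  simpa using this.symm

end LineVanishing

end LineArr

end

noncomputable section

namespace LineArr

open MvPolynomial
open scoped LinearAlgebra.Projectivization Matrix

/-! ### Jacobian syzygies of line arrangements -/

section Syzygies

variable {d : ℕ} {n : Fin d → Fin 3 → ℂ}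

/-- The equation of the arrangement with given covectors. -/
def arrEq (n : Fin d → Fin 3 → ℂ) : S := ∏ i, linForm (n i)

theorem isHomogeneous_arrEq (n : Fin d → Fin 3 → ℂ) : (arrEq n).IsHomogeneous d := by
  have := isHomogeneous_prod_linForm Finset.univ n
  rwa [Finset.card_univ, Fintype.card_fin] at this

/-- The covectors define pairwise distinct lines. -/
def DistinctLines (n : Fin d → Fin 3 → ℂ) : Prop := ∀ i j, i ≠ j → n i ⨯₃ n j ≠ 0

theorem DistinctLines.ne_zero (h : DistinctLines n) (hd : 2 ≤ d) (i : Fin d) : n i ≠ 0 := by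
  have : Nontrivial (Fin d) := Fin.nontrivial_iff_two_le.2 hd
  obtain ⟨j, hj⟩ := exists_ne i
  intro h0
  exact h i j hj.symm (by rw [h0]; simp)

theorem DistinctLines.pairwiseIndep (h : DistinctLines n) (hd : 2 ≤ d) (s : Finset (Fin d)) :
    PairwiseIndep s n :=
  ⟨fun i _ => h.ne_zero hd i, fun i _ j _ hij c hc => h i j hij (by rw [hc, map_smul, cross_self,
    smul_zero])⟩

theorem DistinctLines.arrEq_ne_zero (h : DistinctLines n) (hd : 2 ≤ d) : arrEq n ≠ 0 :=
  prod_linForm_ne_zero fun i _ => h.ne_zero hd i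

theorem DistinctLines.isPrimitiveVec_grad (h : DistinctLines n) (hd : 2 ≤ d) :
    IsPrimitiveVec (grad (arrEq n)) := by
  intro π hπ
  by_contra! H
  exact (h.pairwiseIndep hd Finset.univ).not_forall_dvd_pderiv
    ⟨⟨0, by omega⟩, Finset.mem_univ _⟩ hπ H

theorem IsPrimitiveVec.ne_zero {u : Fin 3 → S} (h : IsPrimitiveVec u) : u ≠ 0 := by
  rintro rfl
  obtain ⟨k, hk⟩ := h (X 0) (X_prime)
  exact hk (dvd_zero _)

theorem isPrimitiveVec_xvec : IsPrimitiveVec xvec := by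
  intro π hπ
  by_contra! H
  have key : ∀ k : Fin 3, Associated π (linForm (Pi.single k 1)) := by
    intro k
    have e : (X k : S) = linForm (Pi.single k 1) := by simp [linForm, Pi.single_apply]
    refine hπ.irreducible.associated_of_dvd (prime_linForm (by simp)).irreducible ?_
    rw [← e]; exact H k
  obtain ⟨c, hc⟩ := linForm_dvd_linForm ((key 0).symm.trans (key 1)).dvd
  have := congrFun hc 1
  simp at this

/-- Write f = ℓ_i f'. A derivation killing f satisfies f' θ(ℓ_i) ∈ (ℓ_i), and ℓ_i does not divide
f'. Thus a syzygy, seen as a derivation, preserves each line. -/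
theorem DistinctLines.dvd_dot (h : DistinctLines n) (hd : 2 ≤ d) {θ : Fin 3 → S}
    (hθ : θ ∈ AR (arrEq n)) (i : Fin d) : linForm (n i) ∣ θ ⬝ᵥ cvec (n i) := by
  classical
  rw [mem_AR, arrEq, ← Finset.mul_prod_erase _ _ (Finset.mem_univ i), grad_mul, grad_linForm,
    dotProduct_add, dotProduct_smul, dotProduct_smul, smul_eq_mul, smul_eq_mul] at hθ
  have h1 : linForm (n i) ∣ (∏ j ∈ Finset.univ.erase i, linForm (n j)) * (θ ⬝ᵥ cvec (n i)) :=
    ⟨-(θ ⬝ᵥ grad (∏ j ∈ Finset.univ.erase i, linForm (n j))), by linear_combination hθ⟩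
  exact ((prime_linForm (h.ne_zero hd i)).dvd_or_dvd h1).resolve_left
    ((h.pairwiseIndep hd Finset.univ).not_dvd_prod_erase (Finset.mem_univ i))

/-- Both syzygies are orthogonal to the gradient, so their cross product is proportional to it, with
polynomial factor because the gradient is primitive. All later arguments on freeness are about this
factor `α`. -/
theorem exists_cross_eq_smul_grad {f : S} (hf : IsPrimitiveVec (grad f)) {θ θ' : Fin 3 → S}
    (hθ : θ ∈ AR f) (hθ' : θ' ∈ AR f) : ∃ α : S, θ ⨯₃ θ' = α • grad f := by
  refine hf.exists_smul hf.ne_zero ?_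
  rw [cross_cross_eq_smul_sub_smul, mem_AR.1 hθ, mem_AR.1 hθ']
  simp

/-- A multiple γ x of the Euler field sends f to γ k f, which vanishes only for γ = 0. -/
theorem eq_zero_of_cross_xvec {f : S} {k : ℕ} (hk : k ≠ 0) (hf : f.IsHomogeneous k) (hf0 : f ≠ 0)
    {θ : Fin 3 → S} (hθ : θ ∈ AR f) (h : θ ⨯₃ xvec = 0) : θ = 0 := by
  obtain ⟨γ, rfl⟩ := isPrimitiveVec_xvec.exists_smul isPrimitiveVec_xvec.ne_zero h
  rw [mem_AR, smul_dotProduct, xvec_dot_grad hf, smul_eq_mul] at hθ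
  have hk' : (k : S) ≠ 0 := Nat.cast_ne_zero.2 hk
  rcases mul_eq_zero.1 hθ with h1 | h1
  · rw [h1, zero_smul]
  · exact absurd h1 (mul_ne_zero hk' hf0)

/-- A syzygy evaluated at the intersection of two lines is radial. -/
theorem DistinctLines.eval_cross_xvec (h : DistinctLines n) (hd : 2 ≤ d) {θ : Fin 3 → S}
    (hθ : θ ∈ AR (arrEq n)) {i j : Fin d} (hij : i ≠ j) (k : Fin 3) :
    eval (n i ⨯₃ n j) ((θ ⨯₃ xvec) k) = 0 := by
  set q := n i ⨯₃ n j with hq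
  -- At `q` the vector θ(q) is annihilated by both covectors, hence is a multiple of `q`.
  have hdot : ∀ i', n i' ⬝ᵥ q = 0 → n i' ⬝ᵥ (eval q ∘ θ) = 0 := by
    intro i' hi'
    obtain ⟨c, hc⟩ := h.dvd_dot hd hθ i'
    have h1 := congrArg (eval q) hc
    rw [map_mul, eval_linForm, hi', zero_mul, map_dot] at h1
    rw [dotProduct_comm, ← h1]
    congr 1
    ext k; simp [cvec]
  obtain ⟨t, ht⟩ := eq_smul_cross (h i j hij) (hdot i (dot_self_cross _ _)) (hdot j (dot_cross_self _ _))
  have h2 : eval q ((θ ⨯₃ xvec) k) = ((eval q ∘ θ) ⨯₃ (eval q ∘ xvec)) k := by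
    rw [← map_cross]; rfl
  have h3 : eval q ∘ xvec = q := by ext k; simp [xvec]
  rw [h2, h3, ht, ← hq, map_smul, LinearMap.smul_apply, cross_self, smul_zero]
  rfl

variable {m : ℕ} {M : Finset (Fin d)} {v : Fin 3 → ℂ}

theorem TypeData.distinctLines (h : TypeData m n M v) : DistinctLines n := h.cross

theorem TypeData.le (h : TypeData m n M v) : m ≤ d := by
  rw [← h.card]; exact (Finset.card_le_univ M).trans (by simp)

/-- The lower bound for the degrees of Jacobian syzygies. -/
theorem TypeData.sub_le_degree (h : TypeData m n M v) (hm : 2 ≤ m) {θ : Fin 3 → S}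
    (hθ : θ ∈ AR (arrEq n)) (hθ0 : θ ≠ 0) {r : ℕ} (hr : ∀ i, (θ i).IsHomogeneous r) :
    d - m ≤ r := by
  classical
  by_contra! hlt
  have hD := h.distinctLines
  have hmd := h.le
  have hd : 2 ≤ d := hm.trans hmd
  refine hθ0 (eq_zero_of_cross_xvec (by omega) (isHomogeneous_arrEq n) (hD.arrEq_ne_zero hd) hθ ?_)
  have hω := isHomogeneous_cross hr isHomogeneous_xvec
  -- The entries of θ × x have degree r + 1 and vanish at intersections of lines. The lines in `J`
  -- meet line `i` in at least r + 2 distinct points: for i in `M`, the point v (on a further line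
  -- `j₀` of `M`) and the points on the d - m lines outside `M`; for i outside `M`, the points on
  -- all other lines. So every ℓ_i divides each entry, and d exceeds r + 1.
  have key : ∀ i, ∃ J : Finset (Fin d), r + 2 ≤ J.card ∧ i ∉ J ∧
      ∀ j ∈ J, ∀ k ∈ J, j ≠ k → ¬ (i ∈ M ∧ j ∈ M ∧ k ∈ M) := by
    intro i
    by_cases hi : i ∈ M
    · obtain ⟨j₀, hj₀, hne⟩ := Finset.exists_mem_ne (by rw [h.card]; omega : 1 < M.card) i
      refine ⟨insert j₀ Mᶜ, ?_, ?_, ?_⟩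
      · rw [Finset.card_insert_of_notMem (by simp [hj₀]), Finset.card_compl, Fintype.card_fin, h.card]
        omega
      · simp [hi, hne.symm]
      · rintro j hj k hk hjk ⟨-, h1, h2⟩
        simp only [Finset.mem_insert, Finset.mem_compl, h1, h2, not_true, or_false] at hj hk
        exact hjk (hj.trans hk.symm)
    · refine ⟨Finset.univ.erase i, ?_, by simp, fun _ _ _ _ _ hM => hi hM.1⟩
      rw [Finset.card_erase_of_mem (Finset.mem_univ i), Finset.card_univ, Fintype.card_fin]
      omega
  ext1 k
  refine (hD.pairwiseIndep hd Finset.univ).eq_zero_of_dvd (hω k) (by simp; omega) fun i _ => ?_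
  obtain ⟨J, hJ, hiJ, hJM⟩ := key i
  refine linForm_dvd_of_points (J := J) (q := fun j => n i ⨯₃ n j) (hD.ne_zero hd i)
    (fun j _ => dot_self_cross _ _) ?_ (hω k) (by omega) (by omega)
    (fun j hj => hD.eval_cross_xvec hd hθ (by rintro rfl; exact hiJ hj) k)
  intro j hj k hk hjk h0
  refine h.triple i j k (fun e => hiJ (e ▸ hj)) (fun e => hiJ (e ▸ hk)) hjk (hJM j hj k hk hjk) ?_
  have e : (n i ⨯₃ n j) ⨯₃ (n i ⨯₃ n k) = (n i ⬝ᵥ n j ⨯₃ n k) • n i := by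
    apply vec_three_ext <;>
    · simp only [dot_three, cross_zero_apply, cross_one_apply, cross_two_apply,
        Pi.smul_apply, smul_eq_mul]
      ring
  rw [e] at h0
  exact (smul_eq_zero.1 h0).resolve_right (hD.ne_zero hd i)

/-- The product of the equations of the lines not through the special point. -/
def offEq (n : Fin d → Fin 3 → ℂ) (M : Finset (Fin d)) : S := ∏ i ∈ Mᶜ, linForm (n i)

/-- The product of the equations of the lines through the special point. -/
def onEq (n : Fin d → Fin 3 → ℂ) (M : Finset (Fin d)) : S := ∏ i ∈ M, linForm (n i)

theorem onEq_mul_offEq (n : Fin d → Fin 3 → ℂ) (M : Finset (Fin d)) :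
    onEq n M * offEq n M = arrEq n := Finset.prod_mul_prod_compl M _

theorem TypeData.dot_grad_onEq (h : TypeData m n M v) : cvec v ⬝ᵥ grad (onEq n M) = 0 :=
  dot_grad_prod M n fun i hi => by rw [cvec_dot, dotProduct_comm, h.dot i hi, C_0]

/-- The syzygy of degree `d - m` attached to the special point. -/
def centerSyz (n : Fin d → Fin 3 → ℂ) (M : Finset (Fin d)) (v : Fin 3 → ℂ) : Fin 3 → S :=
  ((d : S) * offEq n M) • cvec v - (cvec v ⬝ᵥ grad (offEq n M)) • xvec

/-- The derivation ∂_v kills `onEq`, so d · offEq · ∂_v f = d · f · ∂_v offEq, which is also the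
value on f of the Euler field times ∂_v offEq. -/
theorem TypeData.centerSyz_mem (h : TypeData m n M v) : centerSyz n M v ∈ AR (arrEq n) := by
  rw [mem_AR, centerSyz, sub_dotProduct, smul_dotProduct, smul_dotProduct,
    xvec_dot_grad (isHomogeneous_arrEq n), ← onEq_mul_offEq n M, grad_mul, dotProduct_add,
    dotProduct_smul, dotProduct_smul, h.dot_grad_onEq]
  simp only [smul_eq_mul]
  ring

theorem TypeData.isHomogeneous_offEq (h : TypeData m n M v) : (offEq n M).IsHomogeneous (d - m) := by
  have := isHomogeneous_prod_linForm Mᶜ n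
  rwa [Finset.card_compl, Fintype.card_fin, h.card] at this

theorem TypeData.isHomogeneous_centerSyz (h : TypeData m n M v) (i : Fin 3) :
    (centerSyz n M v i).IsHomogeneous (d - m) := by
  refine IsHomogeneous.sub ?_ ?_
  · have := ((isHomogeneous_C (Fin 3) (d : ℂ)).mul h.isHomogeneous_offEq).mul
      (isHomogeneous_cvec v i)
    simpa using this
  -- For d = m the truncated degree of the gradient would be off by one, but then `offEq` is
  -- constant and its gradient vanishes.
  · rcases Nat.eq_zero_or_pos (d - m) with h0 | h0
    · have h1 : (offEq n M).totalDegree = 0 := (totalDegree_zero_iff_isHomogeneous _).2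
        (h0 ▸ h.isHomogeneous_offEq)
      rw [totalDegree_eq_zero_iff_eq_C] at h1
      rw [h1, grad_C, dotProduct_zero, zero_smul]
      exact isHomogeneous_zero _ _ _
    · have := (isHomogeneous_dot (isHomogeneous_cvec v) (isHomogeneous_grad h.isHomogeneous_offEq)).mul
        (isHomogeneous_xvec i)
      rwa [zero_add, Nat.sub_add_cancel h0] at this

theorem cvec_cross_xvec_ne_zero {v : Fin 3 → ℂ} (hv : v ≠ 0) : cvec v ⨯₃ xvec ≠ 0 := by
  intro h
  obtain ⟨γ, hγ⟩ := isPrimitiveVec_xvec.exists_smul isPrimitiveVec_xvec.ne_zero h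
  have key : ∀ k, v k = 0 := by
    intro k
    have := congrArg (eval 0) (congrFun hγ k)
    simpa [cvec, xvec] using this
  exact hv (funext key)

theorem TypeData.offEq_ne_zero (h : TypeData m n M v) (hm : 2 ≤ m) : offEq n M ≠ 0 :=
  prod_linForm_ne_zero fun i _ => h.distinctLines.ne_zero (hm.trans h.le) i

theorem TypeData.centerSyz_ne_zero (h : TypeData m n M v) (hm : 2 ≤ m) : centerSyz n M v ≠ 0 := by
  intro h0
  have h1 : centerSyz n M v ⨯₃ xvec = ((d : S) * offEq n M) • (cvec v ⨯₃ xvec) := by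
    rw [centerSyz, map_sub, LinearMap.sub_apply, map_smul, map_smul, LinearMap.smul_apply,
      LinearMap.smul_apply, cross_self, smul_zero, sub_zero]
  rw [h0, map_zero, LinearMap.zero_apply, eq_comm, smul_eq_zero] at h1
  rcases h1 with h1 | h1
  · have hd : (d : S) ≠ 0 := Nat.cast_ne_zero.2 (by have := h.le; omega)
    exact mul_ne_zero hd (h.offEq_ne_zero hm) h1
  · exact cvec_cross_xvec_ne_zero h.ne_zero h1

theorem TypeData.mdr_eq (h : TypeData m n M v) (hm : 2 ≤ m) : mdr (arrEq n) = d - m := by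
  have hmem : d - m ∈ {r | ∃ a ∈ AR (arrEq n), a ≠ 0 ∧ ∀ i, (a i).IsHomogeneous r} :=
    ⟨_, h.centerSyz_mem, h.centerSyz_ne_zero hm, h.isHomogeneous_centerSyz⟩
  refine le_antisymm (Nat.sInf_le hmem) (le_csInf ⟨_, hmem⟩ ?_)
  rintro r ⟨a, ha, ha0, har⟩
  exact h.sub_le_degree hm ha ha0 har

/-! ### Free arrangements -/

/-- Saito's criterion. If θ × θ₁ = α ∇f and θ × θ₂ = β ∇f, then κ θ - β θ₁ + α θ₂ has zero cross
product with both θ₁ and θ₂, hence is zero, and κ is invertible. -/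
theorem isFree_of_cross_eq {f : S} (hf : IsPrimitiveVec (grad f)) {θ₁ θ₂ : Fin 3 → S}
    (h₁ : θ₁ ∈ AR f) (h₂ : θ₂ ∈ AR f) {κ : ℂ} (hκ : κ ≠ 0) (h : θ₁ ⨯₃ θ₂ = (C κ : S) • grad f)
    {e₁ e₂ : ℕ} (he₁ : ∀ i, (θ₁ i).IsHomogeneous e₁) (he₂ : ∀ i, (θ₂ i).IsHomogeneous e₂) :
    IsFree f := by
  have hκS : (C κ : S) ≠ 0 := by simpa using hκ
  have hne : θ₁ ⨯₃ θ₂ ≠ 0 := by rw [h]; exact smul_ne_zero hκS hf.ne_zero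
  have hli : LinearIndependent S ![(⟨θ₁, h₁⟩ : AR f), ⟨θ₂, h₂⟩] := by
    rw [LinearIndependent.pair_iff]
    intro s t hst
    have hst' : s • θ₁ + t • θ₂ = 0 := congrArg Subtype.val hst
    have c1 : (s • θ₁ + t • θ₂) ⨯₃ θ₂ = s • (θ₁ ⨯₃ θ₂) := by simp
    have c2 : θ₁ ⨯₃ (s • θ₁ + t • θ₂) = t • (θ₁ ⨯₃ θ₂) := by simp
    rw [hst'] at c1 c2
    rw [map_zero, LinearMap.zero_apply, eq_comm, smul_eq_zero] at c1
    rw [map_zero, eq_comm, smul_eq_zero] at c2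
    exact ⟨c1.resolve_right hne, c2.resolve_right hne⟩
  have hspan : ⊤ ≤ Submodule.span S (Set.range ![(⟨θ₁, h₁⟩ : AR f), ⟨θ₂, h₂⟩]) := by
    rintro ⟨θ, hθ⟩ -
    obtain ⟨α, hα⟩ := exists_cross_eq_smul_grad hf hθ h₁
    obtain ⟨β, hβ⟩ := exists_cross_eq_smul_grad hf hθ h₂
    have hη : (C κ : S) • θ - β • θ₁ + α • θ₂ = 0 := by
      refine eq_zero_of_cross_eq_zero hne ?_ ?_
      · have : ((C κ : S) • θ - β • θ₁ + α • θ₂) ⨯₃ θ₁ = (C κ : S) • (θ ⨯₃ θ₁) - α • (θ₁ ⨯₃ θ₂) := by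
          simp only [map_add, map_sub, map_smul, LinearMap.add_apply, LinearMap.sub_apply,
            LinearMap.smul_apply, cross_self, smul_zero, sub_zero, ← cross_anticomm θ₁ θ₂, smul_neg]
          exact (sub_eq_add_neg _ _).symm
        rw [this, hα, h, smul_comm, sub_self]
      · have : ((C κ : S) • θ - β • θ₁ + α • θ₂) ⨯₃ θ₂ = (C κ : S) • (θ ⨯₃ θ₂) - β • (θ₁ ⨯₃ θ₂) := by
          simp
        rw [this, hβ, h, smul_comm, sub_self]
    rw [Matrix.range_cons, Matrix.range_cons, Matrix.range_empty, Set.union_empty,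
      Set.singleton_union, Submodule.mem_span_pair]
    refine ⟨C κ⁻¹ * β, -(C κ⁻¹ * α), Subtype.ext ?_⟩
    show (C κ⁻¹ * β : S) • θ₁ + (-(C κ⁻¹ * α) : S) • θ₂ = θ
    have hinv : (C κ⁻¹ * C κ : S) = 1 := by rw [← C_mul, inv_mul_cancel₀ hκ, C_1]
    calc (C κ⁻¹ * β : S) • θ₁ + (-(C κ⁻¹ * α) : S) • θ₂
        = (C κ⁻¹ * C κ : S) • θ - (C κ⁻¹ : S) • ((C κ : S) • θ - β • θ₁ + α • θ₂) := by
          simp only [smul_add, smul_sub, mul_smul, neg_smul]; abel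
      _ = θ := by rw [hη, hinv, one_smul, smul_zero, sub_zero]
  refine ⟨![e₁, e₂], Module.Basis.mk hli hspan, fun j i => ?_⟩
  rw [Module.Basis.mk_apply]
  fin_cases j
  · exact he₁ i
  · exact he₂ i

/-- The constant vector `v` is a syzygy, and a Koszul syzygy w × ∇f with w · v ≠ 0 completes it to a
basis: v × (w × ∇f) = -(w · v) ∇f. -/
theorem TypeData.isFree_of_eq (h : TypeData m n M v) (hm : 2 ≤ m) (hmd : m = d) :
    IsFree (arrEq n) := by
  have hd : 2 ≤ d := hmd ▸ hm
  have hMu : M = Finset.univ := (Finset.card_eq_iff_eq_univ M).1 (by rw [h.card, Fintype.card_fin, hmd])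
  have hv0 : cvec v ⬝ᵥ grad (arrEq n) = 0 :=
    dot_grad_prod _ n fun i _ => by rw [cvec_dot, dotProduct_comm, h.dot i (hMu ▸ Finset.mem_univ i), C_0]
  obtain ⟨k, hk⟩ := Function.ne_iff.1 h.ne_zero
  set w : Fin 3 → ℂ := Pi.single k 1
  have hwv : v ⬝ᵥ w = v k := by simp [w]
  refine isFree_of_cross_eq (h.distinctLines.isPrimitiveVec_grad hd) (mem_AR.2 hv0)
    (θ₂ := cvec w ⨯₃ grad (arrEq n)) (κ := -v k) (mem_AR.2 ?_) (neg_ne_zero.2 hk) ?_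
    (isHomogeneous_cvec v) (isHomogeneous_cross (isHomogeneous_cvec w)
      (isHomogeneous_grad (isHomogeneous_arrEq n)))
  · rw [dotProduct_comm, dot_cross_self]
  · rw [cross_cross_eq_smul_sub_smul', hv0, dotProduct_comm (cvec w), cvec_dot, hwv, zero_smul, zero_sub, C_neg, neg_smul]

theorem TypeData.isHomogeneous_onEq (h : TypeData m n M v) : (onEq n M).IsHomogeneous m := by
  have := isHomogeneous_prod_linForm M n
  rwa [h.card] at this

/-- Let N be the covector of the one line missing `v` and g the product of the other forms. Then N ×
∇g kills both g and the last form, and together with `centerSyz` it satisfies Saito's criterion. -/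
theorem TypeData.isFree_of_pred (h : TypeData m n M v) (hm : 2 ≤ m) (hmd : m + 1 = d) :
    IsFree (arrEq n) := by
  have hd : 2 ≤ d := by omega
  obtain ⟨a, ha⟩ := Finset.card_eq_one.1 (show Mᶜ.card = 1 by
    rw [Finset.card_compl, Fintype.card_fin, h.card]; omega)
  have haM : a ∉ M := by rw [← Finset.mem_compl, ha]; exact Finset.mem_singleton_self a
  have hoff : offEq n M = linForm (n a) := by rw [offEq, ha, Finset.prod_singleton]
  have hav := h.dot_ne_zero hm haM
  set g := onEq n M
  set N := cvec (n a)
  have hgrad : grad (arrEq n) = g • N + linForm (n a) • grad g := by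
    rw [← onEq_mul_offEq n M, hoff, grad_mul, grad_linForm]
  have hvg : cvec v ⬝ᵥ grad g = 0 := h.dot_grad_onEq
  have hxg : xvec ⬝ᵥ grad g = (m : S) * g := xvec_dot_grad h.isHomogeneous_onEq
  have hvN : cvec v ⬝ᵥ N = C (n a ⬝ᵥ v) := by rw [cvec_dot, dotProduct_comm]
  have hc : centerSyz n M v = ((d : S) * linForm (n a)) • cvec v - (C (n a ⬝ᵥ v) : S) • xvec := by
    rw [centerSyz, hoff, grad_linForm, hvN]
  refine isFree_of_cross_eq (h.distinctLines.isPrimitiveVec_grad hd) h.centerSyz_mem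
    (θ₂ := N ⨯₃ grad g) (κ := -(m * (n a ⬝ᵥ v))) (mem_AR.2 ?_) ?_ ?_ h.isHomogeneous_centerSyz
    (isHomogeneous_cross (isHomogeneous_cvec _) (isHomogeneous_grad h.isHomogeneous_onEq))
  · rw [hgrad, dotProduct_add, dotProduct_smul, dotProduct_smul, dotProduct_comm,
      dot_self_cross, dotProduct_comm, dot_cross_self]
    simp
  · exact neg_ne_zero.2 (mul_ne_zero (Nat.cast_ne_zero.2 (by omega)) hav)
  · have hxN : N ⬝ᵥ xvec = linForm (n a) := rfl
    rw [cross_cross_eq_smul_sub_smul', hc, hgrad]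
    have hNv : N ⬝ᵥ cvec v = C (n a ⬝ᵥ v) := cvec_dot _ _
    simp only [sub_dotProduct, smul_dotProduct, dotProduct_sub, dotProduct_smul, hvg, hxg, hNv, hxN,
      smul_eq_mul]
    have hdm : (d : S) = (m : S) + 1 := by rw [← hmd]; push_cast; ring
    rw [hdm]
    simp only [C_neg, C_mul, map_natCast]
    ext1 k
    simp only [Pi.sub_apply, Pi.add_apply, Pi.smul_apply, smul_eq_mul]
    ring

end Syzygies

end LineArr

end

noncomputable section

namespace LineArr

open MvPolynomial
open scoped LinearAlgebra.Projectivization Matrix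

/-! ### Nearly free arrangements -/

section NearlyFree

theorem isPrimitiveVec_of_prime {h : Fin 3 → S} {i j : Fin 3} (hi : Prime (h i))
    (hij : ¬ h i ∣ h j) : IsPrimitiveVec h := by
  intro π hπ
  by_contra! H
  exact hij ((hπ.irreducible.associated_of_dvd hi.irreducible (H i)).symm.dvd.trans (H j))

theorem linearCombination_three (ρ : Fin 3 → Fin 3 → S) (κ : Fin 3 → S) :
    Fintype.linearCombination S ρ κ = κ 0 • ρ 0 + κ 1 • ρ 1 + κ 2 • ρ 2 := by
  rw [Fintype.linearCombination_apply, Fin.sum_univ_three]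

/-- A criterion for the exactness of a resolution of nearly free type. -/
theorem exact_of_cross_eq {f : S} (hf : IsPrimitiveVec (grad f)) {ρ : Fin 3 → Fin 3 → S}
    (hρ : ∀ j, ρ j ∈ AR f) {h : Fin 3 → S} {γ : ℂ} (hγ : γ ≠ 0)
    (h12 : ρ 1 ⨯₃ ρ 2 = (C γ * h 0) • grad f) (h20 : ρ 2 ⨯₃ ρ 0 = (C γ * h 1) • grad f)
    (h01 : ρ 0 ⨯₃ ρ 1 = (C γ * h 2) • grad f) (hrel : h 0 • ρ 0 + h 1 • ρ 1 + h 2 • ρ 2 = 0)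
    (h1 : Prime (h 1)) (h2 : h 2 ≠ 0) (hdvd : ¬ h 1 ∣ h 2)
    (hgen : ∀ θ ∈ AR f, ∀ α : S, θ ⨯₃ ρ 0 = α • grad f → ∃ s t : S, α = s * h 1 + t * h 2) :
    Function.Injective (LinearMap.toSpanSingleton S (Fin 3 → S) h) ∧
    Function.Exact (LinearMap.toSpanSingleton S (Fin 3 → S) h) (Fintype.linearCombination S ρ) ∧
    Function.Exact (Fintype.linearCombination S ρ) (jacMap f) := by
  have hC : (C γ : S) ≠ 0 := by simpa using hγ
  have hprim := isPrimitiveVec_of_prime h1 hdvd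
  have h10 : ρ 1 ⨯₃ ρ 0 = -((C γ * h 2) • grad f) := by rw [← h01, cross_anticomm]
  have h02 : ρ 0 ⨯₃ ρ 2 = -((C γ * h 1) • grad f) := by rw [← h20, cross_anticomm]
  have h21 : ρ 2 ⨯₃ ρ 1 = -((C γ * h 0) • grad f) := by rw [← h12, cross_anticomm]
  obtain ⟨k, hk⟩ := Function.ne_iff.1 hf.ne_zero
  rw [Pi.zero_apply] at hk
  refine ⟨?_, ?_, ?_⟩
  · rw [← LinearMap.ker_eq_bot, LinearMap.ker_eq_bot']
    intro s hs
    rw [LinearMap.toSpanSingleton_apply, smul_eq_zero] at hs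
    exact hs.resolve_right fun h0 => h2 (congrFun h0 2)
  · intro κ
    rw [linearCombination_three]
    constructor
    -- Cross products of the relation with the three ρ j give κ × h = 0, and `h` is primitive.
    · intro hκ
      have e0 := congrArg (fun w => (w ⨯₃ ρ 0) k) hκ
      have e1 := congrArg (fun w => (w ⨯₃ ρ 1) k) hκ
      have e2 := congrArg (fun w => (w ⨯₃ ρ 2) k) hκ
      simp only [map_add, map_smul, LinearMap.add_apply, LinearMap.smul_apply, cross_self,
        h12, h20, h01, h10, h02, h21, map_zero, LinearMap.zero_apply, Pi.add_apply, Pi.smul_apply,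
        Pi.neg_apply, smul_eq_mul, Pi.zero_apply] at e0 e1 e2
      have hc : κ ⨯₃ h = 0 := by
        apply vec_three_ext
        · rw [cross_zero_apply]
          refine mul_left_cancel₀ (mul_ne_zero hC hk) ?_
          rw [Pi.zero_apply]
          linear_combination -e0
        · rw [cross_one_apply]
          refine mul_left_cancel₀ (mul_ne_zero hC hk) ?_
          rw [Pi.zero_apply]
          linear_combination -e1
        · rw [cross_two_apply]
          refine mul_left_cancel₀ (mul_ne_zero hC hk) ?_
          rw [Pi.zero_apply]
          linear_combination -e2
      obtain ⟨s, hs⟩ := hprim.exists_smul hprim.ne_zero hc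
      exact ⟨s, by rw [LinearMap.toSpanSingleton_apply, hs]⟩
    · rintro ⟨s, rfl⟩
      simp only [LinearMap.toSpanSingleton_apply, Pi.smul_apply, smul_assoc]
      rw [← smul_add, ← smul_add, hrel, smul_zero]
  · intro θ
    constructor
    · intro hθ
      have hθ : θ ∈ AR f := hθ
      obtain ⟨α, hα⟩ := exists_cross_eq_smul_grad hf hθ (hρ 0)
      obtain ⟨s, t, rfl⟩ := hgen θ hθ α hα
      -- The multiples of ρ 1 and ρ 2 are those that make η × ρ 0 vanish, which is what `hgen`
      -- provides. Then h 1 · η and h 2 · η are polynomial multiples of ρ 0, and since the prime h 1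
      -- does not divide h 2, so is η.
      set η := (C γ : S) • θ - s • ρ 2 + t • ρ 1 with hη
      have hηAR : η ∈ AR f := (AR f).add_mem ((AR f).sub_mem ((AR f).smul_mem _ hθ)
        ((AR f).smul_mem _ (hρ 2))) ((AR f).smul_mem _ (hρ 1))
      have hη0 : η ⨯₃ ρ 0 = 0 := by
        rw [hη]
        simp only [map_add, map_sub, map_smul, LinearMap.add_apply, LinearMap.sub_apply,
          LinearMap.smul_apply, h20, h10, hα]
        ext1 j
        simp only [Pi.add_apply, Pi.sub_apply, Pi.smul_apply, Pi.neg_apply, smul_eq_mul,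
          Pi.zero_apply]
        ring
      obtain ⟨α₁, hα₁⟩ := exists_cross_eq_smul_grad hf hηAR (hρ 1)
      obtain ⟨α₂, hα₂⟩ := exists_cross_eq_smul_grad hf hηAR (hρ 2)
      have hne1 : ρ 0 ⨯₃ ρ 1 ≠ 0 := by rw [h01]; exact smul_ne_zero (mul_ne_zero hC h2) hf.ne_zero
      have hne2 : ρ 0 ⨯₃ ρ 2 ≠ 0 := by
        rw [h02]; exact neg_ne_zero.2 (smul_ne_zero (mul_ne_zero hC h1.ne_zero) hf.ne_zero)
      have k1 : (C γ * h 2) • η - α₁ • ρ 0 = 0 := by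
        refine eq_zero_of_cross_eq_zero hne1 ?_ ?_
        · rw [map_sub, LinearMap.sub_apply, map_smul, map_smul, LinearMap.smul_apply,
            LinearMap.smul_apply, hη0, cross_self, smul_zero, smul_zero, sub_zero]
        · rw [map_sub, LinearMap.sub_apply, map_smul, map_smul, LinearMap.smul_apply,
            LinearMap.smul_apply, hα₁, h01, smul_comm, sub_self]
      have k2 : (C γ * h 1) • η + α₂ • ρ 0 = 0 := by
        refine eq_zero_of_cross_eq_zero hne2 ?_ ?_
        · rw [map_add, LinearMap.add_apply, map_smul, map_smul, LinearMap.smul_apply,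
            LinearMap.smul_apply, hη0, cross_self, smul_zero, smul_zero, add_zero]
        · rw [map_add, LinearMap.add_apply, map_smul, map_smul, LinearMap.smul_apply,
            LinearMap.smul_apply, hα₂, h02, smul_neg, smul_comm, add_neg_cancel]
      obtain ⟨l, hl⟩ : ∃ l, ρ 0 l ≠ 0 := by
        by_contra! H
        exact hne1 (by rw [show ρ 0 = 0 from funext H]; simp)
      have k3 : h 1 * α₁ = -(h 2 * α₂) := by
        have q1 := congrFun k1 l
        have q2 := congrFun k2 l
        simp only [Pi.add_apply, Pi.sub_apply, Pi.smul_apply, smul_eq_mul, Pi.zero_apply] at q1 q2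
        refine mul_right_cancel₀ hl ?_
        linear_combination -h 1 * q1 + h 2 * q2
      obtain ⟨δ, hδ⟩ := (h1.dvd_or_dvd ⟨-α₁, by linear_combination k3⟩ : h 1 ∣ h 2 ∨ h 1 ∣ α₂).resolve_left hdvd
      have k4 : (C γ : S) • η + δ • ρ 0 = 0 := by
        refine (smul_eq_zero.1 (?_ : h 1 • ((C γ : S) • η + δ • ρ 0) = 0)).resolve_left h1.ne_zero
        rw [← k2, hδ, smul_add, smul_smul, smul_smul, mul_comm (h 1) (C γ)]
      have hinv : (C γ⁻¹ * C γ : S) = 1 := by rw [← C_mul, inv_mul_cancel₀ hγ, C_1]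
      refine ⟨![-(C γ⁻¹ * C γ⁻¹ * δ), -(C γ⁻¹ * t), C γ⁻¹ * s], ?_⟩
      rw [linearCombination_three]
      ext1 j
      have q := congrFun k4 j
      rw [hη] at q
      simp only [Pi.add_apply, Pi.sub_apply, Pi.smul_apply, smul_eq_mul, Pi.zero_apply] at q
      simp only [Pi.add_apply, Pi.smul_apply, smul_eq_mul, Matrix.cons_val_zero,
        Matrix.cons_val_one, Matrix.cons_val]
      linear_combination (-C γ⁻¹ * C γ⁻¹) * q + ((C γ⁻¹ * C γ + 1) * θ j - C γ⁻¹ * s * ρ 2 j +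
        C γ⁻¹ * t * ρ 1 j) * hinv
    · rintro ⟨κ, rfl⟩
      rw [linearCombination_three]
      exact (AR f).add_mem ((AR f).add_mem ((AR f).smul_mem _ (hρ 0)) ((AR f).smul_mem _ (hρ 1)))
        ((AR f).smul_mem _ (hρ 2))

/-- A polynomial vanishing on the line through the origin spanned by `n₁ × n₂` belongs to the ideal
generated by the linear forms with coefficients `n₁`, `n₂`. -/
theorem exists_eq_of_aeval_eq_zero {n₁ n₂ w : Fin 3 → ℂ} (hw : w ⬝ᵥ n₁ ⨯₃ n₂ = 1) {P : S}
    (hP : aeval (fun k => C ((n₁ ⨯₃ n₂) k) * linForm w) P = 0) :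
    ∃ s t : S, s * linForm n₁ + t * linForm n₂ = P := by
  rw [← Ideal.mem_span_pair]
  set I : Ideal S := Ideal.span {linForm n₁, linForm n₂}
  set q := n₁ ⨯₃ n₂
  have hq0 : q ≠ 0 := by intro h; rw [h, dotProduct_zero] at hw; exact zero_ne_one hw
  -- The substitution is x ↦ (w · x) q, the projection onto the line spanned by `q`. It changes each
  -- coordinate by a linear form vanishing at `q`, that is, by a combination of `n₁` and `n₂`.
  have key : (Ideal.Quotient.mkₐ ℂ I).comp (aeval (fun k => C (q k) * linForm w)) =
      Ideal.Quotient.mkₐ ℂ I := by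
    refine algHom_ext fun k => ?_
    rw [AlgHom.comp_apply, aeval_X, Ideal.Quotient.mkₐ_eq_mk, Ideal.Quotient.eq,
      Ideal.mem_span_pair]
    have hk : q ⬝ᵥ (q k • w - Pi.single k 1) = 0 := by
      rw [dotProduct_sub, dotProduct_smul, dotProduct_comm q w, hw]
      simp
    obtain ⟨s, t, hst⟩ := exists_combination (u := n₁) (w := n₂) hq0 hq0
      (by rw [dotProduct_comm, dot_self_cross]) (by rw [dotProduct_comm, dot_cross_self]) hk
    refine ⟨C s, C t, ?_⟩
    have e : (X k : S) = linForm (Pi.single k 1) := by simp [linForm, Pi.single_apply]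
    have h1 := congrArg linForm (eq_add_of_sub_eq hst)
    rw [linForm_add, linForm_add, linForm_smul, linForm_smul, linForm_smul, ← e] at h1
    linear_combination -h1
  rw [← Ideal.Quotient.eq_zero_iff_mem, ← Ideal.Quotient.mkₐ_eq_mk ℂ, ← key, AlgHom.comp_apply, hP,
    map_zero]

variable {d m : ℕ} {n : Fin d → Fin 3 → ℂ} {M : Finset (Fin d)} {v : Fin 3 → ℂ}

/-- The vector algebra behind the resolution for d = m + 2: A, B are the covectors of the two lines
missing the special point V, G is the gradient of the product g of the other forms, F that of f. The
cross products of the three syzygies are c m F times the coefficients of their relation, a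
Hilbert–Burch pattern. The relation comes from J V = bv (A × G) - av (B × G), which uses V · G = 0.
-/
theorem nearlyFree_cross_identities {R : Type} [CommRing R] {A B G x V : Fin 3 → R}
    {c m g la lb av bv J : R} (hc : c = m + 2) (hVG : V ⬝ᵥ G = 0) (hxG : x ⬝ᵥ G = m * g)
    (hla : A ⬝ᵥ x = la) (hlb : B ⬝ᵥ x = lb) (hav : A ⬝ᵥ V = av) (hbv : B ⬝ᵥ V = bv)
    (hJ : A ⬝ᵥ G ⨯₃ B = J) {ρ₀ ρ₁ ρ₂ F : Fin 3 → R}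
    (h₀ : ρ₀ = (c * (la * lb)) • V - (av * lb + bv * la) • x)
    (h₁ : ρ₁ = (c * lb) • (A ⨯₃ G) - J • x) (h₂ : ρ₂ = (c * la) • (B ⨯₃ G) + J • x)
    (hF : F = (la * lb) • G + (g * lb) • A + (g * la) • B) :
    ρ₁ ⨯₃ ρ₂ = (c * m * -J) • F ∧ ρ₂ ⨯₃ ρ₀ = (c * m * (bv * la)) • F ∧
    ρ₀ ⨯₃ ρ₁ = (c * m * -(av * lb)) • F ∧
    (-J) • ρ₀ + (bv * la) • ρ₁ + (-(av * lb)) • ρ₂ = 0 := by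
  have hGx : G ⬝ᵥ x = m * g := by rw [dotProduct_comm, hxG]
  have hGV : G ⬝ᵥ V = 0 := by rw [dotProduct_comm, hVG]
  have hUx : (A ⨯₃ G) ⨯₃ x = la • G - (m * g) • A := by
    rw [cross_cross_eq_smul_sub_smul, hla, hGx]
  have hWx : (B ⨯₃ G) ⨯₃ x = lb • G - (m * g) • B := by
    rw [cross_cross_eq_smul_sub_smul, hlb, hGx]
  have hxU : x ⨯₃ (A ⨯₃ G) = (m * g) • A - la • G := by
    rw [← cross_anticomm, hUx, neg_sub]
  have hxW : x ⨯₃ (B ⨯₃ G) = (m * g) • B - lb • G := by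
    rw [← cross_anticomm, hWx, neg_sub]
  have hWV : (B ⨯₃ G) ⨯₃ V = bv • G := by
    rw [cross_cross_eq_smul_sub_smul, hbv, hGV, zero_smul, sub_zero]
  have hVU : V ⨯₃ (A ⨯₃ G) = -(av • G) := by
    rw [← cross_anticomm, cross_cross_eq_smul_sub_smul, hav, hGV, zero_smul, sub_zero]
  have hUW : (A ⨯₃ G) ⨯₃ (B ⨯₃ G) = -(J • G) := by
    rw [← hJ]
    apply vec_three_ext <;>
    · simp only [dot_three, cross_zero_apply, cross_one_apply, cross_two_apply, Pi.neg_apply,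
        Pi.smul_apply, smul_eq_mul]
      ring
  have hJV : J • V = bv • (A ⨯₃ G) - av • (B ⨯₃ G) := by
    rw [← hJ, ← hav, ← hbv]
    rw [dot_three] at hVG
    apply vec_three_ext
    · simp only [dot_three, cross_zero_apply, cross_one_apply, cross_two_apply, Pi.sub_apply,
        Pi.smul_apply, smul_eq_mul]
      linear_combination -(A 1 * B 2 - A 2 * B 1) * hVG
    · simp only [dot_three, cross_zero_apply, cross_one_apply, cross_two_apply, Pi.sub_apply,
        Pi.smul_apply, smul_eq_mul]
      linear_combination -(A 2 * B 0 - A 0 * B 2) * hVG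
    · simp only [dot_three, cross_zero_apply, cross_one_apply, cross_two_apply, Pi.sub_apply,
        Pi.smul_apply, smul_eq_mul]
      linear_combination -(A 0 * B 1 - A 1 * B 0) * hVG
  have hJVx : J • (V ⨯₃ x) = bv • (la • G - (m * g) • A) - av • (lb • G - (m * g) • B) := by
    rw [← hUx, ← hWx, ← LinearMap.smul_apply, ← map_smul, hJV]
    simp
  have hJxV : J • (x ⨯₃ V) = -(J • (V ⨯₃ x)) := by rw [← cross_anticomm V x, smul_neg]
  rw [hJVx] at hJxV
  refine ⟨?_, ?_, ?_, ?_⟩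
  · rw [h₁, h₂, hF]
    simp only [map_add, map_sub, map_smul, LinearMap.sub_apply,
      LinearMap.smul_apply, cross_self, hUW, hUx, hxW]
    ext1 k
    simp only [Pi.add_apply, Pi.sub_apply, Pi.smul_apply, smul_eq_mul, Pi.neg_apply, Pi.zero_apply]
    rw [hc]; ring
  · rw [h₀, h₂, hF]
    simp only [map_add, map_sub, map_smul, LinearMap.add_apply,
      LinearMap.smul_apply, cross_self, hWV, hWx]
    ext1 k
    have := congrFun hJxV k
    simp only [Pi.add_apply, Pi.sub_apply, Pi.smul_apply, smul_eq_mul, Pi.neg_apply,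
      Pi.zero_apply] at this ⊢
    rw [hc]; linear_combination ((m + 2) * (la * lb)) * this
  · rw [h₀, h₁, hF]
    simp only [map_sub, map_smul, LinearMap.sub_apply,
      LinearMap.smul_apply, cross_self, hVU, hxU]
    ext1 k
    have := congrFun hJVx k
    simp only [Pi.add_apply, Pi.sub_apply, Pi.smul_apply, smul_eq_mul, Pi.neg_apply,
      Pi.zero_apply] at this ⊢
    rw [hc]; linear_combination (-(m + 2) * (la * lb)) * this
  · rw [h₀, h₁, h₂]
    ext1 k
    have := congrFun hJV k
    simp only [Pi.add_apply, Pi.sub_apply, Pi.smul_apply, smul_eq_mul,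
      Pi.zero_apply] at this ⊢
    linear_combination (-c * (la * lb)) * this

theorem aeval_linForm_smul (q w n : Fin 3 → ℂ) :
    aeval (fun k => C (q k) * linForm w) (linForm n) = (C (n ⬝ᵥ q) * linForm w : S) := by
  rw [show linForm n = ∑ i, C (n i) * X i from rfl, map_sum, dotProduct, map_sum, Finset.sum_mul]
  refine Finset.sum_congr rfl fun i _ => ?_
  rw [map_mul, aeval_X, C_mul, ← algebraMap_eq, AlgHom.commutes, algebraMap_eq]
  ring

/-- Besides `centerSyz` of degree 2 there are two syzygies of degree m. The derivation A × G kills g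
and ℓ_a but not ℓ_b; multiplied by d ℓ_b it is corrected by the Euler field, and likewise for B × G.
That these three generate is tested at the point q where the two lines missing `v` meet. -/
theorem TypeData.isNearlyFree (h : TypeData m n M v) (hm : 2 ≤ m) (hmd : m + 2 = d) :
    IsNearlyFree (arrEq n) := by
  have hd : 2 ≤ d := by omega
  obtain ⟨a, b, hab, hMc⟩ := Finset.card_eq_two.1 (show Mᶜ.card = 2 by
    rw [Finset.card_compl, Fintype.card_fin, h.card]; omega)
  have haM : a ∉ M := by rw [← Finset.mem_compl, hMc]; simp
  have hbM : b ∉ M := by rw [← Finset.mem_compl, hMc]; simp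
  have hoff : offEq n M = linForm (n a) * linForm (n b) := by rw [offEq, hMc, Finset.prod_pair hab]
  have hD := h.distinctLines
  set q := n a ⨯₃ n b with hq
  have hq0 : q ≠ 0 := hD a b hab
  set g := onEq n M with hg
  set G := grad g with hG
  set A := cvec (n a) with hA
  set B := cvec (n b) with hB
  set la : S := linForm (n a) with hla
  set lb : S := linForm (n b) with hlb
  set V := cvec v with hV
  set J : S := A ⬝ᵥ G ⨯₃ B with hJ
  have hav := h.dot_ne_zero hm haM
  have hbv := h.dot_ne_zero hm hbM
  set av := n a ⬝ᵥ v with hav'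
  set bv := n b ⬝ᵥ v with hbv'
  have hgrad : grad (arrEq n) = (la * lb) • G + (g * lb) • A + (g * la) • B := by
    rw [← onEq_mul_offEq n M, hoff, grad_mul, grad_mul, grad_linForm, grad_linForm, smul_add,
      smul_smul, smul_smul]
    abel
  have hVG : V ⬝ᵥ G = 0 := h.dot_grad_onEq
  have hxG : xvec ⬝ᵥ G = (m : S) * g := xvec_dot_grad h.isHomogeneous_onEq
  have hAV : A ⬝ᵥ V = C av := cvec_dot _ _
  have hBV : B ⬝ᵥ V = C bv := cvec_dot _ _
  have hAx : A ⬝ᵥ xvec = la := rfl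
  have hBx : B ⬝ᵥ xvec = lb := rfl
  have hdm : (d : S) = (m : S) + 2 := by rw [← hmd]; push_cast; ring
  set H : S := C av * lb + C bv * la with hH
  have hρ0 : centerSyz n M v = ((d : S) * (la * lb)) • V - H • xvec := by
    rw [centerSyz, hoff, grad_mul, grad_linForm, grad_linForm, dotProduct_add, dotProduct_smul,
      dotProduct_smul, dotProduct_comm, dotProduct_comm (cvec v), hAV, hBV, smul_eq_mul, smul_eq_mul]
    congr 2
    rw [hH]; ring
  have hla : Prime la := prime_linForm (hD.ne_zero hd a)
  have hlb : Prime lb := prime_linForm (hD.ne_zero hd b)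
  have hC : ∀ c : ℂ, c ≠ 0 → IsUnit (C c : S) := fun c hc => (isUnit_iff_ne_zero.2 hc).map C
  have hp1 : Prime (C bv * la) :=
    ((associated_unit_mul_left la _ (hC bv hbv)).prime_iff).2 hla
  have hmC : (m : ℂ) ≠ 0 := Nat.cast_ne_zero.2 (by omega)
  have hdC : (d : ℂ) ≠ 0 := Nat.cast_ne_zero.2 (by omega)
  set ρ₁ : Fin 3 → S := ((d : S) * lb) • (A ⨯₃ G) - J • xvec with hρ1
  set ρ₂ : Fin 3 → S := ((d : S) * la) • (B ⨯₃ G) + J • xvec with hρ2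
  obtain ⟨i12, i20, i01, irel⟩ := nearlyFree_cross_identities hdm hVG hxG hAx hBx hAV hBV rfl hρ0 hρ1
    hρ2 hgrad
  have hγ : (C ((d : ℂ) * m) : S) = (d : S) * m := by simp
  have hGq : G ⬝ᵥ cvec q = -J := by
    rw [hJ, triple_product_permutation, hq, ← cvec_cross, ← cross_anticomm, dotProduct_neg]
  have hF : ∀ {f' : Fin 3 → S}, f' = grad (arrEq n) → f' ⬝ᵥ cvec q = -(J * (la * lb)) := by
    rintro _ rfl
    rw [hgrad, add_dotProduct, add_dotProduct, smul_dotProduct, smul_dotProduct, smul_dotProduct, hGq,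
      hq, ← cvec_cross, dot_self_cross, dot_cross_self]
    simp only [smul_eq_mul]; ring
  -- Pairing with `q` and expanding (Binet–Cauchy) shows that α J vanishes where ℓ_a = ℓ_b = 0. The
  -- map `Φ` restricts to that locus, where J times a linear form equals -m g by Euler's formula.
  -- Since g does not vanish at `q`, neither does J, so α lies in the ideal (ℓ_a, ℓ_b).
  have hgen : ∀ θ ∈ AR (arrEq n), ∀ α : S, θ ⨯₃ centerSyz n M v = α • grad (arrEq n) →
      ∃ s t : S, α = s * (C bv * la) + t * -(C av * lb) := by
    intro θ hθ α hα
    obtain ⟨c₁, hc₁⟩ := hD.dvd_dot hd hθ a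
    obtain ⟨c₂, hc₂⟩ := hD.dvd_dot hd hθ b
    have e := congrArg (· ⬝ᵥ cvec q) hα
    simp only [smul_dotProduct, hF rfl] at e
    rw [hq, ← cvec_cross, cross_dot_cross, hc₁, hc₂, hρ0, sub_dotProduct, sub_dotProduct,
      smul_dotProduct, smul_dotProduct, smul_dotProduct, smul_dotProduct,
      dotProduct_comm V, dotProduct_comm V, dotProduct_comm xvec, dotProduct_comm xvec] at e
    rw [← hA, ← hB, hAV, hBV, hAx, hBx] at e
    simp only [smul_eq_mul] at e
    have e' : -(α * J) = c₁ * ((d : S) * C bv * la - H) - c₂ * ((d : S) * C av * lb - H) := by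
      refine mul_left_cancel₀ (mul_ne_zero hla.ne_zero hlb.ne_zero) ?_
      linear_combination -e
    obtain ⟨k, hk⟩ := Function.ne_iff.1 hq0
    set w : Fin 3 → ℂ := Pi.single k (q k)⁻¹ with hw
    have hwq : w ⬝ᵥ q = 1 := by
      rw [hw, single_dotProduct]; exact inv_mul_cancel₀ hk
    have hw0 : linForm w ≠ 0 := linForm_ne_zero fun h0 => by
      rw [h0, zero_dotProduct] at hwq; exact zero_ne_one hwq
    set Φ : S →ₐ[ℂ] S := aeval (fun k => C (q k) * linForm w) with hΦ
    have hΦa : Φ la = 0 := by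
      rw [hΦ, aeval_linForm_smul, hq, dot_self_cross, C_0, zero_mul]
    have hΦb : Φ lb = 0 := by
      rw [hΦ, aeval_linForm_smul, hq, dot_cross_self, C_0, zero_mul]
    have hΦH : Φ H = 0 := by rw [hH, map_add, map_mul, map_mul, hΦa, hΦb, mul_zero, mul_zero, add_zero]
    have hΦg : Φ g ≠ 0 := by
      rw [hg, onEq, map_prod]
      refine Finset.prod_ne_zero_iff.2 fun i hi => ?_
      rw [hΦ, aeval_linForm_smul]
      refine mul_ne_zero ?_ hw0
      rw [Ne, C_eq_zero]
      exact h.triple i a b (fun e => haM (e ▸ hi)) (fun e => hbM (e ▸ hi)) hab fun e => haM e.2.1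
    have hΦJ : Φ J ≠ 0 := by
      intro h0
      have h1 : linForm w * Φ J = -((m : S) * Φ g) := by
        rw [← map_natCast Φ m, ← map_mul, ← hxG, ← neg_eq_iff_eq_neg.2 hGq, map_neg, mul_neg,
          dot_three, dot_three, map_add, map_add, map_add, map_add, map_mul, map_mul, map_mul,
          map_mul, map_mul, map_mul]
        simp only [xvec, cvec, hΦ, aeval_X, ← algebraMap_eq, AlgHom.commutes]
        ring
      rw [h0, mul_zero, eq_comm, neg_eq_zero] at h1
      exact mul_ne_zero (Nat.cast_ne_zero.2 (by omega)) hΦg h1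
    have hΦα : Φ α = 0 := by
      have := congrArg Φ e'
      rw [map_neg, map_mul, map_sub, map_mul, map_mul, map_sub, map_sub, map_mul, map_mul Φ _ lb,
        hΦa, hΦb, hΦH] at this
      refine (mul_eq_zero.1 ?_).resolve_right hΦJ
      linear_combination -this
    obtain ⟨s, t, hst⟩ := exists_eq_of_aeval_eq_zero hwq hΦα
    refine ⟨s * C bv⁻¹, -(t * C av⁻¹), ?_⟩
    have e1 : (C bv⁻¹ * C bv : S) = 1 := by rw [← C_mul, inv_mul_cancel₀ hbv, C_1]
    have e2 : (C av⁻¹ * C av : S) = 1 := by rw [← C_mul, inv_mul_cancel₀ hav, C_1]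
    rw [← hst]
    linear_combination (-s * la) * e1 - (t * lb) * e2
  have hρ1AR : ρ₁ ∈ AR (arrEq n) := by
    rw [mem_AR, hρ1, sub_dotProduct, smul_dotProduct, smul_dotProduct,
      xvec_dot_grad (isHomogeneous_arrEq n), hgrad, dotProduct_add, dotProduct_add,
      dotProduct_smul, dotProduct_smul, dotProduct_smul, dotProduct_comm _ G, dot_cross_self,
      dotProduct_comm _ A, dot_self_cross, dotProduct_comm _ B, triple_product_permutation, ← hJ,
      ← onEq_mul_offEq n M, hoff]
    simp only [smul_eq_mul]; ring
  have hρ2AR : ρ₂ ∈ AR (arrEq n) := by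
    have e : A ⬝ᵥ B ⨯₃ G = -J := by rw [hJ, ← cross_anticomm, dotProduct_neg]
    rw [mem_AR, hρ2, add_dotProduct, smul_dotProduct, smul_dotProduct,
      xvec_dot_grad (isHomogeneous_arrEq n), hgrad, dotProduct_add, dotProduct_add,
      dotProduct_smul, dotProduct_smul, dotProduct_smul, dotProduct_comm _ G, dot_cross_self,
      dotProduct_comm _ A, e, dotProduct_comm _ B, dot_self_cross,
      ← onEq_mul_offEq n M, hoff]
    simp only [smul_eq_mul]; ring
  have hdvd : ¬ C bv * la ∣ -(C av * lb) := by
    rw [dvd_neg]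
    intro h0
    have h1 : la ∣ linForm (av • n b) := by
      rw [linForm_smul]; exact (dvd_mul_left _ _).trans h0
    obtain ⟨c, hc⟩ := linForm_dvd_linForm h1
    have h2 := congrArg (fun u => n a ⨯₃ u) hc
    simp only [map_smul, cross_self, smul_zero] at h2
    exact smul_ne_zero hav hq0 h2
  have hGh : ∀ k, (G k).IsHomogeneous (m - 1) := isHomogeneous_grad h.isHomogeneous_onEq
  have hJh : J.IsHomogeneous (m - 1) := by
    have := isHomogeneous_dot (isHomogeneous_cvec (n a))
      (isHomogeneous_cross hGh (isHomogeneous_cvec (n b)))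
    rwa [zero_add, add_zero] at this
  have hlah : la.IsHomogeneous 1 := isHomogeneous_linForm _
  have hlbh : lb.IsHomogeneous 1 := isHomogeneous_linForm _
  have hdh : (d : S).IsHomogeneous 0 := by simpa using isHomogeneous_C (Fin 3) (d : ℂ)
  have hm1 : m - 1 + 1 = m := by omega
  obtain ⟨x1, x2, x3⟩ := exact_of_cross_eq (hD.isPrimitiveVec_grad hd)
    (ρ := ![centerSyz n M v, ρ₁, ρ₂]) (h := ![-J, C bv * la, -(C av * lb)])
    (forall_fin_three.2 ⟨h.centerSyz_mem, hρ1AR, hρ2AR⟩) (mul_ne_zero hdC hmC)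
    (by rw [hγ]; exact i12) (by rw [hγ]; exact i20) (by rw [hγ]; exact i01) irel hp1
    (neg_ne_zero.2 (mul_ne_zero (hC av hav).ne_zero hlb.ne_zero)) hdvd hgen
  -- The degrees are d₁ = 2 and d₂ = m = d - 2. The relation coefficient `-J` has degree m - 1 = d₂
  -- - d₁ + 1.
  refine ⟨2, m, by norm_num, hm, _, _, ?_, ?_, ?_, ?_, ?_, ?_, x1, x2, x3⟩
  · intro i
    have := h.isHomogeneous_centerSyz i
    rwa [show d - m = 2 by omega] at this
  · intro i
    refine IsHomogeneous.sub ?_ ?_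
    · have := (hdh.mul hlbh).mul (isHomogeneous_cross (isHomogeneous_cvec (n a)) hGh i)
      rwa [zero_add, zero_add, Nat.add_comm, hm1] at this
    · have := hJh.mul (isHomogeneous_xvec i)
      rwa [hm1] at this
  · intro i
    refine IsHomogeneous.add ?_ ?_
    · have := (hdh.mul hlah).mul (isHomogeneous_cross (isHomogeneous_cvec (n b)) hGh i)
      rwa [zero_add, zero_add, Nat.add_comm, hm1] at this
    · have := hJh.mul (isHomogeneous_xvec i)
      rwa [hm1] at this
  · have := hJh.neg
    rwa [show m - 1 = m - 2 + 1 by omega] at this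
  · simpa using (isHomogeneous_C (Fin 3) bv).mul hlah
  · simpa using ((isHomogeneous_C (Fin 3) av).mul hlbh).neg

end NearlyFree

end LineArr

end

noncomputable section

namespace LineArr

open MvPolynomial
open scoped LinearAlgebra.Projectivization Matrix

/-! ### Arrangements that are neither free nor nearly free -/

section NotFree

variable {d m : ℕ} {n : Fin d → Fin 3 → ℂ} {M : Finset (Fin d)} {v : Fin 3 → ℂ}

theorem koszul_mem_AR (f : S) (w : Fin 3 → S) : w ⨯₃ grad f ∈ AR f := by
  rw [mem_AR, dotProduct_comm, dot_cross_self]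

theorem cross_cross_cross_right {R : Type} [CommRing R] (A B G : Fin 3 → R) :
    (A ⨯₃ G) ⨯₃ (B ⨯₃ G) = (G ⬝ᵥ A ⨯₃ B) • G := by
  apply vec_three_ext <;>
  · simp only [dot_three, cross_zero_apply, cross_one_apply, cross_two_apply, Pi.smul_apply,
      smul_eq_mul]
    ring

theorem single_cross_single (k : Fin 3) :
    (Pi.single (k + 1) 1 : Fin 3 → ℂ) ⨯₃ Pi.single (k + 2) 1 = Pi.single k 1 := by
  revert k
  rw [forall_fin_three]
  refine ⟨?_, ?_, ?_⟩ <;>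
  · apply vec_three_ext <;>
    simp [cross_zero_apply, cross_one_apply, cross_two_apply]

/-- An element dividing the coefficients of all products of syzygies is a unit. -/
theorem isUnit_of_dvd_cross {f : S} (hf : IsPrimitiveVec (grad f)) {β : S}
    (h : ∀ θ ∈ AR f, ∀ θ' ∈ AR f, ∃ c : S, θ ⨯₃ θ' = (β * c) • grad f) : IsUnit β := by
  have key : ∀ k, β ∣ grad f k := by
    intro k
    -- With indices modulo 3, the Koszul syzygies e_{k+1} × ∇f and e_{k+2} × ∇f have cross product
    -- (∂_k f) ∇f. So `β` divides every partial, and the partials have no common prime factor.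
    obtain ⟨c, hc⟩ := h _ (koszul_mem_AR f (cvec (Pi.single (k + 1) 1))) _
      (koszul_mem_AR f (cvec (Pi.single (k + 2) 1)))
    obtain ⟨j, hj⟩ := Function.ne_iff.1 hf.ne_zero
    refine ⟨c, mul_right_cancel₀ hj ?_⟩
    have h1 := congrFun hc j
    rw [Pi.smul_apply, smul_eq_mul] at h1
    rw [← h1, cross_cross_cross_right, cvec_cross, single_cross_single, Pi.smul_apply, smul_eq_mul]
    simp [dotProduct, cvec, Pi.single_apply]
  by_contra hu
  rcases eq_or_ne β 0 with rfl | h0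
  · exact hf.ne_zero (funext fun k => zero_dvd_iff.1 (key k))
  · obtain ⟨π, hπ, hπβ⟩ := WfDvdMonoid.exists_irreducible_factor hu h0
    obtain ⟨k, hk⟩ := hf π hπ.prime
    exact hk (hπβ.trans (key k))

/-- A factor of degree `e ≥ r` leaves room only for the constant term of `κ` in degree `r`. This
makes a syzygy of minimal degree a constant combination of homogeneous generators. -/
theorem homogeneousComponent_mul_of_le {b κ : S} {e r : ℕ} (hb : b.IsHomogeneous e) (hr : r ≤ e) :
    homogeneousComponent r (κ * b) = C (coeff 0 κ) * homogeneousComponent r b := by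
  classical
  ext μ
  rw [coeff_C_mul, coeff_homogeneousComponent, coeff_homogeneousComponent]
  split_ifs with hμ
  · rw [coeff_mul]
    refine Finset.sum_eq_single (0, μ) (fun x hx hne => ?_) fun h0 => absurd (by simp) h0
    rw [Finset.HasAntidiagonal.mem_antidiagonal] at hx
    refine mul_eq_zero_of_right _ (hb.coeff_eq_zero fun hx2 => hne ?_)
    have h1 : x.1.degree + x.2.degree = r := by rw [← map_add, hx, hμ]
    have h2 : x.1 = 0 := (Finsupp.degree_eq_zero_iff _).1 (by omega)
    rw [h2, zero_add] at hx
    exact Prod.ext h2 hx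
  · rw [mul_zero]

/-- The coefficients of the special syzygy along the lines vanish at the double points off the
special point. -/
theorem TypeData.eval_eq_zero_of_cross_centerSyz (h : TypeData m n M v) (hm : 2 ≤ m) {θ : Fin 3 → S}
    (hθ : θ ∈ AR (arrEq n)) {α : S} (hα : θ ⨯₃ centerSyz n M v = α • grad (arrEq n)) {i j : Fin d}
    (hij : i ≠ j) (hi : i ∉ M) (hj : j ∉ M) : eval (n i ⨯₃ n j) α = 0 := by
  classical
  have hD := h.distinctLines
  have hd : 2 ≤ d := hm.trans h.le
  set q := n i ⨯₃ n j with hq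
  set f' : S := ∏ k ∈ (Finset.univ.erase i).erase j, linForm (n k) with hf'
  set p' : S := ∏ k ∈ (Mᶜ.erase i).erase j, linForm (n k) with hp'
  have hsp : arrEq n = linForm (n i) * linForm (n j) * f' := by
    rw [arrEq, ← Finset.mul_prod_erase _ _ (Finset.mem_univ i), mul_assoc, hf',
      Finset.mul_prod_erase _ (fun k => linForm (n k))
        (Finset.mem_erase.2 ⟨hij.symm, Finset.mem_univ j⟩)]
  have hop : offEq n M = linForm (n i) * linForm (n j) * p' := by
    rw [offEq, ← Finset.mul_prod_erase _ _ (Finset.mem_compl.2 hi), mul_assoc, hp',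
      Finset.mul_prod_erase _ (fun k => linForm (n k))
        (Finset.mem_erase.2 ⟨hij.symm, Finset.mem_compl.2 hj⟩)]
  set la := linForm (n i) with hla
  set lb := linForm (n j) with hlb
  have hla0 : la ≠ 0 := linForm_ne_zero (hD.ne_zero hd i)
  have hlb0 : lb ≠ 0 := linForm_ne_zero (hD.ne_zero hd j)
  have hqa : eval q la = 0 := by rw [eval_linForm, dot_self_cross]
  have hqb : eval q lb = 0 := by rw [eval_linForm, dot_cross_self]
  obtain ⟨c₁, hc₁⟩ := hD.dvd_dot hd hθ i
  obtain ⟨c₂, hc₂⟩ := hD.dvd_dot hd hθ j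
  set D : S := cvec v ⬝ᵥ grad (offEq n M) with hDef
  have hD0 : eval q D = 0 := by
    rw [hDef, hop, grad_mul, grad_mul, dotProduct_add, dotProduct_smul, dotProduct_smul,
      dotProduct_add, dotProduct_smul, dotProduct_smul]
    simp only [smul_eq_mul, map_add, map_mul, hqa, hqb]
    ring
  have hgrad : grad (arrEq n) ⬝ᵥ cvec q = la * lb * (grad f' ⬝ᵥ cvec q) := by
    rw [hsp, grad_mul, grad_mul, grad_linForm, grad_linForm, hq, ← cvec_cross, add_dotProduct,
      smul_dotProduct, smul_dotProduct, add_dotProduct, smul_dotProduct, smul_dotProduct,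
      dot_self_cross, dot_cross_self]
    simp only [smul_eq_mul]; ring
  have hσ : ∀ u : Fin 3 → ℂ, centerSyz n M v ⬝ᵥ cvec u =
      (d : S) * offEq n M * C (u ⬝ᵥ v) - D * linForm u := by
    intro u
    rw [centerSyz, sub_dotProduct, smul_dotProduct, smul_dotProduct, dotProduct_comm, cvec_dot,
      dotProduct_comm xvec, linForm_eq_dot, smul_eq_mul, smul_eq_mul]
  have e := congrArg (· ⬝ᵥ cvec q) hα
  simp only [smul_dotProduct, hgrad] at e
  rw [hq, ← cvec_cross, cross_dot_cross, hc₁, hc₂, hσ, hσ, hop, smul_eq_mul] at e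
  -- The pairing of the cross product with `q`, divided by ℓ_i ℓ_j. The right side vanishes at `q`,
  -- where `D` vanishes as well, whereas by Euler's formula the factor of `α` takes there the value
  -- (d - 2) f'(q) ≠ 0.
  have e' : α * (grad f' ⬝ᵥ cvec q) = c₁ * ((d : S) * la * p' * C (n j ⬝ᵥ v) - D) -
      c₂ * ((d : S) * lb * p' * C (n i ⬝ᵥ v) - D) := by
    refine mul_left_cancel₀ (mul_ne_zero hla0 hlb0) ?_
    rw [hq, ← cvec_cross]
    linear_combination -e
  have e2 := congrArg (eval q) e'
  simp only [map_mul, map_sub, hqa, hqb, hD0, mul_zero, zero_mul, sub_zero] at e2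
  refine (mul_eq_zero.1 e2).resolve_right ?_
  have hf'h : f'.IsHomogeneous (d - 2) := by
    have := isHomogeneous_prod_linForm ((Finset.univ.erase i).erase j) n
    rwa [Finset.card_erase_of_mem (by simp [hij.symm]), Finset.card_erase_of_mem (Finset.mem_univ i),
      Finset.card_univ, Fintype.card_fin, Nat.sub_sub] at this
  have h3 : eval q (grad f' ⬝ᵥ cvec q) = ((d - 2 : ℕ) : ℂ) * eval q f' := by
    rw [← map_natCast (eval q), ← map_mul, ← xvec_dot_grad hf'h, map_dot, map_dot, dotProduct_comm]
    congr 1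
    ext k; simp [cvec, xvec]
  rw [h3]
  refine mul_ne_zero (Nat.cast_ne_zero.2 ?_) ?_
  · have := Finset.card_le_card (show {i, j} ⊆ Mᶜ by
      intro k; simp only [Finset.mem_insert, Finset.mem_singleton, Finset.mem_compl]
      rintro (rfl | rfl) <;> assumption)
    rw [Finset.card_pair hij, Finset.card_compl, Fintype.card_fin, h.card] at this
    omega
  · rw [hf', map_prod]
    refine Finset.prod_ne_zero_iff.2 fun k hk => ?_
    simp only [Finset.mem_erase, Finset.mem_univ, and_true] at hk
    rw [eval_linForm]
    exact h.triple k i j hk.2 hk.1 hij fun e => hi e.2.1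

/-- For a basis with θ 0 × θ 1 = β ∇f, `β` is a unit by `isUnit_of_dvd_cross`. Having minimal
degree, `centerSyz` is a constant combination of the basis, so its cross products with the basis
have as coefficients constants times β. They vanish at the intersection of two lines missing `v`, so
the constants are zero. -/
theorem TypeData.not_isFree (h : TypeData m n M v) (hm : 2 ≤ m) (hmd : m + 2 ≤ d) :
    ¬ IsFree (arrEq n) := by
  have hD := h.distinctLines
  have hd : 2 ≤ d := by omega
  have hf := hD.isPrimitiveVec_grad hd
  rintro ⟨e, b, hb⟩
  set θ : Fin 2 → Fin 3 → S := fun j => b j with hθ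
  have hθAR : ∀ j, θ j ∈ AR (arrEq n) := fun j => (b j).2
  have hθ0 : ∀ j, θ j ≠ 0 := fun j h0 => b.ne_zero j (Subtype.ext h0)
  have hrep : ∀ η ∈ AR (arrEq n), ∃ κ : Fin 2 → S, η = κ 0 • θ 0 + κ 1 • θ 1 := by
    intro η hη
    refine ⟨b.repr ⟨η, hη⟩, ?_⟩
    have := congrArg Subtype.val (b.sum_repr ⟨η, hη⟩)
    rw [Fin.sum_univ_two] at this
    exact this.symm
  obtain ⟨β, hβ⟩ := exists_cross_eq_smul_grad hf (hθAR 0) (hθAR 1)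
  have hβ' : θ 1 ⨯₃ θ 0 = -(β • grad (arrEq n)) := by rw [← hβ, cross_anticomm]
  have hβU : IsUnit β := by
    refine isUnit_of_dvd_cross hf fun η hη η' hη' => ?_
    obtain ⟨κ, rfl⟩ := hrep η hη
    obtain ⟨κ', rfl⟩ := hrep η' hη'
    refine ⟨κ 0 * κ' 1 - κ 1 * κ' 0, ?_⟩
    simp only [map_add, map_smul, LinearMap.add_apply, LinearMap.smul_apply, cross_self, hβ, hβ']
    ext1 k
    simp only [Pi.add_apply, Pi.smul_apply, smul_eq_mul, Pi.neg_apply, Pi.zero_apply]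
    ring
  obtain ⟨κ, hκ⟩ := hrep _ h.centerSyz_mem
  set r := d - m with hr
  have her : ∀ j, r ≤ e j := fun j => h.sub_le_degree hm (hθAR j) (hθ0 j) (hb j)
  set c : Fin 2 → ℂ := fun j => if e j = r then coeff 0 (κ j) else 0 with hc
  have hσ : centerSyz n M v = (C (c 0) : S) • θ 0 + (C (c 1) : S) • θ 1 := by
    ext1 k
    have h1 := congrArg (homogeneousComponent r) (congrFun hκ k)
    rw [homogeneousComponent_of_mem (h.isHomogeneous_centerSyz k), if_pos rfl] at h1
    simp only [Pi.add_apply, Pi.smul_apply, smul_eq_mul, map_add] at h1 ⊢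
    rw [h1, homogeneousComponent_mul_of_le (hb 0 k) (her 0),
      homogeneousComponent_mul_of_le (hb 1 k) (her 1),
      homogeneousComponent_of_mem (hb 0 k), homogeneousComponent_of_mem (hb 1 k)]
    congr 1
    · by_cases he : e 0 = r
      · simp [hc, he, hθ]
      · simp [hc, he, Ne.symm he]
    · by_cases he : e 1 = r
      · simp [hc, he, hθ]
      · simp [hc, he, Ne.symm he]
  obtain ⟨i, j, hi, hj, hij⟩ : ∃ i j, i ∉ M ∧ j ∉ M ∧ i ≠ j := by
    obtain ⟨i, hi, j, hj, hij⟩ := Finset.one_lt_card.1 (show 1 < Mᶜ.card by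
      rw [Finset.card_compl, Fintype.card_fin, h.card]; omega)
    exact ⟨i, j, by simpa using hi, by simpa using hj, hij⟩
  have hβq : eval (n i ⨯₃ n j) β ≠ 0 := (hβU.map (eval (n i ⨯₃ n j))).ne_zero
  have c0 : c 0 = 0 := by
    have h1 : θ 1 ⨯₃ centerSyz n M v = (-(C (c 0) * β)) • grad (arrEq n) := by
      rw [hσ]
      simp only [map_add, map_smul, cross_self, hβ', smul_zero, add_zero, smul_neg, neg_smul,
        mul_smul]
    have := h.eval_eq_zero_of_cross_centerSyz hm (hθAR 1) h1 hij hi hj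
    simpa [hβq] using this
  have c1 : c 1 = 0 := by
    have h1 : θ 0 ⨯₃ centerSyz n M v = (C (c 1) * β) • grad (arrEq n) := by
      rw [hσ]
      simp only [map_add, map_smul, cross_self, hβ, smul_zero, zero_add, mul_smul]
    have := h.eval_eq_zero_of_cross_centerSyz hm (hθAR 0) h1 hij hi hj
    simpa [hβq] using this
  exact h.centerSyz_ne_zero hm (by rw [hσ, c0, c1]; simp)

/-- The cross products of the three generators are γ g_j ∇f with `γ` a unit. If `centerSyz` is Σ c_j
ρ_j with constant c_j, the coefficients of its cross products with the ρ_l are, up to units, the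
entries of g × c, which are linear forms. They vanish at the vertices of a triangle of lines missing
`v`, so g × c = 0 and c is a multiple of the primitive vector g. As g vanishes at the origin, c = 0.
-/
theorem TypeData.not_isNearlyFree (h : TypeData m n M v) (hm : 2 ≤ m) (hmd : m + 3 ≤ d) :
    ¬ IsNearlyFree (arrEq n) := by
  have hD := h.distinctLines
  have hd : 2 ≤ d := by omega
  have hf := hD.isPrimitiveVec_grad hd
  rintro ⟨d₁, d₂, hd₁, hd₁₂, ρ, g, hρ0, hρ1, hρ2, hg0, hg1, hg2, hinj, hex, hex'⟩
  set e : Fin 3 → ℕ := ![d₁, d₂, d₂] with he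
  have hρ : ∀ j i, (ρ j i).IsHomogeneous (e j) := forall_fin_three.2 ⟨hρ0, hρ1, hρ2⟩
  have hgz : ∀ j, eval 0 (g j) = 0 := by
    have key : ∀ {p : S} {k : ℕ}, p.IsHomogeneous k → k ≠ 0 → eval 0 p = 0 := by
      intro p k hp hk
      rw [← zero_smul ℂ (0 : Fin 3 → ℂ), eval_smul_of_isHomogeneous hp, zero_pow hk, zero_mul]
    exact forall_fin_three.2 ⟨key hg0 (by omega), key hg1 one_ne_zero, key hg2 one_ne_zero⟩
  have hρAR : ∀ j, ρ j ∈ AR (arrEq n) := fun j =>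
    (hex' (ρ j)).2 ⟨Pi.single j 1, by simp⟩
  have hrel : ∀ κ : Fin 3 → S, κ 0 • ρ 0 + κ 1 • ρ 1 + κ 2 • ρ 2 = 0 ↔ ∃ s : S, κ = s • g := by
    intro κ
    rw [← linearCombination_three]
    refine (hex κ).trans ⟨?_, ?_⟩
    · rintro ⟨s, rfl⟩; exact ⟨s, rfl⟩
    · rintro ⟨s, rfl⟩; exact ⟨s, rfl⟩
  have hrep : ∀ η ∈ AR (arrEq n), ∃ κ : Fin 3 → S, η = κ 0 • ρ 0 + κ 1 • ρ 1 + κ 2 • ρ 2 := by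
    intro η hη
    obtain ⟨κ, hκ⟩ := (hex' η).1 hη
    exact ⟨κ, by rw [← linearCombination_three, hκ]⟩
  have hg : g 0 • ρ 0 + g 1 • ρ 1 + g 2 • ρ 2 = 0 := (hrel g).2 ⟨1, (one_smul _ _).symm⟩
  have hconst : ∀ {c : Fin 3 → ℂ} {s : S}, cvec c = s • g → c = 0 := by
    intro c s hs
    ext k
    have := congrArg (eval 0) (congrFun hs k)
    rwa [Pi.smul_apply, smul_eq_mul, map_mul, hgz, mul_zero, cvec, eval_C] at this
  have hρne : ∀ j, ρ j ≠ 0 := by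
    intro j h0
    obtain ⟨s, hs⟩ := (hrel (cvec (Pi.single j 1))).1 (by
      revert h0; revert j
      rw [forall_fin_three]
      refine ⟨?_, ?_, ?_⟩ <;> intro h0 <;> simp [cvec, h0])
    have := congrFun (hconst hs) j
    simp at this
  have hgp : IsPrimitiveVec g := by
    intro π hπ
    by_contra! H
    choose g' hg' using H
    have h1 : g' 0 • ρ 0 + g' 1 • ρ 1 + g' 2 • ρ 2 = 0 := by
      refine (smul_eq_zero.1 (?_ : π • (g' 0 • ρ 0 + g' 1 • ρ 1 + g' 2 • ρ 2) = 0)).resolve_left hπ.ne_zero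
      rw [← hg, hg', hg', hg', smul_add, smul_add, smul_smul, smul_smul, smul_smul]
    obtain ⟨s, hs⟩ := (hrel g').1 h1
    obtain ⟨k, hk⟩ : ∃ k, g k ≠ 0 := by
      by_contra! H
      exact one_ne_zero (hinj (a₁ := (1 : S)) (a₂ := 0)
        (by rw [show g = 0 from funext H]; simp))
    have := congrFun hs k
    rw [Pi.smul_apply, smul_eq_mul] at this
    refine hπ.not_isUnit (IsUnit.of_mul_eq_one s (mul_right_cancel₀ hk ?_))
    rw [one_mul, mul_assoc, ← this, ← hg']
  obtain ⟨A0, hA0⟩ := exists_cross_eq_smul_grad hf (hρAR 1) (hρAR 2)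
  obtain ⟨A1, hA1⟩ := exists_cross_eq_smul_grad hf (hρAR 2) (hρAR 0)
  obtain ⟨A2, hA2⟩ := exists_cross_eq_smul_grad hf (hρAR 0) (hρAR 1)
  have hA0' : ρ 2 ⨯₃ ρ 1 = -(A0 • grad (arrEq n)) := by rw [← hA0, cross_anticomm]
  have hA1' : ρ 0 ⨯₃ ρ 2 = -(A1 • grad (arrEq n)) := by rw [← hA1, cross_anticomm]
  have hA2' : ρ 1 ⨯₃ ρ 0 = -(A2 • grad (arrEq n)) := by rw [← hA2, cross_anticomm]
  obtain ⟨l, hl⟩ := Function.ne_iff.1 hf.ne_zero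
  rw [Pi.zero_apply] at hl
  obtain ⟨γ, hγ⟩ : ∃ γ : S, ![A0, A1, A2] = γ • g := by
    refine hgp.exists_smul hgp.ne_zero ?_
    have e0 := congrArg (fun w => (w ⨯₃ ρ 0) l) hg
    have e1 := congrArg (fun w => (w ⨯₃ ρ 1) l) hg
    have e2 := congrArg (fun w => (w ⨯₃ ρ 2) l) hg
    simp only [map_add, map_smul, LinearMap.add_apply, LinearMap.smul_apply, cross_self,
      hA0, hA1, hA2, hA0', hA1', hA2', map_zero, LinearMap.zero_apply, Pi.add_apply, Pi.smul_apply,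
      Pi.neg_apply, smul_eq_mul, Pi.zero_apply] at e0 e1 e2
    apply vec_three_ext
    · rw [cross_zero_apply]
      refine mul_left_cancel₀ hl ?_
      simp only [Pi.zero_apply, Matrix.cons_val_one, Matrix.cons_val, Matrix.cons_val_zero]
      linear_combination e0
    · rw [cross_one_apply]
      refine mul_left_cancel₀ hl ?_
      simp only [Pi.zero_apply, Matrix.cons_val, Matrix.cons_val_zero]
      linear_combination e1
    · rw [cross_two_apply]
      refine mul_left_cancel₀ hl ?_
      simp only [Pi.zero_apply, Matrix.cons_val_one, Matrix.cons_val_zero]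
      linear_combination e2
  have hγ0 : A0 = γ * g 0 := congrFun hγ 0
  have hγ1 : A1 = γ * g 1 := congrFun hγ 1
  have hγ2 : A2 = γ * g 2 := congrFun hγ 2
  have hcr : ∀ κ κ' : Fin 3 → S, (κ 0 • ρ 0 + κ 1 • ρ 1 + κ 2 • ρ 2) ⨯₃
      (κ' 0 • ρ 0 + κ' 1 • ρ 1 + κ' 2 • ρ 2) = (γ * (κ ⨯₃ κ' ⬝ᵥ g)) • grad (arrEq n) := by
    intro κ κ'
    simp only [map_add, map_smul, LinearMap.add_apply, LinearMap.smul_apply, cross_self,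
      hA0, hA1, hA2, hA0', hA1', hA2']
    ext1 k
    simp only [Pi.add_apply, Pi.smul_apply, smul_eq_mul, Pi.neg_apply, Pi.zero_apply, dot_three,
      cross_zero_apply, cross_one_apply, cross_two_apply, hγ0, hγ1, hγ2]
    ring
  have hγU : IsUnit γ := by
    refine isUnit_of_dvd_cross hf fun η hη η' hη' => ?_
    obtain ⟨κ, rfl⟩ := hrep η hη
    obtain ⟨κ', rfl⟩ := hrep η' hη'
    exact ⟨_, hcr κ κ'⟩
  obtain ⟨κ, hκ⟩ := hrep _ h.centerSyz_mem
  set r := d - m with hr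
  have her : ∀ j, r ≤ e j := fun j => h.sub_le_degree hm (hρAR j) (hρne j) (hρ j)
  set c : Fin 3 → ℂ := fun j => if e j = r then coeff 0 (κ j) else 0 with hc
  have hσ : centerSyz n M v = cvec c 0 • ρ 0 + cvec c 1 • ρ 1 + cvec c 2 • ρ 2 := by
    ext1 k
    have h1 := congrArg (homogeneousComponent r) (congrFun hκ k)
    rw [homogeneousComponent_of_mem (h.isHomogeneous_centerSyz k), if_pos rfl] at h1
    simp only [Pi.add_apply, Pi.smul_apply, smul_eq_mul, map_add] at h1 ⊢
    have key : ∀ j, homogeneousComponent r (κ j * ρ j k) = cvec c j * ρ j k := by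
      intro j
      rw [homogeneousComponent_mul_of_le (hρ j k) (her j), homogeneousComponent_of_mem (hρ j k)]
      by_cases hej : e j = r
      · simp [cvec, hc, hej]
      · simp [cvec, hc, hej, Ne.symm hej]
    rw [h1, key, key, key]
  -- If d₁ < d₂, then r ≤ d₁ leaves only ρ 0 in the combination, and the entry `g 0` of higher
  -- degree does not enter g × c.
  have hlin : ∀ k, ((g ⨯₃ cvec c) k).IsHomogeneous 1 := by
    by_cases h12 : d₁ = d₂
    · have hg' : ∀ j, (g j).IsHomogeneous 1 := forall_fin_three.2
        ⟨by rwa [h12, Nat.sub_self, zero_add] at hg0, hg1, hg2⟩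
      exact isHomogeneous_cross hg' (isHomogeneous_cvec c)
    · have hr1 : r ≤ d₁ := her 0
      have hc1 : c 1 = 0 := by
        have : e 1 ≠ r := by show d₂ ≠ r; omega
        simp [hc, this]
      have hc2 : c 2 = 0 := by
        have : e 2 ≠ r := by show d₂ ≠ r; omega
        simp [hc, this]
      rw [forall_fin_three, cross_zero_apply, cross_one_apply, cross_two_apply]
      simp only [cvec, hc1, hc2, C_0, mul_zero, sub_zero, zero_sub]
      have hC : ∀ {p : S}, p.IsHomogeneous 1 → (p * C (c 0)).IsHomogeneous 1 := by
        intro p hp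
        exact hp.mul (isHomogeneous_C _ (c 0))
      exact ⟨isHomogeneous_zero _ _ _, hC hg2, (hC hg1).neg⟩
  obtain ⟨i, hi, j, hj, k, hk, hij, hik, hjk⟩ := Finset.two_lt_card.1 (show 2 < Mᶜ.card by
      rw [Finset.card_compl, Fintype.card_fin, h.card]; omega)
  have hvan : ∀ {i j : Fin d}, i ≠ j → i ∉ M → j ∉ M → ∀ l,
      eval (n i ⨯₃ n j) ((g ⨯₃ cvec c) l) = 0 := by
    intro i j hij hi hj l
    have h1 := hcr (cvec (Pi.single l 1)) (cvec c)
    rw [← hσ] at h1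
    have h2 := h.eval_eq_zero_of_cross_centerSyz hm ((AR (arrEq n)).add_mem ((AR (arrEq n)).add_mem
      ((AR (arrEq n)).smul_mem _ (hρAR 0)) ((AR (arrEq n)).smul_mem _ (hρAR 1)))
        ((AR (arrEq n)).smul_mem _ (hρAR 2))) h1 hij hi hj
    rw [map_mul] at h2
    have h3 := (mul_eq_zero.1 h2).resolve_left (hγU.map (eval (n i ⨯₃ n j))).ne_zero
    have h4 : cvec (Pi.single l 1) ⨯₃ cvec c ⬝ᵥ g = -(g ⨯₃ cvec c) l := by
      rw [dotProduct_comm, triple_product_permutation, ← cross_anticomm, dotProduct_neg]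
      simp [dotProduct, cvec, Pi.single_apply]
    rwa [h4, map_neg, neg_eq_zero] at h3
  have hzero : g ⨯₃ cvec c = 0 := by
    ext1 l
    obtain ⟨w, hw⟩ := linEquiv.surjective ⟨(g ⨯₃ cvec c) l, (mem_homogeneousSubmodule _ _).2 (hlin l)⟩
    have hw' : linForm w = (g ⨯₃ cvec c) l := by rw [← coe_linEquiv, hw]
    rw [Finset.mem_compl] at hi hj hk
    have h1 := hvan hij hi hj l
    have h2 := hvan hik hi hk l
    have h3 := hvan hjk hj hk l
    rw [← hw', eval_linForm] at h1 h2 h3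
    have hdet := h.triple i j k hij hik hjk fun e => hi e.1
    -- A linear form is determined by its values at the three vertices of the triangle.
    have key : (n i ⬝ᵥ n j ⨯₃ n k) • w = (w ⬝ᵥ n j ⨯₃ n k) • n i - (w ⬝ᵥ n i ⨯₃ n k) • n j +
        (w ⬝ᵥ n i ⨯₃ n j) • n k := by
      apply vec_three_ext <;>
      · simp only [dot_three, cross_zero_apply, cross_one_apply, cross_two_apply, Pi.add_apply,
          Pi.sub_apply, Pi.smul_apply, smul_eq_mul]
        ring
    rw [h1, h2, h3, zero_smul, zero_smul, zero_smul, sub_zero, add_zero] at key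
    rw [← hw', (smul_eq_zero.1 key).resolve_left hdet, linForm_zero, Pi.zero_apply]
  obtain ⟨s, hs⟩ := hgp.exists_smul hgp.ne_zero
    (show cvec c ⨯₃ g = 0 by rw [← cross_anticomm, hzero, neg_zero])
  refine h.centerSyz_ne_zero hm ?_
  rw [hσ, hconst hs]
  simp [cvec]

end NotFree

end LineArr

end

noncomputable section

namespace LineArr

open MvPolynomial
open scoped LinearAlgebra.Projectivization Matrix

/-! ### Arrangements with syzygies of small degree -/

section SmallDegree

variable {d : ℕ} {l : Fin d → ℙ ℂ (Sd 1)}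

theorem arrEq_smul (c : Fin d → ℂ) (n : Fin d → Fin 3 → ℂ) :
    (arrEq fun i => c i • n i) = C (∏ i, c i) * arrEq n := by
  simp only [arrEq, linForm_smul, Finset.prod_mul_distrib, map_prod]

/-- A scalar factor is absorbed by one covector, so the chosen representative of a point of ℙ(S_d)
is again a product `arrEq`. -/
theorem exists_arrEq_smul_eq (hd : 0 < d) (n : Fin d → Fin 3 → ℂ) {c : ℂ} (hc : c ≠ 0) :
    ∃ t : Fin d → ℂ, (∀ i, t i ≠ 0) ∧ (arrEq fun i => t i • n i) = C c * arrEq n := by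
  classical
  refine ⟨Function.update 1 ⟨0, hd⟩ c, fun i => ?_, ?_⟩
  · rcases eq_or_ne i ⟨0, hd⟩ with rfl | hi
    · rwa [Function.update_self]
    · rw [Function.update_of_ne hi]; exact one_ne_zero
  · rw [arrEq_smul, Finset.prod_update_of_mem (Finset.mem_univ _)]
    simp

theorem exists_arrEq_eq_rep (hd : 0 < d) (l : Fin d → ℙ ℂ (Sd 1)) :
    ∃ c : Fin d → ℂ, (∀ i, c i ≠ 0) ∧ ((psi l).rep : S) = arrEq fun i => c i • covec (l i) := by
  obtain ⟨c, hc, h⟩ := psi_rep l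
  obtain ⟨t, ht, e⟩ := exists_arrEq_smul_eq hd (fun i => covec (l i)) hc
  exact ⟨t, ht, by rw [h, e]; rfl⟩

theorem distinctLines_covec (hl : l ∈ Xd d) : DistinctLines fun i => covec (l i) :=
  fun _ _ hij h => hij (hl (cross_covec_eq_zero.1 h))

theorem DistinctLines.smul {n : Fin d → Fin 3 → ℂ} (h : DistinctLines n) {c : Fin d → ℂ}
    (hc : ∀ i, c i ≠ 0) : DistinctLines fun i => c i • n i := by
  intro i j hij h0
  simp only [map_smul, LinearMap.smul_apply] at h0
  exact smul_ne_zero (hc j) (smul_ne_zero (hc i) (h i j hij)) h0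

theorem exists_typeData_of_mem {m : ℕ} (hm : 2 ≤ m) (hl : l ∈ Xd d) (h : HasType m l) :
    ∃ (n : Fin d → Fin 3 → ℂ) (M : Finset (Fin d)) (v : Fin 3 → ℂ),
      TypeData m n M v ∧ ((psi l).rep : S) = arrEq n := by
  obtain ⟨M, v, hT⟩ := (exists_typeData_iff hm).1 ⟨hl, h⟩
  obtain ⟨c, hc, e⟩ := exists_arrEq_eq_rep (by have := hT.le; omega) l
  exact ⟨_, M, v, hT.smul hc, e⟩

/-- Koszul syzygies show that the set of degrees is nonempty, so its infimum is attained and is not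
the default value 0. -/
theorem exists_mem_AR_of_mdr_eq {n : Fin d → Fin 3 → ℂ} (hD : DistinctLines n) (hd : 2 ≤ d) {r : ℕ}
    (h : mdr (arrEq n) = r) : ∃ θ ∈ AR (arrEq n), θ ≠ 0 ∧ ∀ i, (θ i).IsHomogeneous r := by
  have hne : {r | ∃ a ∈ AR (arrEq n), a ≠ 0 ∧ ∀ i, (a i).IsHomogeneous r}.Nonempty := by
    by_contra hempty
    have key : ∀ w : Fin 3 → ℂ, cvec w ⨯₃ grad (arrEq n) = 0 := by
      intro w
      by_contra hw
      exact hempty ⟨_, _, koszul_mem_AR _ _, hw, isHomogeneous_cross (isHomogeneous_cvec w)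
        (isHomogeneous_grad (isHomogeneous_arrEq n))⟩
    have h0 := key (Pi.single 0 1)
    have h1 := key (Pi.single 1 1)
    refine (hD.isPrimitiveVec_grad hd).ne_zero (vec_three_ext ?_ ?_ ?_)
    · have := congrFun h1 2
      simpa [cross_two_apply, cvec, Pi.single_apply] using this
    · have := congrFun h0 2
      simpa [cross_two_apply, cvec, Pi.single_apply] using this
    · have := congrFun h0 1
      simpa [cross_one_apply, cvec, Pi.single_apply] using this
  have := Nat.sInf_mem hne
  rw [← h]
  exact this

theorem mult_mk_eq_card {v : Fin 3 → ℂ} (hv : v ≠ 0) :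
    mult l (Projectivization.mk ℂ v hv) =
      (Finset.univ.filter fun i => covec (l i) ⬝ᵥ v = 0).card := by
  rw [mult_eq_card]
  congr 1
  ext i
  rw [mem_linesAt, mk_mem_line, Finset.mem_filter, and_iff_right (Finset.mem_univ i)]

/-- For a constant syzygy w, the constant w · n_i is divisible by ℓ_i, hence zero: the point w lies
on every line. -/
theorem hasType_of_mdr_eq_zero (hd : 2 ≤ d) (hl : l ∈ Xd d) (h : mdr ((psi l).rep : S) = 0) :
    HasType d l := by
  obtain ⟨c, hc, e⟩ := exists_arrEq_eq_rep (by omega) l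
  have hD := (distinctLines_covec hl).smul hc
  rw [e] at h
  obtain ⟨θ, hθ, hθ0, hh⟩ := exists_mem_AR_of_mdr_eq hD hd h
  have hcst : ∀ i, ∃ w : ℂ, θ i = C w := fun i => by
    have := (totalDegree_zero_iff_isHomogeneous _).2 (hh i)
    rw [totalDegree_eq_zero_iff_eq_C] at this
    exact ⟨_, this⟩
  choose w hw using hcst
  have hθw : θ = cvec w := funext hw
  have hw0 : w ≠ 0 := by
    rintro rfl
    exact hθ0 (by rw [hθw]; ext1 k; simp [cvec])
  refine hasType_of_mult_ge hl (by omega) (p := Projectivization.mk ℂ w hw0) ?_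
  rw [mult_mk_eq_card, Finset.filter_true_of_mem, Finset.card_univ, Fintype.card_fin]
  intro i _
  obtain ⟨p, hp⟩ := hD.dvd_dot hd hθ i
  rw [hθw, cvec_dot] at hp
  have h0 := congrArg (eval 0) hp
  rw [eval_C, map_mul, eval_linForm, dotProduct_zero, zero_mul, dotProduct_smul, smul_eq_mul] at h0
  rw [dotProduct_comm]
  exact (mul_eq_zero.1 h0).resolve_left (hc i)

theorem mdr_eq_of_hasType {m : ℕ} (hm : 2 ≤ m) (hl : l ∈ Xd d) (h : HasType m l) :
    mdr ((psi l).rep : S) = d - m := by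
  obtain ⟨n, M, v, hT, e⟩ := exists_typeData_of_mem hm hl h
  rw [e, hT.mdr_eq hm]

/-- If the lines are pairwise distinct eigenvectors of a non-scalar endomorphism, then all lines
except possibly one pass through a common point. -/
theorem exists_point_of_eigenvectors {n : Fin d → Fin 3 → ℂ} (hD : DistinctLines n) (hd : 4 ≤ d)
    (B : Module.End ℂ (Fin 3 → ℂ)) (hB : ∀ t : ℂ, B ≠ t • LinearMap.id) {μ : Fin d → ℂ}
    (hμ : ∀ i, B (n i) = μ i • n i) :
    ∃ v : Fin 3 → ℂ, v ≠ 0 ∧ ∀ i j, n i ⬝ᵥ v ≠ 0 → n j ⬝ᵥ v ≠ 0 → i = j := by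
  -- Distinct eigenvalues would make at least four vectors of ℂ³ independent. So two lines share an
  -- eigenvalue, and the pencil they span consists of eigenvectors for it.
  have hni : ¬ Function.Injective μ := by
    intro hinj
    have hli := Module.End.eigenvectors_linearIndependent' B μ hinj n fun i =>
      ⟨Module.End.mem_eigenspace_iff.2 (hμ i), hD.ne_zero (by omega) i⟩
    have := hli.fintype_card_le_finrank
    simp at this
    omega
  simp only [Function.Injective, not_forall] at hni
  obtain ⟨i, j, hij, hne⟩ := hni
  refine ⟨n i ⨯₃ n j, hD i j hne, fun a b ha hb => ?_⟩
  by_contra hab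
  set q := n i ⨯₃ n j with hq
  have hq0 : q ≠ 0 := hD i j hne
  have comb : ∀ x : Fin 3 → ℂ, x ⬝ᵥ q = 0 → B x = μ i • x := by
    intro x hx
    obtain ⟨s, t, rfl⟩ := exists_combination (u := n i) (w := n j) (n := q) hq0 hq0
      (by rw [dotProduct_comm, dot_self_cross]) (by rw [dotProduct_comm, dot_cross_self])
      (by rw [dotProduct_comm, hx])
    rw [map_add, map_smul, map_smul, hμ, hμ, ← hij, smul_add, smul_comm s, smul_comm t]
  -- The member through `q` of the pencil spanned by two lines missing `q`. Being an eigenvector for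
  -- μ i, it forces μ a = μ i, and then `B` is scalar.
  set u := (n b ⬝ᵥ q) • n a - (n a ⬝ᵥ q) • n b with hu
  have huq : u ⬝ᵥ q = 0 := by
    rw [hu, sub_dotProduct, smul_dotProduct, smul_dotProduct, smul_eq_mul, smul_eq_mul]; ring
  have h1 := comb u huq
  have h2 : ((n b ⬝ᵥ q) * (μ a - μ i)) • n a = ((n a ⬝ᵥ q) * (μ b - μ i)) • n b := by
    rw [hu, map_sub, map_smul, map_smul, hμ, hμ] at h1
    ext k
    have := congrFun h1 k
    simp only [Pi.sub_apply, Pi.smul_apply, smul_eq_mul] at this ⊢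
    linear_combination this
  have h3 := congrArg (fun x => x ⨯₃ n b) h2
  simp only [map_smul, LinearMap.smul_apply, cross_self, smul_zero] at h3
  have hμa : μ a = μ i := by
    have := (smul_eq_zero.1 h3).resolve_right (hD a b hab)
    exact sub_eq_zero.1 ((mul_eq_zero.1 this).resolve_left hb)
  refine hB (μ i) (LinearMap.ext fun x => ?_)
  have hx : (x - ((x ⬝ᵥ q) / (n a ⬝ᵥ q)) • n a) ⬝ᵥ q = 0 := by
    rw [sub_dotProduct, smul_dotProduct, smul_eq_mul, div_mul_cancel₀ _ ha, sub_self]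
  have h4 := comb _ hx
  rw [map_sub, map_smul, hμ, hμa, smul_sub, smul_comm] at h4
  simpa using h4

/-- A linear syzygy is a matrix acting on covectors, and preserving the lines means that every n_i
is an eigenvector. The matrix is not scalar, because a nonzero multiple of the Euler field is no
syzygy. So all lines but at most one are concurrent, and if all were, `mdr` would be 0. -/
theorem hasType_of_mdr_eq_one (hd : 4 ≤ d) (hl : l ∈ Xd d) (h : mdr ((psi l).rep : S) = 1) :
    HasType (d - 1) l := by
  classical
  obtain ⟨c, hc, e⟩ := exists_arrEq_eq_rep (by omega) l
  have hD := (distinctLines_covec hl).smul hc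
  have hd2 : 2 ≤ d := by omega
  have h' := h
  rw [e] at h
  obtain ⟨θ, hθ, hθ0, hh⟩ := exists_mem_AR_of_mdr_eq hD hd2 h
  set n : Fin d → Fin 3 → ℂ := fun i => c i • covec (l i) with hn
  have hA : ∀ i, ∃ A : Fin 3 → ℂ, θ i = linForm A := fun i => by
    obtain ⟨w, hw⟩ := linEquiv.surjective ⟨θ i, (mem_homogeneousSubmodule _ _).2 (hh i)⟩
    exact ⟨w, by rw [← coe_linEquiv, hw]⟩
  choose A hA using hA
  have hdot : ∀ u : Fin 3 → ℂ, θ ⬝ᵥ cvec u = linForm (∑ k, u k • A k) := by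
    intro u
    simp only [dotProduct, Fin.sum_univ_three, hA, cvec, linForm_add, linForm_smul]
    ring
  set B : Module.End ℂ (Fin 3 → ℂ) := Fintype.linearCombination ℂ A with hBdef
  have hBapp : ∀ u, B u = ∑ k, u k • A k := fun u => Fintype.linearCombination_apply ℂ A u
  have hμ : ∀ i, ∃ μ : ℂ, B (n i) = μ • n i := by
    intro i
    have := hD.dvd_dot hd2 hθ i
    rw [hdot, ← hBapp] at this
    exact linForm_dvd_linForm this
  choose μ hμ using hμ
  have hBs : ∀ t : ℂ, B ≠ t • LinearMap.id := by
    intro t ht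
    have hAk : ∀ k, A k = t • Pi.single k 1 := by
      intro k
      have := congrArg (fun φ : Module.End ℂ (Fin 3 → ℂ) => φ (Pi.single k 1)) ht
      simpa [hBapp, Pi.single_apply] using this
    have hθx : θ = (C t : S) • xvec := by
      ext1 k
      rw [hA, hAk, linForm_smul]
      simp [linForm, Pi.single_apply, xvec]
    rw [mem_AR, hθx, smul_dotProduct, xvec_dot_grad (isHomogeneous_arrEq n), smul_eq_mul] at hθ
    have : (C t : S) = 0 := (mul_eq_zero.1 hθ).resolve_right
      (mul_ne_zero (Nat.cast_ne_zero.2 (by omega)) (hD.arrEq_ne_zero hd2))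
    exact hθ0 (by rw [hθx, this, zero_smul])
  obtain ⟨v, hv, hv1⟩ := exists_point_of_eigenvectors hD hd B hBs hμ
  set T := Finset.univ.filter fun i => covec (l i) ⬝ᵥ v = 0 with hT
  have hTc : Tᶜ.card ≤ 1 := by
    refine Finset.card_le_one.2 fun i hi j hj => hv1 i j ?_ ?_
    · rw [hn, smul_dotProduct]
      exact smul_ne_zero (hc i) (by simpa [hT] using hi)
    · rw [hn, smul_dotProduct]
      exact smul_ne_zero (hc j) (by simpa [hT] using hj)
  have hTd : T.card + Tᶜ.card = d := by rw [Finset.card_add_card_compl, Fintype.card_fin]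
  have hTm := mult_mk_eq_card (l := l) hv
  rw [← hT] at hTm
  rcases Nat.lt_or_ge Tᶜ.card 1 with h0 | h0
  · have := mdr_eq_of_hasType hd2 hl (hasType_of_mult_ge hl (by omega) (hTm.trans (by omega) : _ = d))
    omega
  · exact hasType_of_mult_ge hl (by omega) (hTm.trans (by omega))

end SmallDegree

end LineArr

end

/-! ### Zariski geometry and the ordered strata. -/

noncomputable section

namespace LineArr

open MvPolynomial
open scoped LinearAlgebra.Projectivization Matrix

/-! ### Polynomial functions -/

section PolyFun

variable {E E' : Type} [AddCommGroup E] [Module ℂ E] [AddCommGroup E'] [Module ℂ E']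

theorem dual_mem_polyFun (φ : Module.Dual ℂ E) : (fun x => φ x) ∈ PolyFun E :=
  Algebra.subset_adjoin ⟨φ, rfl⟩

theorem const_mem_polyFun (c : ℂ) : (fun _ : E => c) ∈ PolyFun E := (PolyFun E).algebraMap_mem c

theorem add_mem_polyFun {F G : E → ℂ} (hF : F ∈ PolyFun E) (hG : G ∈ PolyFun E) :
    (fun x => F x + G x) ∈ PolyFun E := (PolyFun E).add_mem hF hG

theorem sub_mem_polyFun {F G : E → ℂ} (hF : F ∈ PolyFun E) (hG : G ∈ PolyFun E) :
    (fun x => F x - G x) ∈ PolyFun E := (PolyFun E).sub_mem hF hG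

theorem mul_mem_polyFun {F G : E → ℂ} (hF : F ∈ PolyFun E) (hG : G ∈ PolyFun E) :
    (fun x => F x * G x) ∈ PolyFun E := (PolyFun E).mul_mem hF hG

theorem sum_mem_polyFun {κ : Type} (s : Finset κ) {F : κ → E → ℂ} (hF : ∀ i ∈ s, F i ∈ PolyFun E) :
    (fun x => ∑ i ∈ s, F i x) ∈ PolyFun E := by
  convert (PolyFun E).sum_mem hF using 1
  ext x; simp

theorem prod_mem_polyFun {κ : Type} (s : Finset κ) {F : κ → E → ℂ} (hF : ∀ i ∈ s, F i ∈ PolyFun E) :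
    (fun x => ∏ i ∈ s, F i x) ∈ PolyFun E := by
  convert (PolyFun E).prod_mem hF using 1
  ext x; simp

theorem comp_mem_polyFun {F : E' → ℂ} (hF : F ∈ PolyFun E') {G : E → E'}
    (hG : ∀ φ : Module.Dual ℂ E', (fun x => φ (G x)) ∈ PolyFun E) : (fun x => F (G x)) ∈ PolyFun E := by
  induction hF using Algebra.adjoin_induction with
  | mem F hF => obtain ⟨φ, rfl⟩ := hF; exact hG φ
  | algebraMap c => exact const_mem_polyFun c
  | add F F' _ _ h h' => exact add_mem_polyFun h h'
  | mul F F' _ _ h h' => exact mul_mem_polyFun h h'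

theorem comp_linear_mem_polyFun {F : E' → ℂ} (hF : F ∈ PolyFun E') (T : E →ₗ[ℂ] E') :
    (fun x => F (T x)) ∈ PolyFun E :=
  comp_mem_polyFun hF fun φ => dual_mem_polyFun (φ ∘ₗ T)

theorem exists_polynomial_of_mem_polyFun {F : E → ℂ} (hF : F ∈ PolyFun E) (p w : E) :
    ∃ P : Polynomial ℂ, ∀ t : ℂ, F (p + t • w) = P.eval t := by
  induction hF using Algebra.adjoin_induction with
  | mem F hF =>
    obtain ⟨φ, rfl⟩ := hF
    exact ⟨Polynomial.C (φ p) + Polynomial.C (φ w) * Polynomial.X, fun t => by simp; ring⟩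
  | algebraMap c => exact ⟨Polynomial.C c, fun t => by simp⟩
  | add F F' _ _ h h' =>
    obtain ⟨P, hP⟩ := h; obtain ⟨P', hP'⟩ := h'
    exact ⟨P + P', fun t => by rw [Polynomial.eval_add, Pi.add_apply, hP, hP']⟩
  | mul F F' _ _ h h' =>
    obtain ⟨P, hP⟩ := h; obtain ⟨P', hP'⟩ := h'
    exact ⟨P * P', fun t => by rw [Polynomial.eval_mul, Pi.mul_apply, hP, hP']⟩

/-- The polynomial functions on a vector space form a domain. -/
theorem exists_mul_ne_zero_of_mem_polyFun {F G : E → ℂ} (hF : F ∈ PolyFun E) (hG : G ∈ PolyFun E)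
    {p q : E} (hp : F p ≠ 0) (hq : G q ≠ 0) : ∃ x, F x * G x ≠ 0 := by
  -- On the line joining `p` and `q` both functions are nonzero polynomials in one variable.
  obtain ⟨P, hP⟩ := exists_polynomial_of_mem_polyFun hF p (q - p)
  obtain ⟨Q, hQ⟩ := exists_polynomial_of_mem_polyFun hG p (q - p)
  have hP0 : P ≠ 0 := by
    rintro rfl
    have := hP 0
    rw [zero_smul, add_zero, Polynomial.eval_zero] at this
    exact hp this
  have hQ0 : Q ≠ 0 := by
    rintro rfl
    have := hQ 1
    rw [one_smul, add_sub_cancel, Polynomial.eval_zero] at this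
    exact hq this
  obtain ⟨t, ht⟩ : ∃ t, (P * Q).eval t ≠ 0 := by
    by_contra! H
    exact mul_ne_zero hP0 hQ0 (Polynomial.funext fun t => by rw [H, Polynomial.eval_zero])
  exact ⟨p + t • (q - p), by rwa [hP, hQ, ← Polynomial.eval_mul]⟩

/-- Homogenization of a polynomial function with respect to a linear functional. -/
theorem exists_homogenization {F : E → ℂ} (hF : F ∈ PolyFun E) (a : Module.Dual ℂ E) :
    ∃ (k : ℕ) (G : E → ℂ), G ∈ PolyFun E ∧ (∀ (c : ℂ) x, G (c • x) = c ^ k * G x) ∧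
      ∀ x, a x = 1 → G x = F x := by
  induction hF using Algebra.adjoin_induction with
  | mem F hF =>
    obtain ⟨φ, rfl⟩ := hF
    exact ⟨1, fun x => φ x, dual_mem_polyFun φ, fun c x => by simp, fun x _ => rfl⟩
  | algebraMap c => exact ⟨0, fun _ => c, const_mem_polyFun c, fun c x => by simp, fun x _ => rfl⟩
  | add F F' _ _ h h' =>
    obtain ⟨k, G, hG, hk, h⟩ := h; obtain ⟨k', G', hG', hk', h'⟩ := h'
    -- Powers of `a` equalize the degrees without changing values where a = 1.
    refine ⟨k + k', fun x => a x ^ k' * G x + a x ^ k * G' x, ?_, fun c x => ?_, fun x hx => ?_⟩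
    · exact add_mem_polyFun (mul_mem_polyFun ((PolyFun E).pow_mem (dual_mem_polyFun a) k') hG)
        (mul_mem_polyFun ((PolyFun E).pow_mem (dual_mem_polyFun a) k) hG')
    · simp only [map_smul, smul_eq_mul, hk, hk']; ring
    · simp only [hx, h x hx, h' x hx, one_pow, one_mul, Pi.add_apply]
  | mul F F' _ _ h h' =>
    obtain ⟨k, G, hG, hk, h⟩ := h; obtain ⟨k', G', hG', hk', h'⟩ := h'
    refine ⟨k + k', fun x => G x * G' x, mul_mem_polyFun hG hG', fun c x => ?_, fun x hx => ?_⟩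
    · simp only [hk, hk']; ring
    · simp only [h x hx, h' x hx, Pi.mul_apply]

end PolyFun

section MultiHom

variable {ι : Type} [Fintype ι] {V : Type} [AddCommGroup V] [Module ℂ V]

theorem IsMultiHom.mul {F G : (ι → V) → ℂ} (hF : IsMultiHom F) (hG : IsMultiHom G) :
    IsMultiHom fun v => F v * G v := by
  obtain ⟨hF, k, hk⟩ := hF; obtain ⟨hG, k', hk'⟩ := hG
  refine ⟨mul_mem_polyFun hF hG, k + k', fun c v => ?_⟩
  simp only [hk, hk', Pi.add_apply, pow_add, Finset.prod_mul_distrib]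
  ring

theorem isMultiHom_one : IsMultiHom fun _ : ι → V => (1 : ℂ) :=
  ⟨const_mem_polyFun 1, 0, fun c v => by simp⟩

theorem isMultiHom_prod {κ : Type} (s : Finset κ) {F : κ → (ι → V) → ℂ}
    (hF : ∀ i ∈ s, IsMultiHom (F i)) : IsMultiHom fun v => ∏ i ∈ s, F i v := by
  classical
  induction s using Finset.induction_on with
  | empty => simpa using isMultiHom_one
  | insert a s ha ih =>
    simp only [Finset.prod_insert ha]
    exact (hF a (Finset.mem_insert_self a s)).mul (ih fun i hi => hF i (Finset.mem_insert_of_mem hi))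

theorem isMultiHom_unit {F : V → ℂ} (hF : F ∈ PolyFun V) {k : ℕ}
    (hk : ∀ (c : ℂ) x, F (c • x) = c ^ k * F x) : IsMultiHom fun v : Unit → V => F (v ()) :=
  ⟨comp_linear_mem_polyFun hF (LinearMap.proj (R := ℂ) (φ := fun _ : Unit => V) ()), fun _ => k, fun c v => by simp [hk]⟩

theorem linearIndependent_of_diagonal {κ E : Type} [Finite κ] {f : κ → E → ℂ} (w : κ → E)
    (hne : ∀ i, f i (w i) ≠ 0) (h0 : ∀ i j, i ≠ j → f i (w j) = 0) : LinearIndependent ℂ f := by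
  cases nonempty_fintype κ
  rw [Fintype.linearIndependent_iff]
  intro g hg i
  have := congrFun hg (w i)
  rw [Finset.sum_apply, Finset.sum_eq_single i] at this
  · exact (mul_eq_zero.1 this).resolve_right (hne i)
  · intro j _ hj
    rw [Pi.smul_apply, h0 j i hj, smul_zero]
  · simp

/-- Smoothness of a subset of a projective space, checked in an affine chart. -/
theorem isSmoothOfDim_of_chart {V : Type} [AddCommGroup V] [Module ℂ V] {Z : Set (ℙ ℂ V)} {n : ℕ}
    (hZ : Z.Nonempty)
    (h : ∀ p ∈ Z, ∃ (a : Module.Dual ℂ V) (x₀ : V) (κ : Type) (_ : Fintype κ) (g : V → ℂ)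
      (F : κ → V → ℂ) (w : κ → V) (b : κ → ℂ), a p.rep ≠ 0 ∧ x₀ = (a p.rep)⁻¹ • p.rep ∧
        g ∈ PolyFun V ∧ g x₀ ≠ 0 ∧ (∀ j, F j ∈ PolyFun V) ∧
        Fintype.card κ + n + 1 = Module.finrank ℂ V ∧ (∀ j, a (w j) = 0) ∧ (∀ j, b j ≠ 0) ∧
        (∀ j, HasDerivAt (fun t : ℂ => F j (x₀ + t • w j)) (b j) 0) ∧
        (∀ i j, i ≠ j → ∀ t : ℂ, F i (x₀ + t • w j) = 0) ∧
        ∀ q : ℙ ℂ V, ∀ c : ℂ, a (c • q.rep) = 1 → g (c • q.rep) ≠ 0 →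
          (q ∈ Z ↔ ∀ j, F j (c • q.rep) = 0)) :
    IsSmoothOfDim {q : Unit → ℙ ℂ V | q () ∈ Z} n := by
  refine ⟨⟨fun _ => hZ.some, hZ.some_mem⟩, fun p hp => ?_⟩
  obtain ⟨a, x₀, κ, _, g, F, w, b, ha, hx₀, hg, hgx, hF, hdim, hw, hb, hder, hoff, hq⟩ := h (p ()) hp
  obtain ⟨kg, G, hG, hkG, hGg⟩ := exists_homogenization hg a
  choose k H hH hkH hHF using fun j => exists_homogenization (hF j) a
  set r := (p ()).rep with hr
  have hax : a x₀ = 1 := by rw [hx₀, map_smul, smul_eq_mul, inv_mul_cancel₀ ha]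
  have hrx : r = a r • x₀ := by rw [hx₀, smul_inv_smul₀ ha]
  -- Everything is homogenized with respect to `a`. The factor `a` in the open condition keeps the
  -- neighbourhood inside the chart.
  refine ⟨fun v => a (v ()) * G (v ()), ?_, ?_, Fintype.card κ,
    fun j v => H ((Fintype.equivFin κ).symm j) (v ()), fun j => isMultiHom_unit (hH _) (hkH _), ?_,
    ?_, ?_⟩
  · exact (isMultiHom_unit (F := fun x => a x) (dual_mem_polyFun a) (k := 1) fun c x => by simp).mul
      (isMultiHom_unit hG hkG)
  · refine mul_ne_zero ha ?_
    show G r ≠ 0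
    rw [hrx, hkG, hGg _ hax]
    exact mul_ne_zero (pow_ne_zero _ ha) hgx
  · rw [Fintype.card_unit, one_mul, hdim]
  · have key : ∀ i j (t : ℂ), H i (r + t • w j) = a r ^ k i * F i (x₀ + ((a r)⁻¹ * t) • w j) := by
      intro i j t
      rw [← hHF i _ (by rw [map_add, map_smul, hw, hax, smul_zero, add_zero]), ← hkH, smul_add,
        ← hrx, smul_smul, mul_inv_cancel_left₀ ha]
    have hline : ∀ i j, lineDeriv ℂ (fun v : Unit → V => H i (v ())) (reps p) (fun _ => w j) =
        deriv (fun t : ℂ => a r ^ k i * F i (x₀ + ((a r)⁻¹ * t) • w j)) 0 := by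
      intro i j
      rw [lineDeriv]
      congr 1
      ext t
      exact key i j t
    refine linearIndependent_of_diagonal (fun j _ => w ((Fintype.equivFin κ).symm j)) (fun j => ?_)
      fun i j hij => ?_
    · rw [hline]
      set j' := (Fintype.equivFin κ).symm j
      have h1 : HasDerivAt (fun t : ℂ => F j' (x₀ + ((a r)⁻¹ * t) • w j')) (b j' * (a r)⁻¹) 0 := by
        have h2 : HasDerivAt (fun t : ℂ => (a r)⁻¹ * t) ((a r)⁻¹) 0 := by
          simpa using (hasDerivAt_id (0 : ℂ)).const_mul ((a r)⁻¹)
        have h3 := hder j'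
        rw [← mul_zero (a r)⁻¹] at h3
        exact HasDerivAt.comp (0 : ℂ) h3 h2
      rw [(h1.const_mul (a r ^ k j')).deriv]
      exact mul_ne_zero (pow_ne_zero _ ha) (mul_ne_zero (hb j') (inv_ne_zero ha))
    · rw [hline]
      have : (fun t : ℂ => a r ^ k ((Fintype.equivFin κ).symm i) * F ((Fintype.equivFin κ).symm i)
          (x₀ + ((a r)⁻¹ * t) • w ((Fintype.equivFin κ).symm j))) = fun _ => 0 := by
        ext t
        rw [hoff _ _ (by simpa using hij), mul_zero]
      rw [this, deriv_const]
  · intro q hgq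
    obtain ⟨h1, h2⟩ := mul_ne_zero_iff.1 hgq
    set r' := reps q () with hr'
    have h3 : a ((a r')⁻¹ • r') = 1 := by rw [map_smul, smul_eq_mul, inv_mul_cancel₀ h1]
    have h4 : g ((a r')⁻¹ • r') ≠ 0 := by
      rw [← hGg _ h3, hkG]
      exact mul_ne_zero (pow_ne_zero _ (inv_ne_zero h1)) h2
    refine (hq (q ()) _ h3 h4).trans ⟨fun H' j => ?_, fun H' j => ?_⟩
    · have := H' ((Fintype.equivFin κ).symm j)
      rw [show (q ()).rep = r' from rfl, ← hHF _ _ h3, hkH] at this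
      exact (mul_eq_zero.1 this).resolve_left (pow_ne_zero _ (inv_ne_zero h1))
    · rw [show (q ()).rep = r' from rfl, ← hHF _ _ h3, hkH]
      have := H' (Fintype.equivFin κ j)
      simp only [Equiv.symm_apply_apply] at this
      exact mul_eq_zero_of_right _ this

end MultiHom

end LineArr

end

noncomputable section

namespace LineArr

open MvPolynomial
open scoped LinearAlgebra.Projectivization Matrix

/-! ### Ordered arrangements of the given type -/

section OrderedStratum

variable {d m : ℕ} {n : Fin d → Fin 3 → ℂ} {M : Finset (Fin d)} {v : Fin 3 → ℂ}

/-- The triples of distinct labels not contained in `M`. -/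
def offTriples (M : Finset (Fin d)) : Finset (Fin d × Fin d × Fin d) := by
  classical exact Finset.univ.filter fun t =>
    t.1 ≠ t.2.1 ∧ t.1 ≠ t.2.2 ∧ t.2.1 ≠ t.2.2 ∧ ¬ (t.1 ∈ M ∧ t.2.1 ∈ M ∧ t.2.2 ∈ M)

theorem mem_offTriples {t : Fin d × Fin d × Fin d} : t ∈ offTriples M ↔
    t.1 ≠ t.2.1 ∧ t.1 ≠ t.2.2 ∧ t.2.1 ≠ t.2.2 ∧ ¬ (t.1 ∈ M ∧ t.2.1 ∈ M ∧ t.2.2 ∈ M) := by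
  classical
  rw [offTriples, Finset.mem_filter, and_iff_right (Finset.mem_univ t)]

/-- The product of the determinants of the triples of covectors not contained in `M`. -/
def offDet (M : Finset (Fin d)) (n : Fin d → Fin 3 → ℂ) : ℂ :=
  ∏ t ∈ offTriples M, n t.1 ⬝ᵥ n t.2.1 ⨯₃ n t.2.2

theorem offDet_ne_zero : offDet M n ≠ 0 ↔ ∀ i j k, i ≠ j → i ≠ k → j ≠ k →
    ¬ (i ∈ M ∧ j ∈ M ∧ k ∈ M) → n i ⬝ᵥ n j ⨯₃ n k ≠ 0 := by
  rw [offDet, Finset.prod_ne_zero_iff]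
  constructor
  · intro h i j k h1 h2 h3 h4
    exact h (i, j, k) (mem_offTriples.2 ⟨h1, h2, h3, h4⟩)
  · rintro h ⟨i, j, k⟩ ht
    obtain ⟨h1, h2, h3, h4⟩ := mem_offTriples.1 ht
    exact h i j k h1 h2 h3 h4

theorem typeData_of_offDet_ne_zero (hM : M.card = m) (hD : DistinctLines n) (h0 : offDet M n ≠ 0)
    {i₁ i₂ : Fin d} (h12 : i₁ ≠ i₂)
    (h : ∀ j ∈ M, j ≠ i₁ → j ≠ i₂ → n i₁ ⬝ᵥ n i₂ ⨯₃ n j = 0) :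
    TypeData m n M (n i₁ ⨯₃ n i₂) where
  card := hM
  ne_zero := hD i₁ i₂ h12
  dot := by
    intro j hj
    by_cases h1 : j = i₁
    · rw [h1, dot_self_cross]
    by_cases h2 : j = i₂
    · rw [h2, dot_cross_self]
    rw [triple_product_permutation, h j hj h1 h2]
  cross := hD
  triple := offDet_ne_zero.1 h0

theorem TypeData.triple_eq_zero (h : TypeData m n M v) {i j k : Fin d} (hi : i ∈ M) (hj : j ∈ M)
    (hk : k ∈ M) : n i ⬝ᵥ n j ⨯₃ n k = 0 :=
  triple_eq_zero_of_dot h.ne_zero (h.dot i hi) (h.dot j hj) (h.dot k hk)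

/-- A label of `M` outside `M'`, with two further labels of `M`, would be a concurrent triple not
inside `M'`. So for `3 ≤ m` the labels of the lines through the special point are locally constant.
-/
theorem TypeData.eq_of_offDet_ne_zero (h : TypeData m n M v) (hm : 3 ≤ m) {M' : Finset (Fin d)}
    (hM' : M'.card = m) (h0 : offDet M' n ≠ 0) : M = M' := by
  refine Finset.eq_of_subset_of_card_le (fun x hx => ?_) (by rw [h.card, hM'])
  obtain ⟨y, hy, hyx⟩ := Finset.exists_mem_ne (by rw [h.card]; omega : 1 < M.card) x
  obtain ⟨z, hz, hzx⟩ := Finset.exists_mem_ne (s := M.erase x) (by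
    rw [Finset.card_erase_of_mem hx, h.card]; omega) y
  have hz' := Finset.mem_erase.1 hz
  by_contra hxM
  exact offDet_ne_zero.1 h0 x y z hyx.symm hz'.1.symm hzx.symm (fun e => hxM e.1)
    (h.triple_eq_zero hx hy hz'.2)

/-- An arrangement with `m` concurrent lines and no other multiple points of order at least three. -/
theorem exists_typeData (hmd : m ≤ d) :
    ∃ n : Fin d → Fin 3 → ℂ, TypeData m n (firstLines d m) ![0, 0, 1] := by
  -- The lines of the pencil are (1, x, 0); the covectors (1, x, x² + d²) of the others lie on a
  -- parabola. Each determinant is a product of differences of the x's and, unless all three lines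
  -- lie on the parabola, a factor that cannot vanish because x_j x_k < d².
  set x : Fin d → ℂ := fun i => (i : ℕ) with hx
  have hinj : ∀ i j : Fin d, i ≠ j → x j - x i ≠ 0 := by
    intro i j hij h
    exact hij (Fin.ext (Nat.cast_injective (R := ℂ) (sub_eq_zero.1 h))).symm
  set A : ℂ := (d : ℂ) * d with hA
  have hpos : ∀ i j k : Fin d, x j * x k - A - x i * (x j + x k) ≠ 0 := by
    intro i j k h
    have h1 : (((j : ℕ) * k : ℕ) : ℂ) = ((d * d + i * (j + k) : ℕ) : ℂ) := by
      push_cast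
      linear_combination h
    have h2 : (j : ℕ) * k = d * d + i * (j + k) := Nat.cast_injective h1
    have h3 : (j : ℕ) * k < d * d := Nat.mul_lt_mul'' j.2 k.2
    omega
  have hpos2 : ∀ k : Fin d, x k ^ 2 + A ≠ 0 := by
    intro k h
    have h1 : (((k : ℕ) ^ 2 + d * d : ℕ) : ℂ) = ((0 : ℕ) : ℂ) := by
      push_cast
      exact h
    have h2 : (k : ℕ) ^ 2 + d * d = 0 := Nat.cast_injective h1
    have h3 : 0 < d * d := Nat.mul_pos (Fin.pos k) (Fin.pos k)
    omega
  set y : Fin d → ℂ := fun i => if i ∈ firstLines d m then 0 else x i ^ 2 + A with hy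
  refine ⟨fun i => ![1, x i, y i], card_firstLines hmd, ?_, ?_, ?_, ?_⟩
  · intro h; simpa using congrFun h 2
  · intro i hi
    simp only [hy, if_pos hi]
    simp
  · intro i j hij h
    have := congrFun h 2
    rw [cross_two_apply] at this
    exact hinj i j hij (by simpa using this)
  · have hd : ∀ i j k : Fin d, (![1, x i, y i] : Fin 3 → ℂ) ⬝ᵥ ![1, x j, y j] ⨯₃ ![1, x k, y k] =
        (x j * y k - x k * y j) - x i * (y k - y j) + y i * (x k - x j) := by
      intro i j k
      simp only [dot_three, cross_zero_apply, cross_one_apply, cross_two_apply, Matrix.cons_val_zero,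
        Matrix.cons_val_one, Matrix.cons_val]
      ring
    intro i j k hij hik hjk hM
    rw [hd]
    by_cases hi : i ∈ firstLines d m <;> by_cases hj : j ∈ firstLines d m <;>
      by_cases hk : k ∈ firstLines d m
    · exact absurd ⟨hi, hj, hk⟩ hM
    all_goals simp only [hy, hi, hj, hk, if_true, if_false]
    all_goals intro h
    · refine mul_ne_zero (hinj i j hij) (hpos2 k) ?_
      linear_combination h
    · refine mul_ne_zero (hinj k i hik.symm) (hpos2 j) ?_
      linear_combination h
    · refine mul_ne_zero (hinj j k hjk) (hpos i j k) ?_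
      linear_combination h
    · refine mul_ne_zero (hinj j k hjk) (hpos2 i) ?_
      linear_combination h
    · refine mul_ne_zero (hinj i k hik) (hpos j i k) ?_
      linear_combination -h
    · refine mul_ne_zero (hinj i j hij) (hpos k i j) ?_
      linear_combination h
    · refine mul_ne_zero (mul_ne_zero (hinj i j hij) (hinj i k hik)) (hinj j k hjk) ?_
      linear_combination h

theorem covec_ofCovec_typeData (hd : 2 ≤ d) (h : TypeData m n M v) :
    ∃ l : Fin d → ℙ ℂ (Sd 1), ∃ c : Fin d → ℂ, (∀ i, c i ≠ 0) ∧
      (∀ i, covec (l i) = c i • n i) ∧ TypeData m (fun i => covec (l i)) M v := by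
  choose c hc hcn using fun i => covec_ofCovec (h.distinctLines.ne_zero hd i)
  refine ⟨fun i => ofCovec (n i) (h.distinctLines.ne_zero hd i), c, hc, hcn, ?_⟩
  simp only [hcn]
  exact h.smul hc

theorem nonempty_XL (hm : 2 ≤ m) (hmd : m ≤ d) : (XL d (Ldm d m)).Nonempty := by
  obtain ⟨n, hn⟩ := exists_typeData hmd
  obtain ⟨l, c, hc, hcn, hT⟩ := covec_ofCovec_typeData (hm.trans hmd) hn
  refine ⟨l, ?_⟩
  rw [XL_Ldm_eq hm hmd]
  exact (exists_typeData_iff hm).2 ⟨_, _, hT⟩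

/-- The coordinates of the covectors as functions on the product of the spaces of linear forms. -/
def covecs (w : Fin d → Sd 1) : Fin d → Fin 3 → ℂ := fun i => linEquiv.symm (w i)

theorem covecs_mem_polyFun (i : Fin d) (k : Fin 3) :
    (fun w : Fin d → Sd 1 => covecs w i k) ∈ PolyFun (Fin d → Sd 1) :=
  dual_mem_polyFun (LinearMap.proj k ∘ₗ linEquiv.symm.toLinearMap ∘ₗ
    LinearMap.proj (R := ℂ) (φ := fun _ : Fin d => Sd 1) i)

theorem covecs_smul (c : Fin d → ℂ) (w : Fin d → Sd 1) (i : Fin d) :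
    covecs (fun i => c i • w i) i = c i • covecs w i := by
  rw [covecs, map_smul]; rfl

theorem prod_pow_single {ι : Type} [Fintype ι] [DecidableEq ι] (c : ι → ℂ) (i : ι) :
    ∏ x, c x ^ (Pi.single i 1 : ι → ℕ) x = c i := by
  simp [Pi.single_apply, pow_ite]

theorem isMultiHom_cross (i j : Fin d) (k : Fin 3) :
    IsMultiHom fun w : Fin d → Sd 1 => (covecs w i ⨯₃ covecs w j) k := by
  classical
  refine ⟨?_, Pi.single i 1 + Pi.single j 1, fun c w => ?_⟩
  · revert k
    rw [forall_fin_three]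
    simp only [cross_zero_apply, cross_one_apply, cross_two_apply]
    exact ⟨sub_mem_polyFun (mul_mem_polyFun (covecs_mem_polyFun _ _) (covecs_mem_polyFun _ _))
        (mul_mem_polyFun (covecs_mem_polyFun _ _) (covecs_mem_polyFun _ _)),
      sub_mem_polyFun (mul_mem_polyFun (covecs_mem_polyFun _ _) (covecs_mem_polyFun _ _))
        (mul_mem_polyFun (covecs_mem_polyFun _ _) (covecs_mem_polyFun _ _)),
      sub_mem_polyFun (mul_mem_polyFun (covecs_mem_polyFun _ _) (covecs_mem_polyFun _ _))
        (mul_mem_polyFun (covecs_mem_polyFun _ _) (covecs_mem_polyFun _ _))⟩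
  · simp only [covecs_smul]
    simp only [Pi.add_apply, pow_add, Finset.prod_mul_distrib, prod_pow_single, map_smul,
      LinearMap.smul_apply, Pi.smul_apply, smul_eq_mul]
    ring

theorem isMultiHom_triple (i j k : Fin d) :
    IsMultiHom fun w : Fin d → Sd 1 => covecs w i ⬝ᵥ covecs w j ⨯₃ covecs w k := by
  classical
  refine ⟨?_, Pi.single i 1 + Pi.single j 1 + Pi.single k 1, fun c w => ?_⟩
  · simp only [dot_three]
    exact add_mem_polyFun (add_mem_polyFun
      (mul_mem_polyFun (covecs_mem_polyFun _ _) (isMultiHom_cross _ _ _).1)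
      (mul_mem_polyFun (covecs_mem_polyFun _ _) (isMultiHom_cross _ _ _).1))
      (mul_mem_polyFun (covecs_mem_polyFun _ _) (isMultiHom_cross _ _ _).1)
  · simp only [covecs_smul]
    simp only [Pi.add_apply, pow_add, Finset.prod_mul_distrib, prod_pow_single, map_smul,
      LinearMap.smul_apply, smul_eq_mul, dotProduct_smul, smul_dotProduct]
    ring

/-- Near a given arrangement, distinctness and the determinants of triples outside `M` persist, and
there the stratum is cut out by det(i₁, i₂, j) = 0 for the other m - 2 elements j of `M`. Each
equation involves its own covector n_j, so moving that one line off the pencil gives diagonal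
differentials. -/
theorem isSmoothOfDim_XL (hm : 2 ≤ m) (hmd : m ≤ d) :
    IsSmoothOfDim (XL d (Ldm d m)) (2 * d - m + 2) := by
  classical
  refine ⟨nonempty_XL hm hmd, fun p hp => ?_⟩
  rw [XL_Ldm_eq hm hmd] at hp ⊢
  obtain ⟨M, v, hT⟩ := (exists_typeData_iff hm).1 hp
  obtain ⟨i₁, hi₁, i₂, hi₂, h12⟩ := Finset.one_lt_card.1 (by rw [hT.card]; omega : 1 < M.card)
  have hcv : ∀ q : Fin d → ℙ ℂ (Sd 1), covecs (reps q) = fun i => covec (q i) := fun q => rfl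
  have hcomp : ∀ i j, ∃ k, i ≠ j → (covec (p i) ⨯₃ covec (p j)) k ≠ 0 := by
    intro i j
    by_cases hij : i = j
    · exact ⟨0, fun h => absurd hij h⟩
    · obtain ⟨k, hk⟩ := Function.ne_iff.1 (hT.cross i j hij)
      exact ⟨k, fun _ => hk⟩
  -- `k i j` is a coordinate in which n_i × n_j is nonzero at the given point, so distinctness is
  -- ensured by one polynomial condition.
  choose k hk using hcomp
  set K := (M.erase i₁).erase i₂ with hK
  have hKc : K.card = m - 2 := by
    rw [hK, Finset.card_erase_of_mem (Finset.mem_erase.2 ⟨h12.symm, hi₂⟩), Finset.card_erase_of_mem hi₁,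
      hT.card, Nat.sub_sub]
  set ε : Fin (m - 2) ≃ K := (Fintype.equivFinOfCardEq (by rw [Fintype.card_coe, hKc])).symm with hε
  have hKne : ∀ j : K, (j : Fin d) ≠ i₁ ∧ (j : Fin d) ≠ i₂ ∧ (j : Fin d) ∈ M := fun j => by
    have h1 := Finset.mem_erase.1 j.2
    have h2 := Finset.mem_erase.1 h1.2
    exact ⟨h2.1, h1.1, h2.2⟩
  set pairs := Finset.univ.filter fun t : Fin d × Fin d => t.1 ≠ t.2 with hpairs
  have hg : ∀ q : Fin d → ℙ ℂ (Sd 1),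
      (∏ t ∈ pairs, (covecs (reps q) t.1 ⨯₃ covecs (reps q) t.2) (k t.1 t.2)) *
        offDet M (covecs (reps q)) ≠ 0 →
      (DistinctLines fun i => covec (q i)) ∧ offDet M (fun i => covec (q i)) ≠ 0 := by
    intro q hq
    obtain ⟨h1, h2⟩ := mul_ne_zero_iff.1 hq
    refine ⟨fun i j hij h0 => ?_, h2⟩
    refine Finset.prod_ne_zero_iff.1 h1 (i, j) (by simp [hpairs, hij]) ?_
    show (covec (q i) ⨯₃ covec (q j)) (k i j) = 0
    rw [h0]; rfl
  refine ⟨fun w => (∏ t ∈ pairs, (covecs w t.1 ⨯₃ covecs w t.2) (k t.1 t.2)) * offDet M (covecs w),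
    ?_, ?_, m - 2, fun j w => covecs w i₁ ⬝ᵥ covecs w i₂ ⨯₃ covecs w (ε j),
    fun j => isMultiHom_triple _ _ _, ?_, ?_, ?_⟩
  · exact (isMultiHom_prod _ fun t _ => isMultiHom_cross _ _ _).mul
      (isMultiHom_prod _ fun t _ => isMultiHom_triple _ _ _)
  · refine mul_ne_zero (Finset.prod_ne_zero_iff.2 fun t ht => ?_) (offDet_ne_zero.2 hT.triple)
    exact hk t.1 t.2 (by simpa [hpairs] using ht)
  · rw [Fintype.card_fin, finrank_Sd_one]
    omega
  · obtain ⟨s, hs⟩ := Function.ne_iff.1 (hT.cross i₁ i₂ h12)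
    set u : Fin 3 → ℂ := Pi.single s 1 with hu
    have hup : covec (p i₁) ⬝ᵥ covec (p i₂) ⨯₃ u ≠ 0 := by
      rw [← triple_product_permutation, hu, single_dotProduct, one_mul]
      exact hs
    set W : Fin (m - 2) → Fin d → Sd 1 := fun j' => Pi.single (ε j' : Fin d) (linEquiv u) with hW
    have hline : ∀ j j' (t : ℂ), (fun w : Fin d → Sd 1 => covecs w i₁ ⬝ᵥ covecs w i₂ ⨯₃ covecs w (ε j))
        (reps p + t • W j') =
        covec (p i₁) ⬝ᵥ covec (p i₂) ⨯₃ covec (p (ε j)) +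
          t * (if j = j' then covec (p i₁) ⬝ᵥ covec (p i₂) ⨯₃ u else 0) := by
      intro j j' t
      have h1 : ∀ i : Fin d, covecs (reps p + t • W j') i =
          covec (p i) + t • (if i = ε j' then u else 0) := by
        intro i
        have : covecs (reps p + t • W j') i =
          linEquiv.symm ((p i).rep + t • W j' i) := rfl
        rw [this, map_add, map_smul]
        simp only [hW, Pi.single_apply]
        split_ifs
        · rw [LinearEquiv.symm_apply_apply]; rfl
        · rw [map_zero]; rfl
      simp only [h1, if_neg (hKne (ε j')).1.symm, if_neg (hKne (ε j')).2.1.symm, smul_zero, add_zero,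
        Subtype.coe_inj, ε.injective.eq_iff]
      split_ifs <;> simp
    have hder : ∀ j j', lineDeriv ℂ
        (fun w : Fin d → Sd 1 => covecs w i₁ ⬝ᵥ covecs w i₂ ⨯₃ covecs w (ε j)) (reps p)
        (W j') =
        if j = j' then covec (p i₁) ⬝ᵥ covec (p i₂) ⨯₃ u else 0 := by
      intro j j'
      rw [lineDeriv]
      simp only [hline j j']
      exact (((hasDerivAt_id (0 : ℂ)).mul_const _).const_add _).deriv.trans (one_mul _)
    refine linearIndependent_of_diagonal W
      (fun j => ?_) fun j j' hjj => ?_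
    · rw [hder, if_pos rfl]; exact hup
    · rw [hder, if_neg hjj]
  · intro q hq
    obtain ⟨hD, h0⟩ := hg q hq
    constructor
    · intro hqZ j
      obtain ⟨M', v', hT'⟩ := (exists_typeData_iff hm).1 hqZ
      have hm3 : 3 ≤ m := by have := j.2; omega
      have hMM := hT'.eq_of_offDet_ne_zero hm3 hT.card h0
      subst hMM
      exact hT'.triple_eq_zero hi₁ hi₂ (hKne (ε j)).2.2
    · intro hF
      refine (exists_typeData_iff hm).2 ⟨M, _, typeData_of_offDet_ne_zero hT.card hD h0 h12 ?_⟩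
      intro j hj h1 h2
      have := hF (ε.symm ⟨j, Finset.mem_erase.2 ⟨h2, Finset.mem_erase.2 ⟨h1, hj⟩⟩⟩)
      simp only [Equiv.apply_symm_apply] at this
      exact this

end OrderedStratum

end LineArr

end

/-! ### The unordered strata: smoothness and irreducibility. -/

noncomputable section

namespace LineArr

open MvPolynomial
open scoped LinearAlgebra.Projectivization Matrix

/-! ### Coordinates adapted to an arrangement -/

section Frame

variable {d : ℕ}

theorem pderiv_prod {σ ι : Type} [DecidableEq ι] (s : Finset ι) (f : ι → MvPolynomial σ ℂ) (k : σ) :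
    pderiv k (∏ i ∈ s, f i) = ∑ i ∈ s, pderiv k (f i) * ∏ j ∈ s.erase i, f j := by
  induction s using Finset.induction_on with
  | empty => simp
  | insert a s ha ih =>
    rw [Finset.prod_insert ha, pderiv_mul, Finset.sum_insert ha, Finset.erase_insert ha, ih,
      Finset.mul_sum]
    congr 1
    refine Finset.sum_congr rfl fun i hi => ?_
    have hia : a ≠ i := fun e => ha (e ▸ hi)
    rw [Finset.erase_insert_of_ne hia, Finset.prod_insert (fun h => ha (Finset.mem_of_mem_erase h))]
    ring

theorem exists_dot_ne_zero {ι : Type} (s : Finset ι) {u : ι → Fin 3 → ℂ} (hu : ∀ i ∈ s, u i ≠ 0) :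
    ∃ x : Fin 3 → ℂ, ∀ i ∈ s, u i ⬝ᵥ x ≠ 0 := by
  have h0 := prod_linForm_ne_zero hu
  obtain ⟨x, hx⟩ : ∃ x, eval x (∏ i ∈ s, linForm (u i)) ≠ 0 := by
    by_contra! H
    exact h0 (MvPolynomial.funext fun x => by rw [H, map_zero])
  rw [map_prod, Finset.prod_ne_zero_iff] at hx
  exact ⟨x, fun i hi => by rw [← eval_linForm]; exact hx i hi⟩

/-- A basis `e` of `ℂ³` together with the dual basis `ε`. -/
structure Frame where
  /-- The basis. -/
  e : Fin 3 → Fin 3 → ℂ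
  /-- The dual basis. -/
  ε : Fin 3 → Fin 3 → ℂ
  dot : ∀ i j, ε i ⬝ᵥ e j = if i = j then 1 else 0
  sum : ∀ n : Fin 3 → ℂ, ∑ j, (n ⬝ᵥ e j) • ε j = n

/-- The point `e 0` avoids all lines, and `e 1` is such that the lines meet the line joining the two
in distinct points. Both choices exclude finitely many hyperplanes. -/
theorem exists_frame {n : Fin d → Fin 3 → ℂ} (hD : DistinctLines n) (hd : 2 ≤ d) :
    ∃ B : Frame, (∀ i, n i ⬝ᵥ B.e 0 ≠ 0) ∧
      ∀ i j, i ≠ j → (n i ⬝ᵥ B.e 0) * (n j ⬝ᵥ B.e 1) - (n j ⬝ᵥ B.e 0) * (n i ⬝ᵥ B.e 1) ≠ 0 := by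
  classical
  obtain ⟨e₀, he₀⟩ := exists_dot_ne_zero Finset.univ (u := n) fun i _ => hD.ne_zero hd i
  set u : Fin d × Fin d → Fin 3 → ℂ := fun t => (n t.1 ⬝ᵥ e₀) • n t.2 - (n t.2 ⬝ᵥ e₀) • n t.1 with hu
  obtain ⟨e₁, he₁⟩ := exists_dot_ne_zero (Finset.univ.filter fun t : Fin d × Fin d => t.1 ≠ t.2)
    (u := u) (by
      rintro ⟨i, j⟩ hij h0
      have h1 := congrArg (fun x => n j ⨯₃ x) h0
      simp only [hu, map_sub, map_smul, cross_self, smul_zero, zero_sub, map_zero, neg_eq_zero,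
        smul_eq_zero] at h1
      rcases h1 with h1 | h1
      · exact he₀ j (Finset.mem_univ j) h1
      · exact hD j i (by simpa [eq_comm] using hij) h1)
  have hsep : ∀ i j, i ≠ j → (n i ⬝ᵥ e₀) * (n j ⬝ᵥ e₁) - (n j ⬝ᵥ e₀) * (n i ⬝ᵥ e₁) ≠ 0 := by
    intro i j hij
    have := he₁ (i, j) (by simpa using hij)
    simpa only [hu, sub_dotProduct, smul_dotProduct, smul_eq_mul] using this
  have h01 : e₀ ⨯₃ e₁ ≠ 0 := by
    intro h0
    have hi : (⟨0, by omega⟩ : Fin d) ≠ ⟨1, by omega⟩ := by simp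
    refine hsep _ _ hi ?_
    have h1 := cross_dot_cross (n ⟨0, by omega⟩) (n ⟨1, by omega⟩) e₀ e₁
    rw [h0, dotProduct_zero] at h1
    linear_combination -h1
  obtain ⟨k, hk⟩ := Function.ne_iff.1 h01
  set e₂ : Fin 3 → ℂ := Pi.single k 1 with he₂
  set Δ : ℂ := e₀ ⬝ᵥ e₁ ⨯₃ e₂ with hΔdef
  have hΔ : Δ ≠ 0 := by
    rw [hΔdef, ← triple_product_permutation, he₂, single_dotProduct, one_mul]
    exact hk
  have d00 : e₁ ⨯₃ e₂ ⬝ᵥ e₀ = Δ := dotProduct_comm _ _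
  have d11 : e₂ ⨯₃ e₀ ⬝ᵥ e₁ = Δ := by rw [dotProduct_comm, ← triple_product_permutation]
  have d22 : e₀ ⨯₃ e₁ ⬝ᵥ e₂ = Δ := by rw [dotProduct_comm, triple_product_permutation]
  have z1 : ∀ a b : Fin 3 → ℂ, a ⨯₃ b ⬝ᵥ a = 0 := fun a b => by rw [dotProduct_comm, dot_self_cross]
  have z2 : ∀ a b : Fin 3 → ℂ, a ⨯₃ b ⬝ᵥ b = 0 := fun a b => by rw [dotProduct_comm, dot_cross_self]
  refine ⟨⟨![e₀, e₁, e₂], ![Δ⁻¹ • (e₁ ⨯₃ e₂), Δ⁻¹ • (e₂ ⨯₃ e₀), Δ⁻¹ • (e₀ ⨯₃ e₁)], ?_, ?_⟩,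
    fun i => he₀ i (Finset.mem_univ i), hsep⟩
  · rw [forall_fin_three]
    simp only [forall_fin_three]
    simp [d00, d11, d22, z1, z2, hΔ]
  · intro x
    rw [Fin.sum_univ_three]
    have key : (x ⬝ᵥ e₀) • (e₁ ⨯₃ e₂) + (x ⬝ᵥ e₁) • (e₂ ⨯₃ e₀) + (x ⬝ᵥ e₂) • (e₀ ⨯₃ e₁) = Δ • x := by
      rw [hΔdef]
      apply vec_three_ext <;>
      · simp only [dot_three, cross_zero_apply, cross_one_apply, cross_two_apply, Pi.add_apply,
          Pi.smul_apply, smul_eq_mul]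
        ring
    calc _ = Δ⁻¹ • ((x ⬝ᵥ e₀) • (e₁ ⨯₃ e₂) + (x ⬝ᵥ e₁) • (e₂ ⨯₃ e₀) + (x ⬝ᵥ e₂) • (e₀ ⨯₃ e₁)) := by
          simp only [smul_add, Matrix.cons_val_zero, Matrix.cons_val_one, Matrix.cons_val]
          rw [smul_comm, smul_comm (x ⬝ᵥ e₁), smul_comm (x ⬝ᵥ e₂)]
      _ = x := by rw [key, inv_smul_smul₀ hΔ]

namespace Frame

variable (B : Frame)

/-- The substitution expressing a polynomial in the coordinates of the frame. -/
def toCoord : S →ₐ[ℂ] S := aeval fun k => linForm fun j => B.e j k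

/-- The inverse substitution. -/
def ofCoord : S →ₐ[ℂ] S := aeval fun j => linForm (B.ε j)

theorem toCoord_linForm (n : Fin 3 → ℂ) : B.toCoord (linForm n) = linForm fun j => n ⬝ᵥ B.e j := by
  have h : ∀ x : Fin 3 → ℂ, linForm x = ∑ k, C (x k) * X k := fun _ => rfl
  rw [h n, map_sum]
  simp only [map_mul, toCoord, aeval_X, ← algebraMap_eq, AlgHom.commutes]
  simp only [algebraMap_eq, dot_three, Fin.sum_univ_three, h, C_add, C_mul]
  ring

theorem ofCoord_linForm (n : Fin 3 → ℂ) : B.ofCoord (linForm n) = linForm (∑ j, n j • B.ε j) := by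
  have h : linForm n = ∑ k, C (n k) * X k := rfl
  rw [h, map_sum]
  simp only [map_mul, ofCoord, aeval_X, ← algebraMap_eq, AlgHom.commutes]
  simp only [algebraMap_eq, Fin.sum_univ_three, linForm_add, linForm_smul]

theorem X_eq_linForm (k : Fin 3) : (X k : S) = linForm (Pi.single k 1) := by
  simp [linForm, Pi.single_apply]

theorem ofCoord_toCoord (F : S) : B.ofCoord (B.toCoord F) = F := by
  have : B.ofCoord.comp B.toCoord = AlgHom.id ℂ S := algHom_ext fun k => by
    rw [AlgHom.comp_apply, X_eq_linForm, toCoord_linForm, ofCoord_linForm, B.sum]; rfl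
  exact congrArg (fun φ : S →ₐ[ℂ] S => φ F) this

theorem toCoord_ofCoord (F : S) : B.toCoord (B.ofCoord F) = F := by
  have : B.toCoord.comp B.ofCoord = AlgHom.id ℂ S := algHom_ext fun k => by
    rw [AlgHom.comp_apply, X_eq_linForm, ofCoord_linForm, toCoord_linForm, AlgHom.id_apply]
    congr 1
    ext j
    rw [Fin.sum_univ_three]
    simp only [add_dotProduct, smul_dotProduct, B.dot]
    fin_cases k <;> fin_cases j <;> simp
  exact congrArg (fun φ : S →ₐ[ℂ] S => φ F) this

theorem isHomogeneous_toCoord {F : S} {k : ℕ} (hF : F.IsHomogeneous k) :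
    (B.toCoord F).IsHomogeneous k := by
  have := hF.aeval (fun k => linForm fun j => B.e j k) (n := 1) fun k => isHomogeneous_linForm _
  rwa [one_mul] at this

theorem isHomogeneous_ofCoord {F : S} {k : ℕ} (hF : F.IsHomogeneous k) :
    (B.ofCoord F).IsHomogeneous k := by
  have := hF.aeval (fun j => linForm (B.ε j)) (n := 1) fun k => isHomogeneous_linForm _
  rwa [one_mul] at this

end Frame

/-! ### Restriction to the line at infinity -/

/-- The dehomogenized restriction to the line where the last coordinate vanishes. -/
def slice : S →ₐ[ℂ] Polynomial ℂ := aeval ![Polynomial.X, 1, 0]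

theorem coeff_slice_monomial (μ : Fin 3 →₀ ℕ) (c : ℂ) (k : ℕ) :
    (slice (monomial μ c)).coeff k = if μ 0 = k ∧ μ 2 = 0 then c else 0 := by
  rw [slice, aeval_monomial, Finsupp.prod_fintype _ _ fun _ => pow_zero _, Fin.prod_univ_three]
  simp only [Matrix.cons_val_zero, Matrix.cons_val_one, Matrix.cons_val, one_pow, mul_one]
  rw [Polynomial.algebraMap_eq, Polynomial.coeff_C_mul]
  by_cases h2 : μ 2 = 0
  · rw [h2, pow_zero, mul_one, Polynomial.coeff_X_pow]
    by_cases h0 : μ 0 = k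
    · simp [h0]
    · simp [h0, Ne.symm h0]
  · rw [zero_pow h2]; simp [h2]

theorem coeff_slice (G : S) (k : ℕ) :
    (slice G).coeff k = ∑ ν ∈ G.support, if ν 0 = k ∧ ν 2 = 0 then coeff ν G else 0 := by
  conv_lhs => rw [G.as_sum, map_sum]
  rw [Polynomial.finsetSum_coeff]
  exact Finset.sum_congr rfl fun ν _ => coeff_slice_monomial ν _ k

theorem degree_three (ν : Fin 3 →₀ ℕ) : ν.degree = ν 0 + ν 1 + ν 2 := by
  rw [Finsupp.degree_eq_sum, Fin.sum_univ_three]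

theorem coeff_slice_of_isHomogeneous {G : S} {r : ℕ} (hG : G.IsHomogeneous r) {μ : Fin 3 →₀ ℕ}
    (hμ : μ.degree = r) (h2 : μ 2 = 0) : (slice G).coeff (μ 0) = coeff μ G := by
  rw [coeff_slice, Finset.sum_eq_single μ]
  · rw [if_pos ⟨rfl, h2⟩]
  · intro ν hν hne
    rw [if_neg]
    rintro ⟨h0, h2'⟩
    refine hne (Finsupp.ext (forall_fin_three.2 ⟨h0, ?_, by rw [h2, h2']⟩))
    have hd : ν.degree = r := by
      by_contra h
      exact mem_support_iff.1 hν (hG.coeff_eq_zero h)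
    rw [degree_three] at hμ hd
    omega
  · intro h
    rw [if_pos ⟨rfl, h2⟩, notMem_support_iff.1 h]

theorem natDegree_slice_le {G : S} {r : ℕ} (hG : G.IsHomogeneous r) : (slice G).natDegree ≤ r := by
  rw [Polynomial.natDegree_le_iff_coeff_eq_zero]
  intro k hk
  rw [coeff_slice]
  refine Finset.sum_eq_zero fun ν hν => if_neg ?_
  rintro ⟨h0, -⟩
  have hd : ν.degree = r := by
    by_contra h
    exact mem_support_iff.1 hν (hG.coeff_eq_zero h)
  rw [degree_three] at hd
  omega

/-- A homogeneous polynomial is determined by its restriction to a line, by the restriction of its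
normal derivative and by the remaining coefficients. -/
theorem eq_of_slice_eq {G H : S} {r : ℕ} (hG : G.IsHomogeneous r) (hH : H.IsHomogeneous r)
    (h0 : slice G = slice H) (h1 : slice (pderiv 2 G) = slice (pderiv 2 H))
    (h2 : ∀ μ : Fin 3 →₀ ℕ, μ.degree = r → 2 ≤ μ 2 → coeff μ G = coeff μ H) : G = H := by
  ext μ
  by_cases hμ : μ.degree = r
  · obtain h | h | h : μ 2 = 0 ∨ μ 2 = 1 ∨ 2 ≤ μ 2 := by omega
    · rw [← coeff_slice_of_isHomogeneous hG hμ h, h0, coeff_slice_of_isHomogeneous hH hμ h]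
    · set ν := μ - Finsupp.single 2 1 with hν
      have hνμ : ν + Finsupp.single 2 1 = μ :=
        tsub_add_cancel_of_le (Finsupp.single_le_iff.2 h.ge)
      have hν2 : ν 2 = 0 := by
        have := DFunLike.congr_fun hνμ 2
        simp [h] at this
        exact this
      have hνd : ν.degree = r - 1 := by
        rw [← hμ, ← hνμ, map_add, Finsupp.degree_single, Nat.add_sub_cancel]
      have key : ∀ {P : S}, P.IsHomogeneous r → (slice (pderiv 2 P)).coeff (ν 0) = coeff μ P := by
        intro P hP
        rw [coeff_slice_of_isHomogeneous hP.pderiv hνd hν2, coeff_pderiv, hνμ, hν2]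
        simp
      rw [← key hG, h1, key hH]
    · exact h2 μ hμ h
  · rw [hG.coeff_eq_zero hμ, hH.coeff_eq_zero hμ]

theorem slice_monomial_eq_zero {μ : Fin 3 →₀ ℕ} (h : μ 2 ≠ 0) (c : ℂ) : slice (monomial μ c) = 0 := by
  ext k
  rw [coeff_slice_monomial, if_neg fun e => h e.2, Polynomial.coeff_zero]

theorem slice_pderiv_monomial_eq_zero {μ : Fin 3 →₀ ℕ} (h : 2 ≤ μ 2) (c : ℂ) :
    slice (pderiv 2 (monomial μ c)) = 0 := by
  rw [pderiv_monomial]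
  refine slice_monomial_eq_zero ?_ _
  rw [Finsupp.tsub_apply, Finsupp.single_eq_same]
  omega

end Frame

end LineArr

end

noncomputable section

namespace LineArr

open MvPolynomial
open scoped LinearAlgebra.Projectivization Matrix

/-! ### Products of lines in normal form -/

section NormalForm

variable {d : ℕ}

theorem exists_eq_prod_X_sub_C {p : Polynomial ℂ} (hp : p.Monic) (hd : p.natDegree = d) :
    ∃ T : Fin d → ℂ, p = ∏ i, (Polynomial.X - Polynomial.C (T i)) := by
  have hs := IsAlgClosed.splits p
  have h1 := hs.eq_prod_roots_of_monic hp
  have h2 := hs.natDegree_eq_card_roots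
  obtain ⟨l, hl⟩ := Quot.exists_rep p.roots
  have hl' : (l : Multiset ℂ) = p.roots := hl
  rw [← hl'] at h1 h2
  rw [hd, Multiset.coe_card] at h2
  subst h2
  refine ⟨fun i => l.get i, ?_⟩
  conv_lhs => rw [h1]
  rw [Multiset.map_coe, Multiset.prod_coe, ← List.prod_ofFn]
  congr 1
  rw [List.ofFn_comp' _ (fun t => Polynomial.X - Polynomial.C t)]
  simp

namespace Frame

variable (B : Frame)

/-- The restriction of a form to the line at infinity of the frame. -/
def sl : Sd d →ₗ[ℂ] Polynomial ℂ :=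
  slice.toLinearMap ∘ₗ B.toCoord.toLinearMap ∘ₗ (homogeneousSubmodule (Fin 3) ℂ d).subtype

/-- The normal derivative of a form along the line at infinity of the frame. -/
def dsl : Sd d →ₗ[ℂ] Polynomial ℂ :=
  slice.toLinearMap ∘ₗ (pderiv (2 : Fin 3) : Derivation ℂ S S).toLinearMap ∘ₗ B.toCoord.toLinearMap ∘ₗ (homogeneousSubmodule (Fin 3) ℂ d).subtype

theorem sl_apply (F : Sd d) : B.sl F = slice (B.toCoord F) := rfl

theorem dsl_apply (F : Sd d) : B.dsl F = slice (pderiv 2 (B.toCoord F)) := rfl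

theorem homog (F : Sd d) : (B.toCoord (F : S)).IsHomogeneous d :=
  B.isHomogeneous_toCoord ((mem_homogeneousSubmodule _ _).1 F.2)

/-- The polynomial functions of the coefficients of `sl` and `dsl`. -/
def baseFun (d : ℕ) : Subalgebra ℂ (Sd d → ℂ) :=
  Algebra.adjoin ℂ ((Set.range fun k : ℕ => fun F => (B.sl F).coeff k) ∪
    Set.range fun k : ℕ => fun F => (B.dsl F).coeff k)

theorem sl_coeff_mem (k : ℕ) : (fun F => (B.sl F).coeff k) ∈ B.baseFun d :=
  Algebra.subset_adjoin (Or.inl ⟨k, rfl⟩)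

theorem dsl_coeff_mem (k : ℕ) : (fun F => (B.dsl F).coeff k) ∈ B.baseFun d :=
  Algebra.subset_adjoin (Or.inr ⟨k, rfl⟩)

theorem baseFun_le : B.baseFun d ≤ PolyFun (Sd d) := by
  refine Algebra.adjoin_le ?_
  rintro _ (⟨k, rfl⟩ | ⟨k, rfl⟩)
  · exact dual_mem_polyFun (Polynomial.lcoeff ℂ k ∘ₗ B.sl)
  · exact dual_mem_polyFun (Polynomial.lcoeff ℂ k ∘ₗ B.dsl)

theorem eq_of_mem_baseFun {Q : Sd d → ℂ} (hQ : Q ∈ B.baseFun d) {F F' : Sd d}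
    (h : B.sl F = B.sl F') (h' : B.dsl F = B.dsl F') : Q F = Q F' := by
  induction hQ using Algebra.adjoin_induction with
  | mem Q hQ => rcases hQ with ⟨k, rfl⟩ | ⟨k, rfl⟩ <;> simp [h, h']
  | algebraMap c => rfl
  | add Q Q' _ _ h h' => rw [Pi.add_apply, Pi.add_apply, h, h']
  | mul Q Q' _ _ h h' => rw [Pi.mul_apply, Pi.mul_apply, h, h']

/-- The covectors of lines in normal form. -/
def lineVec (x : (Fin d → ℂ) × (Fin d → ℂ)) (i : Fin d) : Fin 3 → ℂ :=
  B.ε 0 - x.1 i • B.ε 1 - x.2 i • B.ε 2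

/-- The product of lines in normal form. -/
def arr (x : (Fin d → ℂ) × (Fin d → ℂ)) : Sd d :=
  ⟨arrEq (B.lineVec x), (mem_homogeneousSubmodule _ _).2 (isHomogeneous_arrEq _)⟩

theorem lineVec_dot (x : (Fin d → ℂ) × (Fin d → ℂ)) (i : Fin d) :
    (fun j => B.lineVec x i ⬝ᵥ B.e j) = ![1, -x.1 i, -x.2 i] := by
  ext j
  rw [lineVec, sub_dotProduct, sub_dotProduct, smul_dotProduct, smul_dotProduct, B.dot, B.dot, B.dot]
  fin_cases j <;> simp

theorem toCoord_arr (x : (Fin d → ℂ) × (Fin d → ℂ)) :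
    B.toCoord (B.arr x : S) = ∏ i, linForm ![1, -x.1 i, -x.2 i] := by
  show B.toCoord (∏ i, linForm (B.lineVec x i)) = _
  rw [map_prod]
  exact Finset.prod_congr rfl fun i _ => by rw [toCoord_linForm, lineVec_dot]

theorem slice_linForm (t s : ℂ) :
    slice (linForm ![1, -t, -s]) = Polynomial.X - Polynomial.C t := by
  rw [show linForm ![1, -t, -s] = ∑ k, C ((![1, -t, -s] : Fin 3 → ℂ) k) * X k from rfl, map_sum]
  simp only [map_mul, slice, aeval_X, ← algebraMap_eq, AlgHom.commutes, Fin.sum_univ_three]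
  simp [sub_eq_add_neg]

theorem sl_arr (x : (Fin d → ℂ) × (Fin d → ℂ)) :
    B.sl (B.arr x) = ∏ i, (Polynomial.X - Polynomial.C (x.1 i)) := by
  rw [sl_apply, toCoord_arr, map_prod]
  exact Finset.prod_congr rfl fun i _ => slice_linForm _ _

/-- To first order in z, the product of the forms X - T_i - s_i z has this sum as coefficient of z.
It is a Lagrange interpolation sum, whose value at T_k recovers s_k when the slopes are distinct. -/
theorem dsl_arr (x : (Fin d → ℂ) × (Fin d → ℂ)) :
    B.dsl (B.arr x) = ∑ i, Polynomial.C (-x.2 i) *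
      ∏ j ∈ Finset.univ.erase i, (Polynomial.X - Polynomial.C (x.1 j)) := by
  rw [dsl_apply, toCoord_arr, pderiv_prod, map_sum]
  refine Finset.sum_congr rfl fun i _ => ?_
  rw [map_mul, map_prod, pderiv_linForm]
  congr 1
  · rw [← algebraMap_eq, AlgHom.commutes]; rfl
  · exact Finset.prod_congr rfl fun i _ => slice_linForm _ _

theorem arr_comp (x : (Fin d → ℂ) × (Fin d → ℂ)) (σ : Equiv.Perm (Fin d)) :
    B.arr (x.1 ∘ σ, x.2 ∘ σ) = B.arr x :=
  Subtype.ext (Equiv.prod_comp σ fun i => linForm (B.lineVec x i))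

/-- The leading coefficient. -/
def lead : Module.Dual ℂ (Sd d) := Polynomial.lcoeff ℂ d ∘ₗ B.sl

theorem lead_apply (F : Sd d) : B.lead F = (B.sl F).coeff d := rfl

theorem lead_arr (x : (Fin d → ℂ) × (Fin d → ℂ)) : B.lead (B.arr x) = 1 := by
  rw [lead_apply, sl_arr]
  have h := Polynomial.monic_prod_X_sub_C x.1 Finset.univ
  have h2 : (∏ i, (Polynomial.X - Polynomial.C (x.1 i))).natDegree = d := by
    rw [Polynomial.natDegree_finsetProd_X_sub_C_eq_card, Finset.card_univ, Fintype.card_fin]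
  have h3 := h.coeff_natDegree
  rwa [h2] at h3

theorem exists_sl_eq {F : Sd d} (hF : B.lead F = 1) :
    ∃ T : Fin d → ℂ, B.sl F = ∏ i, (Polynomial.X - Polynomial.C (T i)) := by
  have h1 : (B.sl F).natDegree ≤ d := natDegree_slice_le (B.homog F)
  have h2 : (B.sl F).Monic := Polynomial.monic_of_natDegree_le_of_coeff_eq_one d h1 hF
  refine exists_eq_prod_X_sub_C h2 (le_antisymm h1 (Polynomial.le_natDegree_of_ne_zero ?_))
  rw [← lead_apply, hF]
  exact one_ne_zero

/-- The product of the differences of the slopes. -/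
def disc (x : (Fin d → ℂ) × (Fin d → ℂ)) : ℂ := ∏ i, ∏ j ∈ Finset.univ.erase i, (x.1 i - x.1 j)

theorem disc_ne_zero {x : (Fin d → ℂ) × (Fin d → ℂ)} : disc x ≠ 0 ↔ Function.Injective x.1 := by
  rw [disc, Finset.prod_ne_zero_iff]
  simp only [Finset.prod_ne_zero_iff, Finset.mem_erase, Finset.mem_univ, and_true, true_implies,
    sub_ne_zero]
  constructor
  · intro h i j hij
    by_contra hne
    exact h i j (Ne.symm hne) hij
  · intro h i j hne hij
    exact hne (h hij).symm

theorem disc_comp (x : (Fin d → ℂ) × (Fin d → ℂ)) (σ : Equiv.Perm (Fin d)) :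
    disc (x.1 ∘ σ, x.2 ∘ σ) = disc x := by
  refine Finset.prod_equiv σ (by simp) fun i _ => ?_
  exact Finset.prod_equiv σ (by simp) fun _ _ => rfl

theorem eval_dsl_arr (x : (Fin d → ℂ) × (Fin d → ℂ)) (k : Fin d) :
    (B.dsl (B.arr x)).eval (x.1 k) = -x.2 k * ∏ j ∈ Finset.univ.erase k, (x.1 k - x.1 j) := by
  rw [dsl_arr, Polynomial.eval_finsetSum, Finset.sum_eq_single k]
  · simp [Polynomial.eval_prod]
  · intro i _ hik
    rw [Polynomial.eval_mul, Polynomial.eval_prod, Finset.prod_eq_zero (i := k), mul_zero]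
    · exact Finset.mem_erase.2 ⟨hik.symm, Finset.mem_univ _⟩
    · simp
  · simp

theorem natDegree_dsl_lt (hd : 0 < d) (F : Sd d) : (B.dsl F).natDegree < d := by
  have := natDegree_slice_le ((B.homog F).pderiv (i := 2))
  exact lt_of_le_of_lt this (by omega)

/-- Lagrange interpolation: `dsl F` has degree less than `d`, and the s_k prescribe its values at
the `d` distinct slopes. -/
theorem exists_dsl_eq (hd : 0 < d) (F : Sd d) {T : Fin d → ℂ} (hT : Function.Injective T) :
    ∃ s : Fin d → ℂ, B.dsl F = B.dsl (B.arr (T, s)) := by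
  refine ⟨fun k => -((B.dsl F).eval (T k) / ∏ j ∈ Finset.univ.erase k, (T k - T j)), ?_⟩
  have hdeg : ∀ G : Sd d, (B.dsl G).degree < (Finset.univ : Finset (Fin d)).card := by
    intro G
    rw [Finset.card_univ, Fintype.card_fin]
    exact lt_of_le_of_lt Polynomial.degree_le_natDegree (by exact_mod_cast B.natDegree_dsl_lt hd G)
  refine Polynomial.eq_of_degrees_lt_of_eval_index_eq Finset.univ (v := T) hT.injOn (hdeg _) (hdeg _)
    fun k _ => ?_
  have h0 : ∏ j ∈ Finset.univ.erase k, (T k - T j) ≠ 0 :=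
    Finset.prod_ne_zero_iff.2 fun j hj => sub_ne_zero.2 fun e => (Finset.mem_erase.1 hj).1 (hT e).symm
  have := B.eval_dsl_arr (T, fun k => -((B.dsl F).eval (T k) / ∏ j ∈ Finset.univ.erase k, (T k - T j))) k
  rw [this, neg_neg, div_mul_cancel₀ _ h0]

/-- Vieta's formula; it makes the elementary symmetric functions of the slopes polynomial in the
base coordinates. -/
theorem esymm_eq_coeff (T : Fin d → ℂ) (k : Fin d) :
    aeval T (esymm (Fin d) ℂ (k + 1)) = (-1) ^ ((k : ℕ) + 1) *
      (∏ i, (Polynomial.X - Polynomial.C (T i))).coeff (d - (k + 1)) := by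
  have h := Multiset.prod_X_sub_C_coeff (Finset.univ.val.map T) (k := d - (k + 1)) (by simp)
  rw [Multiset.map_map] at h
  have h2 : (Multiset.map ((fun t => Polynomial.X - Polynomial.C t) ∘ T) Finset.univ.val).prod =
    ∏ i, (Polynomial.X - Polynomial.C (T i)) := rfl
  have h3 : d - (d - ((k : ℕ) + 1)) = k + 1 := by omega
  rw [h2, Multiset.card_map, Finset.card_val, Finset.card_univ, Fintype.card_fin, h3] at h
  rw [h, aeval_esymm_eq_multiset_esymm, ← mul_assoc, ← mul_pow]
  simp

end Frame

end NormalForm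

end LineArr

end

noncomputable section

namespace LineArr

open MvPolynomial
open scoped LinearAlgebra.Projectivization Matrix

/-! ### Symmetrization -/

namespace Frame

variable {d : ℕ} (B : Frame)

/-- The functions of the parameters of a product of lines which depend polynomially on the base
coordinates of the product. -/
def symFun (d : ℕ) : Subalgebra ℂ ((Fin d → ℂ) × (Fin d → ℂ) → ℂ) :=
  (B.baseFun d).map (AlgHom.pi fun x => Pi.evalAlgHom ℂ (fun _ => ℂ) (B.arr x))

theorem mem_symFun {f : (Fin d → ℂ) × (Fin d → ℂ) → ℂ} :
    f ∈ B.symFun d ↔ ∃ Q ∈ B.baseFun d, ∀ x, Q (B.arr x) = f x := by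
  rw [symFun, Subalgebra.mem_map]
  exact exists_congr fun Q => and_congr_right fun _ => funext_iff

/-- Polynomial functions of the parameters. -/
def paramFun (d : ℕ) : Subalgebra ℂ ((Fin d → ℂ) × (Fin d → ℂ) → ℂ) :=
  Algebra.adjoin ℂ ((Set.range fun i : Fin d => fun x => x.1 i) ∪
    Set.range fun i : Fin d => fun x => x.2 i)

/-- Polynomials in the slopes over the algebra `symFun`. -/
def slopeEval (d : ℕ) : MvPolynomial (Fin d) (B.symFun d) →ₐ[B.symFun d]
    ((Fin d → ℂ) × (Fin d → ℂ) → ℂ) := aeval fun i x => x.1 i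

theorem symFun_mem_range {f : (Fin d → ℂ) × (Fin d → ℂ) → ℂ} (hf : f ∈ B.symFun d) :
    f ∈ (B.slopeEval d).range :=
  (B.slopeEval d).range.algebraMap_mem (⟨f, hf⟩ : B.symFun d)

theorem fst_mem_range (i : Fin d) :
    (fun x : (Fin d → ℂ) × (Fin d → ℂ) => x.1 i) ∈ (B.slopeEval d).range :=
  ⟨X i, aeval_X _ i⟩

theorem const_mem_range (c : ℂ) :
    (fun _ : (Fin d → ℂ) × (Fin d → ℂ) => c) ∈ (B.slopeEval d).range :=
  B.symFun_mem_range ((B.symFun d).algebraMap_mem c)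

theorem prod_erase_mem_range (i : Fin d) :
    (fun x : (Fin d → ℂ) × (Fin d → ℂ) => ∏ j ∈ Finset.univ.erase i, (x.1 i - x.1 j)) ∈
      (B.slopeEval d).range := by
  convert (B.slopeEval d).range.prod_mem (t := Finset.univ.erase i)
    (f := fun j (x : (Fin d → ℂ) × (Fin d → ℂ)) => x.1 i - x.1 j) fun j _ =>
      (B.slopeEval d).range.sub_mem (B.fst_mem_range i) (B.fst_mem_range j) using 1
  ext x; simp

theorem disc_mem_range : (disc : (Fin d → ℂ) × (Fin d → ℂ) → ℂ) ∈ (B.slopeEval d).range := by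
  convert (B.slopeEval d).range.prod_mem (t := Finset.univ) fun i _ => B.prod_erase_mem_range i using 1
  ext x; simp [disc]

/-- The value of `dsl` at the slope T_i is -s_i ∏ (T_i - T_j), so multiplication by the discriminant
turns s_i into a polynomial in the slopes over `symFun`. -/
theorem disc_mul_snd_mem_range (i : Fin d) :
    (fun x : (Fin d → ℂ) × (Fin d → ℂ) => disc x * x.2 i) ∈ (B.slopeEval d).range := by
  have hd : 0 < d := Fin.pos i
  have h1 : (fun x : (Fin d → ℂ) × (Fin d → ℂ) => (B.dsl (B.arr x)).eval (x.1 i)) ∈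
      (B.slopeEval d).range := by
    convert (B.slopeEval d).range.sum_mem (t := Finset.range d)
      (f := fun k (x : (Fin d → ℂ) × (Fin d → ℂ)) => (B.dsl (B.arr x)).coeff k * x.1 i ^ k)
      fun k _ => (B.slopeEval d).range.mul_mem
        (B.symFun_mem_range (B.mem_symFun.2 ⟨_, B.dsl_coeff_mem k, fun x => rfl⟩))
        ((B.slopeEval d).range.pow_mem (B.fst_mem_range i) k) using 1
    ext x
    rw [Finset.sum_apply, Polynomial.eval_eq_sum_range' (B.natDegree_dsl_lt hd _)]
  have h2 : (fun x : (Fin d → ℂ) × (Fin d → ℂ) =>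
      ∏ k ∈ Finset.univ.erase i, ∏ j ∈ Finset.univ.erase k, (x.1 k - x.1 j)) ∈
      (B.slopeEval d).range := by
    convert (B.slopeEval d).range.prod_mem (t := Finset.univ.erase i)
      fun k _ => B.prod_erase_mem_range k using 1
    ext x; simp
  convert (B.slopeEval d).range.neg_mem ((B.slopeEval d).range.mul_mem h1 h2) using 1
  ext x
  simp only [Pi.neg_apply, Pi.mul_apply]
  rw [disc, ← Finset.mul_prod_erase _ _ (Finset.mem_univ i), eval_dsl_arr]
  ring

theorem exists_disc_pow_mul_mem_range {H : (Fin d → ℂ) × (Fin d → ℂ) → ℂ} (hH : H ∈ paramFun d) :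
    ∃ N : ℕ, (fun x => disc x ^ N * H x) ∈ (B.slopeEval d).range := by
  induction hH using Algebra.adjoin_induction with
  | mem H hH =>
    rcases hH with ⟨i, rfl⟩ | ⟨i, rfl⟩
    · exact ⟨0, by simpa using B.fst_mem_range i⟩
    · exact ⟨1, by simpa using B.disc_mul_snd_mem_range i⟩
  | algebraMap c => exact ⟨0, by simpa using B.const_mem_range c⟩
  | add H H' _ _ h h' =>
    obtain ⟨N, h⟩ := h; obtain ⟨N', h'⟩ := h'
    refine ⟨N + N', ?_⟩
    convert (B.slopeEval d).range.add_mem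
      ((B.slopeEval d).range.mul_mem ((B.slopeEval d).range.pow_mem B.disc_mem_range N') h)
      ((B.slopeEval d).range.mul_mem ((B.slopeEval d).range.pow_mem B.disc_mem_range N) h') using 1
    ext x
    simp only [Pi.add_apply, Pi.mul_apply, Pi.pow_apply]
    ring
  | mul H H' _ _ h h' =>
    obtain ⟨N, h⟩ := h; obtain ⟨N', h'⟩ := h'
    refine ⟨N + N', ?_⟩
    convert (B.slopeEval d).range.mul_mem h h' using 1
    ext x
    simp only [Pi.mul_apply]
    ring

/-- Permutation of the parameters, as an algebra automorphism over `symFun`. -/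
def permHom (σ : Equiv.Perm (Fin d)) : ((Fin d → ℂ) × (Fin d → ℂ) → ℂ) →ₐ[B.symFun d]
    ((Fin d → ℂ) × (Fin d → ℂ) → ℂ) where
  toFun f x := f (x.1 ∘ σ, x.2 ∘ σ)
  map_one' := rfl
  map_mul' _ _ := rfl
  map_zero' := rfl
  map_add' _ _ := rfl
  commutes' := by
    rintro ⟨f, hf⟩
    obtain ⟨Q, -, hQ⟩ := B.mem_symFun.1 hf
    ext x
    show f (x.1 ∘ σ, x.2 ∘ σ) = f x
    rw [← hQ, ← hQ, arr_comp]

/-- Permutations fix `symFun`, so the sum is a symmetric polynomial in the slopes over it. By the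
fundamental theorem it is a polynomial in the elementary symmetric functions, which are coefficients
of `sl` up to sign. -/
theorem sum_perm_mem_symFun {K : (Fin d → ℂ) × (Fin d → ℂ) → ℂ} (hK : K ∈ (B.slopeEval d).range) :
    (fun x : (Fin d → ℂ) × (Fin d → ℂ) => ∑ σ : Equiv.Perm (Fin d), K (x.1 ∘ σ, x.2 ∘ σ)) ∈
      B.symFun d := by
  obtain ⟨p, rfl⟩ := hK
  have hren : ∀ σ : Equiv.Perm (Fin d), B.permHom σ (B.slopeEval d p) =
      B.slopeEval d (rename σ p) := by
    intro σ
    have : (B.permHom σ).comp (B.slopeEval d) = (B.slopeEval d).comp (rename σ) :=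
      algHom_ext fun i => by
        rw [AlgHom.comp_apply, AlgHom.comp_apply, rename_X, slopeEval, aeval_X, aeval_X]; rfl
    exact congrArg (fun φ : MvPolynomial (Fin d) (B.symFun d) →ₐ[B.symFun d] _ => φ p) this
  have hsym : (∑ σ : Equiv.Perm (Fin d), rename σ p).IsSymmetric := by
    intro τ
    rw [map_sum]
    simp only [rename_rename]
    exact Fintype.sum_equiv (Equiv.mulLeft τ) _ _ fun σ => rfl
  obtain ⟨q, hq⟩ := esymmAlgHom_surjective (B.symFun d) (σ := Fin d) (n := d) (by simp)
    ⟨_, (mem_symmetricSubalgebra _).2 hsym⟩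
  have hq' := congrArg Subtype.val hq
  rw [esymmAlgHom_apply] at hq'
  replace hq' : aeval (fun k : Fin d => esymm (Fin d) (B.symFun d) (k + 1)) q =
    ∑ σ : Equiv.Perm (Fin d), rename σ p := hq'
  have hb : ∀ k : Fin d, B.slopeEval d (esymm (Fin d) (B.symFun d) (k + 1)) ∈ B.symFun d := by
    intro k
    refine B.mem_symFun.2 ⟨fun F => (-1) ^ ((k : ℕ) + 1) * (B.sl F).coeff (d - (k + 1)),
      (B.baseFun d).mul_mem ((B.baseFun d).algebraMap_mem _) (B.sl_coeff_mem _), fun x => ?_⟩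
    simp only [sl_arr]
    rw [← esymm_eq_coeff, esymm, esymm, map_sum, map_sum, Finset.sum_apply]
    refine Finset.sum_congr rfl fun t _ => ?_
    rw [map_prod, map_prod, Finset.prod_apply]
    refine Finset.prod_congr rfl fun i _ => ?_
    rw [aeval_X, slopeEval, aeval_X]
  have key : (∑ σ : Equiv.Perm (Fin d), B.slopeEval d (rename σ p)) ∈ B.symFun d := by
    rw [← map_sum, ← hq']
    clear hq hq' hsym
    induction q using MvPolynomial.induction_on with
    | C a => rw [← algebraMap_eq, AlgHom.commutes, AlgHom.commutes]; exact a.2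
    | add p q hp hq => rw [map_add, map_add]; exact (B.symFun d).add_mem hp hq
    | mul_X p k hp => rw [map_mul, map_mul, aeval_X]; exact (B.symFun d).mul_mem hp (hb k)
  convert key using 1
  ext x
  rw [Finset.sum_apply]
  exact Finset.sum_congr rfl fun σ _ => by rw [← hren]; rfl

/-- The symmetrization of a polynomial in the parameters is, up to a power of the discriminant, a
polynomial in the base coordinates. -/
theorem exists_symmetrization {H : (Fin d → ℂ) × (Fin d → ℂ) → ℂ} (hH : H ∈ paramFun d) :
    ∃ (N : ℕ) (Q : Sd d → ℂ), Q ∈ B.baseFun d ∧ ∀ x, Q (B.arr x) =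
      disc x ^ N * ∑ σ : Equiv.Perm (Fin d), H (x.1 ∘ σ, x.2 ∘ σ) := by
  obtain ⟨N, hN⟩ := B.exists_disc_pow_mul_mem_range hH
  obtain ⟨Q, hQ, h⟩ := B.mem_symFun.1 (B.sum_perm_mem_symFun hN)
  refine ⟨N, Q, hQ, fun x => ?_⟩
  rw [h, Finset.mul_sum]
  exact Finset.sum_congr rfl fun σ _ => by simp only [disc_comp]

/-- The discriminant as a polynomial in the base coordinates. -/
theorem exists_disc (d : ℕ) : ∃ D ∈ B.baseFun d, ∀ (F : Sd d) (x : (Fin d → ℂ) × (Fin d → ℂ)),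
    B.sl F = ∏ i, (Polynomial.X - Polynomial.C (x.1 i)) → D F = disc x := by
  set P : MvPolynomial (Fin d) ℂ := ∏ i, ∏ j ∈ Finset.univ.erase i, (X i - X j) with hP
  have hsym : P.IsSymmetric := by
    intro τ
    rw [hP, map_prod]
    refine Finset.prod_equiv τ (by simp) fun i _ => ?_
    rw [map_prod]
    refine Finset.prod_equiv τ (by simp) fun j _ => ?_
    rw [map_sub, rename_X, rename_X]
  obtain ⟨q, hq⟩ := esymmAlgHom_surjective ℂ (σ := Fin d) (n := d) (by simp)
    ⟨_, (mem_symmetricSubalgebra _).2 hsym⟩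
  have hq' := congrArg Subtype.val hq
  rw [esymmAlgHom_apply] at hq'
  replace hq' : aeval (fun k : Fin d => esymm (Fin d) ℂ (k + 1)) q = P := hq'
  set b : Fin d → B.baseFun d := fun k =>
    ⟨fun F => (-1) ^ ((k : ℕ) + 1) * (B.sl F).coeff (d - (k + 1)),
      (B.baseFun d).mul_mem ((B.baseFun d).algebraMap_mem _) (B.sl_coeff_mem _)⟩ with hb
  refine ⟨_, (aeval b q).2, fun F x hx => ?_⟩
  have h1 : (aeval b q : B.baseFun d).1 F = aeval (fun k => (b k).1 F) q := by
    have : (((Pi.evalAlgHom ℂ (fun _ : Sd d => ℂ) F).comp (B.baseFun d).val).comp (aeval b)) =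
      aeval (fun k => (b k).1 F) := algHom_ext fun k => by
        rw [AlgHom.comp_apply, aeval_X, aeval_X]; rfl
    exact congrArg (fun φ : MvPolynomial (Fin d) ℂ →ₐ[ℂ] ℂ => φ q) this
  have h2 : (fun k => (b k).1 F) = fun k : Fin d => aeval x.1 (esymm (Fin d) ℂ (k + 1)) := by
    ext k
    rw [esymm_eq_coeff, ← hx]
  rw [h1, h2, ← comp_aeval_apply, hq', hP, disc, map_prod]
  refine Finset.prod_congr rfl fun i _ => ?_
  rw [map_prod]
  exact Finset.prod_congr rfl fun j _ => by rw [map_sub, aeval_X, aeval_X]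

end Frame

end LineArr

end

noncomputable section

namespace LineArr

open MvPolynomial
open scoped LinearAlgebra.Projectivization Matrix

/-! ### Unordered arrangements of the given type -/

section UnorderedStratum

variable {d m : ℕ} {M : Finset (Fin d)}

theorem mem_AL_iff (hm : 2 ≤ m) (hmd : m ≤ d) {q : Curves d} {c : ℂ} (hc : c ≠ 0) :
    q ∈ AL d (Ldm d m) ↔ ∃ (n : Fin d → Fin 3 → ℂ) (M : Finset (Fin d)) (v : Fin 3 → ℂ),
      TypeData m n M v ∧ ((c • q.rep : Sd d) : S) = arrEq n := by
  constructor
  · rintro ⟨l, hl, rfl⟩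
    rw [XL_Ldm_eq hm hmd] at hl
    obtain ⟨n, M, v, hT, e⟩ := exists_typeData_of_mem hm hl.1 hl.2
    obtain ⟨t, ht, e'⟩ := exists_arrEq_smul_eq (by omega) n hc
    exact ⟨_, M, v, hT.smul ht, by rw [e', Submodule.coe_smul, e, smul_eq_C_mul]⟩
  · rintro ⟨n, M, v, hT, e⟩
    obtain ⟨l, t, ht, hl, hT'⟩ := covec_ofCovec_typeData (hm.trans hmd) hT
    refine ⟨l, ?_, ?_⟩
    · rw [XL_Ldm_eq hm hmd]
      exact (exists_typeData_iff hm).2 ⟨M, v, hT'⟩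
    · obtain ⟨κ, hκ, h⟩ := psi_rep l
      have h' : ((psi l).rep : S) = C κ * arrEq fun i => covec (l i) := h
      rw [← (psi l).mk_rep, ← q.mk_rep, Projectivization.mk_eq_mk_iff']
      refine ⟨κ * (∏ i, t i) * c, Subtype.ext ?_⟩
      rw [h', mul_smul, Submodule.coe_smul, e]
      simp only [hl]
      rw [arrEq_smul, smul_eq_C_mul, C_mul, mul_assoc]

theorem TypeData.comp {n : Fin d → Fin 3 → ℂ} {v : Fin 3 → ℂ} (h : TypeData m n M v)
    (σ : Equiv.Perm (Fin d)) : TypeData m (n ∘ σ) (M.map σ.symm.toEmbedding) v where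
  card := by rw [Finset.card_map, h.card]
  ne_zero := h.ne_zero
  dot i hi := h.dot _ (by simpa using hi)
  cross i j hij := h.cross _ _ fun e => hij (σ.injective e)
  triple i j k hij hik hjk hM := h.triple _ _ _ (fun e => hij (σ.injective e))
    (fun e => hik (σ.injective e)) (fun e => hjk (σ.injective e)) (by simpa using hM)

/-- The determinant of three lines in normal form. -/
def tri (x : (Fin d → ℂ) × (Fin d → ℂ)) (i j k : Fin d) : ℂ :=
  (x.1 j - x.1 i) * (x.2 k - x.2 i) - (x.1 k - x.1 i) * (x.2 j - x.2 i)

/-- Lines passing through the intersection of lines i₁ and i₂ are concurrent; this identity makes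
the implication explicit. -/
theorem slope_mul_tri (x : (Fin d → ℂ) × (Fin d → ℂ)) (i₁ i₂ a b c : Fin d) :
    (x.1 i₂ - x.1 i₁) * tri x a b c = (x.1 c - x.1 b) * tri x i₁ i₂ a +
      (x.1 a - x.1 c) * tri x i₁ i₂ b + (x.1 b - x.1 a) * tri x i₁ i₂ c := by
  simp only [tri]; ring

/-- The product of the determinants of the triples not contained in `M`. -/
def offTri (M : Finset (Fin d)) (x : (Fin d → ℂ) × (Fin d → ℂ)) : ℂ :=
  ∏ t ∈ offTriples M, tri x t.1 t.2.1 t.2.2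

namespace Frame

variable (B : Frame)

theorem triple_ne_zero : B.ε 0 ⬝ᵥ B.ε 1 ⨯₃ B.ε 2 ≠ 0 := by
  have h : (Matrix.of B.ε) * (Matrix.of B.e)ᵀ = 1 := by
    ext i j
    rw [Matrix.mul_apply, Matrix.one_apply, ← B.dot i j]
    rfl
  have h' := congrArg Matrix.det h
  rw [Matrix.det_mul, Matrix.det_one] at h'
  rw [triple_product_eq_det]
  have h2 : (![B.ε 0, B.ε 1, B.ε 2] : Matrix (Fin 3) (Fin 3) ℂ) = Matrix.of B.ε := by
    ext i j; fin_cases i <;> rfl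
  rw [h2]
  exact left_ne_zero_of_mul_eq_one h'

theorem lineVec_triple (x : (Fin d → ℂ) × (Fin d → ℂ)) (i j k : Fin d) :
    B.lineVec x i ⬝ᵥ B.lineVec x j ⨯₃ B.lineVec x k = (B.ε 0 ⬝ᵥ B.ε 1 ⨯₃ B.ε 2) * tri x i j k := by
  simp only [lineVec, tri, dot_three, cross_zero_apply, cross_one_apply, cross_two_apply,
    Pi.sub_apply, Pi.smul_apply, smul_eq_mul]
  ring

theorem lineVec_cross_ne_zero {x : (Fin d → ℂ) × (Fin d → ℂ)} {i j : Fin d} (h : x.1 i ≠ x.1 j) :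
    B.lineVec x i ⨯₃ B.lineVec x j ≠ 0 := by
  intro h0
  have h1 : B.ε 2 ⬝ᵥ B.lineVec x i ⨯₃ B.lineVec x j =
      (B.ε 0 ⬝ᵥ B.ε 1 ⨯₃ B.ε 2) * (x.1 i - x.1 j) := by
    simp only [lineVec, dot_three, cross_zero_apply, cross_one_apply, cross_two_apply,
      Pi.sub_apply, Pi.smul_apply, smul_eq_mul]
    ring
  rw [h0, dotProduct_zero] at h1
  exact mul_ne_zero B.triple_ne_zero (sub_ne_zero.2 h) h1.symm

theorem distinctLines_lineVec {x : (Fin d → ℂ) × (Fin d → ℂ)} (h : Function.Injective x.1) :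
    DistinctLines (B.lineVec x) := fun _ _ hij => B.lineVec_cross_ne_zero (h.ne hij)

theorem offTri_ne_zero {x : (Fin d → ℂ) × (Fin d → ℂ)} :
    offTri M x ≠ 0 ↔ offDet M (B.lineVec x) ≠ 0 := by
  rw [offTri, offDet, Finset.prod_ne_zero_iff, Finset.prod_ne_zero_iff]
  refine forall₂_congr fun t _ => ?_
  rw [lineVec_triple, mul_ne_zero_iff, and_iff_right B.triple_ne_zero]

theorem tri_eq_zero {x : (Fin d → ℂ) × (Fin d → ℂ)} {i j k : Fin d} :
    tri x i j k = 0 ↔ B.lineVec x i ⬝ᵥ B.lineVec x j ⨯₃ B.lineVec x k = 0 := by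
  rw [lineVec_triple, mul_eq_zero, or_iff_right B.triple_ne_zero]

theorem exists_eq_smul_lineVec {n : Fin d → Fin 3 → ℂ} (h : ∀ i, n i ⬝ᵥ B.e 0 ≠ 0) :
    ∃ x : (Fin d → ℂ) × (Fin d → ℂ), (∀ i, B.lineVec x i = (n i ⬝ᵥ B.e 0)⁻¹ • n i) ∧
      ∀ i, x.1 i = -(n i ⬝ᵥ B.e 1) / (n i ⬝ᵥ B.e 0) := by
  refine ⟨(fun i => -(n i ⬝ᵥ B.e 1) / (n i ⬝ᵥ B.e 0), fun i => -(n i ⬝ᵥ B.e 2) / (n i ⬝ᵥ B.e 0)),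
    fun i => ?_, fun i => rfl⟩
  have hs := B.sum (n i)
  rw [Fin.sum_univ_three] at hs
  ext k
  have hk := congrFun hs k
  have hi := h i
  simp only [lineVec, Pi.sub_apply, Pi.smul_apply, Pi.add_apply, smul_eq_mul] at hk ⊢
  rw [← hk]
  field_simp
  ring

theorem lead_arrEq {F : Sd d} {n : Fin d → Fin 3 → ℂ} (hF : (F : S) = arrEq n) :
    B.lead F = ∏ i, n i ⬝ᵥ B.e 0 := by
  rw [lead_apply, sl_apply, hF, arrEq, map_prod, map_prod]
  have h : ∀ i, slice (B.toCoord (linForm (n i))) =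
      Polynomial.C (n i ⬝ᵥ B.e 0) * Polynomial.X + Polynomial.C (n i ⬝ᵥ B.e 1) := by
    intro i
    rw [toCoord_linForm, show ∀ u : Fin 3 → ℂ, linForm u = ∑ k, C (u k) * X k from fun _ => rfl,
      map_sum]
    simp only [map_mul, slice, aeval_X, ← algebraMap_eq, AlgHom.commutes, Fin.sum_univ_three]
    simp
  simp only [h]
  have := Polynomial.coeff_prod_of_natDegree_le (s := (Finset.univ : Finset (Fin d)))
    (fun i => Polynomial.C (n i ⬝ᵥ B.e 0) * Polynomial.X + Polynomial.C (n i ⬝ᵥ B.e 1)) 1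
    fun i _ => Polynomial.natDegree_linear_le
  rw [Finset.card_univ, Fintype.card_fin, mul_one] at this
  rw [this]
  exact Finset.prod_congr rfl fun i _ => by simp

theorem arr_eq_of_smul {F : Sd d} {n : Fin d → Fin 3 → ℂ} (hF : (F : S) = arrEq n)
    {x : (Fin d → ℂ) × (Fin d → ℂ)} (hx : ∀ i, B.lineVec x i = (n i ⬝ᵥ B.e 0)⁻¹ • n i) :
    B.arr x = (B.lead F)⁻¹ • F := by
  refine Subtype.ext ?_
  show arrEq (B.lineVec x) = (B.lead F)⁻¹ • (F : S)
  rw [show B.lineVec x = fun i => (n i ⬝ᵥ B.e 0)⁻¹ • n i from funext hx, arrEq_smul, hF,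
    smul_eq_C_mul, B.lead_arrEq hF, Finset.prod_inv_distrib]

theorem mem_AL_iff (hm : 2 ≤ m) (hmd : m ≤ d) {q : Curves d} {c : ℂ}
    (hc : B.lead (c • q.rep) = 1) : q ∈ AL d (Ldm d m) ↔
      ∃ (x : (Fin d → ℂ) × (Fin d → ℂ)) (M : Finset (Fin d)) (v : Fin 3 → ℂ),
        TypeData m (B.lineVec x) M v ∧ c • q.rep = B.arr x := by
  have hc0 : c ≠ 0 := by
    rintro rfl
    rw [zero_smul, map_zero] at hc
    exact zero_ne_one hc
  rw [LineArr.mem_AL_iff hm hmd hc0]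
  constructor
  · rintro ⟨n, M, v, hT, e⟩
    have h0 : ∏ i, n i ⬝ᵥ B.e 0 ≠ 0 := by
      rw [← B.lead_arrEq e, hc]; exact one_ne_zero
    rw [Finset.prod_ne_zero_iff] at h0
    obtain ⟨x, hx, -⟩ := B.exists_eq_smul_lineVec fun i => h0 i (Finset.mem_univ i)
    refine ⟨x, M, v, ?_, ?_⟩
    · rw [show B.lineVec x = fun i => (n i ⬝ᵥ B.e 0)⁻¹ • n i from funext hx]
      exact hT.smul fun i => inv_ne_zero (h0 i (Finset.mem_univ i))
    · rw [B.arr_eq_of_smul e hx, hc, inv_one, one_smul]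
  · rintro ⟨x, M, v, hT, e⟩
    exact ⟨_, M, v, hT, by rw [e]; rfl⟩

end Frame

/-! ### Polynomial functions of the parameters -/

theorem fst_mem_paramFun (i : Fin d) : (fun x => x.1 i) ∈ Frame.paramFun d :=
  Algebra.subset_adjoin (Or.inl ⟨i, rfl⟩)

theorem snd_mem_paramFun (i : Fin d) : (fun x => x.2 i) ∈ Frame.paramFun d :=
  Algebra.subset_adjoin (Or.inr ⟨i, rfl⟩)

theorem const_mem_paramFun (c : ℂ) : (fun _ => c) ∈ Frame.paramFun d :=
  (Frame.paramFun d).algebraMap_mem c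

theorem tri_mem_paramFun (i j k : Fin d) : (fun x => tri x i j k) ∈ Frame.paramFun d := by
  exact (Frame.paramFun d).sub_mem
    ((Frame.paramFun d).mul_mem ((Frame.paramFun d).sub_mem (fst_mem_paramFun j) (fst_mem_paramFun i))
      ((Frame.paramFun d).sub_mem (snd_mem_paramFun k) (snd_mem_paramFun i)))
    ((Frame.paramFun d).mul_mem ((Frame.paramFun d).sub_mem (fst_mem_paramFun k) (fst_mem_paramFun i))
      ((Frame.paramFun d).sub_mem (snd_mem_paramFun j) (snd_mem_paramFun i)))

theorem prod_mem_paramFun {κ : Type} (s : Finset κ) {f : κ → (Fin d → ℂ) × (Fin d → ℂ) → ℂ}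
    (h : ∀ i ∈ s, f i ∈ Frame.paramFun d) : (fun x => ∏ i ∈ s, f i x) ∈ Frame.paramFun d := by
  convert (Frame.paramFun d).prod_mem h using 1
  ext x; simp

theorem sum_mem_paramFun {κ : Type} (s : Finset κ) {f : κ → (Fin d → ℂ) × (Fin d → ℂ) → ℂ}
    (h : ∀ i ∈ s, f i ∈ Frame.paramFun d) : (fun x => ∑ i ∈ s, f i x) ∈ Frame.paramFun d := by
  convert (Frame.paramFun d).sum_mem h using 1
  ext x; simp

theorem offTri_mem_paramFun (M : Finset (Fin d)) : offTri M ∈ Frame.paramFun d :=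
  prod_mem_paramFun _ fun _ _ => tri_mem_paramFun _ _ _

theorem comp_mem_paramFun {f : (Fin d → ℂ) × (Fin d → ℂ) → ℂ} (hf : f ∈ Frame.paramFun d)
    (σ : Equiv.Perm (Fin d)) : (fun x => f (x.1 ∘ σ, x.2 ∘ σ)) ∈ Frame.paramFun d := by
  induction hf using Algebra.adjoin_induction with
  | mem f hf =>
    rcases hf with ⟨i, rfl⟩ | ⟨i, rfl⟩
    · exact fst_mem_paramFun (σ i)
    · exact snd_mem_paramFun (σ i)
  | algebraMap c => exact const_mem_paramFun c
  | add f f' _ _ h h' => exact (Frame.paramFun d).add_mem h h'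
  | mul f f' _ _ h h' => exact (Frame.paramFun d).mul_mem h h'

theorem coeff_prod_linForm_mem_paramFun (s : Finset (Fin d)) (μ : Fin 3 →₀ ℕ) :
    (fun x : (Fin d → ℂ) × (Fin d → ℂ) => coeff μ (∏ i ∈ s, linForm ![1, -x.1 i, -x.2 i])) ∈
      Frame.paramFun d := by
  classical
  induction s using Finset.induction_on generalizing μ with
  | empty => simpa using const_mem_paramFun _
  | insert a s ha ih =>
    simp only [Finset.prod_insert ha, coeff_mul]
    refine sum_mem_paramFun _ fun t _ => (Frame.paramFun d).mul_mem ?_ (ih _)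
    have h : ∀ u : Fin 3 → ℂ, linForm u = ∑ k, C (u k) * X k := fun _ => rfl
    simp only [h, Fin.sum_univ_three, coeff_add, coeff_C_mul]
    exact (Frame.paramFun d).add_mem ((Frame.paramFun d).add_mem
      ((Frame.paramFun d).mul_mem (const_mem_paramFun 1) (const_mem_paramFun _))
      ((Frame.paramFun d).mul_mem ((Frame.paramFun d).neg_mem (fst_mem_paramFun a))
        (const_mem_paramFun _)))
      ((Frame.paramFun d).mul_mem ((Frame.paramFun d).neg_mem (snd_mem_paramFun a))
        (const_mem_paramFun _))

/-- There are d + 1 monomials free of the last variable and d linear in it. These 2d + 1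
coefficients are the ones seen by `sl` and `dsl`. -/
theorem card_monIdx_two_le (d : ℕ) :
    Fintype.card {μ : MonIdx (Fin 3) d // 2 ≤ μ.1 2} + (2 * d + 1) = Module.finrank ℂ (Sd d) := by
  rw [finrank_homogeneousSubmodule]
  have h1 := Fintype.card_subtype_compl fun μ : MonIdx (Fin 3) d => 2 ≤ μ.1 2
  have h2 := Fintype.card_subtype_le fun μ : MonIdx (Fin 3) d => 2 ≤ μ.1 2
  have hd : ∀ a b c : ℕ, (Finsupp.equivFunOnFinite.symm ![a, b, c] : Fin 3 →₀ ℕ).degree =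
      a + b + c := fun a b c => by rw [degree_three]; rfl
  let f : Fin (d + 1) ⊕ Fin d → {μ : MonIdx (Fin 3) d // ¬ 2 ≤ μ.1 2} := Sum.elim
    (fun k => ⟨⟨Finsupp.equivFunOnFinite.symm ![k, d - k, 0],
      mem_antidiag_iff.2 (by rw [hd]; omega)⟩, by show ¬ 2 ≤ 0; omega⟩)
    (fun k => ⟨⟨Finsupp.equivFunOnFinite.symm ![k, d - 1 - k, 1],
      mem_antidiag_iff.2 (by rw [hd]; omega)⟩, by show ¬ 2 ≤ 1; omega⟩)
  have hf0 : ∀ k, (f (Sum.inl k)).1.1 0 = k := fun k => rfl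
  have hf1 : ∀ k, (f (Sum.inr k)).1.1 0 = k := fun k => rfl
  have hf2 : ∀ k, (f (Sum.inl k)).1.1 2 = 0 := fun k => rfl
  have hf3 : ∀ k, (f (Sum.inr k)).1.1 2 = 1 := fun k => rfl
  have hf : Function.Bijective f := by
    constructor
    · rintro (k | k) (k' | k') h
      · exact congrArg Sum.inl (Fin.ext (by rw [← hf0, h, hf0]))
      · have := hf2 k; rw [h, hf3] at this; omega
      · have := hf3 k; rw [h, hf2] at this; omega
      · exact congrArg Sum.inr (Fin.ext (by rw [← hf1, h, hf1]))
    · rintro ⟨⟨μ, hμ⟩, h⟩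
      have hμ' := mem_antidiag_iff.1 hμ
      rw [degree_three] at hμ'
      have h : ¬ 2 ≤ μ 2 := h
      rcases Nat.eq_zero_or_pos (μ 2) with h0 | h0
      · refine ⟨Sum.inl ⟨μ 0, by omega⟩, Subtype.ext (Subtype.ext (Finsupp.ext ?_))⟩
        refine forall_fin_three.2 ⟨rfl, ?_, h0.symm⟩
        show d - μ 0 = μ 1
        omega
      · refine ⟨Sum.inr ⟨μ 0, by omega⟩, Subtype.ext (Subtype.ext (Finsupp.ext ?_))⟩
        refine forall_fin_three.2 ⟨rfl, ?_, ?_⟩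
        · show d - 1 - μ 0 = μ 1
          omega
        · show 1 = μ 2
          omega
  have h3 := Fintype.card_of_bijective hf
  rw [Fintype.card_sum, Fintype.card_fin, Fintype.card_fin] at h3
  omega

end UnorderedStratum

end LineArr

end

noncomputable section

namespace LineArr

open MvPolynomial
open scoped LinearAlgebra.Projectivization Matrix

/-! ### Equations for concurrency on unordered arrangements -/

section Concurrency

variable {d m : ℕ} {M : Finset (Fin d)}

/-- A function separating the identity among the permutations of a tuple of distinct slopes. -/
def sepFun (T : Fin d → ℂ) (x : (Fin d → ℂ) × (Fin d → ℂ)) : ℂ :=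
  ∏ i, ∏ j ∈ Finset.univ.erase i, (x.1 i - T j)

theorem sepFun_mem_paramFun (T : Fin d → ℂ) : sepFun T ∈ Frame.paramFun d :=
  prod_mem_paramFun _ fun i _ => prod_mem_paramFun _ fun j _ =>
    (Frame.paramFun d).sub_mem (fst_mem_paramFun i) (const_mem_paramFun (T j))

theorem sepFun_comp_eq_zero (x : (Fin d → ℂ) × (Fin d → ℂ)) {σ : Equiv.Perm (Fin d)} (hσ : σ ≠ 1) :
    sepFun x.1 (x.1 ∘ σ, x.2 ∘ σ) = 0 := by
  obtain ⟨i, hi⟩ : ∃ i, σ i ≠ i := by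
    by_contra! H
    exact hσ (Equiv.ext H)
  refine Finset.prod_eq_zero (Finset.mem_univ i) (Finset.prod_eq_zero (i := σ i) ?_ (sub_self _))
  exact Finset.mem_erase.2 ⟨hi, Finset.mem_univ _⟩

/-- Every permutation other than the identity moves some slope onto an excluded value. Symmetrizing
a multiple of `sepFun` therefore keeps only the original term at parameters with the given slopes.
-/
theorem sum_sepFun_mul (x : (Fin d → ℂ) × (Fin d → ℂ)) (f : Equiv.Perm (Fin d) → ℂ) :
    ∑ σ : Equiv.Perm (Fin d), sepFun x.1 (x.1 ∘ σ, x.2 ∘ σ) * f σ = sepFun x.1 x * f 1 := by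
  rw [Finset.sum_eq_single 1]
  · rfl
  · intro σ _ hσ
    rw [sepFun_comp_eq_zero x hσ, zero_mul]
  · simp

/-- If σ preserves `M`, the last determinant is already that of a triple in `M`. Otherwise `offTri`
of the permuted parameters contains such a determinant: take labels a, b, c not all in `M` that σ
sends into `M`. -/
theorem exists_tri_factor {i₁ i₂ k : Fin d} (h₁ : i₁ ∈ M) (h₂ : i₂ ∈ M) (hk : k ∈ M)
    (hM : 3 ≤ M.card) (σ : Equiv.Perm (Fin d)) :
    ∃ a ∈ M, ∃ b ∈ M, ∃ c ∈ M, ∃ f ∈ Frame.paramFun d, ∀ x : (Fin d → ℂ) × (Fin d → ℂ),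
      offTri M (x.1 ∘ σ, x.2 ∘ σ) * tri (x.1 ∘ σ, x.2 ∘ σ) i₁ i₂ k = f x * tri x a b c := by
  classical
  by_cases hσ : ∀ i ∈ M, σ i ∈ M
  · exact ⟨_, hσ _ h₁, _, hσ _ h₂, _, hσ _ hk, _, comp_mem_paramFun (offTri_mem_paramFun M) σ,
      fun x => rfl⟩
  set M' := M.map σ.symm.toEmbedding with hM'
  have hmem : ∀ i, i ∈ M' ↔ σ i ∈ M := fun i => by simp [hM']
  have hc : M'.card = M.card := Finset.card_map _
  obtain ⟨a, ha, haM⟩ : ∃ a ∈ M', a ∉ M := by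
    by_contra! H
    have : M' = M := Finset.eq_of_subset_of_card_le H hc.ge
    exact hσ fun i hi => (hmem i).1 (by rwa [this])
  obtain ⟨b, hb, hba⟩ := Finset.exists_mem_ne (by omega : 1 < M'.card) a
  obtain ⟨c, hc, hcb⟩ := Finset.exists_mem_ne (s := M'.erase a) (by
    rw [Finset.card_erase_of_mem ha]; omega) b
  obtain ⟨hca, hc⟩ := Finset.mem_erase.1 hc
  have ht : (a, b, c) ∈ offTriples M :=
    mem_offTriples.2 ⟨hba.symm, hca.symm, hcb.symm, fun h => haM h.1⟩
  refine ⟨_, (hmem a).1 ha, _, (hmem b).1 hb, _, (hmem c).1 hc, _,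
    (Frame.paramFun d).mul_mem (prod_mem_paramFun ((offTriples M).erase (a, b, c)) fun t _ =>
      tri_mem_paramFun (σ t.1) (σ t.2.1) (σ t.2.2)) (tri_mem_paramFun (σ i₁) (σ i₂) (σ k)),
    fun x => ?_⟩
  rw [offTri, ← Finset.mul_prod_erase _ _ ht]
  simp only [Pi.mul_apply]
  show tri x (σ a) (σ b) (σ c) * (∏ t ∈ (offTriples M).erase (a, b, c),
    tri x (σ t.1) (σ t.2.1) (σ t.2.2)) * tri x (σ i₁) (σ i₂) (σ k) = _
  ring

/-- The labels in `M` other than `i₁` and `i₂`. -/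
abbrev others (M : Finset (Fin d)) (i₁ i₂ : Fin d) : Type := {j // j ∈ (M.erase i₁).erase i₂}

theorem card_others {i₁ i₂ : Fin d} (h₁ : i₁ ∈ M) (h₂ : i₂ ∈ M) (h12 : i₁ ≠ i₂) :
    ((M.erase i₁).erase i₂).card = M.card - 2 := by
  rw [Finset.card_erase_of_mem (Finset.mem_erase.2 ⟨h12.symm, h₂⟩), Finset.card_erase_of_mem h₁,
    Nat.sub_sub]

/-- Combining `exists_tri_factor` with `slope_mul_tri`, every term of the symmetrized equation lies,
after multiplication by a difference of slopes, in the ideal of the basic determinants det(i₁, i₂,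
j). -/
theorem exists_concurrency_coeff {i₁ i₂ : Fin d} (h₁ : i₁ ∈ M) (h₂ : i₂ ∈ M) (hM : 3 ≤ M.card)
    (σ : Equiv.Perm (Fin d)) (k : others M i₁ i₂) :
    ∃ α : others M i₁ i₂ → Frame.paramFun d, ∀ x : (Fin d → ℂ) × (Fin d → ℂ),
      (x.1 i₂ - x.1 i₁) * (offTri M (x.1 ∘ σ, x.2 ∘ σ) * tri (x.1 ∘ σ, x.2 ∘ σ) i₁ i₂ k) =
        ∑ j, (α j).1 x * tri x i₁ i₂ j := by
  have hk := Finset.mem_of_mem_erase (Finset.mem_of_mem_erase k.2)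
  set h : others M i₁ i₂ → Frame.paramFun d := fun j => ⟨_, tri_mem_paramFun i₁ i₂ j⟩ with hh
  set I := Ideal.span (Set.range h) with hI
  have hmem : ∀ a ∈ M, (⟨_, tri_mem_paramFun i₁ i₂ a⟩ : Frame.paramFun d) ∈ I := by
    intro a ha
    by_cases ha1 : a = i₁
    · have : (⟨_, tri_mem_paramFun i₁ i₂ a⟩ : Frame.paramFun d) = 0 :=
        Subtype.ext (funext fun x => by subst ha1; simp [tri])
      rw [this]; exact I.zero_mem
    by_cases ha2 : a = i₂
    · have : (⟨_, tri_mem_paramFun i₁ i₂ a⟩ : Frame.paramFun d) = 0 :=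
        Subtype.ext (funext fun x => by subst ha2; simp [tri])
      rw [this]; exact I.zero_mem
    exact Ideal.subset_span ⟨⟨a, Finset.mem_erase.2 ⟨ha2, Finset.mem_erase.2 ⟨ha1, ha⟩⟩⟩, rfl⟩
  obtain ⟨a, ha, b, hb, c, hc, f, hf, hfac⟩ := exists_tri_factor h₁ h₂ hk hM σ
  have hsub : ∀ i j : Fin d, (fun x : (Fin d → ℂ) × (Fin d → ℂ) => x.1 i - x.1 j) ∈
      Frame.paramFun d := fun i j =>
    (Frame.paramFun d).sub_mem (fst_mem_paramFun i) (fst_mem_paramFun j)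
  have key : (⟨f, hf⟩ : Frame.paramFun d) * (⟨_, hsub c b⟩ * ⟨_, tri_mem_paramFun i₁ i₂ a⟩ +
      ⟨_, hsub a c⟩ * ⟨_, tri_mem_paramFun i₁ i₂ b⟩ +
      ⟨_, hsub b a⟩ * ⟨_, tri_mem_paramFun i₁ i₂ c⟩) ∈ I :=
    I.mul_mem_left _ (I.add_mem (I.add_mem (I.mul_mem_left _ (hmem a ha))
      (I.mul_mem_left _ (hmem b hb))) (I.mul_mem_left _ (hmem c hc)))
  obtain ⟨α, hα⟩ := Ideal.mem_span_range_iff_exists_fun.1 key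
  refine ⟨α, fun x => ?_⟩
  have hx := congrArg (fun p : Frame.paramFun d => p.1 x) hα
  simp only [AddSubmonoidClass.coe_finsetSum, Finset.sum_apply, MulMemClass.coe_mul, Pi.mul_apply,
    AddMemClass.coe_add, Pi.add_apply, hh] at hx
  rw [hfac, hx, mul_left_comm, slope_mul_tri]

namespace Frame

variable (B : Frame)

/-- The condition det(i₁, i₂, k) = 0 is not symmetric in the lines, so `Q k` is the symmetrization
of `sepFun` · `offTri` · det(i₁, i₂, k). Up to a slope difference and a power of the discriminant,
the vector (Q k) is a matrix `A` times the vector of the det(i₁, i₂, j), and `A` is diagonal and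
invertible at `x₀`. Where `G` does not vanish, `A` is invertible for some reordering of the lines,
and then Q = 0 forces the determinants to vanish. -/
theorem exists_concurrency_system {x₀ : (Fin d → ℂ) × (Fin d → ℂ)}
    (hx₀ : Function.Injective x₀.1) {v : Fin 3 → ℂ} (hT : TypeData m (B.lineVec x₀) M v)
    {i₁ i₂ : Fin d} (h₁ : i₁ ∈ M) (h₂ : i₂ ∈ M) (h12 : i₁ ≠ i₂) :
    ∃ (Q : others M i₁ i₂ → Sd d → ℂ) (G : Sd d → ℂ) (b : others M i₁ i₂ → ℂ),
      (∀ k, Q k ∈ B.baseFun d) ∧ G ∈ B.baseFun d ∧ (∀ k, b k ≠ 0) ∧ G (B.arr x₀) ≠ 0 ∧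
      (∀ k s, Q k (B.arr (x₀.1, s)) = b k * (offTri M (x₀.1, s) * tri (x₀.1, s) i₁ i₂ k)) ∧
      (∀ x, (∃ M' v, TypeData m (B.lineVec x) M' v) → ∀ k, Q k (B.arr x) = 0) ∧
      ∀ x, Function.Injective x.1 → G (B.arr x) ≠ 0 → (∀ k, Q k (B.arr x) = 0) →
        ∃ (σ : Equiv.Perm (Fin d)) (v : Fin 3 → ℂ),
          TypeData m (B.lineVec (x.1 ∘ σ, x.2 ∘ σ)) M v := by
  classical
  have hKM : ∀ k : others M i₁ i₂, (k : Fin d) ∈ M := fun k =>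
    Finset.mem_of_mem_erase (Finset.mem_of_mem_erase k.2)
  have hm : others M i₁ i₂ → 3 ≤ m := fun k => by
    have := Finset.card_pos.2 ⟨_, k.2⟩
    rw [card_others h₁ h₂ h12, hT.card] at this
    omega
  have hcard : others M i₁ i₂ → 3 ≤ M.card := fun k => by rw [hT.card]; exact hm k
  set u := sepFun x₀.1 with hu
  have hux : u x₀ ≠ 0 := disc_ne_zero.2 hx₀
  have hex : offTri M x₀ ≠ 0 := B.offTri_ne_zero.2 (offDet_ne_zero.2 hT.triple)
  have hτx : x₀.1 i₂ - x₀.1 i₁ ≠ 0 := sub_ne_zero.2 (hx₀.ne h12.symm)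
  have hdx := disc_ne_zero.2 hx₀
  choose N Q hQ hQx using fun k : others M i₁ i₂ => B.exists_symmetrization
    ((paramFun d).mul_mem (sepFun_mem_paramFun x₀.1)
      ((paramFun d).mul_mem (offTri_mem_paramFun M) (tri_mem_paramFun i₁ i₂ k)))
  -- For σ = 1 the coefficients are chosen explicitly, so that `A` is diagonal at `x₀`.
  have hα : ∀ (σ : Equiv.Perm (Fin d)) (k : others M i₁ i₂), ∃ α : others M i₁ i₂ → paramFun d,
      (∀ x : (Fin d → ℂ) × (Fin d → ℂ),
        (x.1 i₂ - x.1 i₁) * (offTri M (x.1 ∘ σ, x.2 ∘ σ) * tri (x.1 ∘ σ, x.2 ∘ σ) i₁ i₂ k) =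
          ∑ j, (α j).1 x * tri x i₁ i₂ j) ∧
      (σ = 1 → ∀ j x, (α j).1 x = if k = j then (x.1 i₂ - x.1 i₁) * offTri M x else 0) := by
    intro σ k
    by_cases hσ : σ = 1
    · have hδ : ∀ (j : others M i₁ i₂) (x : (Fin d → ℂ) × (Fin d → ℂ)),
          (if k = j then (⟨_, (paramFun d).mul_mem ((paramFun d).sub_mem (fst_mem_paramFun i₂)
            (fst_mem_paramFun i₁)) (offTri_mem_paramFun M)⟩ : paramFun d) else 0).1 x =
            if k = j then (x.1 i₂ - x.1 i₁) * offTri M x else 0 := by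
        intro j x
        split_ifs <;> rfl
      refine ⟨fun j => if k = j then ⟨_, (paramFun d).mul_mem ((paramFun d).sub_mem
        (fst_mem_paramFun i₂) (fst_mem_paramFun i₁)) (offTri_mem_paramFun M)⟩ else 0, fun x => ?_,
        fun _ => hδ⟩
      simp only [hδ, ite_mul, zero_mul, Finset.sum_ite_eq, Finset.mem_univ, if_true]
      rw [hσ]
      exact (mul_assoc _ _ _).symm
    · obtain ⟨α, h⟩ := exists_concurrency_coeff h₁ h₂ (hcard k) σ k
      exact ⟨α, h, fun e => absurd e hσ⟩
  choose α hαx hα1 using hα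
  set A : Matrix (others M i₁ i₂) (others M i₁ i₂) (paramFun d) := fun k j =>
    ∑ σ : Equiv.Perm (Fin d), ⟨_, comp_mem_paramFun (sepFun_mem_paramFun x₀.1) σ⟩ * α σ k j with hA
  have hAx : ∀ x k j, (A k j).1 x = ∑ σ : Equiv.Perm (Fin d), u (x.1 ∘ σ, x.2 ∘ σ) * (α σ k j).1 x := by
    intro x k j
    simp only [hA, AddSubmonoidClass.coe_finsetSum, Finset.sum_apply, MulMemClass.coe_mul,
      Pi.mul_apply, hu]
  have hdet : ∀ x, (A.det).1 x = (Matrix.of fun k j => (A k j).1 x).det := fun x =>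
    ((Pi.evalRingHom (fun _ => ℂ) x).comp (paramFun d).val.toRingHom).map_det A
  obtain ⟨N', G, hG, hGx⟩ := B.exists_symmetrization ((paramFun d).mul_mem
    (sepFun_mem_paramFun x₀.1) ((paramFun d).mul_mem (offTri_mem_paramFun M) ((paramFun d).mul_mem
      ((paramFun d).sub_mem (fst_mem_paramFun i₂) (fst_mem_paramFun i₁)) A.det.2)))
  refine ⟨Q, G, fun k => disc x₀ ^ N k * u x₀, hQ, hG,
    fun k => mul_ne_zero (pow_ne_zero _ hdx) hux, ?_, ?_, ?_, ?_⟩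
  · rw [hGx]
    refine mul_ne_zero (pow_ne_zero _ hdx) ?_
    simp only [Pi.mul_apply]
    rw [sum_sepFun_mul]
    refine mul_ne_zero hux (mul_ne_zero hex (mul_ne_zero hτx ?_))
    show A.det.1 x₀ ≠ 0
    rw [hdet]
    have : (Matrix.of fun k j => (A k j).1 x₀) =
        Matrix.diagonal fun _ => u x₀ * ((x₀.1 i₂ - x₀.1 i₁) * offTri M x₀) := by
      ext k j
      rw [Matrix.of_apply, hAx, sum_sepFun_mul, hα1 1 k rfl, Matrix.diagonal_apply]
      split_ifs <;> simp [hu]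
    rw [this, Matrix.det_diagonal]
    exact Finset.prod_ne_zero_iff.2 fun _ _ => mul_ne_zero hux (mul_ne_zero hτx hex)
  · intro k s
    rw [hQx]
    simp only [Pi.mul_apply]
    rw [show x₀.1 = ((x₀.1, s) : (Fin d → ℂ) × (Fin d → ℂ)).1 from rfl, sum_sepFun_mul]
    exact (mul_assoc _ _ _).symm
  · rintro x ⟨M', v', hT'⟩ k
    rw [hQx, Finset.sum_eq_zero, mul_zero]
    intro σ _
    simp only [Pi.mul_apply]
    by_cases he : offTri M (x.1 ∘ σ, x.2 ∘ σ) = 0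
    · rw [he, zero_mul, mul_zero]
    have hT'' : TypeData m (B.lineVec (x.1 ∘ σ, x.2 ∘ σ)) _ v' := hT'.comp σ
    have hMM := hT''.eq_of_offDet_ne_zero (hm k) hT.card (B.offTri_ne_zero.1 he)
    rw [B.tri_eq_zero.2, mul_zero, mul_zero]
    exact hT''.triple_eq_zero (hMM ▸ h₁) (hMM ▸ h₂) (hMM ▸ hKM k)
  · intro x hx hGne hQ0
    rw [hGx] at hGne
    -- A nonzero term of the sum defining `G` supplies the reordering in which the pencil is
    -- labelled by `M`.
    obtain ⟨σ, -, hσ⟩ := Finset.exists_ne_zero_of_sum_ne_zero (right_ne_zero_of_mul hGne)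
    set y : (Fin d → ℂ) × (Fin d → ℂ) := (x.1 ∘ σ, x.2 ∘ σ) with hy
    have hyinj : Function.Injective y.1 := hx.comp σ.injective
    obtain ⟨-, h2⟩ := mul_ne_zero_iff.1 hσ
    obtain ⟨hey, h3⟩ := mul_ne_zero_iff.1 h2
    obtain ⟨-, hAy⟩ := mul_ne_zero_iff.1 h3
    replace hAy : A.det.1 y ≠ 0 := hAy
    rw [hdet] at hAy
    have hmv : (Matrix.of fun k j => (A k j).1 y) *ᵥ (fun j : others M i₁ i₂ => tri y i₁ i₂ j) = 0 := by
      ext k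
      have h0 := hQ0 k
      rw [← B.arr_comp x σ, hQx] at h0
      have h1 := (mul_eq_zero.1 h0).resolve_left (pow_ne_zero _ (disc_ne_zero.2 hyinj))
      have h2 := congrArg (fun t => (y.1 i₂ - y.1 i₁) * t) h1
      simp only [mul_zero, Finset.mul_sum, Pi.mul_apply] at h2
      rw [Pi.zero_apply, ← h2]
      simp only [Matrix.mulVec, dotProduct, Matrix.of_apply, hAx, Finset.sum_mul]
      rw [Finset.sum_comm]
      refine Finset.sum_congr rfl fun ρ _ => ?_
      rw [mul_left_comm, hαx ρ k y, Finset.mul_sum]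
      exact Finset.sum_congr rfl fun j _ => mul_assoc _ _ _
    have h0 := Matrix.eq_zero_of_mulVec_eq_zero hAy hmv
    refine ⟨σ, _, typeData_of_offDet_ne_zero hT.card (B.distinctLines_lineVec hyinj)
      (B.offTri_ne_zero.1 hey) h12 fun j hj hj1 hj2 => B.tri_eq_zero.1 ?_⟩
    exact congrFun h0 ⟨j, Finset.mem_erase.2 ⟨hj2, Finset.mem_erase.2 ⟨hj1, hj⟩⟩⟩

end Frame

end Concurrency

end LineArr

end

noncomputable section

namespace LineArr

open MvPolynomial
open scoped LinearAlgebra.Projectivization Matrix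

/-! ### Smoothness of the strata of unordered arrangements -/

section Smooth

variable {d m : ℕ}

namespace Frame

variable (B : Frame)

/-- The equation expressing a coefficient of a product of lines through the base coordinates. -/
theorem exists_graph_equation {D : Sd d → ℂ} (hD : D ∈ B.baseFun d)
    (hDx : ∀ x, D (B.arr x) = Frame.disc x) (μ : Fin 3 →₀ ℕ) :
    ∃ E : Sd d → ℂ, E ∈ PolyFun (Sd d) ∧ ∃ N : ℕ, ∀ (x : (Fin d → ℂ) × (Fin d → ℂ)) (F : Sd d), B.sl F = B.sl (B.arr x) →
      B.dsl F = B.dsl (B.arr x) → E F = (d.factorial : ℂ) * disc x ^ N *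
        (coeff μ (B.toCoord (B.arr x : S)) - coeff μ (B.toCoord (F : S))) := by
  obtain ⟨N, Q, hQ, hQx⟩ := B.exists_symmetrization
    (coeff_prod_linForm_mem_paramFun (Finset.univ : Finset (Fin d)) μ)
  have hcoeff : (fun F : Sd d => coeff μ (B.toCoord (F : S))) ∈ PolyFun (Sd d) :=
    dual_mem_polyFun (lcoeff ℂ μ ∘ₗ B.toCoord.toLinearMap ∘ₗ
      (homogeneousSubmodule (Fin 3) ℂ d).subtype)
  -- A coefficient of the product is invariant under permutations of the lines, so its
  -- symmetrization is d! times itself.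
  refine ⟨fun F => Q F - (d.factorial : ℂ) * D F ^ N * coeff μ (B.toCoord (F : S)),
    sub_mem_polyFun (B.baseFun_le hQ) (mul_mem_polyFun (mul_mem_polyFun (const_mem_polyFun _)
      ((PolyFun (Sd d)).pow_mem (B.baseFun_le hD) N)) hcoeff), N, fun x F h h' => ?_⟩
  simp only
  rw [B.eq_of_mem_baseFun hQ h h', B.eq_of_mem_baseFun hD h h', hDx, hQx]
  have hσ : ∀ σ : Equiv.Perm (Fin d), ∏ i, linForm ![1, -(x.1 ∘ σ) i, -(x.2 ∘ σ) i] =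
      B.toCoord (B.arr x : S) := fun σ => by
    rw [toCoord_arr]
    exact Equiv.prod_comp σ fun i => linForm ![1, -x.1 i, -x.2 i]
  simp only [hσ, Finset.sum_const, Finset.card_univ, Fintype.card_perm, Fintype.card_fin, nsmul_eq_mul]
  ring

/-- The roots of `sl F` are the slopes, distinct because the discriminant is nonzero, and
interpolation of `dsl F` gives the remaining parameters. -/
theorem exists_base_point (hd : 0 < d) {D : Sd d → ℂ}
    (hD : ∀ (F : Sd d) (x : (Fin d → ℂ) × (Fin d → ℂ)),
      B.sl F = ∏ i, (Polynomial.X - Polynomial.C (x.1 i)) → D F = disc x) {F : Sd d}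
    (hF : B.lead F = 1) (h : D F ≠ 0) : ∃ x : (Fin d → ℂ) × (Fin d → ℂ),
      Function.Injective x.1 ∧ B.sl F = B.sl (B.arr x) ∧ B.dsl F = B.dsl (B.arr x) := by
  obtain ⟨T, hT⟩ := B.exists_sl_eq hF
  have hinj : Function.Injective T := by
    rw [hD F (T, 0) hT] at h
    exact disc_ne_zero.1 h
  obtain ⟨s, hs⟩ := B.exists_dsl_eq hd F hinj
  exact ⟨(T, s), hinj, by rw [hT, sl_arr], hs⟩

theorem eq_arr_of_coeff_eq {F : Sd d} {x : (Fin d → ℂ) × (Fin d → ℂ)}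
    (h : B.sl F = B.sl (B.arr x)) (h' : B.dsl F = B.dsl (B.arr x))
    (hμ : ∀ μ : MonIdx (Fin 3) d, 2 ≤ μ.1 2 →
      coeff μ.1 (B.toCoord (B.arr x : S)) = coeff μ.1 (B.toCoord (F : S))) : F = B.arr x := by
  have := eq_of_slice_eq (B.homog F) (B.homog (B.arr x)) h h' fun μ h1 h2 =>
    (hμ ⟨μ, mem_antidiag_iff.2 h1⟩ h2).symm
  have h3 := congrArg B.ofCoord this
  rw [ofCoord_toCoord, ofCoord_toCoord] at h3
  exact Subtype.ext h3

/-- The direction of a monomial in the coordinates of the frame. -/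
def monDir (μ : MonIdx (Fin 3) d) : Sd d :=
  ⟨B.ofCoord (monomial μ.1 1), (mem_homogeneousSubmodule _ _).2
    (B.isHomogeneous_ofCoord (isHomogeneous_monomial 1 (mem_antidiag_iff.1 μ.2)))⟩

theorem toCoord_monDir (μ : MonIdx (Fin 3) d) : B.toCoord (B.monDir μ : S) = monomial μ.1 1 :=
  B.toCoord_ofCoord _

theorem sl_monDir {μ : MonIdx (Fin 3) d} (h : 2 ≤ μ.1 2) : B.sl (B.monDir μ) = 0 := by
  rw [sl_apply, toCoord_monDir, slice_monomial_eq_zero (by omega)]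

theorem dsl_monDir {μ : MonIdx (Fin 3) d} (h : 2 ≤ μ.1 2) : B.dsl (B.monDir μ) = 0 := by
  rw [dsl_apply, toCoord_monDir, slice_pderiv_monomial_eq_zero h]

theorem coe_arr (x : (Fin d → ℂ) × (Fin d → ℂ)) : (B.arr x : S) = arrEq (B.lineVec x) := rfl

/-- The product is affine in each s_k, so moving a single line traces a straight line within the
products of lines. These directions are tangent vectors dual to the concurrency equations. -/
theorem arr_add_single (T s : Fin d → ℂ) (k : Fin d) (t : ℂ) :
    B.arr (T, s + Pi.single k t) = B.arr (T, s) +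
      t • (B.arr (T, s + Pi.single k 1) - B.arr (T, s)) := by
  classical
  have hrest : ∀ t : ℂ, ∏ i ∈ Finset.univ.erase k, linForm (B.lineVec (T, s + Pi.single k t) i) =
      ∏ i ∈ Finset.univ.erase k, linForm (B.lineVec (T, s) i) := fun t =>
    Finset.prod_congr rfl fun i hi => by
      rw [lineVec, lineVec]
      simp [Pi.single_eq_of_ne (Finset.mem_erase.1 hi).1]
  have hk : ∀ t : ℂ, linForm (B.lineVec (T, s + Pi.single k t) k) =
      linForm (B.lineVec (T, s) k) - C t * linForm (B.ε 2) := by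
    intro t
    have h : B.lineVec (T, s + Pi.single k t) k = B.lineVec (T, s) k + (-t) • B.ε 2 := by
      rw [lineVec, lineVec]
      simp only [Pi.add_apply, Pi.single_eq_same, add_smul, neg_smul]
      abel
    rw [h, linForm_add, linForm_smul, C_neg]
    ring
  have hall : ∀ t : ℂ, (B.arr (T, s + Pi.single k t) : S) =
      (linForm (B.lineVec (T, s) k) - C t * linForm (B.ε 2)) *
        ∏ i ∈ Finset.univ.erase k, linForm (B.lineVec (T, s) i) := by
    intro t
    rw [coe_arr, arrEq, ← Finset.mul_prod_erase _ _ (Finset.mem_univ k), hrest, hk]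
  have h0 : (B.arr (T, s) : S) = linForm (B.lineVec (T, s) k) *
        ∏ i ∈ Finset.univ.erase k, linForm (B.lineVec (T, s) i) := by
    rw [coe_arr, arrEq, ← Finset.mul_prod_erase _ _ (Finset.mem_univ k)]
  refine Subtype.ext ?_
  rw [Submodule.coe_add, Submodule.coe_smul, Submodule.coe_sub, hall t, hall 1, h0, smul_eq_C_mul, C_1]
  ring

theorem tri_add_single (T s : Fin d → ℂ) {i₁ i₂ k : Fin d}
    (hk1 : k ≠ i₁) (hk2 : k ≠ i₂) (j : Fin d) (t : ℂ) :
    tri (T, s + Pi.single k t) i₁ i₂ j = tri (T, s) i₁ i₂ j +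
      if j = k then t * (T i₂ - T i₁) else 0 := by
  simp only [tri, Pi.add_apply, Pi.single_eq_of_ne hk1.symm, Pi.single_eq_of_ne hk2.symm]
  split_ifs with h
  · subst h; rw [Pi.single_eq_same]; ring
  · rw [Pi.single_eq_of_ne h]; ring

theorem differentiable_offTri (M : Finset (Fin d)) (T s : Fin d → ℂ) (k : Fin d) :
    Differentiable ℂ fun t : ℂ => offTri M (T, s + Pi.single k t) := by
  have h : ∀ i, Differentiable ℂ fun t : ℂ => (s + Pi.single k t : Fin d → ℂ) i := by
    intro i
    by_cases hi : i = k
    · subst hi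
      simp only [Pi.add_apply, Pi.single_eq_same]
      fun_prop
    · simp only [Pi.add_apply, Pi.single_eq_of_ne hi]
      fun_prop
  refine Differentiable.fun_finsetProd fun t _ => ?_
  exact (((h t.2.2).sub (h t.1)).const_mul (T t.2.1 - T t.1)).sub
    (((h t.2.1).sub (h t.1)).const_mul (T t.2.2 - T t.1))

end Frame

/-- In the chart with leading coefficient 1 and nonzero discriminant, products of lines are the
graph of the other coefficients over the base coordinates (equations `E μ`), and on the graph the `Q
k` impose m - 2 concurrency conditions. Monomial directions with exponent at least two in the last
variable affect the `E μ` diagonally and no `Q k`; the directions `wK` affect the `Q k` diagonally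
and no `E μ`. -/
theorem isSmoothOfDim_AL (hm : 2 ≤ m) (hmd : m ≤ d) :
    IsSmoothOfDim (single (AL d (Ldm d m))) (2 * d - m + 2) := by
  classical
  have hd : 2 ≤ d := hm.trans hmd
  refine isSmoothOfDim_of_chart ((nonempty_XL hm hmd).image _) fun p hp => ?_
  obtain ⟨n, M, v, hT, e⟩ := (mem_AL_iff hm hmd one_ne_zero).1 hp
  rw [one_smul] at e
  obtain ⟨B, hB0, hB1⟩ := exists_frame hT.distinctLines hd
  obtain ⟨x₀, hx₀, hx1⟩ := B.exists_eq_smul_lineVec hB0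
  have hinj : Function.Injective x₀.1 := by
    intro i j hij
    by_contra hne
    rw [hx1, hx1, div_eq_div_iff (hB0 i) (hB0 j)] at hij
    exact hB1 i j hne (by linear_combination hij)
  have hT₀ : TypeData m (B.lineVec x₀) M v := by
    rw [show B.lineVec x₀ = fun i => (n i ⬝ᵥ B.e 0)⁻¹ • n i from funext hx₀]
    exact hT.smul fun i => inv_ne_zero (hB0 i)
  obtain ⟨i₁, hi₁, i₂, hi₂, h12⟩ := Finset.one_lt_card.1 (by rw [hT.card]; omega : 1 < M.card)
  obtain ⟨Q, G, b, hQ, hG, hb, hGx, hQs, hQ0, hQT⟩ :=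
    B.exists_concurrency_system hinj hT₀ hi₁ hi₂ h12
  obtain ⟨D, hD, hDx⟩ := B.exists_disc d
  have hDarr : ∀ x, D (B.arr x) = Frame.disc x := fun x => hDx _ _ (B.sl_arr x)
  choose E hE N hEx using fun μ : {μ : MonIdx (Fin 3) d // 2 ≤ μ.1 2} =>
    B.exists_graph_equation hD hDarr μ.1.1
  have hEarr : ∀ μ x, E μ (B.arr x) = 0 := fun μ x => by
    rw [hEx μ x _ rfl rfl, sub_self, mul_zero]
  have hK : ∀ k : others M i₁ i₂, (k : Fin d) ≠ i₁ ∧ (k : Fin d) ≠ i₂ := fun k =>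
    ⟨(Finset.mem_erase.1 (Finset.mem_of_mem_erase k.2)).1, (Finset.mem_erase.1 k.2).1⟩
  have hdx := Frame.disc_ne_zero.2 hinj
  set wK : others M i₁ i₂ → Sd d := fun k =>
    B.arr (x₀.1, x₀.2 + Pi.single (k : Fin d) 1) - B.arr x₀ with hwK
  have hwKt : ∀ k (t : ℂ), B.arr x₀ + t • wK k = B.arr (x₀.1, x₀.2 + Pi.single (k : Fin d) t) :=
    fun k t => (B.arr_add_single x₀.1 x₀.2 k t).symm
  have hslμ : ∀ (μ : {μ : MonIdx (Fin 3) d // 2 ≤ μ.1 2}) (t : ℂ),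
      B.sl (B.arr x₀ + t • B.monDir μ.1) = B.sl (B.arr x₀) := fun μ t => by
    rw [map_add, map_smul, B.sl_monDir μ.2, smul_zero, add_zero]
  have hdslμ : ∀ (μ : {μ : MonIdx (Fin 3) d // 2 ≤ μ.1 2}) (t : ℂ),
      B.dsl (B.arr x₀ + t • B.monDir μ.1) = B.dsl (B.arr x₀) := fun μ t => by
    rw [map_add, map_smul, B.dsl_monDir μ.2, smul_zero, add_zero]
  have hEμ : ∀ μ ν (t : ℂ), E μ (B.arr x₀ + t • B.monDir ν.1) =
      if μ = ν then -((d.factorial : ℂ) * Frame.disc x₀ ^ N μ) * t else 0 := by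
    intro μ ν t
    rw [hEx μ x₀ _ (hslμ ν t) (hdslμ ν t), Submodule.coe_add, Submodule.coe_smul, map_add, map_smul,
      coeff_add, coeff_smul, B.toCoord_monDir, coeff_monomial]
    by_cases h : μ = ν
    · subst h
      rw [if_pos rfl, if_pos rfl, smul_eq_mul]
      ring
    · rw [if_neg h, if_neg fun h' => h (Subtype.ext (Subtype.ext h'.symm)), smul_zero, add_zero,
        sub_self, mul_zero]
  have htri₀ : ∀ k : others M i₁ i₂, tri x₀ i₁ i₂ k = 0 := fun k =>
    B.tri_eq_zero.2 (hT₀.triple_eq_zero hi₁ hi₂ (Finset.mem_of_mem_erase (Finset.mem_of_mem_erase k.2)))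
  have hQk : ∀ j k (t : ℂ), Q j (B.arr x₀ + t • wK k) = if j = k then
      t * (b j * (offTri M (x₀.1, x₀.2 + Pi.single (k : Fin d) t) * (x₀.1 i₂ - x₀.1 i₁))) else 0 := by
    intro j k t
    rw [hwKt, hQs, Frame.tri_add_single _ _ (hK k).1 (hK k).2,
      show tri (x₀.1, x₀.2) i₁ i₂ j = 0 from htri₀ j, zero_add]
    simp only [Subtype.coe_inj]
    split_ifs <;> ring
  have hQμ : ∀ j (μ : {μ : MonIdx (Fin 3) d // 2 ≤ μ.1 2}) (t : ℂ), Q j (B.arr x₀ + t • B.monDir μ.1) = 0 := by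
    intro j μ t
    rw [B.eq_of_mem_baseFun (hQ j) (hslμ μ t) (hdslμ μ t)]
    exact hQ0 x₀ ⟨M, v, hT₀⟩ j
  refine ⟨B.lead, B.arr x₀, {μ : MonIdx (Fin 3) d // 2 ≤ μ.1 2} ⊕ others M i₁ i₂, inferInstance,
    fun F => D F * G F, Sum.elim E Q, Sum.elim (fun μ => B.monDir μ.1) wK,
    Sum.elim (fun μ => -((d.factorial : ℂ) * Frame.disc x₀ ^ N μ))
      (fun k => b k * (offTri M x₀ * (x₀.1 i₂ - x₀.1 i₁))), ?_, B.arr_eq_of_smul e hx₀, ?_, ?_, ?_, ?_,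
    ?_, ?_, ?_, ?_, ?_⟩
  · rw [B.lead_arrEq e]
    exact Finset.prod_ne_zero_iff.2 fun i _ => hB0 i
  · exact mul_mem_polyFun (B.baseFun_le hD) (B.baseFun_le hG)
  · simp only
    rw [hDarr]
    exact mul_ne_zero hdx hGx
  · rintro (μ | k)
    · exact hE μ
    · exact B.baseFun_le (hQ k)
  · rw [← card_monIdx_two_le d, Fintype.card_sum, Fintype.card_coe, card_others hi₁ hi₂ h12, hT.card]
    omega
  · rintro (μ | k)
    · show B.lead (B.monDir μ.1) = 0
      rw [B.lead_apply, B.sl_monDir μ.2, Polynomial.coeff_zero]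
    · show B.lead (_ - _) = 0
      rw [map_sub, B.lead_arr, B.lead_arr, sub_self]
  · rintro (μ | k)
    · exact neg_ne_zero.2 (mul_ne_zero (Nat.cast_ne_zero.2 d.factorial_ne_zero) (pow_ne_zero _ hdx))
    · exact mul_ne_zero (hb k) (mul_ne_zero (B.offTri_ne_zero.2 (offDet_ne_zero.2 hT₀.triple))
        (sub_ne_zero.2 (hinj.ne h12.symm)))
  · rintro (μ | k)
    · simp only [Sum.elim_inl, hEμ, if_true]
      simpa using (hasDerivAt_id (0 : ℂ)).const_mul (-((d.factorial : ℂ) * Frame.disc x₀ ^ N μ))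
    · simp only [Sum.elim_inr, hQk, if_true]
      have h1 := (((Frame.differentiable_offTri M x₀.1 x₀.2 k).mul_const
        (x₀.1 i₂ - x₀.1 i₁)).const_mul (b k)) 0
      have h2 := (hasDerivAt_id (0 : ℂ)).mul h1.hasDerivAt
      refine HasDerivAt.congr_deriv h2 ?_
      simp
  · rintro (μ | j) (ν | k) hij t
    · simp only [Sum.elim_inl, hEμ]
      rw [if_neg fun h => hij (congrArg Sum.inl h)]
    · show E μ (B.arr x₀ + t • wK k) = 0
      rw [hwKt, hEarr]
    · exact hQμ j ν t
    · simp only [Sum.elim_inr, hQk]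
      rw [if_neg fun h => hij (congrArg Sum.inr h)]
  · intro q c hlead hg
    obtain ⟨hg1, hg2⟩ := mul_ne_zero_iff.1 hg
    rw [B.mem_AL_iff hm hmd hlead]
    constructor
    · rintro ⟨x, M', v', hT', ex⟩
      rintro (μ | k)
      · show E μ _ = 0
        rw [ex, hEarr]
      · show Q k _ = 0
        rw [ex]
        exact hQ0 x ⟨M', v', hT'⟩ k
    -- The equations `E μ` identify the form with the product of lines having the same base
    -- coordinates; the equations `Q k` then give concurrency after a reordering.
    · intro h
      obtain ⟨x, hx, h1, h2⟩ := B.exists_base_point (by omega) hDx hlead hg1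
      have hF : c • q.rep = B.arr x := by
        refine B.eq_arr_of_coeff_eq h1 h2 fun μ hμ => ?_
        have := h (Sum.inl ⟨μ, hμ⟩)
        simp only [Sum.elim_inl] at this
        rw [hEx ⟨μ, hμ⟩ x _ h1 h2] at this
        exact sub_eq_zero.1 ((mul_eq_zero.1 this).resolve_left (mul_ne_zero
          (Nat.cast_ne_zero.2 d.factorial_ne_zero) (pow_ne_zero _ (Frame.disc_ne_zero.2 hx))))
      rw [hF] at h hg2
      obtain ⟨σ, v', hT'⟩ := hQT x hx hg2 fun k => h (Sum.inr k)
      exact ⟨_, M, v', hT', by rw [hF, B.arr_comp]⟩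

end Smooth

end LineArr

end

noncomputable section

namespace LineArr

open MvPolynomial
open scoped LinearAlgebra.Projectivization Matrix

/-! ### Irreducibility of the strata of unordered arrangements -/

section Irreducible

variable {d m : ℕ}

theorem isTopologicalBasis_zariski (ι : Type) [Fintype ι] (V : Type) [AddCommGroup V] [Module ℂ V] :
    @TopologicalSpace.IsTopologicalBasis _ (zariski ι V)
      {U | ∃ F : (ι → V) → ℂ, IsMultiHom F ∧ U = {p | F (reps p) ≠ 0}} := by
  let _ := zariski ι V
  refine ⟨?_, ?_, rfl⟩
  · rintro _ ⟨F, hF, rfl⟩ _ ⟨G, hG, rfl⟩ p ⟨h1, h2⟩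
    exact ⟨_, ⟨_, hF.mul hG, rfl⟩, mul_ne_zero h1 h2, fun q hq =>
      ⟨left_ne_zero_of_mul hq, right_ne_zero_of_mul hq⟩⟩
  · exact Set.eq_univ_of_forall fun p => ⟨_, ⟨_, isMultiHom_one, rfl⟩, one_ne_zero⟩

/-- The product of linear forms with given covectors, as an element of `Sd d`. -/
def arrSd (n : Fin d → Fin 3 → ℂ) : Sd d :=
  ⟨arrEq n, (mem_homogeneousSubmodule _ _).2 (isHomogeneous_arrEq n)⟩

theorem comp_arrSd_mem_polyFun {E : Type} [AddCommGroup E] [Module ℂ E]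
    {n : E → Fin d → Fin 3 → ℂ} (hn : ∀ i k, (fun x => n x i k) ∈ PolyFun E) {F : Sd d → ℂ}
    (hF : F ∈ PolyFun (Sd d)) : (fun x => F (arrSd (n x))) ∈ PolyFun E := by
  classical
  have hcoeff : ∀ (s : Finset (Fin d)) (μ : Fin 3 →₀ ℕ),
      (fun x => coeff μ (∏ i ∈ s, linForm (n x i))) ∈ PolyFun E := by
    intro s
    induction s using Finset.induction_on with
    | empty => intro μ; simpa using const_mem_polyFun _
    | insert a s ha ih =>
      intro μ
      simp only [Finset.prod_insert ha, coeff_mul]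
      refine sum_mem_polyFun _ fun t _ => mul_mem_polyFun ?_ (ih _)
      have h : ∀ u : Fin 3 → ℂ, linForm u = ∑ k, C (u k) * X k := fun _ => rfl
      simp only [h, coeff_sum, coeff_C_mul]
      exact sum_mem_polyFun _ fun k _ => mul_mem_polyFun (hn a k) (const_mem_polyFun _)
  refine comp_mem_polyFun hF fun φ => ?_
  have hφ : ∀ y : Sd d, φ y = ∑ μ, homCoord (Fin 3) d y μ *
      φ ((homCoord (Fin 3) d).symm fun ν => if μ = ν then 1 else 0) := by
    intro y
    conv_lhs => rw [← (homCoord (Fin 3) d).symm_apply_apply y]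
    exact LinearMap.pi_apply_eq_sum_univ (φ ∘ₗ (homCoord (Fin 3) d).symm.toLinearMap) _
  rw [show (fun x => φ (arrSd (n x))) = _ from funext fun x => hφ (arrSd (n x))]
  exact sum_mem_polyFun _ fun μ _ => mul_mem_polyFun (hcoeff Finset.univ μ.1) (const_mem_polyFun _)

/-- The parameters of the arrangements whose lines labelled by `firstLines d m` are spanned by two
given covectors. -/
abbrev Params (d : ℕ) : Type := (Fin 2 → Fin 3 → ℂ) × (Fin d → Fin 2 → ℂ) × (Fin d → Fin 3 → ℂ)

/-- The covectors with given parameters. -/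
def paramVec (m : ℕ) (x : Params d) (i : Fin d) : Fin 3 → ℂ :=
  if i ∈ firstLines d m then x.2.1 i 0 • x.1 0 + x.2.1 i 1 • x.1 1 else x.2.2 i

theorem paramVec_mem_polyFun (i : Fin d) (k : Fin 3) :
    (fun x : Params d => paramVec m x i k) ∈ PolyFun (Params d) := by
  have h1 : ∀ j : Fin 2, (fun x : Params d => x.1 j k) ∈ PolyFun (Params d) := fun j =>
    dual_mem_polyFun (E := Params d) ⟨⟨fun x => x.1 j k, fun _ _ => rfl⟩, fun _ _ => rfl⟩
  have h2 : ∀ j : Fin 2, (fun x : Params d => x.2.1 i j) ∈ PolyFun (Params d) := fun j =>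
    dual_mem_polyFun (E := Params d) ⟨⟨fun x => x.2.1 i j, fun _ _ => rfl⟩, fun _ _ => rfl⟩
  have h3 : (fun x : Params d => x.2.2 i k) ∈ PolyFun (Params d) :=
    dual_mem_polyFun (E := Params d) ⟨⟨fun x => x.2.2 i k, fun _ _ => rfl⟩, fun _ _ => rfl⟩
  by_cases hi : i ∈ firstLines d m
  · simp only [paramVec, if_pos hi]
    exact add_mem_polyFun (mul_mem_polyFun (h2 0) (h1 0)) (mul_mem_polyFun (h2 1) (h1 1))
  · simp only [paramVec, if_neg hi]
    exact h3

theorem cross_mem_polyFun {E : Type} [AddCommGroup E] [Module ℂ E] {u w : E → Fin 3 → ℂ}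
    (hu : ∀ k, (fun x => u x k) ∈ PolyFun E) (hw : ∀ k, (fun x => w x k) ∈ PolyFun E) :
    ∀ k, (fun x => (u x ⨯₃ w x) k) ∈ PolyFun E := by
  rw [forall_fin_three]
  simp only [cross_zero_apply, cross_one_apply, cross_two_apply]
  exact ⟨sub_mem_polyFun (mul_mem_polyFun (hu _) (hw _)) (mul_mem_polyFun (hu _) (hw _)),
    sub_mem_polyFun (mul_mem_polyFun (hu _) (hw _)) (mul_mem_polyFun (hu _) (hw _)),
    sub_mem_polyFun (mul_mem_polyFun (hu _) (hw _)) (mul_mem_polyFun (hu _) (hw _))⟩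

theorem dot_mem_polyFun {E : Type} [AddCommGroup E] [Module ℂ E] {u w : E → Fin 3 → ℂ}
    (hu : ∀ k, (fun x => u x k) ∈ PolyFun E) (hw : ∀ k, (fun x => w x k) ∈ PolyFun E) :
    (fun x => u x ⬝ᵥ w x) ∈ PolyFun E := by
  simp only [dot_three]
  exact add_mem_polyFun (add_mem_polyFun (mul_mem_polyFun (hu _) (hw _))
    (mul_mem_polyFun (hu _) (hw _))) (mul_mem_polyFun (hu _) (hw _))

/-- The covectors orthogonal to `v` are spanned by those of any two distinct lines through `v`. -/
theorem TypeData.exists_paramVec_eq {n : Fin d → Fin 3 → ℂ} {v : Fin 3 → ℂ} (hm : 2 ≤ m)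
    (h : TypeData m n (firstLines d m) v) : ∃ x : Params d, paramVec m x = n := by
  obtain ⟨i₁, hi₁, i₂, hi₂, h12⟩ := Finset.one_lt_card.1 (by rw [h.card]; omega : 1 < (firstLines d m).card)
  have hc : ∀ j, ∃ a : Fin 2 → ℂ, j ∈ firstLines d m → n j = a 0 • n i₁ + a 1 • n i₂ := by
    intro j
    by_cases hj : j ∈ firstLines d m
    · obtain ⟨s, t, e⟩ := exists_combination h.ne_zero (h.cross i₁ i₂ h12) (n := v)
        (by rw [dotProduct_comm, h.dot _ hi₁]) (by rw [dotProduct_comm, h.dot _ hi₂])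
        (by rw [dotProduct_comm, h.dot _ hj])
      exact ⟨![s, t], fun _ => e⟩
    · exact ⟨0, fun e => absurd e hj⟩
  choose a ha using hc
  refine ⟨(![n i₁, n i₂], a, n), funext fun i => ?_⟩
  rw [paramVec]
  split_ifs with hi
  · exact (ha i hi).symm
  · rfl

/-- A nonempty open set of parameters giving arrangements of the right type. -/
theorem exists_paramVec_typeData (hm : 2 ≤ m) (hmd : m ≤ d) :
    ∃ H ∈ PolyFun (Params d), (∃ x, H x ≠ 0) ∧
      ∀ x, H x ≠ 0 → ∃ v, TypeData m (paramVec m x) (firstLines d m) v := by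
  classical
  obtain ⟨n, hT⟩ := exists_typeData hmd
  obtain ⟨x₀, rfl⟩ := hT.exists_paramVec_eq hm
  have hcomp : ∀ i j, ∃ k, i ≠ j → (paramVec m x₀ i ⨯₃ paramVec m x₀ j) k ≠ 0 := by
    intro i j
    by_cases hij : i = j
    · exact ⟨0, fun h => absurd hij h⟩
    · obtain ⟨k, hk⟩ := Function.ne_iff.1 (hT.cross i j hij)
      exact ⟨k, fun _ => hk⟩
  choose k hk using hcomp
  set pairs := Finset.univ.filter fun t : Fin d × Fin d => t.1 ≠ t.2 with hpairs
  obtain ⟨i₁, hi₁, i₂, hi₂, h12⟩ := Finset.one_lt_card.1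
    (by rw [hT.card]; omega : 1 < (firstLines d m).card)
  have hcr := fun i j => cross_mem_polyFun (E := Params d) (paramVec_mem_polyFun (m := m) i)
    (paramVec_mem_polyFun (m := m) j)
  refine ⟨fun x => (∏ t ∈ pairs, (paramVec m x t.1 ⨯₃ paramVec m x t.2) (k t.1 t.2)) *
    offDet (firstLines d m) (paramVec m x), ?_, ⟨x₀, ?_⟩, fun x hx => ?_⟩
  · exact mul_mem_polyFun (prod_mem_polyFun _ fun t _ => hcr _ _ _)
      (prod_mem_polyFun _ fun t _ => dot_mem_polyFun (paramVec_mem_polyFun _) (hcr _ _))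
  · refine mul_ne_zero (Finset.prod_ne_zero_iff.2 fun t ht => ?_) (offDet_ne_zero.2 hT.triple)
    exact hk t.1 t.2 (by simpa [hpairs] using ht)
  · obtain ⟨h1, h2⟩ := mul_ne_zero_iff.1 hx
    refine ⟨_, typeData_of_offDet_ne_zero hT.card (fun i j hij h0 => ?_) h2 h12 fun j hj _ _ => ?_⟩
    · refine Finset.prod_ne_zero_iff.1 h1 (i, j) (by simp [hpairs, hij]) ?_
      simp only [h0]; rfl
    · simp only [paramVec, if_pos hi₁, if_pos hi₂, if_pos hj, dot_three, cross_zero_apply,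
        cross_one_apply, cross_two_apply, Pi.add_apply, Pi.smul_apply, smul_eq_mul]
      ring

theorem exists_paramVec_of_mem_AL (hm : 2 ≤ m) (hmd : m ≤ d) {q : Curves d}
    (hq : q ∈ AL d (Ldm d m)) : ∃ x : Params d, q.rep = arrSd (paramVec m x) := by
  classical
  obtain ⟨n, M, v, hT, e⟩ := (mem_AL_iff hm hmd one_ne_zero).1 hq
  rw [one_smul] at e
  obtain ⟨σ, hσ⟩ : ∃ σ : Equiv.Perm (Fin d), M.map σ.symm.toEmbedding = firstLines d m := by
    obtain ⟨σ, hσ⟩ := exists_perm_map_eq (hT.card.trans (card_firstLines hmd).symm)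
    exact ⟨σ.symm, by rwa [Equiv.symm_symm]⟩
  have hT' := hT.comp σ
  rw [hσ] at hT'
  obtain ⟨x, hx⟩ := hT'.exists_paramVec_eq hm
  refine ⟨x, Subtype.ext ?_⟩
  rw [e, hx]
  exact (Equiv.prod_comp σ fun i => linForm (n i)).symm

/-- After relabelling, all arrangements of the type come from one vector space of parameters. Open
sets meeting the stratum pull back to nonvanishing conditions on polynomial functions, and these
functions and the `H` defining the right type have a common nonzero point, since polynomial
functions form a domain. -/
theorem isIrreducible_AL (hm : 2 ≤ m) (hmd : m ≤ d) :
    @IsIrreducible _ (zariski Unit (Sd d)) (single (AL d (Ldm d m))) := by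
  let _ := zariski Unit (Sd d)
  refine ⟨(isSmoothOfDim_AL hm hmd).1, fun U W hU hW => ?_⟩
  rintro ⟨p, hp, hpU⟩ ⟨q, hq, hqW⟩
  obtain ⟨_, ⟨F, hF, rfl⟩, hFp, hFU⟩ :=
    (isTopologicalBasis_zariski Unit (Sd d)).exists_subset_of_mem_open hpU hU
  obtain ⟨_, ⟨G, hG, rfl⟩, hGq, hGW⟩ :=
    (isTopologicalBasis_zariski Unit (Sd d)).exists_subset_of_mem_open hqW hW
  obtain ⟨x, hx⟩ := exists_paramVec_of_mem_AL hm hmd hp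
  obtain ⟨y, hy⟩ := exists_paramVec_of_mem_AL hm hmd hq
  obtain ⟨H, hH, ⟨z, hz⟩, hHT⟩ := exists_paramVec_typeData hm hmd
  have hpoly : ∀ {F : (Unit → Sd d) → ℂ}, IsMultiHom F →
      (fun x : Params d => F fun _ => arrSd (paramVec m x)) ∈ PolyFun (Params d) := fun hF =>
    comp_arrSd_mem_polyFun paramVec_mem_polyFun
      (comp_linear_mem_polyFun hF.1 (LinearMap.pi fun _ => LinearMap.id))
  have hFx : F (fun _ => arrSd (paramVec m x)) ≠ 0 := by rw [← hx]; exact hFp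
  have hGy : G (fun _ => arrSd (paramVec m y)) ≠ 0 := by rw [← hy]; exact hGq
  obtain ⟨a, ha⟩ := exists_mul_ne_zero_of_mem_polyFun (hpoly hF) (hpoly hG) hFx hGy
  obtain ⟨b, hb⟩ := exists_mul_ne_zero_of_mem_polyFun
    (mul_mem_polyFun (hpoly hF) (hpoly hG)) hH ha hz
  obtain ⟨v, hT⟩ := hHT b (right_ne_zero_of_mul hb)
  have hne : arrSd (paramVec m b) ≠ 0 := fun h =>
    hT.distinctLines.arrEq_ne_zero (hm.trans hmd) (congrArg Subtype.val h)
  obtain ⟨c, hc⟩ := Projectivization.exists_smul_eq_mk_rep ℂ _ hne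
  have hrep : ∀ {F : (Unit → Sd d) → ℂ}, IsMultiHom F → F (fun _ => arrSd (paramVec m b)) ≠ 0 →
      F (reps fun _ : Unit => Projectivization.mk ℂ _ hne) ≠ 0 := by
    rintro F ⟨-, k, hk⟩ h0
    have : (reps fun _ : Unit => Projectivization.mk ℂ _ hne) =
      fun i => (fun _ : Unit => (c : ℂ)) i • (fun _ : Unit => arrSd (paramVec m b)) i :=
      funext fun _ => hc.symm
    rw [this, hk]
    exact mul_ne_zero (Finset.prod_ne_zero_iff.2 fun _ _ => pow_ne_zero _ c.ne_zero) h0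
  refine ⟨fun _ => Projectivization.mk ℂ _ hne, ?_,
    hFU (hrep hF (left_ne_zero_of_mul (left_ne_zero_of_mul hb))),
    hGW (hrep hG (right_ne_zero_of_mul (left_ne_zero_of_mul hb)))⟩
  refine (mem_AL_iff hm hmd (inv_ne_zero c.ne_zero)).2 ⟨_, _, v, hT, ?_⟩
  rw [← hc, Units.smul_def, inv_smul_smul₀ c.ne_zero]
  rfl

end Irreducible

end LineArr

end

/-! ### Assembly of the assertions. -/

theorem proposition4p6 (d : ℕ) (hd : 4 ≤ d) :
    -- the lattice `L(d, m)` is the lattice of the arrangements of the prescribed type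
    (∀ m, 2 ≤ m → m ≤ d →
      LineArr.XL d (LineArr.Ldm d m) = {l | l ∈ LineArr.Xd d ∧ LineArr.HasType m l}) ∧
    -- (1) smoothness, dimension, irreducibility
    (∀ m, 2 ≤ m → m ≤ d →
      LineArr.IsSmoothOfDim (LineArr.XL d (LineArr.Ldm d m)) (2 * d - m + 2) ∧
      LineArr.IsSmoothOfDim (LineArr.single (LineArr.AL d (LineArr.Ldm d m))) (2 * d - m + 2) ∧
      @IsIrreducible _ (LineArr.zariski Unit (LineArr.Sd d))
        (LineArr.single (LineArr.AL d (LineArr.Ldm d m)))) ∧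
    -- (2) Tjurina numbers
    (∀ m, 2 ≤ m → m ≤ d →
      LineArr.tauL (LineArr.Ldm d m) = (m - 1) ^ 2 + ∑ i ∈ Finset.Ico m d, i ∧
      LineArr.tauL (LineArr.Ldm d m) = d.choose 2 + (m - 1).choose 2 ∧
      ∀ c ∈ LineArr.AL d (LineArr.Ldm d m),
        LineArr.tjurina (c.rep : LineArr.S) = d.choose 2 + (m - 1).choose 2) ∧
    -- (3) minimal degree of a syzygy
    (∀ m, 2 ≤ m → m ≤ d → d < 2 * m →
      ∀ c ∈ LineArr.AL d (LineArr.Ldm d m), LineArr.mdr (c.rep : LineArr.S) = d - m) ∧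
    -- (4) free and nearly free arrangements
    (∀ m, m = d ∨ m = d - 1 →
      ∀ c ∈ LineArr.AL d (LineArr.Ldm d m), LineArr.IsFree (c.rep : LineArr.S)) ∧
    (∀ c ∈ LineArr.AL d (LineArr.Ldm d (d - 2)), LineArr.IsNearlyFree (c.rep : LineArr.S)) ∧
    (∀ m, 2 ≤ m → m ≤ d - 3 → ∀ c ∈ LineArr.AL d (LineArr.Ldm d m),
      ¬ LineArr.IsFree (c.rep : LineArr.S) ∧ ¬ LineArr.IsNearlyFree (c.rep : LineArr.S)) ∧
    -- (5) arrangements with small `mdr`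
    (∀ c ∈ LineArr.Ad d, LineArr.mdr (c.rep : LineArr.S) = 0 →
      c ∈ LineArr.AL d (LineArr.Ldm d d)) ∧
    (∀ c ∈ LineArr.Ad d, LineArr.mdr (c.rep : LineArr.S) = 1 →
      c ∈ LineArr.AL d (LineArr.Ldm d (d - 1))) ∧
    -- (6) strata given by the Tjurina number
    LineArr.AL d (LineArr.Ldm d d) = LineArr.Atau d (LineArr.tauL (LineArr.Ldm d d)) ∧
    LineArr.AL d (LineArr.Ldm d (d - 1)) =
      LineArr.Atau d (LineArr.tauL (LineArr.Ldm d (d - 1))) := by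
  open LineArr in
  have hlat : ∀ m, 2 ≤ m → m ≤ d →
      XL d (Ldm d m) = {l | l ∈ Xd d ∧ HasType m l} := fun m hm hmd => XL_Ldm_eq hm hmd
  open LineArr in
  have hmem : ∀ m, 2 ≤ m → m ≤ d → ∀ c ∈ AL d (Ldm d m),
      ∃ l, l ∈ Xd d ∧ HasType m l ∧ psi l = c := by
    rintro m hm hmd _ ⟨l, hl, rfl⟩
    rw [hlat m hm hmd] at hl
    exact ⟨l, hl.1, hl.2, rfl⟩
  open LineArr in
  have hmem' : ∀ m, 2 ≤ m → m ≤ d → ∀ l, l ∈ Xd d → HasType m l → psi l ∈ AL d (Ldm d m) := by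
    intro m hm hmd l hl h
    exact ⟨l, by rw [hlat m hm hmd]; exact ⟨hl, h⟩, rfl⟩
  open LineArr in
  have htau : ∀ m, 2 ≤ m → m ≤ d → ∀ c ∈ AL d (Ldm d m),
      tjurina (c.rep : S) = d.choose 2 + (m - 1).choose 2 := by
    intro m hm hmd c hc
    obtain ⟨l, hl, h, rfl⟩ := hmem m hm hmd c hc
    rw [tjurina_psi hl, sum_sq_of_hasType hm hl h]
  open LineArr in
  have hrep : ∀ m, 2 ≤ m → m ≤ d → ∀ c ∈ AL d (Ldm d m), ∃ (n : Fin d → Fin 3 → ℂ)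
      (M : Finset (Fin d)) (v : Fin 3 → ℂ), TypeData m n M v ∧ (c.rep : S) = arrEq n := by
    intro m hm hmd c hc
    obtain ⟨l, hl, h, rfl⟩ := hmem m hm hmd c hc
    exact exists_typeData_of_mem hm hl h
  refine ⟨hlat, fun m hm hmd => ⟨LineArr.isSmoothOfDim_XL hm hmd, LineArr.isSmoothOfDim_AL hm hmd,
    LineArr.isIrreducible_AL hm hmd⟩, fun m hm hmd => ?_, ?_, ?_, ?_, ?_, ?_, ?_, ?_, ?_⟩
  · have h := LineArr.tauL_Ldm_eq_choose hm hmd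
    exact ⟨h.trans (LineArr.choose_two_add_choose_two hm hmd), h, htau m hm hmd⟩
  · intro m hm hmd _ c hc
    obtain ⟨n, M, v, hT, e⟩ := hrep m hm hmd c hc
    rw [e, hT.mdr_eq hm]
  · rintro m hm c hc
    obtain ⟨n, M, v, hT, e⟩ := hrep m (by omega) (by omega) c hc
    rw [e]
    rcases hm with hm | hm
    · exact hT.isFree_of_eq (by omega) hm
    · exact hT.isFree_of_pred (by omega) (by omega)
  · intro c hc
    obtain ⟨n, M, v, hT, e⟩ := hrep (d - 2) (by omega) (by omega) c hc
    rw [e]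
    exact hT.isNearlyFree (by omega) (by omega)
  · intro m hm hmd c hc
    obtain ⟨n, M, v, hT, e⟩ := hrep m hm (by omega) c hc
    rw [e]
    exact ⟨hT.not_isFree hm (by omega), hT.not_isNearlyFree hm (by omega)⟩
  · rintro _ ⟨l, hl, rfl⟩ h
    exact hmem' d (by omega) le_rfl l hl (LineArr.hasType_of_mdr_eq_zero (by omega) hl h)
  · rintro _ ⟨l, hl, rfl⟩ h
    exact hmem' (d - 1) (by omega) (by omega) l hl (LineArr.hasType_of_mdr_eq_one hd hl h)
  · rw [LineArr.tauL_Ldm_eq_choose (by omega) le_rfl]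
    refine Set.Subset.antisymm (fun c hc => ?_) ?_
    · obtain ⟨l, hl, h, rfl⟩ := hmem d (by omega) le_rfl c hc
      exact ⟨⟨l, hl, rfl⟩, htau d (by omega) le_rfl _ hc⟩
    · rintro _ ⟨⟨l, hl, rfl⟩, h⟩
      -- For m = d the sum over `Finset.Ico d d` is empty, so τ is (d - 1)².
      rw [LineArr.tjurina_psi hl, LineArr.choose_two_add_choose_two (by omega) le_rfl] at h
      refine hmem' d (by omega) le_rfl l hl (LineArr.hasType_of_sum_sq_eq (by omega) hl ?_)
      rw [h, Finset.Ico_self, Finset.sum_empty, add_zero]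
  · rw [LineArr.tauL_Ldm_eq_choose (by omega) (by omega)]
    refine Set.Subset.antisymm (fun c hc => ?_) ?_
    · obtain ⟨l, hl, h, rfl⟩ := hmem (d - 1) (by omega) (by omega) c hc
      exact ⟨⟨l, hl, rfl⟩, htau (d - 1) (by omega) (by omega) _ hc⟩
    · rintro _ ⟨⟨l, hl, rfl⟩, h⟩
      rw [LineArr.tjurina_psi hl] at h
      exact hmem' (d - 1) (by omega) (by omega) l hl (LineArr.hasType_pred_of_sum_sq_eq hd hl h)
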